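/- An instance of $P_n|conc,p_j=1,r_j\ge 0|C_{\max}$ consists of a graph $G$ on the jobs $\{1,\dots,n\}$ (the conflict graph) and integer release times $r_1,\dots,r_n\ge 0$. A feasible schedule assigns to each job $j$ an integer completion time $C_j\ge r_j+1$ so that the unit processing intervals $[C_i-1,C_i)$ and $[C_j-1,C_j)$ are disjoint whenever $ij$ is an edge of $G$; an optimal schedule is a feasible one of minimum makespan $C_{\max}=\max_j C_j$. Let $\mathrm{tw}(G)$ be the treewidth of $G$, let $\log$ be the binary logarithm (with $\log 0=0$), and let $|I|$ be the length of the input, with all numbers written in unary. Algorithms are programs for a random access machine with logarithmic cost. (1) There are an algorithm and a constant $c$ such that, given an instance together with any tree decomposition of $G$, of width $w$, the algorithm computes an optimal schedule in time at most $$c\cdot|I|^{c}\cdot(w\log n+1)^{w+1}.$$ That is, the problem is solvable in $O^*\big((\mathrm{tw}\cdot\log n+1)^{\mathrm{tw}+1}\big)$ time when a tree decomposition of width $\mathrm{tw}=\mathrm{tw}(G)$ is given. (2) There are an algorithm, a constant $c$ and a computable function $f:\mathbb N\to\mathbb N$ such that, given only an instance, the algorithm computes an optimal schedule in time that is at most $$c\cdot|I|^{c}\cdot(\mathrm{tw}(G)\log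 n+1)^{c\cdot \mathrm{tw}(G)}\qquad\text{and at most}\qquad f(\mathrm{tw}(G))\cdot|I|^{c}.$$ In particular the problem is fixed-parameter tractable when parameterized by treewidth. -/

import Mathlib

namespace ConcSched

/-! ### Concurrency constrained scheduling

Jobs are the elements of `Fin n`; a schedule is the function of completion times. -/

/-- `C` is a feasible schedule for the jobs with conflict graph `G`, processing times `p` and
release times `r`: no job starts before its release time, and the processing intervals of two
conflicting jobs are disjoint. -/
def Feasible {n : ℕ} (G : SimpleGraph (Fin n)) (p r C : Fin n → ℕ) : Prop :=
  (∀ j, r j + p j ≤ C j) ∧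
    ∀ i j, G.Adj i j → Disjoint (Set.Ico (C i - p i) (C i)) (Set.Ico (C j - p j) (C j))

/-- The makespan, the largest completion time. -/
def makespan {n : ℕ} (C : Fin n → ℕ) : ℕ := Finset.univ.sup C

/-- `C` is an optimal schedule for the makespan objective. -/
def IsOptimal {n : ℕ} (G : SimpleGraph (Fin n)) (p r C : Fin n → ℕ) : Prop :=
  Feasible G p r C ∧ ∀ C', Feasible G p r C' → makespan C ≤ makespan C'

/-! ### Tree decompositions and treewidth -/

/-- A tree decomposition of `G` whose tree has the `m` nodes `Fin m`. -/
structure TreeDecomposition {n : ℕ} (G : SimpleGraph (Fin n)) (m : ℕ) where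
  tree : SimpleGraph (Fin m)
  bag : Fin m → Finset (Fin n)
  isTree : tree.IsTree
  vertex_mem : ∀ v, ∃ x, v ∈ bag x
  edge_mem : ∀ u v, G.Adj u v → ∃ x, u ∈ bag x ∧ v ∈ bag x
  connected : ∀ v, (tree.induce {x | v ∈ bag x}).Connected

/-- The width: the largest size of a bag, minus one (0 if all the bags are empty). -/
def TreeDecomposition.width {n m : ℕ} {G : SimpleGraph (Fin n)}
    (D : TreeDecomposition G m) : ℕ :=
  (Finset.univ.sup fun x => (D.bag x).card) - 1

/-- The treewidth: the minimum width of a tree decomposition. -/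
noncomputable def treewidth {n : ℕ} (G : SimpleGraph (Fin n)) : ℕ :=
  sInf {w | ∃ (m : ℕ) (D : TreeDecomposition G m), D.width = w}

/-! ### Random access machine programs with logarithmic cost

A memory state has registers and memory banks, all holding natural numbers; a program mentions
only finitely many of them, and addresses cells inside a bank indirectly. Every operation
is charged the bit lengths of the numbers that it handles. -/

inductive Op
  | add | sub | mul | div | mod

/-- Truncated subtraction, division rounding down. -/
def Op.eval : Op → ℕ → ℕ → ℕ
  | .add, a, b => a + b
  | .sub, a, b => a - b
  | .mul, a, b => a * b
  | .div, a, b => a / b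
  | .mod, a, b => a % b

/-- Expressions: a constant, the contents of a register, the contents of the cell of bank `b`
with the computed address, an arithmetic operation. -/
inductive Expr
  | lit (k : ℕ)
  | reg (x : ℕ)
  | get (b : ℕ) (addr : Expr)
  | bin (o : Op) (e₁ e₂ : Expr)

/-- Programs. `assign x e` writes to register `x`, `put b e₁ e₂` writes the value of `e₂` to the
cell of bank `b` with address `e₁`; a test succeeds when its value is not zero. -/
inductive Prog
  | skip
  | assign (x : ℕ) (e : Expr)
  | put (b : ℕ) (addr e : Expr)
  | seq (p q : Prog)
  | ite (e : Expr) (p q : Prog)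
  | loop (e : Expr) (p : Prog)

structure State where
  reg : ℕ → ℕ
  bank : ℕ → ℕ → ℕ

def State.setReg (s : State) (x v : ℕ) : State :=
  { s with reg := Function.update s.reg x v }

def State.setCell (s : State) (b a v : ℕ) : State :=
  { s with bank := Function.update s.bank b (Function.update (s.bank b) a v) }

def Expr.eval (s : State) : Expr → ℕ
  | .lit k => k
  | .reg x => s.reg x
  | .get b e => s.bank b (e.eval s)
  | .bin o e₁ e₂ => o.eval (e₁.eval s) (e₂.eval s)

/-- The cost of evaluating an expression: `1 +` the bit length of the value, for each node
(so that addresses and operands are charged as well). -/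
def Expr.cost (s : State) : Expr → ℕ
  | .lit k => 1 + k.size
  | .reg x => 1 + (s.reg x).size
  | .get b e => e.cost s + (1 + (s.bank b (e.eval s)).size)
  | .bin o e₁ e₂ => e₁.cost s + e₂.cost s + (1 + (o.eval (e₁.eval s) (e₂.eval s)).size)

/-- `Exec P s t s'`: started in state `s`, the program `P` halts in state `s'` after time `t`. -/
inductive Exec : Prog → State → ℕ → State → Prop
  | skip (s : State) : Exec .skip s 1 s
  | assign (s : State) (x : ℕ) (e : Expr) :
      Exec (.assign x e) s (1 + e.cost s) (s.setReg x (e.eval s))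
  | put (s : State) (b : ℕ) (a e : Expr) :
      Exec (.put b a e) s (1 + a.cost s + e.cost s) (s.setCell b (a.eval s) (e.eval s))
  | seq {P Q : Prog} {s s' s'' : State} {t t' : ℕ} :
      Exec P s t s' → Exec Q s' t' s'' → Exec (.seq P Q) s (t + t') s''
  | ite_true {e : Expr} {P Q : Prog} {s s' : State} {t : ℕ} :
      e.eval s ≠ 0 → Exec P s t s' → Exec (.ite e P Q) s (1 + e.cost s + t) s'
  | ite_false {e : Expr} {P Q : Prog} {s s' : State} {t : ℕ} :
      e.eval s = 0 → Exec Q s t s' → Exec (.ite e P Q) s (1 + e.cost s + t) s'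
  | loop_done {e : Expr} {P : Prog} {s : State} :
      e.eval s = 0 → Exec (.loop e P) s (1 + e.cost s) s
  | loop_step {e : Expr} {P : Prog} {s s' s'' : State} {t t' : ℕ} :
      e.eval s ≠ 0 → Exec P s t s' → Exec (.loop e P) s' t' s'' →
        Exec (.loop e P) s (1 + e.cost s + t + t') s''

/-- The initial state: the input word in bank 0, its number of entries in register 0, and 0
everywhere else. -/
def initial (w : List ℕ) : State where
  reg x := if x = 0 then w.length else 0
  bank b a := if b = 0 then w.getD a 0 else 0

/-- The output of a final state for `n` jobs: the first `n` cells of bank 1. -/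
def output (n : ℕ) (s : State) : Fin n → ℕ := fun j => s.bank 1 j

/-! ### Encoding of instances -/

open Classical in
/-- The entries of a 0-1 matrix, row by row. -/
noncomputable def bitMatrix {a b : ℕ} (R : Fin a → Fin b → Prop) : List ℕ :=
  (List.ofFn fun i => List.ofFn fun j => if R i j then 1 else 0).flatten

/-- The number of jobs, the adjacency matrix of the conflict graph, the release times. -/
noncomputable def encodeInstance {n : ℕ} (G : SimpleGraph (Fin n)) (r : Fin n → ℕ) : List ℕ :=
  n :: (bitMatrix G.Adj ++ List.ofFn r)

/-- The number of nodes, the adjacency matrix of the tree, the incidence matrix of the bags. -/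
noncomputable def TreeDecomposition.encode {n m : ℕ} {G : SimpleGraph (Fin n)}
    (D : TreeDecomposition G m) : List ℕ :=
  m :: (bitMatrix D.tree.Adj ++ bitMatrix fun x v => v ∈ D.bag x)

/-- The length of a word of numbers that are written in unary. -/
def unaryLength (w : List ℕ) : ℕ := (w.map (· + 1)).sum

end ConcSched

open ConcSched

/-! Reversing time turns schedules into colorings. If all jobs are done at time `T`, then the colors
`f v = T - C v` form a proper coloring of the conflict graph with `r v + f v + 1 ≤ T`, and
conversely each such coloring gives a schedule. Lowering the color of a vertex respects these
bounds, so one may assume that no vertex can be recolored with a smaller color (`exists_grundy`).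
A graph of treewidth `w` is `w`-degenerate (`RootedDec.exists_degree_le`), and counting edges among
the vertices of large color shows that such a coloring of a `w`-degenerate graph uses a color `t`
only if `2 ^ t ≤ n ^ w` (`two_pow_color_le`). Hence `w log n + 1` colors suffice, and a bag has
at most `(w log n + 1) ^ (w + 1)` colorings.

With a tree decomposition at hand, the algorithm keeps a table of colorings for each bag and, in as
many rounds as there are nodes, deletes those colorings that fit no coloring in the table of some
neighbor. If some coloring at the root survives, then surviving colorings can be chosen from
the root down such that they fit together (`RootedDec.exists_global`); so the tables decide
whether a partial coloring extends (`Core.decideC_spec`). Trying all `T`, and then all colors of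
one vertex after the other, yields an optimal schedule (`Core.searchC_spec`, `searchC_optimal`).

Without a tree decomposition, the treewidth `k` is guessed, starting from `0`. The construction of a
tree decomposition maintains groups of vertices, each with a boundary of at most `3 * k + 4`
vertices that separates it from the rest. A boundary of maximum size contains two disjoint sets
of `k + 2` vertices that can be separated by `k + 1` vertices (`RootedDec.exists_separation`), and
separating them with minimum overlap divides the group into smaller groups with boundaries that are
small again (`Build.exists_labels`, `Build.Inv.step`). All `3 ^ (3 * k + 4)` labelings of the
boundary are tried. By König's theorem, minimum separations amount to maximum matchings in a
bipartite graph, which an auction finds: stable prices exhibit a matching and a vertex cover of the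
same size (`Auction.Inv.exists_separation`). The width is at most `6 * k + 7`, so
the first algorithm applies.

The programs are written in a small language with bounded loops, for which running times need no
attention: each compiled program takes time polynomial in the parameters that are polynomially
bounded, times the length of the long loops over all entries of the tables to the power of
their nesting depth (`Term.exec_comp`, `Cmd.exec_comp`), and this depth is one. A bound of
the form `f(k) |I| ^ c` follows since `(log n + 1) ^ p ≤ (p + 1) ^ p * (n + 1) ^ 2` (`logb_pow_le`). -/

namespace ConcSched

/-! ### A small language with bounded loops, compiled to random access machine programs -/

/-- The memory banks of a machine state. Bank 2 holds parameters; all loop bounds are read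
there. -/
abbrev Mem := ℕ → ℕ → ℕ

/-- Side-effect free expressions. `var i` is the `i`-th bound variable (de Bruijn index), and
`agg p i e` is the product (for `p = true`) or the sum (for `p = false`) of the values of `e` when
its variable `0` runs over the numbers below cell `i` of bank 2. -/
inductive Term
  | lit (k : ℕ)
  | var (i : ℕ)
  | get (b : ℕ) (a : Term)
  | bin (o : Op) (e₁ e₂ : Term)
  | ite (c a b : Term)
  | agg (p : Bool) (i : ℕ) (e : Term)

/-- The sum or the product of the first `n` values of `f`. -/
def aggVal (p : Bool) (f : ℕ → ℕ) (n : ℕ) : ℕ :=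
  if p then ∏ j ∈ Finset.range n, f j else ∑ j ∈ Finset.range n, f j

def aggOp (p : Bool) : Op := if p then .mul else .add

def aggInit (p : Bool) : ℕ := if p then 1 else 0

theorem aggVal_zero (p : Bool) (f : ℕ → ℕ) : aggVal p f 0 = aggInit p := by
  cases p <;> rfl

theorem aggVal_succ (p : Bool) (f : ℕ → ℕ) (n : ℕ) :
    aggVal p f (n + 1) = (aggOp p).eval (aggVal p f n) (f n) := by
  cases p <;> simp [aggVal, aggOp, Op.eval, Finset.sum_range_succ, Finset.prod_range_succ]

/-- The value of an expression, where `Γ` lists the values of the bound variables. -/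
def Term.eval (M : Mem) : Term → List ℕ → ℕ
  | .lit k, _ => k
  | .var i, Γ => Γ.getD i 0
  | .get b a, Γ => M b (a.eval M Γ)
  | .bin o a b, Γ => o.eval (a.eval M Γ) (b.eval M Γ)
  | .ite c a b, Γ => if c.eval M Γ ≠ 0 then a.eval M Γ else b.eval M Γ
  | .agg p i e, Γ => aggVal p (fun j => e.eval M (j :: Γ)) (M 2 i)

/-- `e.comp Γ k` computes `e` into register `k`, using registers from `k` on; the bound variables
are found in the registers `Γ`. -/
def Term.comp : Term → List ℕ → ℕ → Prog
  | .lit n, _, k => .assign k (.lit n)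
  | .var i, Γ, k => .assign k (if h : i < Γ.length then .reg Γ[i] else .lit 0)
  | .get b a, Γ, k => .seq (a.comp Γ k) (.assign k (.get b (.reg k)))
  | .bin o a b, Γ, k =>
      .seq (a.comp Γ k) (.seq (b.comp Γ (k + 1)) (.assign k (.bin o (.reg k) (.reg (k + 1)))))
  | .ite c a b, Γ, k => .seq (c.comp Γ k) (.ite (.reg k) (a.comp Γ k) (b.comp Γ k))
  | .agg p i e, Γ, k =>
      .seq (.assign k (.lit (aggInit p))) (.seq (.assign (k + 1) (.lit 0))
        (.loop (.bin .sub (.get 2 (.lit i)) (.reg (k + 1)))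
          (.seq (e.comp ((k + 1) :: Γ) (k + 2))
            (.seq (.assign k (.bin (aggOp p) (.reg k) (.reg (k + 2))))
              (.assign (k + 1) (.bin .add (.reg (k + 1)) (.lit 1)))))))

/-- The loop bounds are parameters from cell 3 on; these are the ones that will be polynomially
bounded. -/
def Term.ok : Term → Bool
  | .lit _ => true
  | .var _ => true
  | .get _ a => a.ok
  | .bin _ a b => a.ok && b.ok
  | .ite c a b => c.ok && a.ok && b.ok
  | .agg _ i e => decide (3 ≤ i) && e.ok

/-- All numbers in memory have at most `N` bits, and the parameters from cell 3 on are at most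
`N`. -/
structure Bounded (N : ℕ) (M : Mem) : Prop where
  two_le : 2 ≤ N
  size_le : ∀ b a, (M b a).size ≤ N
  par_le : ∀ i, 3 ≤ i → M 2 i ≤ N

theorem le_pow_of_le {N a b x : ℕ} (hN : 2 ≤ N) (h : x ≤ N ^ a) (hab : a ≤ b) : x ≤ N ^ b :=
  h.trans (Nat.pow_le_pow_right (by omega) hab)

theorem add_le_pow {N a b x y : ℕ} (hN : 2 ≤ N) (hx : x ≤ N ^ a) (hy : y ≤ N ^ b) :
    x + y ≤ N ^ (a + b + 1) := by
  have h1 : x ≤ N ^ (a + b) := le_pow_of_le hN hx (by omega)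
  have h2 : y ≤ N ^ (a + b) := le_pow_of_le hN hy (by omega)
  calc x + y ≤ N ^ (a + b) * 2 := by omega
    _ ≤ N ^ (a + b) * N := by gcongr
    _ = N ^ (a + b + 1) := by ring

theorem mul_le_pow {N a b x y : ℕ} (hx : x ≤ N ^ a) (hy : y ≤ N ^ b) :
    x * y ≤ N ^ (a + b) := by
  rw [pow_add]; exact Nat.mul_le_mul hx hy

theorem const_le_pow {N : ℕ} (hN : 2 ≤ N) (k : ℕ) : k ≤ N ^ k :=
  (Nat.lt_two_pow_self).le.trans (Nat.pow_le_pow_left hN k)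

theorem self_le_pow {N x : ℕ} (h : x ≤ N) : x ≤ N ^ 1 := by simpa using h

theorem size_add_le (a b : ℕ) : (a + b).size ≤ a.size + b.size + 1 := by
  rw [Nat.size_le]
  have h1 := Nat.lt_size_self a
  have h2 := Nat.lt_size_self b
  have h3 : 2 ^ a.size ≤ 2 ^ (a.size + b.size) := Nat.pow_le_pow_right (by norm_num) (by omega)
  have h4 : 2 ^ b.size ≤ 2 ^ (a.size + b.size) := Nat.pow_le_pow_right (by norm_num) (by omega)
  rw [pow_succ]; omega

theorem size_mul_le (a b : ℕ) : (a * b).size ≤ a.size + b.size := by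
  rw [Nat.size_le, pow_add]
  exact Nat.mul_lt_mul'' (Nat.lt_size_self a) (Nat.lt_size_self b)

theorem Op.size_eval_le (o : Op) (a b : ℕ) : (o.eval a b).size ≤ a.size + b.size + 1 := by
  cases o
  · exact size_add_le a b
  · exact (Nat.size_le_size (Nat.sub_le a b)).trans (by omega)
  · exact (size_mul_le a b).trans (by omega)
  · exact (Nat.size_le_size (Nat.div_le_self a b)).trans (by omega)
  · exact (Nat.size_le_size (Nat.mod_le a b)).trans (by omega)

theorem size_le_self (a : ℕ) : a.size ≤ a := by
  rw [Nat.size_le]; exact Nat.lt_two_pow_self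

/-- A sum or product of `n` numbers of at most `b` bits has polynomially many bits. -/
theorem size_aggVal_le (p : Bool) (f : ℕ → ℕ) (n b : ℕ) (h : ∀ j < n, (f j).size ≤ b) :
    (aggVal p f n).size ≤ n * b + n + 1 := by
  rw [Nat.size_le]
  induction n with
  | zero => cases p <;> simp [aggVal]
  | succ n ih =>
    have ih := ih fun j hj => h j (by omega)
    have h1 := Nat.size_le.1 (h n (by omega))
    rw [aggVal_succ]
    cases p
    · simp only [aggOp, Op.eval, Bool.false_eq_true, if_false]
      have : 2 ^ ((n + 1) * b + (n + 1) + 1) = 2 ^ (n * b + n + 1) * 2 ^ b * 2 := by ring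
      rw [this]
      have h3 : 1 ≤ 2 ^ b := Nat.one_le_two_pow
      have h4 : 1 ≤ 2 ^ (n * b + n + 1) := Nat.one_le_two_pow
      nlinarith
    · simp only [aggOp, Op.eval, if_true]
      have : 2 ^ ((n + 1) * b + (n + 1) + 1) = 2 ^ (n * b + n + 1) * 2 ^ b * 2 := by ring
      rw [this]
      have := Nat.mul_lt_mul'' ih h1
      omega

/-- The time of a counting loop whose body runs in time `T`. -/
theorem exec_count {body : Prog} {cnt i n T : ℕ} (I : ℕ → State → Prop)
    (hI : ∀ j s, I j s → s.reg cnt = j ∧ s.bank 2 i = n)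
    (hb : ∀ j s, j < n → I j s → ∃ t s', Exec body s t s' ∧ I (j + 1) s' ∧ t ≤ T) (s : State)
    (h0 : I 0 s) :
    ∃ t s', Exec (.loop (.bin .sub (.get 2 (.lit i)) (.reg cnt)) body) s t s' ∧ I n s' ∧
      t ≤ n * T + (n + 1) * (5 + i.size + 3 * n.size) := by
  have key : ∀ d j s, j + d = n → I j s → ∃ t s',
      Exec (.loop (.bin .sub (.get 2 (.lit i)) (.reg cnt)) body) s t s' ∧ I n s' ∧
      t ≤ d * T + (d + 1) * (5 + i.size + 3 * n.size) := by
    intro d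
    induction d with
    | zero =>
      intro j s hj h
      obtain ⟨h1, h2⟩ := hI j s h
      obtain rfl : j = n := by omega
      refine ⟨_, s, Exec.loop_done ?_, h, ?_⟩
      · simp [Expr.eval, Op.eval, h1, h2]
      · simp [Expr.eval, Op.eval, Expr.cost, h1, h2]
        omega
    | succ d ih =>
      intro j s hj h
      obtain ⟨h1, h2⟩ := hI j s h
      obtain ⟨t, s', he, hI', ht⟩ := hb j s (by omega) h
      obtain ⟨t', s'', he', hI'', ht'⟩ := ih (j + 1) s' (by omega) hI'
      refine ⟨_, s'', Exec.loop_step ?_ he he', hI'', ?_⟩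
      · simp [Expr.eval, Op.eval, h1, h2]; omega
      · have a1 : j.size ≤ n.size := Nat.size_le_size (by omega)
        have a2 : (n - j).size ≤ n.size := Nat.size_le_size (by omega)
        simp only [Expr.eval, Op.eval, Expr.cost, h1, h2]
        have : (d + 1) * T + (d + 1 + 1) * (5 + i.size + 3 * n.size) =
          (d * T + (d + 1) * (5 + i.size + 3 * n.size)) + T + (5 + i.size + 3 * n.size) := by ring
        omega
  exact key n 0 s (by omega) h0

@[simp] theorem State.setReg_reg (s : State) (x v y : ℕ) :
    (s.setReg x v).reg y = if y = x then v else s.reg y := by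
  simp [State.setReg, Function.update_apply]

@[simp] theorem State.setReg_bank (s : State) (x v : ℕ) : (s.setReg x v).bank = s.bank := rfl

theorem map_reg_congr {Γ : List ℕ} {s s' : State} {k : ℕ} (hΓ : ∀ x ∈ Γ, x < k)
    (h : ∀ x < k, s'.reg x = s.reg x) : Γ.map s'.reg = Γ.map s.reg :=
  List.map_congr_left fun x hx => h x (hΓ x hx)

/-- Compiled expressions compute the value, and run in polynomial time. -/
theorem Term.exec_comp (e : Term) (he : e.ok = true) : ∃ c, ∀ (N : ℕ) (s : State) (Γ : List ℕ)
    (k : ℕ), Bounded N s.bank → (∀ x ∈ Γ, x < k) → (∀ x ∈ Γ, (s.reg x).size ≤ N) →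
    ∃ t s', Exec (e.comp Γ k) s t s' ∧ s'.reg k = e.eval s.bank (Γ.map s.reg) ∧
      (∀ x < k, s'.reg x = s.reg x) ∧ s'.bank = s.bank ∧ t ≤ N ^ c ∧
      (e.eval s.bank (Γ.map s.reg)).size ≤ N ^ c := by
  induction e with
  | lit n =>
    refine ⟨2 + n, fun N s Γ k hN _ _ => ⟨_, _, .assign _ _ _, ?_, ?_, rfl, ?_, ?_⟩⟩
    · simp [Expr.eval, Term.eval]
    · intro x hx; simp; omega
    · have := size_le_self n
      exact (by simp only [Expr.cost]; omega : _ ≤ 2 + n).trans (const_le_pow hN.two_le _)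
    · have := size_le_self n
      exact (by simp only [Term.eval]; omega : _ ≤ 2 + n).trans (const_le_pow hN.two_le _)
  | var i =>
    refine ⟨4, fun N s Γ k hN hΓ hs => ?_⟩
    have key : ((Γ.map s.reg).getD i 0).size ≤ N := by
      by_cases h : i < Γ.length
      · simpa [h] using hs Γ[i] (List.getElem_mem h)
      · simp [h]
    have h4 : 2 + N ≤ N ^ 4 :=
      le_pow_of_le hN.two_le (add_le_pow hN.two_le (const_le_pow hN.two_le 2)
        (self_le_pow le_rfl)) (by norm_num)
    refine ⟨_, _, .assign _ _ _, ?_, ?_, rfl, ?_, ?_⟩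
    · by_cases h : i < Γ.length <;> simp [h, Expr.eval, Term.eval]
    · intro x hx; simp; omega
    · refine le_trans ?_ h4
      by_cases h : i < Γ.length
      · simp only [h, dif_pos, Expr.cost]
        have := hs Γ[i] (List.getElem_mem h)
        omega
      · simp [h, Expr.cost]
    · exact key.trans (le_trans (by omega) h4)
  | get b a ih =>
    obtain ⟨c, ih⟩ := ih he
    refine ⟨c + c + 8, fun N s Γ k hN hΓ hs => ?_⟩
    obtain ⟨t, s', h1, h2, h3, h4, h5, h6⟩ := ih N s Γ k hN hΓ hs
    have hsz := hN.size_le b (a.eval s.bank (Γ.map s.reg))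
    refine ⟨_, _, .seq h1 (.assign _ _ _), ?_, ?_, h4, ?_, ?_⟩
    · simp [Expr.eval, Term.eval, h2, h4]
    · intro x hx; simp [h3 x hx]; omega
    · simp only [Expr.eval, Expr.cost, h2, h4]
      have := add_le_pow hN.two_le (add_le_pow hN.two_le h5 h6)
        (add_le_pow hN.two_le (const_le_pow hN.two_le 3) (self_le_pow hsz))
      refine le_trans ?_ (le_pow_of_le hN.two_le this (by omega))
      omega
    · exact le_pow_of_le hN.two_le (self_le_pow hsz) (by omega)
  | bin o a b iha ihb =>
    simp only [Term.ok, Bool.and_eq_true] at he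
    obtain ⟨c, iha⟩ := iha he.1
    obtain ⟨d, ihb⟩ := ihb he.2
    refine ⟨3 * c + 3 * d + 13, fun N s Γ k hN hΓ hs => ?_⟩
    obtain ⟨t, s', h1, h2, h3, h4, h5, h6⟩ := iha N s Γ k hN hΓ hs
    have hreg := map_reg_congr hΓ h3
    obtain ⟨t', s'', h1', h2', h3', h4', h5', h6'⟩ := ihb N s' Γ (k + 1) (h4 ▸ hN)
      (fun x hx => (hΓ x hx).trans (by omega)) (fun x hx => by rw [h3 x (hΓ x hx)]; exact hs x hx)
    rw [h4, hreg] at h2' h6'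
    have hk : s''.reg k = a.eval s.bank (Γ.map s.reg) := by rw [h3' k (by omega), h2]
    have hsz := Op.size_eval_le o (a.eval s.bank (Γ.map s.reg)) (b.eval s.bank (Γ.map s.reg))
    refine ⟨_, _, .seq h1 (.seq h1' (.assign _ _ _)), ?_, ?_, h4'.trans h4, ?_, ?_⟩
    · simp [Expr.eval, Term.eval, h2', hk]
    · intro x hx
      rw [State.setReg_reg, if_neg (by omega), h3' x (by omega), h3 x hx]
    · simp only [Expr.eval, Expr.cost, h2', hk]
      have e1 := add_le_pow hN.two_le h6 h6'
      have := add_le_pow hN.two_le (add_le_pow hN.two_le h5 h5')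
        (add_le_pow hN.two_le (const_le_pow hN.two_le 5) (add_le_pow hN.two_le e1 e1))
      refine le_trans ?_ (le_pow_of_le hN.two_le this (by omega))
      omega
    · refine hsz.trans ?_
      have := add_le_pow hN.two_le (add_le_pow hN.two_le h6 h6') (const_le_pow hN.two_le 1)
      exact le_pow_of_le hN.two_le this (by omega)
  | ite c a b ihc iha ihb =>
    simp only [Term.ok, Bool.and_eq_true] at he
    obtain ⟨d, ihc⟩ := ihc he.1.1
    obtain ⟨da, iha⟩ := iha he.1.2
    obtain ⟨db, ihb⟩ := ihb he.2
    refine ⟨2 * d + da + db + 10, fun N s Γ k hN hΓ hs => ?_⟩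
    obtain ⟨t, s', h1, h2, h3, h4, h5, h6⟩ := ihc N s Γ k hN hΓ hs
    have hreg := map_reg_congr hΓ h3
    have hs' : ∀ x ∈ Γ, (s'.reg x).size ≤ N :=
      fun x hx => by rw [h3 x (hΓ x hx)]; exact hs x hx
    by_cases hc : c.eval s.bank (Γ.map s.reg) = 0
    · obtain ⟨t', s'', h1', h2', h3', h4', h5', h6'⟩ := ihb N s' Γ k (h4 ▸ hN) hΓ hs'
      rw [h4, hreg] at h2' h6'
      refine ⟨_, _, .seq h1 (.ite_false (by simp [Expr.eval, h2, hc]) h1'), ?_, ?_,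
        h4'.trans h4, ?_, ?_⟩
      · simp [Term.eval, hc, h2']
      · intro x hx; rw [h3' x hx, h3 x hx]
      · simp only [Expr.cost, h2]
        have := add_le_pow hN.two_le (add_le_pow hN.two_le h5 h6)
          (add_le_pow hN.two_le (const_le_pow hN.two_le 2) h5')
        refine le_trans ?_ (le_pow_of_le hN.two_le this (by omega))
        omega
      · simp only [Term.eval, hc, ne_eq, not_true_eq_false, if_false]
        exact le_pow_of_le hN.two_le h6' (by omega)
    · obtain ⟨t', s'', h1', h2', h3', h4', h5', h6'⟩ := iha N s' Γ k (h4 ▸ hN) hΓ hs'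
      rw [h4, hreg] at h2' h6'
      refine ⟨_, _, .seq h1 (.ite_true (by simp [Expr.eval, h2, hc]) h1'), ?_, ?_,
        h4'.trans h4, ?_, ?_⟩
      · simp [Term.eval, hc, h2']
      · intro x hx; rw [h3' x hx, h3 x hx]
      · simp only [Expr.cost, h2]
        have := add_le_pow hN.two_le (add_le_pow hN.two_le h5 h6)
          (add_le_pow hN.two_le (const_le_pow hN.two_le 2) h5')
        refine le_trans ?_ (le_pow_of_le hN.two_le this (by omega))
        omega
      · simp only [Term.eval, ne_eq, hc, not_false_eq_true, if_true]
        exact le_pow_of_le hN.two_le h6' (by omega)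
  | agg p i e ih =>
    simp only [Term.ok, Bool.and_eq_true, decide_eq_true_eq] at he
    obtain ⟨c, ih⟩ := ih he.2
    refine ⟨10 * c + i + 80, fun N s Γ k hN hΓ hs => ?_⟩
    have hn := hN.par_le i he.1
    have h2 := hN.two_le
    set n := s.bank 2 i with hnn
    set f : ℕ → ℕ := fun j => e.eval s.bank (j :: Γ.map s.reg) with hf
    -- the bit lengths of the partial results
    set A := n * N ^ c + n + 1 with hA
    set T := N ^ c + (8 + 2 * A + N ^ c + 2 * N + 10) with hT
    let I : ℕ → State → Prop := fun j s' => s'.bank = s.bank ∧ (∀ x < k, s'.reg x = s.reg x) ∧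
      s'.reg k = aggVal p f j ∧ s'.reg (k + 1) = j ∧ ∀ j' < j, (f j').size ≤ N ^ c
    have hA' : ∀ j ≤ n, (∀ j' < j, (f j').size ≤ N ^ c) → (aggVal p f j).size ≤ A := by
      intro j hj hj'
      refine (size_aggVal_le p f j _ hj').trans ?_
      rw [hA]; gcongr
    obtain ⟨t, s', hex, ⟨hI1, hI2, hI3, hI4, hI5⟩, ht⟩ := exec_count (cnt := k + 1) (i := i)
      (n := n) (T := T)
      (body := .seq (e.comp ((k + 1) :: Γ) (k + 2))
            (.seq (.assign k (.bin (aggOp p) (.reg k) (.reg (k + 2))))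
              (.assign (k + 1) (.bin .add (.reg (k + 1)) (.lit 1))))) I
      (fun j s' h => ⟨h.2.2.2.1, by rw [h.1]⟩)
      (by
        rintro j s' hj ⟨hI1, hI2, hI3, hI4, hI5⟩
        have hjs : j.size ≤ N := (size_le_self j).trans (by omega)
        obtain ⟨t, s'', g1, g2, g3, g4, g5, g6⟩ := ih N s' ((k + 1) :: Γ) (k + 2) (hI1 ▸ hN)
          (by
            intro x hx
            rcases List.mem_cons.1 hx with rfl | hx
            · omega
            · have := hΓ x hx; omega)
          (by
            intro x hx
            rcases List.mem_cons.1 hx with rfl | hx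
            · rw [hI4]; exact hjs
            · rw [hI2 x (hΓ x hx)]; exact hs x hx)
        have hreg := map_reg_congr hΓ hI2
        rw [List.map_cons, hI4, hreg, hI1] at g2 g6
        have g2' : s''.reg (k + 2) = f j := g2
        have g6' : (f j).size ≤ N ^ c := g6
        have gk : s''.reg k = aggVal p f j := by rw [g3 k (by omega), hI3]
        have gk1 : s''.reg (k + 1) = j := by rw [g3 (k + 1) (by omega), hI4]
        have hI5' : ∀ j' < j + 1, (f j').size ≤ N ^ c := by
          intro j' hj'
          rcases Nat.lt_succ_iff_lt_or_eq.1 hj' with h | rfl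
          · exact hI5 j' h
          · exact g6'
        refine ⟨_, _, .seq g1 (.seq (.assign _ _ _) (.assign _ _ _)),
          ⟨g4.trans hI1, ?_, ?_, ?_, hI5'⟩, ?_⟩
        · intro x hx
          rw [State.setReg_reg, if_neg (by omega), State.setReg_reg, if_neg (by omega),
            g3 x (by omega), hI2 x hx]
        · rw [State.setReg_reg, if_neg (by omega), State.setReg_reg, if_pos rfl, aggVal_succ]
          simp [Expr.eval, gk, g2']
        · simp [Expr.eval, Op.eval, gk1]
        · have a1 := hA' j hj.le hI5
          have a2 := hA' (j + 1) hj hI5'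
          rw [aggVal_succ] at a2
          have a3 := size_add_le j 1
          rw [Nat.size_one] at a3
          have a4 : Op.add.eval j 1 = j + 1 := rfl
          simp only [Expr.cost, Expr.eval, gk, g2', State.setReg_reg,
            if_neg (show k + 1 ≠ k by omega), gk1, Nat.size_one, a4]
          omega)
      ((s.setReg k (aggInit p)).setReg (k + 1) 0)
      ⟨rfl, by
          intro x hx
          rw [State.setReg_reg, if_neg (by omega), State.setReg_reg, if_neg (by omega)],
        by rw [State.setReg_reg, if_neg (by omega), State.setReg_reg, if_pos rfl, aggVal_zero],
        by simp, by simp⟩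
    have hAN : A ≤ N ^ (c + 5) := by
      have := add_le_pow h2 (add_le_pow h2 (mul_le_pow (self_le_pow hn)
        (le_refl (N ^ c))) (self_le_pow hn)) (const_le_pow h2 1)
      exact le_pow_of_le h2 this (by omega)
    refine ⟨_, s', .seq (.assign _ _ _) (.seq (.assign _ _ _) hex), ?_, ?_, ?_, ?_, ?_⟩
    · rw [hI3]; rfl
    · exact hI2
    · exact hI1
    · have hi0 : (aggInit p).size ≤ 1 := by cases p <;> simp [aggInit]
      simp only [Expr.cost, Nat.size_zero]
      have hTN : T ≤ N ^ (2 * c + c + c + 50) := by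
        have := add_le_pow h2 (add_le_pow h2 (le_refl (N ^ c)) (le_refl (N ^ c)))
          (add_le_pow h2 (add_le_pow h2 hAN hAN)
            (add_le_pow h2 (const_le_pow h2 18) (add_le_pow h2 (self_le_pow (le_refl N))
              (self_le_pow (le_refl N)))))
        refine le_trans ?_ (le_pow_of_le h2 this (by omega))
        omega
      have hsz : n.size ≤ N := (size_le_self n).trans hn
      have hisz := size_le_self i
      have h3N : 5 + i.size + 3 * n.size + 5 ≤ N ^ (i + 20) := by
        have hNN := add_le_pow h2 (self_le_pow (le_refl N)) (self_le_pow (le_refl N))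
        have := add_le_pow h2 (const_le_pow h2 (10 + i))
          (add_le_pow h2 hNN (self_le_pow (le_refl N)))
        refine le_trans ?_ (le_pow_of_le h2 this (by omega))
        omega
      have hn1 : n + 1 ≤ N ^ 3 := by
        have := add_le_pow h2 (self_le_pow hn) (const_le_pow h2 1)
        exact this
      have := add_le_pow h2 (mul_le_pow (self_le_pow hn) hTN) (mul_le_pow hn1 h3N)
      refine le_trans ?_ (le_pow_of_le h2 this (by omega))
      have : (n + 1) * (5 + i.size + 3 * n.size) + 5 ≤
        (n + 1) * (5 + i.size + 3 * n.size + 5) := by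
          rw [Nat.mul_add (n + 1) (5 + i.size + 3 * n.size) 5]; omega
      omega
    · exact (hA' n le_rfl hI5).trans (le_pow_of_le h2 hAN (by omega))
/-- Commands. A store reduces the value modulo cell 0 of bank 2: this bounds all numbers in memory
whatever the command does. `loop i c` runs `c` with its variable `0` running over the
numbers below cell `i` of bank 2. -/
inductive Cmd
  | skip
  | put (b : ℕ) (a e : Term)
  | seq (c₁ c₂ : Cmd)
  | ite (e : Term) (c₁ c₂ : Cmd)
  | loop (i : ℕ) (c : Cmd)

/-- The memory after a store. -/
def Mem.set (M : Mem) (b a v : ℕ) : Mem :=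
  Function.update M b (Function.update (M b) a v)

/-- The memory after a command, where `Γ` lists the values of the loop variables. -/
noncomputable def Cmd.run : Cmd → List ℕ → Mem → Mem
  | .skip, _, M => M
  | .put b a e, Γ, M => M.set b (a.eval M Γ) (e.eval M Γ % M 2 0)
  | .seq c d, Γ, M => d.run Γ (c.run Γ M)
  | .ite e c d, Γ, M => if e.eval M Γ ≠ 0 then c.run Γ M else d.run Γ M
  | .loop i c, Γ, M => (M 2 i).rec M (fun j M' => c.run (j :: Γ) M')

/-- `c.comp Γ k` runs `c` with the loop variables in the registers `Γ`, using registers from `k`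
on. -/
def Cmd.comp : Cmd → List ℕ → ℕ → Prog
  | .skip, _, _ => .skip
  | .put b a e, Γ, k => .seq (a.comp Γ k) (.seq (e.comp Γ (k + 1))
      (.put b (.reg k) (.bin .mod (.reg (k + 1)) (.get 2 (.lit 0)))))
  | .seq c d, Γ, k => .seq (c.comp Γ k) (d.comp Γ k)
  | .ite e c d, Γ, k => .seq (e.comp Γ k) (.ite (.reg k) (c.comp Γ k) (d.comp Γ k))
  | .loop i c, Γ, k =>
      .seq (.assign k (.lit 0))
        (.loop (.bin .sub (.get 2 (.lit i)) (.reg k))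
          (.seq (c.comp (k :: Γ) (k + 1)) (.assign k (.bin .add (.reg k) (.lit 1)))))

/-- Nothing is stored in bank 2, commands loop over cell 1 or over a parameter from cell 3 on, and
expressions only over the latter. -/
def Cmd.ok : Cmd → Bool
  | .skip => true
  | .put b a e => decide (b ≠ 2) && a.ok && e.ok
  | .seq c d => c.ok && d.ok
  | .ite e c d => e.ok && c.ok && d.ok
  | .loop i c => decide (i = 1 ∨ 3 ≤ i) && c.ok

/-- The nesting depth of the loops over cell 1 of bank 2, the long loops. -/
def Cmd.depth : Cmd → ℕ
  | .skip => 0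
  | .put _ _ _ => 0
  | .seq c d => max c.depth d.depth
  | .ite _ c d => max c.depth d.depth
  | .loop i c => (if i = 1 then 1 else 0) + c.depth

/-- Whether a command stores into bank `b`. -/
def Cmd.writes (b : ℕ) : Cmd → Bool
  | .skip => false
  | .put b' _ _ => decide (b' = b)
  | .seq c d => c.writes b || d.writes b
  | .ite _ c d => c.writes b || d.writes b
  | .loop _ c => c.writes b

theorem Cmd.run_of_not_writes {b : ℕ} (c : Cmd) (h : c.writes b = false) (Γ : List ℕ) (M : Mem) :
    c.run Γ M b = M b := by
  induction c generalizing Γ M with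
  | skip => rfl
  | put b' a e =>
    simp only [Cmd.writes, decide_eq_false_iff_not] at h
    simp [Cmd.run, Mem.set, Function.update_of_ne (Ne.symm h)]
  | seq c d ihc ihd =>
    simp only [Cmd.writes, Bool.or_eq_false_iff] at h
    rw [Cmd.run, ihd h.2, ihc h.1]
  | ite e c d ihc ihd =>
    simp only [Cmd.writes, Bool.or_eq_false_iff] at h
    rw [Cmd.run]
    split_ifs
    · exact ihc h.1 _ _
    · exact ihd h.2 _ _
  | loop i c ih =>
    rw [Cmd.run]
    induction M 2 i with
    | zero => rfl
    | succ n ihn => rw [← ihn]; exact ih h _ _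

theorem Cmd.run_par {c : Cmd} (h : c.ok = true) (Γ : List ℕ) (M : Mem) : c.run Γ M 2 = M 2 := by
  apply Cmd.run_of_not_writes
  induction c with
  | skip => rfl
  | put b a e => simp_all [Cmd.ok, Cmd.writes]
  | seq c d ihc ihd => simp_all [Cmd.ok, Cmd.writes]
  | ite e c d ihc ihd => simp_all [Cmd.ok, Cmd.writes]
  | loop i c ih => simp_all [Cmd.ok, Cmd.writes]

/-- Invariants of loops. -/
theorem Cmd.loop_induct {i : ℕ} {c : Cmd} {Γ : List ℕ} {M : Mem} (I : ℕ → Mem → Prop)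
    (h0 : I 0 M) (hs : ∀ j M', j < M 2 i → I j M' → I (j + 1) (c.run (j :: Γ) M')) :
    I (M 2 i) ((Cmd.loop i c).run Γ M) := by
  have : ∀ n ≤ M 2 i, I n (n.rec M (fun j M' => c.run (j :: Γ) M')) := by
    intro n
    induction n with
    | zero => intro _; exact h0
    | succ n ih => intro hn; exact hs n _ hn (ih (by omega))
  exact this _ le_rfl

theorem Bounded.set {N : ℕ} {M : Mem} (h : Bounded N M) {b a v : ℕ} (hb : b ≠ 2)
    (hv : v.size ≤ N) : Bounded N (M.set b a v) := by
  refine ⟨h.two_le, fun b' a' => ?_, fun i hi => ?_⟩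
  · by_cases hb' : b' = b
    · subst hb'
      by_cases ha : a' = a
      · subst ha; simpa [Mem.set] using hv
      · simpa [Mem.set, Function.update_of_ne ha] using h.size_le _ _
    · simpa [Mem.set, Function.update_of_ne hb'] using h.size_le _ _
  · simpa [Mem.set, Function.update_of_ne (Ne.symm hb)] using h.par_le i hi

theorem add_le_pow_mul {N a b x y P : ℕ} (hN : 2 ≤ N) (hx : x ≤ N ^ a * P) (hy : y ≤ N ^ b * P) :
    x + y ≤ N ^ (a + b + 1) * P := by
  have h1 : N ^ a ≤ N ^ (a + b) := Nat.pow_le_pow_right (by omega) (by omega)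
  have h2 : N ^ b ≤ N ^ (a + b) := Nat.pow_le_pow_right (by omega) (by omega)
  have h3 := Nat.mul_le_mul_right P h1
  have h4 := Nat.mul_le_mul_right P h2
  calc x + y ≤ 2 * (N ^ (a + b) * P) := by omega
    _ ≤ N * (N ^ (a + b) * P) := by gcongr
    _ = N ^ (a + b + 1) * P := by ring

theorem le_pow_mul {N a x P : ℕ} (hP : 1 ≤ P) (hx : x ≤ N ^ a) : x ≤ N ^ a * P :=
  hx.trans (Nat.le_mul_of_pos_right _ hP)

theorem le_pow_mul_of_le {N a b x P P' : ℕ} (hN : 2 ≤ N) (h : x ≤ N ^ a * P) (hab : a ≤ b)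
    (hP : P ≤ P') : x ≤ N ^ b * P' :=
  h.trans (Nat.mul_le_mul (Nat.pow_le_pow_right (by omega) hab) hP)

/-- Compiled commands do what they should, in time polynomial in `N` and in the length
of the long loops. -/
theorem Cmd.exec_comp (c : Cmd) (hc : c.ok = true) : ∃ d, ∀ (N : ℕ) (s : State) (Γ : List ℕ)
    (k : ℕ), Bounded N s.bank → s.bank 2 0 ≠ 0 → (∀ x ∈ Γ, x < k) →
    (∀ x ∈ Γ, (s.reg x).size ≤ N) →
    ∃ t s', Exec (c.comp Γ k) s t s' ∧ s'.bank = c.run (Γ.map s.reg) s.bank ∧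
      (∀ x < k, s'.reg x = s.reg x) ∧ t ≤ N ^ d * (s.bank 2 1 + 1) ^ c.depth ∧
      Bounded N s'.bank := by
  induction c with
  | skip =>
    refine ⟨0, fun N s Γ k hN _ _ _ => ⟨_, s, .skip s, rfl, fun _ _ => rfl, ?_, hN⟩⟩
    simp [Cmd.depth]
  | put b a e =>
    simp only [Cmd.ok, Bool.and_eq_true, decide_eq_true_eq] at hc
    obtain ⟨c, iha⟩ := a.exec_comp hc.1.2
    obtain ⟨d, ihb⟩ := e.exec_comp hc.2
    refine ⟨3 * c + 3 * d + 20, fun N s Γ k hN hL hΓ hs => ?_⟩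
    have h2 := hN.two_le
    obtain ⟨t, s', h1, h2, h3, h4, h5, h6⟩ := iha N s Γ k hN hΓ hs
    have hreg := map_reg_congr hΓ h3
    obtain ⟨t', s'', h1', h2', h3', h4', h5', h6'⟩ := ihb N s' Γ (k + 1) (h4 ▸ hN)
      (fun x hx => (hΓ x hx).trans (by omega)) (fun x hx => by rw [h3 x (hΓ x hx)]; exact hs x hx)
    rw [h4, hreg] at h2' h6'
    have hk : s''.reg k = a.eval s.bank (Γ.map s.reg) := by rw [h3' k (by omega), h2]
    have hlim := hN.size_le 2 0
    have hsz : (e.eval s.bank (Γ.map s.reg) % s.bank 2 0).size ≤ N :=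
      (Nat.size_le_size (Nat.mod_lt _ (Nat.pos_of_ne_zero hL)).le).trans hlim
    have hbank : (s''.setCell b ((Expr.reg k).eval s'')
        ((Expr.bin .mod (.reg (k + 1)) (.get 2 (.lit 0))).eval s'')).bank =
        (Cmd.put b a e).run (Γ.map s.reg) s.bank := by
      simp [State.setCell, Cmd.run, Mem.set, Expr.eval, Op.eval, h2', hk, h4', h4]
    refine ⟨_, _, .seq h1 (.seq h1' (.put _ _ _ _)), hbank, ?_, ?_, ?_⟩
    · intro x hx
      show s''.reg x = s.reg x
      rw [h3' x (by omega), h3 x hx]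
    · simp only [Expr.eval, Expr.cost, h2', hk, h4', h4, Op.eval, Nat.size_zero, Cmd.depth,
        pow_zero, mul_one]
      have h2 := hN.two_le
      have := add_le_pow h2 (add_le_pow h2 (add_le_pow h2 h5 h5') (add_le_pow h2 h6 h6'))
        (add_le_pow h2 (const_le_pow h2 10) (add_le_pow h2 (self_le_pow (le_refl N))
          (self_le_pow (le_refl N))))
      refine le_trans ?_ (le_pow_of_le h2 this (by omega))
      omega
    · rw [hbank]
      exact hN.set hc.1.1 hsz
  | seq c d ihc ihd =>
    simp only [Cmd.ok, Bool.and_eq_true] at hc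
    obtain ⟨e, ihc⟩ := ihc hc.1
    obtain ⟨e', ihd⟩ := ihd hc.2
    refine ⟨e + e' + 1, fun N s Γ k hN hL hΓ hs => ?_⟩
    have h2 := hN.two_le
    obtain ⟨t, s', g1, g2, g3, g4, g5⟩ := ihc N s Γ k hN hL hΓ hs
    have hpar : s'.bank 2 = s.bank 2 := by rw [g2]; exact Cmd.run_par hc.1 _ _
    obtain ⟨t', s'', g1', g2', g3', g4', g5'⟩ := ihd N s' Γ k g5 (hpar ▸ hL) hΓ
      (fun x hx => by rw [g3 x (hΓ x hx)]; exact hs x hx)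
    refine ⟨_, s'', .seq g1 g1', ?_, fun x hx => by rw [g3' x hx, g3 x hx], ?_, g5'⟩
    · rw [g2', map_reg_congr hΓ g3, g2]; rfl
    · rw [hpar] at g4'
      exact add_le_pow_mul h2
        (le_pow_mul_of_le h2 g4 le_rfl (Nat.pow_le_pow_right (by omega) (le_max_left _ _)))
        (le_pow_mul_of_le h2 g4' le_rfl (Nat.pow_le_pow_right (by omega) (le_max_right _ _)))
  | ite e c d ihc ihd =>
    simp only [Cmd.ok, Bool.and_eq_true] at hc
    obtain ⟨m, ihe⟩ := e.exec_comp hc.1.1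
    obtain ⟨f, ihc⟩ := ihc hc.1.2
    obtain ⟨f', ihd⟩ := ihd hc.2
    refine ⟨2 * m + f + f' + 10, fun N s Γ k hN hL hΓ hs => ?_⟩
    have h2 := hN.two_le
    obtain ⟨t, s', h1, hv, h3, h4, h5, h6⟩ := ihe N s Γ k hN hΓ hs
    have hreg := map_reg_congr hΓ h3
    have hs' : ∀ x ∈ Γ, (s'.reg x).size ≤ N :=
      fun x hx => by rw [h3 x (hΓ x hx)]; exact hs x hx
    by_cases hz : e.eval s.bank (Γ.map s.reg) = 0
    · obtain ⟨t', s'', g1, g2, g3, g4, g5⟩ := ihd N s' Γ k (h4 ▸ hN) (by rwa [h4]) hΓ hs'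
      refine ⟨_, s'', .seq h1 (.ite_false (by simp [Expr.eval, hv, hz]) g1), ?_,
        fun x hx => by rw [g3 x hx, h3 x hx], ?_, g5⟩
      · rw [g2, hreg, h4]; simp [Cmd.run, hz]
      · simp only [Expr.cost, hv]
        have hP : 1 ≤ (s.bank 2 1 + 1) ^ (Cmd.ite e c d).depth := Nat.one_le_pow _ _ (by omega)
        rw [h4] at g4
        have g4 := le_pow_mul_of_le h2 g4 le_rfl (Nat.pow_le_pow_right (by omega)
          (le_max_right c.depth d.depth))
        have := add_le_pow_mul h2 (add_le_pow_mul h2 (le_pow_mul hP h5) (le_pow_mul hP h6))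
          (add_le_pow_mul h2 (le_pow_mul hP (const_le_pow h2 2)) g4)
        refine le_trans ?_ (le_pow_mul_of_le h2 this (by omega) le_rfl)
        omega
    · obtain ⟨t', s'', g1, g2, g3, g4, g5⟩ := ihc N s' Γ k (h4 ▸ hN) (by rwa [h4]) hΓ hs'
      refine ⟨_, s'', .seq h1 (.ite_true (by simp [Expr.eval, hv, hz]) g1), ?_,
        fun x hx => by rw [g3 x hx, h3 x hx], ?_, g5⟩
      · rw [g2, hreg, h4]; simp [Cmd.run, hz]
      · simp only [Expr.cost, hv]
        have hP : 1 ≤ (s.bank 2 1 + 1) ^ (Cmd.ite e c d).depth := Nat.one_le_pow _ _ (by omega)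
        rw [h4] at g4
        have g4 := le_pow_mul_of_le h2 g4 le_rfl (Nat.pow_le_pow_right (by omega)
          (le_max_left c.depth d.depth))
        have := add_le_pow_mul h2 (add_le_pow_mul h2 (le_pow_mul hP h5) (le_pow_mul hP h6))
          (add_le_pow_mul h2 (le_pow_mul hP (const_le_pow h2 2)) g4)
        refine le_trans ?_ (le_pow_mul_of_le h2 this (by omega) le_rfl)
        omega
  | loop i c ih =>
    simp only [Cmd.ok, Bool.and_eq_true, decide_eq_true_eq] at hc
    obtain ⟨d, ih⟩ := ih hc.2
    refine ⟨d + i + 43, fun N s Γ k hN hL hΓ hs => ?_⟩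
    have h2 := hN.two_le
    set n := s.bank 2 i with hnn
    have hns : n.size ≤ N := hN.size_le 2 i
    set P := (s.bank 2 1 + 1) ^ c.depth with hP
    have hP1 : 1 ≤ P := Nat.one_le_pow _ _ (by omega)
    set T := N ^ d * P + (10 + 2 * N) with hT
    let I : ℕ → State → Prop := fun j s' =>
      s'.bank = j.rec s.bank (fun j M' => c.run (j :: Γ.map s.reg) M') ∧
      s'.bank 2 = s.bank 2 ∧ (∀ x < k, s'.reg x = s.reg x) ∧ s'.reg k = j ∧ Bounded N s'.bank
    obtain ⟨t, s', hex, ⟨hI1, hI2, hI3, hI4, hI5⟩, ht⟩ := exec_count (cnt := k) (i := i)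
      (n := n) (T := T)
      (body := .seq (c.comp (k :: Γ) (k + 1)) (.assign k (.bin .add (.reg k) (.lit 1)))) I
      (fun j s' h => ⟨h.2.2.2.1, by rw [h.2.1]⟩)
      (by
        rintro j s' hj ⟨hI1, hI2, hI3, hI4, hI5⟩
        have hjs : j.size ≤ N := (Nat.size_le_size hj.le).trans hns
        obtain ⟨t, s'', g1, g2, g3, g4, g5⟩ := ih N s' (k :: Γ) (k + 1) hI5 (by rwa [hI2])
          (by
            intro x hx
            rcases List.mem_cons.1 hx with rfl | hx
            · omega
            · have := hΓ x hx; omega)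
          (by
            intro x hx
            rcases List.mem_cons.1 hx with rfl | hx
            · rw [hI4]; exact hjs
            · rw [hI3 x (hΓ x hx)]; exact hs x hx)
        have gk : s''.reg k = j := by rw [g3 k (by omega), hI4]
        rw [List.map_cons, hI4, map_reg_congr hΓ hI3, hI1] at g2
        refine ⟨_, _, .seq g1 (.assign _ _ _), ⟨g2, ?_, ?_, ?_, g5⟩, ?_⟩
        · show s''.bank 2 = _
          rw [g2, Cmd.run_par hc.2, ← hI1, hI2]
        · intro x hx
          rw [State.setReg_reg, if_neg (by omega), g3 x (by omega), hI3 x hx]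
        · simp [Expr.eval, Op.eval, gk]
        · have a3 := size_add_le j 1
          rw [Nat.size_one] at a3
          have a4 : Op.add.eval j 1 = j + 1 := rfl
          rw [hI2, ← hP] at g4
          simp only [Expr.cost, Expr.eval, gk, Nat.size_one, a4]
          omega)
      (s.setReg k 0)
      ⟨rfl, rfl, by intro x hx; rw [State.setReg_reg, if_neg (by omega)], by simp, hN⟩
    refine ⟨_, s', .seq (.assign _ _ _) hex, hI1, hI3, ?_, hI5⟩
    simp only [Expr.cost, Nat.size_zero]
    have hTN : T ≤ N ^ (d + 20) * P := by
      have := add_le_pow_mul h2 (le_refl (N ^ d * P)) (le_pow_mul hP1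
        (add_le_pow h2 (const_le_pow h2 10) (add_le_pow h2 (self_le_pow (le_refl N))
          (self_le_pow (le_refl N)))))
      refine le_trans ?_ (le_pow_mul_of_le h2 this (by omega) le_rfl)
      omega
    have hisz := size_le_self i
    have h3N : 5 + i.size + 3 * n.size + 5 ≤ N ^ (i + 18) := by
      have hNN := add_le_pow h2 (self_le_pow (le_refl N)) (self_le_pow (le_refl N))
      have := add_le_pow h2 (const_le_pow h2 (10 + i))
        (add_le_pow h2 hNN (self_le_pow (le_refl N)))
      refine le_trans ?_ (le_pow_of_le h2 this (by omega))
      omega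
    have hsum : n * T + (n + 1) * (5 + i.size + 3 * n.size) + 5 ≤
        (n + 1) * (N ^ (d + i + 39) * P) := by
      have h5 : 5 ≤ (n + 1) * 5 := by omega
      have := add_le_pow_mul h2 hTN (le_pow_mul hP1 h3N)
      have := le_pow_mul_of_le h2 this (show d + 20 + (i + 18) + 1 ≤ d + i + 39 by omega)
        (le_refl P)
      have := Nat.mul_le_mul_left (n + 1) this
      have e1 : (n + 1) * (T + (5 + i.size + 3 * n.size + 5)) =
        n * T + T + (n + 1) * (5 + i.size + 3 * n.size) + (n + 1) * 5 := by ring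
      omega
    have hfin : (n + 1) * (N ^ (d + i + 39) * P) ≤
        N ^ (d + i + 43) * (s.bank 2 1 + 1) ^ (Cmd.loop i c).depth := by
      rcases hc.1 with rfl | hi
      · have : (Cmd.loop 1 c).depth = 1 + c.depth := rfl
        have e1 : (n + 1) ^ (1 + c.depth) = (n + 1) * (n + 1) ^ c.depth := by ring
        rw [this, ← hnn, e1, hP, ← hnn, mul_left_comm]
        gcongr <;> omega
      · have : (Cmd.loop i c).depth = c.depth := by
          simp [Cmd.depth]; omega
        rw [this, ← hP, ← mul_assoc]
        have hn1 : n + 1 ≤ N ^ 3 :=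
          add_le_pow h2 (self_le_pow (hN.par_le i hi)) (const_le_pow h2 1)
        have := mul_le_pow hn1 (le_refl (N ^ (d + i + 39)))
        exact le_pow_mul_of_le h2 (Nat.mul_le_mul_right P this) (by omega) le_rfl
    refine le_trans (b := (n + 1) * (N ^ (d + i + 39) * P)) ?_ hfin
    omega
/-! ### Rooted tree decompositions and degeneracy -/

/-- A tree decomposition of the graph `adj` on the vertices below `n` whose nodes are the
numbers below `m`, given by a parent function towards the root `0`; `dep` is a depth
function, and `top v` is the node closest to the root whose bag contains `v`. Every edge from a
parent to a child is recorded in `tree`. -/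
structure RootedDec (n m : ℕ) (adj bag tree : ℕ → ℕ → Prop) where
  par : ℕ → ℕ
  dep : ℕ → ℕ
  top : ℕ → ℕ
  pos : 0 < m
  dep_lt : ∀ x < m, dep x < m
  par_zero : par 0 = 0
  par_lt : ∀ x < m, x ≠ 0 → par x < m
  dep_par : ∀ x < m, x ≠ 0 → dep (par x) < dep x
  tree_par : ∀ x < m, x ≠ 0 → tree (par x) x
  top_lt : ∀ v < n, top v < m
  top_mem : ∀ v < n, bag (top v) v
  bag_par : ∀ x < m, ∀ v < n, bag x v → x = top v ∨ (x ≠ 0 ∧ bag (par x) v)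
  edge : ∀ u < n, ∀ v < n, adj u v → ∃ x < m, bag x u ∧ bag x v

namespace RootedDec

variable {n m : ℕ} {adj bag tree : ℕ → ℕ → Prop} (D : RootedDec n m adj bag tree)
include D

/-- The top node of a vertex is its unique node of least depth. -/
theorem dep_top {x v : ℕ} (hx : x < m) (hv : v < n) (h : bag x v) :
    x = D.top v ∨ D.dep (D.top v) < D.dep x := by
  induction hd : D.dep x using Nat.strong_induction_on generalizing x with
  | _ d ih =>
    subst hd
    rcases D.bag_par x hx v hv h with h1 | ⟨h1, h2⟩
    · exact .inl h1
    · have h3 := D.dep_par x hx h1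
      rcases ih _ h3 (D.par_lt x hx h1) h2 rfl with h4 | h4
      · rw [← h4]; exact .inr h3
      · exact .inr (h4.trans h3)

/-- If two vertices meet in a bag, then they meet in the deeper one of their top nodes. -/
theorem bag_top {x u v : ℕ} (hx : x < m) (hu : u < n) (hv : v < n) (h1 : bag x u) (h2 : bag x v)
    (h : D.dep (D.top u) ≤ D.dep (D.top v)) : bag (D.top v) u := by
  induction hd : D.dep x using Nat.strong_induction_on generalizing x with
  | _ d ih =>
    subst hd
    rcases D.dep_top hx hv h2 with h3 | h3
    · rwa [← h3]
    rcases D.bag_par x hx v hv h2 with h4 | ⟨h4, h5⟩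
    · rwa [← h4]
    rcases D.bag_par x hx u hu h1 with h6 | ⟨_, h6⟩
    · rw [← h6] at h; omega
    · exact ih _ (D.dep_par x hx h4) (D.par_lt x hx h4) h6 h5 rfl

open Classical in
/-- Graphs with a tree decomposition of width `w` are `w`-degenerate: in a set of vertices, consider
one whose top node is deepest. -/
theorem exists_degree_le {w : ℕ} (hirr : ∀ v, ¬ adj v v)
    (hw : ∀ x < m, ((Finset.range n).filter (bag x)).card ≤ w + 1) (U : Finset ℕ)
    (hU : U ⊆ Finset.range n) (hne : U.Nonempty) :
    ∃ v ∈ U, (U.filter (adj v)).card ≤ w := by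
  obtain ⟨v, hv, hmax⟩ := U.exists_max_image (fun v => D.dep (D.top v)) hne
  refine ⟨v, hv, ?_⟩
  have hvn := Finset.mem_range.1 (hU hv)
  have hsub : U.filter (adj v) ⊆ ((Finset.range n).filter (bag (D.top v))).erase v := by
    intro u hu
    rw [Finset.mem_filter] at hu
    have hun := Finset.mem_range.1 (hU hu.1)
    obtain ⟨x, hx, h1, h2⟩ := D.edge v hvn u hun hu.2
    rw [Finset.mem_erase, Finset.mem_filter]
    refine ⟨fun h => hirr v (h ▸ hu.2), hU hu.1, D.bag_top hx hun hvn h2 h1 (hmax u hu.1)⟩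
  have h1 := Finset.card_le_card hsub
  rw [Finset.card_erase_of_mem (by simp [hvn, D.top_mem v hvn])] at h1
  have := hw _ (D.top_lt v hvn)
  omega

end RootedDec

/-! ### Colorings in which no vertex can be recolored with a smaller color -/

section Grundy

open Classical Finset

variable {n w : ℕ} {adj : ℕ → ℕ → Prop} {f : ℕ → ℕ}

/-- The number of edges inside `U`, each counted at its end of larger color. -/
noncomputable def edgeCount (adj : ℕ → ℕ → Prop) (f : ℕ → ℕ) (U : Finset ℕ) : ℕ :=
  ∑ v ∈ U, (U.filter fun u => adj v u ∧ f u < f v).card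

theorem edgeCount_le_erase (hsymm : ∀ u v, adj u v → adj v u) (U : Finset ℕ) {v : ℕ}
    (hv : v ∈ U) :
    edgeCount adj f U ≤ edgeCount adj f (U.erase v) + (U.filter (adj v)).card := by
  have h1 : ∀ x ∈ U.erase v, (U.filter fun u => adj x u ∧ f u < f x).card ≤
      ((U.erase v).filter fun u => adj x u ∧ f u < f x).card +
        if adj v x ∧ f v < f x then 1 else 0 := by
    intro x hx
    have : (U.filter fun u => adj x u ∧ f u < f x) ⊆
        ((U.erase v).filter fun u => adj x u ∧ f u < f x) ∪
          if adj v x ∧ f v < f x then {v} else ∅ := by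
      intro u hu
      rw [mem_filter] at hu
      by_cases huv : u = v
      · subst huv
        rw [if_pos ⟨hsymm _ _ hu.2.1, hu.2.2⟩]
        simp
      · simp [huv, hu]
    refine (card_le_card this).trans ((card_union_le _ _).trans ?_)
    split_ifs <;> simp
  have h2 := sum_le_sum h1
  rw [sum_add_distrib, sum_boole, Nat.cast_id] at h2
  have h3 : (U.filter fun u => adj v u ∧ f u < f v).card +
      ((U.erase v).filter fun x => adj v x ∧ f v < f x).card ≤ (U.filter (adj v)).card := by
    rw [← card_union_of_disjoint]
    · apply card_le_card
      intro u hu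
      simp only [mem_union, mem_filter, mem_erase] at hu ⊢
      tauto
    · rw [disjoint_left]
      intro u hu hu'
      simp only [mem_filter] at hu hu'
      omega
  have h4 : edgeCount adj f U = ∑ x ∈ U.erase v, (U.filter fun u => adj x u ∧ f u < f x).card +
      (U.filter fun u => adj v u ∧ f u < f v).card := (sum_erase_add _ _ hv).symm
  have h5 : edgeCount adj f (U.erase v) =
      ∑ x ∈ U.erase v, ((U.erase v).filter fun u => adj x u ∧ f u < f x).card := rfl
  omega

theorem two_mul_sum_min (w c : ℕ) (h : w ≤ c) :
    2 * ∑ i ∈ range c, min i w + w * (w + 1) = 2 * (w * c) := by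
  induction c, h using Nat.le_induction with
  | base =>
    have h1 : ∑ i ∈ range w, min i w = ∑ i ∈ range w, i :=
      sum_congr rfl fun i hi => min_eq_left (mem_range.1 hi).le
    have h2 := Finset.sum_range_id_mul_two w
    rw [h1]
    cases w with
    | zero => simp
    | succ w => simp only [Nat.add_sub_cancel] at h2; nlinarith
  | succ c hc ih => rw [sum_range_succ, min_eq_right hc]; linarith

/-- In a `w`-degenerate graph, `c` vertices span at most `0 + 1 + ⋯ + w + w + ⋯ + w` edges, with `c`
terms: remove vertices of degree at most `w` one by one. -/
theorem edgeCount_le (hsymm : ∀ u v, adj u v → adj v u) (hirr : ∀ v, ¬ adj v v)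
    (hdeg : ∀ U ⊆ range n, U.Nonempty → ∃ v ∈ U, (U.filter (adj v)).card ≤ w)
    (U : Finset ℕ) (hU : U ⊆ range n) :
    edgeCount adj f U ≤ ∑ i ∈ range U.card, min i w := by
  induction hc : U.card generalizing U with
  | zero => rw [card_eq_zero] at hc; subst hc; simp [edgeCount]
  | succ c ih =>
    obtain ⟨v, hv, hd⟩ := hdeg U hU (card_pos.1 (by omega))
    have h1 := edgeCount_le_erase (f := f) hsymm U hv
    have h2 := ih (U.erase v) ((erase_subset _ _).trans hU) (by rw [card_erase_of_mem hv]; omega)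
    have h3 : (U.filter (adj v)).card ≤ c := by
      have : U.filter (adj v) ⊆ U.erase v := fun u hu => by
        rw [mem_filter] at hu
        exact mem_erase.2 ⟨fun h => hirr v (h ▸ hu.2), hu.1⟩
      have := card_le_card this
      rw [card_erase_of_mem hv] at this
      omega
    rw [sum_range_succ]
    have := le_min h3 hd
    omega

/-- If no vertex of a `w`-degenerate graph can be recolored with a smaller color, then the largest
color `t` satisfies `2 ^ t ≤ n ^ w`. The excess `∑ v, (f v - i)` over color `i` is at most the
number of edges among the vertices of color at least `i`, so that it drops by a factor of
`1 + 1 / w` with each color. -/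
theorem two_pow_color_le (hsymm : ∀ u v, adj u v → adj v u) (hirr : ∀ v, ¬ adj v v)
    (hdeg : ∀ U ⊆ range n, U.Nonempty → ∃ v ∈ U, (U.filter (adj v)).card ≤ w)
    (hG : ∀ v < n, ∀ c < f v, ∃ u < n, adj v u ∧ f u = c) {v : ℕ} (hv : v < n) :
    2 ^ f v ≤ n ^ w := by
  set t := f v with ht
  -- the vertices of color at least `i`
  let U : ℕ → Finset ℕ := fun i => (range n).filter fun x => i ≤ f x
  have hUn : ∀ i, U i ⊆ range n := fun i => filter_subset _ _
  let S : ℕ → ℕ := fun i => ∑ x ∈ range n, (f x - i)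
  have hS : ∀ i, S i = S (i + 1) + (U (i + 1)).card := by
    intro i
    have : (U (i + 1)).card = ∑ x ∈ range n, if i + 1 ≤ f x then 1 else 0 := by
      rw [sum_boole, Nat.cast_id]
    rw [this, ← sum_add_distrib]
    apply sum_congr rfl
    intro x _
    split_ifs <;> omega
  have hSe : ∀ i, S i ≤ edgeCount adj f (U i) := by
    intro i
    have h1 : S i = ∑ x ∈ U i, (f x - i) := by
      rw [sum_filter]
      apply sum_congr rfl
      intro x _
      split_ifs <;> omega
    rw [h1]
    apply sum_le_sum
    intro x hx
    simp only [U, mem_filter, mem_range] at hx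
    have h2 : Ico i (f x) ⊆ ((U i).filter fun u => adj x u ∧ f u < f x).image f := by
      intro c hc
      rw [mem_Ico] at hc
      obtain ⟨u, hu, h3, h4⟩ := hG x hx.1 c hc.2
      rw [mem_image]
      refine ⟨u, ?_, h4⟩
      simp only [U, mem_filter, mem_range]
      exact ⟨⟨hu, by omega⟩, h3, by omega⟩
    have := (card_le_card h2).trans card_image_le
    rwa [Nat.card_Ico] at this
  -- the bound on the excess that the number of edges in a degenerate graph gives
  have hSm : ∀ i, w ≤ (U i).card → 2 * S i + w * (w + 1) ≤ 2 * (w * (U i).card) := by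
    intro i hi
    rw [← two_mul_sum_min w _ hi]
    have := (hSe i).trans (edgeCount_le hsymm hirr hdeg (U i) (hUn i))
    omega
  -- every color up to `t` is used
  have hcol : ∀ c ≤ t, ∃ u < n, f u = c := by
    intro c hc
    rcases hc.lt_or_eq with h | h
    · obtain ⟨u, hu, _, h1⟩ := hG v hv c h
      exact ⟨u, hu, h1⟩
    · exact ⟨v, hv, by omega⟩
  choose! g hgn hgf using hcol
  have hUcard : ∀ i ≤ t, t + 1 - i ≤ (U i).card := by
    intro i hi
    have h2 : Icc i t ⊆ (U i).image f := by
      intro c hc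
      rw [mem_Icc] at hc
      rw [mem_image]
      refine ⟨g c, ?_, hgf c hc.2⟩
      simp only [U, mem_filter, mem_range]
      exact ⟨hgn c hc.2, by rw [hgf c hc.2]; exact hc.1⟩
    have := (card_le_card h2).trans card_image_le
    rwa [Nat.card_Icc] at this
  have hn : t + 1 ≤ n := by
    have := (hUcard 0 (by omega)).trans (card_le_card (hUn 0))
    simpa using this
  rcases Nat.eq_zero_or_pos w with rfl | hw
  · have h0 := hSm 0 (by omega)
    have : f v - 0 ≤ S 0 := single_le_sum (f := fun x => f x - 0) (fun _ _ => Nat.zero_le _)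
      (mem_range.2 hv)
    have : t = 0 := by omega
    simp [this]
  by_cases htw : t + 1 < w
  · rcases Nat.eq_zero_or_pos t with h0 | h0
    · rw [h0, pow_zero]; exact Nat.one_le_pow _ _ (by omega)
    · calc 2 ^ t ≤ 2 ^ w := Nat.pow_le_pow_right (by norm_num) (by omega)
        _ ≤ n ^ w := Nat.pow_le_pow_left (by omega) w
  push Not at htw
  obtain ⟨i₀, hi₀⟩ : ∃ i₀, i₀ + w = t + 1 := ⟨t + 1 - w, by omega⟩
  -- by `hSm` and `hS`, the number `2 * S i + w * (w + 1)` shrinks by a factor of `w / (w + 1)` when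
  -- `i` grows by one, as long as there are `w` vertices left
  have hV : ∀ i ≤ i₀, (w + 1) ^ i * (2 * S i + w * (w + 1)) ≤
      w ^ i * (2 * (w * n)) := by
    intro i
    induction i with
    | zero =>
      intro _
      have h0 := hSm 0 (by have := hUcard 0 (by omega); omega)
      have h1 : (U 0).card ≤ n := by simpa using card_le_card (hUn 0)
      have := Nat.mul_le_mul_left w h1
      simp only [pow_zero, one_mul]
      omega
    | succ i ih =>
      intro hi
      have ih := ih (by omega)
      have h0 := hSm (i + 1) (by have := hUcard (i + 1) (by omega); omega)
      have h1 : (w + 1) * (2 * S (i + 1) + w * (w + 1)) ≤ w * (2 * S i + w * (w + 1)) := by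
        rw [hS i]; nlinarith
      calc (w + 1) ^ (i + 1) * (2 * S (i + 1) + w * (w + 1))
          = (w + 1) ^ i * ((w + 1) * (2 * S (i + 1) + w * (w + 1))) := by ring
        _ ≤ (w + 1) ^ i * (w * (2 * S i + w * (w + 1))) := Nat.mul_le_mul_left _ h1
        _ = w * ((w + 1) ^ i * (2 * S i + w * (w + 1))) := by ring
        _ ≤ w * (w ^ i * (2 * (w * n))) := Nat.mul_le_mul_left _ ih
        _ = w ^ (i + 1) * (2 * (w * n)) := by ring
  -- the last `w` colors are still there
  have hS0 : ∑ l ∈ range w, l ≤ S i₀ := by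
    have hinj : Set.InjOn g (Set.Icc i₀ t) := fun a ha b hb hab => by
      rw [← hgf a ha.2, ← hgf b hb.2, hab]
    calc ∑ l ∈ range w, l = ∑ l ∈ range w, (f (g (i₀ + l)) - i₀) := by
          apply sum_congr rfl
          intro l hl
          rw [mem_range] at hl
          rw [hgf _ (by omega)]; omega
      _ = ∑ x ∈ (range w).image (fun l => g (i₀ + l)), (f x - i₀) := by
          rw [sum_image]
          intro a ha b hb hab
          simp only [coe_range, Set.mem_Iio] at ha hb
          have := hinj ⟨by omega, by omega⟩ ⟨by omega, by omega⟩ hab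
          omega
      _ ≤ S i₀ := by
          apply sum_le_sum_of_subset
          intro x hx
          rw [mem_image] at hx
          obtain ⟨l, hl, rfl⟩ := hx
          rw [mem_range] at hl ⊢
          exact hgn _ (by omega)
  have hfin : (w + 1) ^ i₀ * w ≤ w ^ i₀ * n := by
    have h1 := hV i₀ le_rfl
    have h2 := Finset.sum_range_id_mul_two w
    have h3 : w * (w - 1) + w * (w + 1) = 2 * w * w := by
      cases w with
      | zero => rfl
      | succ w => simp only [Nat.add_sub_cancel]; ring
    have h4 : (w + 1) ^ i₀ * (2 * w * w) ≤ w ^ i₀ * (2 * (w * n)) :=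
      (Nat.mul_le_mul_left _ (by omega)).trans h1
    have h5 : (2 * w) * ((w + 1) ^ i₀ * w) ≤ (2 * w) * (w ^ i₀ * n) := by
      calc (2 * w) * ((w + 1) ^ i₀ * w) = (w + 1) ^ i₀ * (2 * w * w) := by ring
        _ ≤ w ^ i₀ * (2 * (w * n)) := h4
        _ = (2 * w) * (w ^ i₀ * n) := by ring
    exact Nat.le_of_mul_le_mul_left h5 (by omega)
  -- Bernoulli: `(1 + 1 / w) ^ w ≥ 2`
  have hbern : 2 * w ^ w ≤ (w + 1) ^ w := by
    have h1 : ∀ k, w ^ k * (w + k) ≤ (w + 1) ^ k * w := by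
      intro k
      induction k with
      | zero => simp
      | succ k ih =>
        calc w ^ (k + 1) * (w + (k + 1)) ≤ (w + 1) * (w ^ k * (w + k)) := by
              rw [pow_succ]; nlinarith [Nat.zero_le (w ^ k * k)]
          _ ≤ (w + 1) * ((w + 1) ^ k * w) := Nat.mul_le_mul_left _ ih
          _ = (w + 1) ^ (k + 1) * w := by ring
    refine Nat.le_of_mul_le_mul_right (le_of_eq_of_le ?_ (h1 w)) hw
    ring
  have hww : 2 ^ (w - 1) ≤ w ^ w := by
    rcases Nat.lt_or_ge 1 w with h | h
    · calc 2 ^ (w - 1) ≤ 2 ^ w := Nat.pow_le_pow_right (by norm_num) (by omega)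
        _ ≤ w ^ w := Nat.pow_le_pow_left (by omega) w
    · have : w = 1 := by omega
      simp [this]
  have hmul : (w ^ w) ^ i₀ * 2 ^ t ≤ (w ^ w) ^ i₀ * n ^ w := by
    calc (w ^ w) ^ i₀ * 2 ^ t = (2 * w ^ w) ^ i₀ * 2 ^ (w - 1) := by
          rw [show t = i₀ + (w - 1) by omega]; ring
      _ ≤ ((w + 1) ^ w) ^ i₀ * w ^ w := Nat.mul_le_mul (Nat.pow_le_pow_left hbern _) hww
      _ = ((w + 1) ^ i₀ * w) ^ w := by rw [mul_pow, ← pow_mul, ← pow_mul, mul_comm w i₀]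
      _ ≤ (w ^ i₀ * n) ^ w := Nat.pow_le_pow_left hfin w
      _ = (w ^ w) ^ i₀ * n ^ w := by rw [mul_pow, ← pow_mul, ← pow_mul, mul_comm w i₀]
  exact Nat.le_of_mul_le_mul_left hmul (by positivity)

/-- Some coloring below a given proper one admits no smaller color at any vertex: take one
with minimum sum. -/
theorem exists_grundy (hsymm : ∀ u v, adj u v → adj v u) (hirr : ∀ v, ¬ adj v v)
    (hf : ∀ u < n, ∀ v < n, adj u v → f u ≠ f v) :
    ∃ g : ℕ → ℕ, (∀ u < n, ∀ v < n, adj u v → g u ≠ g v) ∧ (∀ v, g v ≤ f v) ∧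
      ∀ v < n, ∀ c < g v, ∃ u < n, adj v u ∧ g u = c := by
  induction hs : ∑ v ∈ range n, f v using Nat.strong_induction_on generalizing f with
  | _ s ih =>
    subst hs
    by_cases h : ∀ v < n, ∀ c < f v, ∃ u < n, adj v u ∧ f u = c
    · exact ⟨f, hf, fun _ => le_rfl, h⟩
    push Not at h
    obtain ⟨v, hv, c, hc, hn⟩ := h
    obtain ⟨g, h1, h2, h3⟩ := ih (∑ x ∈ range n, Function.update f v c x)
      (sum_lt_sum (fun x _ => by
        by_cases hx : x = v
        · subst hx; simpa using hc.le
        · simp [hx]) ⟨v, mem_range.2 hv, by simpa using hc⟩)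
      (f := Function.update f v c) (by
        intro a ha b hb hab
        by_cases hav : a = v
        · subst hav
          have hba : b ≠ a := fun h => hirr a (h ▸ hab)
          simpa [hba] using (hn b hb hab).symm
        · by_cases hbv : b = v
          · subst hbv
            simpa [hav] using hn a ha (hsymm _ _ hab)
          · simpa [hav, hbv] using hf a ha b hb hab) rfl
    refine ⟨g, h1, fun x => (h2 x).trans ?_, h3⟩
    by_cases hx : x = v
    · subst hx; simpa using hc.le
    · simp [hx]

end Grundy

/-! ### Separations in graphs of bounded treewidth -/

namespace RootedDec

variable {n m : ℕ} {adj bag tree : ℕ → ℕ → Prop} (D : RootedDec n m adj bag tree)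

/-- Node `z` lies in the subtree of node `y`. -/
def Desc (y z : ℕ) : Prop := ∃ i, D.par^[i] z = y

variable {D}

theorem Desc.refl (y : ℕ) : D.Desc y y := ⟨0, rfl⟩

theorem Desc.step {y z : ℕ} (h : D.Desc y (D.par z)) : D.Desc y z := by
  obtain ⟨i, h⟩ := h
  exact ⟨i + 1, h⟩

theorem Desc.eq_or {y z : ℕ} (h : D.Desc y z) : z = y ∨ D.Desc y (D.par z) := by
  obtain ⟨_ | i, h⟩ := h
  · exact .inl h
  · exact .inr ⟨i, h⟩

theorem Desc.trans {x y z : ℕ} (h : D.Desc x y) (h' : D.Desc y z) : D.Desc x z := by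
  obtain ⟨i, rfl⟩ := h
  obtain ⟨j, rfl⟩ := h'
  exact ⟨i + j, Function.iterate_add_apply _ _ _ _⟩

theorem desc_zero {z : ℕ} (hz : z < m) : D.Desc 0 z := by
  induction hd : D.dep z using Nat.strong_induction_on generalizing z with
  | _ d ih =>
    subst hd
    by_cases h : z = 0
    · rw [h]; exact .refl 0
    · exact .step (ih _ (D.dep_par z hz h) (D.par_lt z hz h) rfl)

theorem Desc.exists_child {x z : ℕ} (hz : z < m) (h : D.Desc x z) (hne : z ≠ x) :
    ∃ y < m, y ≠ 0 ∧ D.par y = x ∧ D.Desc y z := by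
  induction hd : D.dep z using Nat.strong_induction_on generalizing z with
  | _ d ih =>
    subst hd
    have hz0 : z ≠ 0 := by
      rintro rfl
      obtain ⟨i, hi⟩ := h
      rw [Function.iterate_fixed D.par_zero] at hi
      exact hne hi
    rcases h.eq_or with h1 | h1
    · exact absurd h1 hne
    by_cases hp : D.par z = x
    · exact ⟨z, hz, hz0, hp, .refl z⟩
    · obtain ⟨y, hy, hy0, h2, h3⟩ := ih _ (D.dep_par z hz hz0) (D.par_lt z hz hz0) h1 hp rfl
      exact ⟨y, hy, hy0, h2, h3.step⟩

theorem desc_top {z v : ℕ} (hz : z < m) (hv : v < n) (h : bag z v) : D.Desc (D.top v) z := by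
  induction hd : D.dep z using Nat.strong_induction_on generalizing z with
  | _ d ih =>
    subst hd
    rcases D.bag_par z hz v hv h with h1 | ⟨h1, h2⟩
    · rw [← h1]; exact .refl _
    · exact .step (ih _ (D.dep_par z hz h1) (D.par_lt z hz h1) h2 rfl)

theorem Desc.top_or {y z v : ℕ} (hz : z < m) (hv : v < n) (hd : D.Desc y z) (h : bag z v) :
    D.Desc y (D.top v) ∨ bag (D.par y) v := by
  induction hdep : D.dep z using Nat.strong_induction_on generalizing z with
  | _ d ih =>
    subst hdep
    rcases D.bag_par z hz v hv h with h1 | ⟨h1, h2⟩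
    · rw [← h1]; exact .inl hd
    rcases hd.eq_or with h3 | h3
    · rw [← h3]; exact .inr h2
    · exact ih _ (D.dep_par z hz h1) (D.par_lt z hz h1) h3 h2 rfl

open Classical Finset

/-- In a graph of treewidth at most `k`, every large set `W` contains two disjoint sets of `k + 2`
vertices that can be separated by `k + 1` vertices. In the tree, take a deepest node whose
subtree sees `k + 2` vertices of `W`, and as many of its children as are needed for this. -/
theorem exists_separation (D : RootedDec n m adj bag tree) {k : ℕ}
    (hw : ∀ x < m, ((range n).filter (bag x)).card ≤ k + 1) (W : Finset ℕ)
    (hWn : W ⊆ range n) (hW : 3 * k + 4 ≤ W.card) :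
    ∃ X Y : Finset ℕ, X ∪ Y = range n ∧ (∀ u ∈ X \ Y, ∀ v ∈ Y \ X, ¬ adj u v) ∧
      (X ∩ Y).card ≤ k + 1 ∧ ∃ A ⊆ W ∩ X, ∃ B ⊆ W ∩ Y, Disjoint A B ∧
        A.card = k + 2 ∧ B.card = k + 2 := by
  -- `X x j`: the vertices in the bag of `x`, and those with top node in the subtree of one of its
  -- children `y < j`
  let X : ℕ → ℕ → Finset ℕ := fun x j => (range n).filter fun v =>
    bag x v ∨ ∃ y < j, y < m ∧ y ≠ 0 ∧ D.par y = x ∧ D.Desc y (D.top v)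
  have hX : ∀ x < m, ∀ v < n, D.Desc x (D.top v) → v ∈ X x m := by
    intro x hx v hv h
    simp only [X, mem_filter, mem_range]
    refine ⟨hv, ?_⟩
    by_cases hxt : D.top v = x
    · left; rw [← hxt]; exact D.top_mem v hv
    · obtain ⟨y, h1, h2, h3, h4⟩ := h.exists_child (D.top_lt v hv) hxt
      exact .inr ⟨y, h1, h1, h2, h3, h4⟩
  let P : Finset ℕ := (range m).filter fun x => k + 2 ≤ (W ∩ X x m).card
  have hP : P.Nonempty := by
    refine ⟨0, ?_⟩
    simp only [P, mem_filter, mem_range]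
    refine ⟨D.pos, ?_⟩
    have : W ⊆ W ∩ X 0 m := fun v hv => mem_inter.2 ⟨hv, hX 0 D.pos v (mem_range.1 (hWn hv))
      (desc_zero (D.top_lt v (mem_range.1 (hWn hv))))⟩
    have := card_le_card this
    omega
  -- the deepest node whose subtree sees `k + 2` vertices of `W`, and the first `j` that suffices
  obtain ⟨x, hx, hmax⟩ := P.exists_max_image D.dep hP
  simp only [P, mem_filter, mem_range] at hx hmax
  have hex : ∃ j, k + 2 ≤ (W ∩ X x j).card := ⟨m, hx.2⟩
  have hjs := Nat.find_spec hex
  have hjm := fun i => Nat.find_min hex (m := i)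
  set j := Nat.find hex
  have hWb : (W ∩ X x 0).card ≤ k + 1 := by
    refine (card_le_card ?_).trans (hw x hx.1)
    intro v hv
    simp only [X, mem_inter, mem_filter, Nat.not_lt_zero, false_and, exists_false, or_false] at hv
    simpa using hv.2
  have hj0 : j ≠ 0 := by
    intro h
    rw [h] at hjs
    omega
  obtain ⟨i, hi⟩ := Nat.exists_eq_succ_of_ne_zero hj0
  -- the bag and the children below `j - 1` contribute at most `k + 1` vertices since `j` is minimal,
  -- the child `j - 1` at most `k + 1` since `x` is deepest
  have hupper : (W ∩ X x j).card ≤ 2 * k + 2 := by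
    have h1 : (W ∩ X x i).card ≤ k + 1 := by
      have := hjm i (by omega); omega
    by_cases hc : i < m ∧ i ≠ 0 ∧ D.par i = x
    · have h2 : (W ∩ X i m).card ≤ k + 1 := by
        by_contra h
        have h3 := hmax i ⟨hc.1, by omega⟩
        have h4 := D.dep_par i hc.1 hc.2.1
        rw [hc.2.2] at h4
        omega
      have h3 : W ∩ X x j ⊆ (W ∩ X x i) ∪ (W ∩ X i m) := by
        intro v hv
        rw [mem_inter] at hv
        have hvn := mem_range.1 (hWn hv.1)
        have h4 := hv.2
        simp only [X, mem_filter] at h4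
        rw [mem_union, mem_inter, mem_inter]
        rcases h4.2 with h5 | ⟨y, h5, h6⟩
        · left
          refine ⟨hv.1, ?_⟩
          simp only [X, mem_filter]
          exact ⟨h4.1, .inl h5⟩
        · rcases Nat.lt_succ_iff_lt_or_eq.1 (hi ▸ h5) with h7 | rfl
          · left
            refine ⟨hv.1, ?_⟩
            simp only [X, mem_filter]
            exact ⟨h4.1, .inr ⟨y, h7, h6⟩⟩
          · exact .inr ⟨hv.1, hX y hc.1 v hvn h6.2.2.2⟩
      have := (card_le_card h3).trans (card_union_le _ _)
      omega
    · have h3 : W ∩ X x j ⊆ W ∩ X x i := by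
        intro v hv
        rw [mem_inter] at hv ⊢
        refine ⟨hv.1, ?_⟩
        have h4 := hv.2
        simp only [X, mem_filter] at h4 ⊢
        refine ⟨h4.1, h4.2.imp id ?_⟩
        rintro ⟨y, h5, h6, h7, h8, h9⟩
        refine ⟨y, ?_, h6, h7, h8, h9⟩
        rcases Nat.lt_succ_iff_lt_or_eq.1 (hi ▸ h5) with h | rfl
        · exact h
        · exact absurd ⟨h6, h7, h8⟩ hc
      have := card_le_card h3
      omega
  -- the separator is the bag of `x`
  let S : Finset ℕ := (range n).filter (bag x)
  refine ⟨X x j, (range n \ X x j) ∪ S, ?_, ?_, ?_, ?_⟩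
  · have hXn : X x j ⊆ range n := filter_subset _ _
    have hSn : S ⊆ range n := filter_subset _ _
    ext v
    have h1 := @hXn v
    have h2 := @hSn v
    rw [mem_union, mem_union, mem_sdiff]
    tauto
  · intro u hu v hv huv
    simp only [mem_sdiff, mem_union, not_or] at hu hv
    have hun : u < n := by have := hu.1; simp only [X, mem_filter, mem_range] at this; exact this.1
    have hvS : v ∉ S := fun h => hv.2 (by
      simp only [S, X, mem_filter] at h ⊢
      exact ⟨h.1, .inl h.2⟩)
    have hvn : v < n := by
      rcases hv.1 with h | h
      · exact mem_range.1 h.1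
      · exact absurd h hvS
    obtain ⟨z, hz, h1, h2⟩ := D.edge u hun v hvn huv
    have h3 := hu.1
    simp only [X, mem_filter] at h3
    rcases h3.2 with h4 | ⟨y, h4, h5, h6, h7, h8⟩
    · exact hu.2.2 (by simp [S, hun, h4])
    · rcases (h8.trans (desc_top hz hun h1)).top_or hz hvn h2 with h9 | h9
      · exact hv.2 (by
          simp only [X, mem_filter, mem_range]
          exact ⟨hvn, .inr ⟨y, h4, h5, h6, h7, h9⟩⟩)
      · rw [h7] at h9
        exact hvS (by simp [S, hvn, h9])
  · refine (card_le_card ?_).trans (hw x hx.1)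
    intro v hv
    simp only [mem_inter, mem_union, mem_sdiff] at hv
    tauto
  · obtain ⟨A, hA, hAc⟩ := exists_subset_card_eq hjs
    have h1 : k + 2 ≤ (W \ X x j).card := by
      have := card_sdiff_add_card_inter W (X x j)
      omega
    obtain ⟨B, hB, hBc⟩ := exists_subset_card_eq h1
    refine ⟨A, hA, B, ?_, ?_, hAc, hBc⟩
    · intro v hv
      have := hB hv
      rw [mem_sdiff] at this
      rw [mem_inter, mem_union, mem_sdiff]
      exact ⟨this.1, .inl ⟨hWn this.1, this.2⟩⟩
    · rw [disjoint_left]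
      intro v h2 h3
      exact (mem_sdiff.1 (hB h3)).2 (mem_inter.1 (hA h2)).2

end RootedDec

/-! ### Rooting a tree decomposition -/

/-- A relation on bounded numbers as a relation on all numbers. -/
def onNat {a b : ℕ} (R : Fin a → Fin b → Prop) (i j : ℕ) : Prop :=
  ∃ (hi : i < a) (hj : j < b), R ⟨i, hi⟩ ⟨j, hj⟩

section Rooting

variable {V : Type*} {T : SimpleGraph V}

theorem exists_closer (hT : T.IsTree) (r : V) {x : V} (hx : x ≠ r) :
    ∃ y, T.Adj y x ∧ T.dist r y < T.dist r x := by
  obtain ⟨p, hp⟩ := hT.connected.exists_walk_length_eq_dist x r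
  cases p with
  | nil => exact absurd rfl hx
  | cons h q =>
    refine ⟨_, h.symm, ?_⟩
    rw [SimpleGraph.dist_comm (v := x), ← hp, SimpleGraph.Walk.length_cons,
      SimpleGraph.dist_comm]
    have := SimpleGraph.dist_le q
    omega

theorem closer_unique (hT : T.IsTree) (r : V) {x y z : V} (hy : T.Adj y x) (hz : T.Adj z x)
    (hyd : T.dist r y < T.dist r x) (hzd : T.dist r z < T.dist r x) : y = z := by
  obtain ⟨p, hp⟩ := hT.connected.exists_walk_length_eq_dist r y
  obtain ⟨q, hq⟩ := hT.connected.exists_walk_length_eq_dist r z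
  have h1 := hT.dist_eq_dist_add_one_of_adj r hy
  have h2 := hT.dist_eq_dist_add_one_of_adj r hz
  have hp' : (p.concat hy).IsPath :=
    SimpleGraph.Walk.isPath_of_length_eq_dist _ (by rw [SimpleGraph.Walk.length_concat]; omega)
  have hq' : (q.concat hz).IsPath :=
    SimpleGraph.Walk.isPath_of_length_eq_dist _ (by rw [SimpleGraph.Walk.length_concat]; omega)
  have h := congrArg Subtype.val ((hT.isAcyclic.subsingleton_path r x).elim ⟨_, hp'⟩ ⟨_, hq'⟩)
  have := congrArg SimpleGraph.Walk.penultimate h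
  simpa using this

open Classical in
/-- The neighbor of `x` that is closer to `r`. -/
noncomputable def closer (T : SimpleGraph V) (r x : V) : V :=
  if h : ∃ y, T.Adj y x ∧ T.dist r y < T.dist r x then h.choose else r

theorem closer_spec (hT : T.IsTree) (r : V) {x : V} (hx : x ≠ r) :
    T.Adj (closer T r x) x ∧ T.dist r (closer T r x) < T.dist r x := by
  have h := exists_closer hT r hx
  rw [closer, dif_pos h]
  exact h.choose_spec

theorem closer_self (T : SimpleGraph V) (r : V) : closer T r r = r := by
  rw [closer, dif_neg]
  simp

theorem closer_of_adj (hT : T.IsTree) (r : V) {x y : V} (h : T.Adj x y) :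
    (y ≠ r ∧ closer T r y = x) ∨ (x ≠ r ∧ closer T r x = y) := by
  rcases hT.dist_eq_dist_add_one_of_adj r h with h1 | h1
  · have hx : x ≠ r := by rintro rfl; simp at h1
    obtain ⟨h2, h3⟩ := closer_spec hT r hx
    exact .inr ⟨hx, closer_unique hT r h2 h.symm h3 (by omega)⟩
  · have hy : y ≠ r := by rintro rfl; simp at h1
    obtain ⟨h2, h3⟩ := closer_spec hT r hy
    exact .inl ⟨hy, closer_unique hT r h2 h h3 (by omega)⟩

/-- A connected set of nodes contains, with a node that is not closest to the root, its parent: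
otherwise it would stay in the subtree below that node. -/
theorem closer_mem (hT : T.IsTree) (r : V) {S : Set V} (hS : (T.induce S).Connected) {x t : V}
    (hx : x ∈ S) (ht : t ∈ S) (hmin : T.dist r t ≤ T.dist r x) (hne : x ≠ t) :
    x ≠ r ∧ closer T r x ∈ S := by
  have hxr : x ≠ r := by
    rintro rfl
    rw [SimpleGraph.dist_self, Nat.le_zero] at hmin
    exact hne ((hT.connected.dist_eq_zero_iff).1 hmin)
  refine ⟨hxr, ?_⟩
  by_contra hp
  have key : ∀ z : S, Relation.ReflTransGen (T.induce S).Adj ⟨x, hx⟩ z →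
      ∃ i, (closer T r)^[i] z.1 = x := by
    intro z hz
    induction hz with
    | refl => exact ⟨0, rfl⟩
    | @tail a b _ hab ih =>
      obtain ⟨i, hi⟩ := ih
      rcases closer_of_adj hT r (show T.Adj a.1 b.1 from hab) with ⟨_, h⟩ | ⟨_, h⟩
      · exact ⟨i + 1, by rw [Function.iterate_succ_apply, h, hi]⟩
      · cases i with
        | zero =>
          simp only [Function.iterate_zero, id_eq] at hi
          rw [hi] at h
          exact absurd (h ▸ b.2) hp
        | succ i => exact ⟨i, by rw [← h]; exact hi⟩
  have hdist : ∀ i z, (closer T r)^[i] z = x → T.dist r x ≤ T.dist r z ∧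
      (z ≠ x → T.dist r x < T.dist r z) := by
    intro i
    induction i with
    | zero => rintro z rfl; simp
    | succ i ih =>
      intro z hz
      rw [Function.iterate_succ_apply] at hz
      have h1 := (ih _ hz).1
      by_cases hzr : z = r
      · subst hzr
        rw [closer_self] at h1 hz
        exact ih _ hz
      · have h2 := (closer_spec hT r hzr).2
        exact ⟨by omega, fun _ => by omega⟩
  obtain ⟨i, hi⟩ := key ⟨t, ht⟩ ((SimpleGraph.reachable_iff_reflTransGen _ _).1
    (hS.preconnected ⟨x, hx⟩ ⟨t, ht⟩))
  have := (hdist i t hi).2 (Ne.symm hne)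
  omega

end Rooting

open Classical in
/-- A tree decomposition, rooted at node `0`. -/
theorem TreeDecomposition.exists_rootedDec {n m : ℕ} {G : SimpleGraph (Fin n)}
    (D : TreeDecomposition G m) :
    Nonempty (RootedDec n m (onNat G.Adj) (onNat fun x v => v ∈ D.bag x) (onNat D.tree.Adj)) := by
  have hm : 0 < m := Fin.pos_iff_nonempty.2 D.isTree.connected.nonempty
  let r : Fin m := ⟨0, hm⟩
  have htop : ∀ v : Fin n, ∃ t, v ∈ D.bag t ∧ ∀ x, v ∈ D.bag x → D.tree.dist r t ≤ D.tree.dist r x := by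
    intro v
    obtain ⟨t, ht, h⟩ := (Finset.univ.filter fun x => v ∈ D.bag x).exists_min_image
      (D.tree.dist r) (by
        obtain ⟨x, hx⟩ := D.vertex_mem v
        exact ⟨x, by simpa using hx⟩)
    exact ⟨t, by simpa using ht, fun x hx => h x (by simpa using hx)⟩
  choose top htop1 htop2 using htop
  have hr : ∀ x : Fin m, x.1 ≠ 0 → x ≠ r := fun x hx h => hx (by rw [h])
  exact ⟨{
    par := fun x => if h : x < m then (closer D.tree r ⟨x, h⟩ : Fin m).1 else 0
    dep := fun x => if h : x < m then D.tree.dist r ⟨x, h⟩ else 0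
    top := fun v => if h : v < n then top ⟨v, h⟩ else 0
    pos := hm
    dep_lt := by
      intro x hx
      simp only [hx, dif_pos]
      obtain ⟨p, hp, hl⟩ := D.isTree.connected.exists_path_of_dist r ⟨x, hx⟩
      have := hp.length_lt
      rw [Fintype.card_fin] at this
      omega
    par_zero := by
      simp only [hm, dif_pos]
      exact congrArg Fin.val (closer_self D.tree r)
    par_lt := by
      intro x hx _
      simp only [hx, dif_pos]
      exact Fin.is_lt _
    dep_par := by
      intro x hx h0
      simp only [hx, dif_pos, Fin.is_lt]
      exact (closer_spec D.isTree r (hr ⟨x, hx⟩ h0)).2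
    tree_par := by
      intro x hx h0
      simp only [hx, dif_pos]
      exact ⟨Fin.is_lt _, hx, (closer_spec D.isTree r (hr ⟨x, hx⟩ h0)).1⟩
    top_lt := by
      intro v hv
      simp only [hv, dif_pos]
      exact Fin.is_lt _
    top_mem := by
      intro v hv
      simp only [hv, dif_pos]
      exact ⟨Fin.is_lt _, hv, htop1 ⟨v, hv⟩⟩
    bag_par := by
      rintro x hx v hv ⟨_, _, h⟩
      simp only [hv, hx, dif_pos]
      by_cases hxt : (⟨x, hx⟩ : Fin m) = top ⟨v, hv⟩
      · exact .inl (congrArg Fin.val hxt)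
      · obtain ⟨h1, h2⟩ := closer_mem D.isTree r (D.connected ⟨v, hv⟩) (x := ⟨x, hx⟩) h
          (htop1 _) (htop2 _ _ h) hxt
        exact .inr ⟨fun h0 => h1 (Fin.ext h0), Fin.is_lt _, hv, h2⟩
    edge := by
      rintro u hu v hv ⟨_, _, h⟩
      obtain ⟨x, h1, h2⟩ := D.edge_mem _ _ h
      exact ⟨x, x.2, ⟨x.2, hu, h1⟩, ⟨x.2, hv, h2⟩⟩ }⟩

open Classical in
theorem TreeDecomposition.card_bag_le {n m : ℕ} {G : SimpleGraph (Fin n)}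
    (D : TreeDecomposition G m) (x : ℕ) :
    ((Finset.range n).filter ((onNat fun x v => v ∈ D.bag x) x)).card ≤ D.width + 1 := by
  by_cases hx : x < m
  · have h1 : ((Finset.range n).filter ((onNat fun x v => v ∈ D.bag x) x)) ⊆
        (D.bag ⟨x, hx⟩).map Fin.valEmbedding := by
      intro v hv
      simp only [Finset.mem_filter, onNat] at hv
      obtain ⟨_, _, hv, h⟩ := hv
      exact Finset.mem_map.2 ⟨_, h, rfl⟩
    have h2 := Finset.card_le_card h1
    rw [Finset.card_map] at h2
    have h3 : (D.bag ⟨x, hx⟩).card ≤ Finset.univ.sup fun x => (D.bag x).card :=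
      Finset.le_sup (f := fun x => (D.bag x).card) (Finset.mem_univ _)
    simp only [TreeDecomposition.width]
    omega
  · rw [Finset.filter_false_of_mem]
    · simp
    · rintro v _ ⟨h, _⟩
      exact hx h

/-! ### Consistency along the tree -/

open Classical in
/-- Let `A t x` be families of partial solutions at the nodes of a rooted tree decomposition such
that each member of `A (t + 1) x` agrees with some member of `A t y` on the common
vertices, for all neighbors `y` of `x`. If `A m 0` is not empty then there are members of `A 0 x`
that fit together. -/
theorem RootedDec.exists_global {n m : ℕ} {adj bag tree : ℕ → ℕ → Prop}
    (D : RootedDec n m adj bag tree) (A : ℕ → ℕ → (ℕ → ℕ) → Prop)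
    (hmono : ∀ t x g, A (t + 1) x g → A t x g)
    (hstep : ∀ t, ∀ x < m, ∀ g, A (t + 1) x g → ∀ y < m, tree x y →
      ∃ g', A t y g' ∧ ∀ v < n, bag x v → bag y v → g v = g' v)
    {g₀ : ℕ → ℕ} (h0 : A m 0 g₀) :
    ∃ f : ℕ → ℕ, ∀ x < m, ∃ g, A 0 x g ∧ ∀ v < n, bag x v → f v = g v := by
  have hmono' : ∀ s t x g, s ≤ t → A t x g → A s x g := by
    intro s t x g hst
    induction hst with
    | refl => exact id
    | step _ ih => exact fun h => ih (hmono _ _ _ h)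
  -- choose partial solutions level by level: the one at a node of depth `d` survives `m - d` rounds,
  -- so that each of its neighbors has a matching one that survives one round less
  have key : ∀ d, ∃ σ : ℕ → ℕ → ℕ, σ 0 = g₀ ∧ ∀ x < m, D.dep x < d → A (m - D.dep x) x (σ x) ∧
      (x ≠ 0 → ∀ v < n, bag x v → bag (D.par x) v → σ x v = σ (D.par x) v) := by
    intro d
    induction d with
    | zero => exact ⟨fun _ => g₀, rfl, fun x _ h => absurd h (Nat.not_lt_zero _)⟩
    | succ d ih =>
      obtain ⟨σ, hσ0, hσ⟩ := ih
      have hnew : ∀ x, ∃ g', x < m → D.dep x = d → x ≠ 0 → A (m - D.dep x) x g' ∧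
          ∀ v < n, bag x v → bag (D.par x) v → g' v = σ (D.par x) v := by
        intro x
        by_cases h : x < m ∧ D.dep x = d ∧ x ≠ 0
        · obtain ⟨hx, hd, hx0⟩ := h
          have h1 := D.dep_par x hx hx0
          have h2 := D.dep_lt x hx
          obtain ⟨h3, -⟩ := hσ (D.par x) (D.par_lt x hx hx0) (by omega)
          rw [show m - D.dep (D.par x) = (m - D.dep (D.par x) - 1) + 1 by omega] at h3
          obtain ⟨g', h4, h5⟩ := hstep _ _ (D.par_lt x hx hx0) _ h3 x hx (D.tree_par x hx hx0)
          exact ⟨g', fun _ _ _ => ⟨hmono' _ _ _ _ (by omega) h4,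
            fun v hv h6 h7 => (h5 v hv h7 h6).symm⟩⟩
        · exact ⟨g₀, fun h1 h2 h3 => absurd ⟨h1, h2, h3⟩ h⟩
      choose τ hτ using hnew
      refine ⟨fun x => if x = 0 then g₀ else if D.dep x < d then σ x else τ x, if_pos rfl, ?_⟩
      intro x hx hd
      by_cases hx0 : x = 0
      · subst hx0
        exact ⟨by simpa using hmono' _ _ _ _ (Nat.sub_le _ _) h0, fun h => absurd rfl h⟩
      have h1 := D.dep_par x hx hx0
      have hpar : (if D.par x = 0 then g₀ else if D.dep (D.par x) < d then σ (D.par x)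
          else τ (D.par x)) = σ (D.par x) := by
        split_ifs with h2 h3
        · rw [h2, hσ0]
        · rfl
        · omega
      simp only [if_neg hx0, hpar]
      by_cases hd' : D.dep x < d
      · simp only [hd', if_true]
        exact ⟨(hσ x hx hd').1, (hσ x hx hd').2⟩
      · simp only [hd', if_false]
        have := hτ x hx (by omega) hx0
        exact ⟨this.1, fun _ => this.2⟩
  obtain ⟨σ, hσ0, hσ⟩ := key m
  refine ⟨fun v => σ (D.top v) v, fun x hx => ⟨σ x, hmono' _ _ _ _ (Nat.zero_le _)
    (hσ x hx (D.dep_lt x hx)).1, ?_⟩⟩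
  intro v hv hxv
  induction hd : D.dep x using Nat.strong_induction_on generalizing x with
  | _ d ih =>
    subst hd
    show σ (D.top v) v = σ x v
    rcases D.bag_par x hx v hv hxv with h1 | ⟨h1, h2⟩
    · rw [← h1]
    · refine (ih _ (D.dep_par x hx h1) _ (D.par_lt x hx h1) h2 rfl).trans ?_
      exact ((hσ x hx (D.dep_lt x hx)).2 h1 v hv hxv h2).symm

/-! ### Mixed radix numbers -/

section Radix

open Finset

/-- The number with digits `f` in the mixed radix system with bases `b`. -/
def radix (b f : ℕ → ℕ) (n : ℕ) : ℕ := ∑ v ∈ range n, f v * ∏ u ∈ range v, b u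

theorem radix_lt {b f : ℕ → ℕ} {n : ℕ} (h : ∀ v < n, f v < b v) :
    radix b f n < ∏ u ∈ range n, b u := by
  induction n with
  | zero => simp [radix]
  | succ n ih =>
    have h1 := ih fun v hv => h v (by omega)
    have h2 := h n (by omega)
    rw [radix, sum_range_succ, prod_range_succ]
    rw [radix] at h1
    have h3 : f n + 1 ≤ b n := h2
    calc _ < ∏ u ∈ range n, b u + f n * ∏ u ∈ range n, b u := by omega
      _ = (∏ u ∈ range n, b u) * (f n + 1) := by ring
      _ ≤ _ := Nat.mul_le_mul_left _ h3

theorem radix_digit {b f : ℕ → ℕ} {n v : ℕ} (h : ∀ v < n, f v < b v) (hv : v < n) :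
    radix b f n / (∏ u ∈ range v, b u) % b v = f v := by
  have hpos : ∀ v < n, 0 < b v := fun v hv => (Nat.zero_le _).trans_lt (h v hv)
  have hW : 0 < ∏ u ∈ range v, b u :=
    Finset.prod_pos fun u hu => hpos u ((mem_range.1 hu).trans hv)
  have hlow := radix_lt (fun u hu => h u (hu.trans hv) : ∀ u < v, f u < b u)
  obtain ⟨q, hq⟩ : ∃ q, radix b f n = radix b f v + (∏ u ∈ range v, b u) * (f v + b v * q) := by
    clear hlow
    induction n, hv using Nat.le_induction with
    | base =>
      refine ⟨0, ?_⟩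
      rw [radix, sum_range_succ, ← radix]; ring
    | succ n hn ih =>
      obtain ⟨q, hq⟩ := ih (fun u hu => h u (by omega)) (fun u hu => hpos u (by omega))
      obtain ⟨d, hd⟩ : (∏ u ∈ range (v + 1), b u) ∣ ∏ u ∈ range n, b u :=
        prod_dvd_prod_of_subset _ _ _ (range_subset_range.2 hn)
      refine ⟨q + f n * d, ?_⟩
      rw [radix, sum_range_succ, ← radix, hq, hd, prod_range_succ]; ring
  rw [hq, Nat.add_mul_div_left _ _ hW, Nat.div_eq_of_lt hlow, zero_add, Nat.add_mul_mod_self_left,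
    Nat.mod_eq_of_lt (h v hv)]

end Radix

/-! ### Building expressions -/

namespace Term

instance (k : ℕ) : OfNat Term k := ⟨.lit k⟩
instance : Add Term := ⟨.bin .add⟩
instance : Sub Term := ⟨.bin .sub⟩
instance : Mul Term := ⟨.bin .mul⟩
instance : Div Term := ⟨.bin .div⟩
instance : Mod Term := ⟨.bin .mod⟩

/-- The expression counts as true: its value is not zero. -/
def holds (e : Term) (M : Mem) (Γ : List ℕ) : Prop := e.eval M Γ ≠ 0

instance (e : Term) (M : Mem) (Γ : List ℕ) : Decidable (e.holds M Γ) :=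
  inferInstanceAs (Decidable (_ ≠ _))

/-! The connectives may take any nonzero value when they hold; `flag` turns such a value into `1`. -/

def not (a : Term) : Term := .ite a 0 1
def and (a b : Term) : Term := .bin .mul a b
def or (a b : Term) : Term := .ite a 1 b
def imp (a b : Term) : Term := .ite a b 1
def lt (a b : Term) : Term := .bin .sub b a
def le (a b : Term) : Term := (b.lt a).not
def eq (a b : Term) : Term := (a.le b).and (b.le a)
def sum (i : ℕ) (e : Term) : Term := .agg false i e
def prod (i : ℕ) (e : Term) : Term := .agg true i e
def all (i : ℕ) (e : Term) : Term := .agg true i e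
def ex (i : ℕ) (e : Term) : Term := .agg false i e
def flag (a : Term) : Term := .ite a 1 0

/-- Skip the bound variable with index `n`. -/
def lift (n : ℕ) : Term → Term
  | .lit k => .lit k
  | .var i => .var (if i < n then i else i + 1)
  | .get b a => .get b (a.lift n)
  | .bin o a b => .bin o (a.lift n) (b.lift n)
  | .ite c a b => .ite (c.lift n) (a.lift n) (b.lift n)
  | .agg p i e => .agg p i (e.lift (n + 1))

/-- An expression below one more binder. -/
def up (e : Term) : Term := e.lift 0

variable (M : Mem) (Γ : List ℕ)

theorem eval_lift (e : Term) (Δ : List ℕ) (j : ℕ) :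
    (e.lift Δ.length).eval M (Δ ++ j :: Γ) = e.eval M (Δ ++ Γ) := by
  induction e generalizing Δ with
  | lit k => rfl
  | var i =>
    simp only [lift, eval]
    split_ifs with h
    · rw [List.getD_append _ _ _ _ h, List.getD_append _ _ _ _ h]
    · rw [List.getD_append_right _ _ _ _ (by omega), List.getD_append_right _ _ _ _ (by omega),
        show i + 1 - Δ.length = (i - Δ.length) + 1 by omega, List.getD_cons_succ]
  | get b a ih => simp only [lift, eval, ih]
  | bin o a b iha ihb => simp only [lift, eval, iha, ihb]
  | ite c a b ihc iha ihb => simp only [lift, eval, ihc, iha, ihb]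
  | agg p i e ih =>
    simp only [lift, eval]
    congr 1
    funext j'
    exact ih (j' :: Δ)

@[simp] theorem eval_up (e : Term) (j : ℕ) : e.up.eval M (j :: Γ) = e.eval M Γ :=
  eval_lift M Γ e [] j

@[simp] theorem eval_lit (k : ℕ) : (lit k).eval M Γ = k := rfl
@[simp] theorem eval_ofNat (k : ℕ) : (OfNat.ofNat k : Term).eval M Γ = k := rfl
@[simp] theorem eval_zero : (0 : Term).eval M Γ = 0 := rfl
@[simp] theorem eval_one : (1 : Term).eval M Γ = 1 := rfl
@[simp] theorem eval_two : (2 : Term).eval M Γ = 2 := rfl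
@[simp] theorem eval_var_zero (j : ℕ) : (var 0).eval M (j :: Γ) = j := rfl
@[simp] theorem eval_var_succ (i j : ℕ) : (var (i + 1)).eval M (j :: Γ) = (var i).eval M Γ := rfl
@[simp] theorem eval_var_one (j j' : ℕ) : (var 1).eval M (j' :: j :: Γ) = j := rfl
@[simp] theorem eval_var_two (j j' j'' : ℕ) : (var 2).eval M (j'' :: j' :: j :: Γ) = j := rfl
@[simp] theorem eval_get (b : ℕ) (a : Term) : (get b a).eval M Γ = M b (a.eval M Γ) := rfl
@[simp] theorem eval_add (a b : Term) : (a + b).eval M Γ = a.eval M Γ + b.eval M Γ := rfl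
@[simp] theorem eval_sub (a b : Term) : (a - b).eval M Γ = a.eval M Γ - b.eval M Γ := rfl
@[simp] theorem eval_mul (a b : Term) : (a * b).eval M Γ = a.eval M Γ * b.eval M Γ := rfl
@[simp] theorem eval_div (a b : Term) : (a / b).eval M Γ = a.eval M Γ / b.eval M Γ := rfl
@[simp] theorem eval_mod (a b : Term) : (a % b).eval M Γ = a.eval M Γ % b.eval M Γ := rfl
@[simp] theorem eval_ite (c a b : Term) :
    (ite c a b).eval M Γ = if c.holds M Γ then a.eval M Γ else b.eval M Γ := rfl
@[simp] theorem eval_sum (i : ℕ) (e : Term) :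
    (sum i e).eval M Γ = ∑ j ∈ Finset.range (M 2 i), e.eval M (j :: Γ) := rfl
@[simp] theorem eval_prod (i : ℕ) (e : Term) :
    (prod i e).eval M Γ = ∏ j ∈ Finset.range (M 2 i), e.eval M (j :: Γ) := rfl
@[simp] theorem eval_flag (a : Term) :
    (flag a).eval M Γ = if a.holds M Γ then 1 else 0 := rfl

@[simp] theorem holds_not (a : Term) : a.not.holds M Γ ↔ ¬ a.holds M Γ := by
  by_cases h : a.eval M Γ = 0 <;> simp [holds, Term.not, h]
@[simp] theorem holds_and (a b : Term) : (a.and b).holds M Γ ↔ a.holds M Γ ∧ b.holds M Γ :=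
  Nat.mul_ne_zero_iff
@[simp] theorem holds_or (a b : Term) : (a.or b).holds M Γ ↔ a.holds M Γ ∨ b.holds M Γ := by
  by_cases h : a.holds M Γ <;> simp [holds, Term.or] <;> simp_all [holds]
@[simp] theorem holds_imp (a b : Term) : (a.imp b).holds M Γ ↔ (a.holds M Γ → b.holds M Γ) := by
  by_cases h : a.holds M Γ <;> simp [holds, Term.imp] <;> simp_all [holds]
@[simp] theorem holds_lt (a b : Term) : (a.lt b).holds M Γ ↔ a.eval M Γ < b.eval M Γ :=
  Nat.sub_ne_zero_iff_lt
@[simp] theorem holds_le (a b : Term) : (a.le b).holds M Γ ↔ a.eval M Γ ≤ b.eval M Γ := by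
  simp [Term.le]
@[simp] theorem holds_eq (a b : Term) : (a.eq b).holds M Γ ↔ a.eval M Γ = b.eval M Γ := by
  simp only [Term.eq, holds_and, holds_le]; omega
@[simp] theorem holds_all (i : ℕ) (e : Term) :
    (all i e).holds M Γ ↔ ∀ j < M 2 i, e.holds M (j :: Γ) := by
  show (∏ j ∈ Finset.range (M 2 i), e.eval M (j :: Γ)) ≠ 0 ↔ _
  simp [Finset.prod_ne_zero_iff, holds]
@[simp] theorem holds_ex (i : ℕ) (e : Term) :
    (ex i e).holds M Γ ↔ ∃ j < M 2 i, e.holds M (j :: Γ) := by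
  show (∑ j ∈ Finset.range (M 2 i), e.eval M (j :: Γ)) ≠ 0 ↔ _
  simp [Finset.sum_eq_zero_iff, holds]
@[simp] theorem holds_get (b : ℕ) (a : Term) : (get b a).holds M Γ ↔ M b (a.eval M Γ) ≠ 0 := Iff.rfl
@[simp] theorem holds_ite (c a b : Term) : (ite c a b).holds M Γ ↔
    if c.holds M Γ then a.holds M Γ else b.holds M Γ := by
  rw [holds, eval_ite]; split_ifs <;> rfl

/-- Whether an expression reads bank `b`. -/
def reads (b : ℕ) : Term → Bool
  | .lit _ => false
  | .var _ => false
  | .get b' a => decide (b' = b) || a.reads b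
  | .bin _ x y => x.reads b || y.reads b
  | .ite c x y => c.reads b || x.reads b || y.reads b
  | .agg _ _ e => e.reads b

/-- Expressions that do not read bank `b` are not affected by changes there. -/
theorem eval_congr {M M' : Mem} {b : ℕ} (hb : b ≠ 2) (h : ∀ b', b' ≠ b → M' b' = M b') (e : Term)
    (he : e.reads b = false) (Γ : List ℕ) : e.eval M' Γ = e.eval M Γ := by
  induction e generalizing Γ with
  | lit k => rfl
  | var i => rfl
  | get b' a ih =>
    simp only [reads, Bool.or_eq_false_iff, decide_eq_false_iff_not] at he
    simp only [eval, ih he.2, h b' he.1]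
  | bin o x y ihx ihy =>
    simp only [reads, Bool.or_eq_false_iff] at he
    simp only [eval, ihx he.1, ihy he.2]
  | ite c x y ihc ihx ihy =>
    simp only [reads, Bool.or_eq_false_iff] at he
    simp only [eval, ihc he.1.1, ihx he.1.2, ihy he.2]
  | agg p i e ih =>
    simp only [eval, h 2 (Ne.symm hb), ih he]

end Term

/-! ### Loops that fill a bank -/

theorem Cmd.run_seq (c d : Cmd) (Γ : List ℕ) (M : Mem) :
    (c.seq d).run Γ M = d.run Γ (c.run Γ M) := rfl

theorem Cmd.run_ite (e : Term) (c d : Cmd) (Γ : List ℕ) (M : Mem) :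
    (Cmd.ite e c d).run Γ M = if e.holds M Γ then c.run Γ M else d.run Γ M := rfl

@[simp] theorem Mem.set_same (M : Mem) (b a v a' : ℕ) :
    M.set b a v b a' = if a' = a then v else M b a' := by
  simp [Mem.set, Function.update_apply]

theorem Mem.set_of_ne (M : Mem) {b a v b' : ℕ} (h : b' ≠ b) : M.set b a v b' = M b' := by
  simp [Mem.set, h]

/-- Overwrite the first `N` cells of bank `b`. -/
def Mem.fill (M : Mem) (b N : ℕ) (g : ℕ → ℕ) : Mem :=
  Function.update M b fun a => if a < N then g a else M b a

@[simp] theorem Mem.fill_same (M : Mem) (b N : ℕ) (g : ℕ → ℕ) (a : ℕ) :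
    M.fill b N g b a = if a < N then g a else M b a := by
  simp [Mem.fill]

theorem Mem.fill_of_ne (M : Mem) {b N b' : ℕ} {g : ℕ → ℕ} (h : b' ≠ b) :
    M.fill b N g b' = M b' := by
  simp [Mem.fill, h]

/-- A loop that overwrites the cells of a bank one by one, where each new value may depend on the old
contents of the same cell. -/
theorem Cmd.run_fill {b i : ℕ} {e : Term} {Γ : List ℕ} {M : Mem} (hb : b ≠ 2) (g : ℕ → ℕ)
    (he : ∀ j < M 2 i, ∀ M' : Mem, (∀ b', b' ≠ b → M' b' = M b') → M' b j = M b j →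
      e.eval M' (j :: Γ) = g j)
    (hg : ∀ j < M 2 i, g j < M 2 0) :
    (Cmd.loop i (.put b (.var 0) e)).run Γ M = M.fill b (M 2 i) g := by
  have := Cmd.loop_induct (i := i) (c := .put b (.var 0) e) (Γ := Γ) (M := M)
    (fun j M' => M' = M.fill b j g) (by
      funext b' a
      by_cases h : b' = b
      · subst h; simp
      · rw [Mem.fill_of_ne _ h])
    (by
      rintro j M' hj rfl
      have h1 := he j hj (M.fill b j g) (fun b' h => Mem.fill_of_ne _ h) (by simp)
      have h2 : M.fill b j g 2 0 = M 2 0 := by rw [Mem.fill_of_ne _ (Ne.symm hb)]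
      funext b' a
      simp only [Cmd.run, h1, h2, Nat.mod_eq_of_lt (hg j hj), Term.eval_var_zero]
      by_cases h : b' = b
      · subst h
        simp only [Mem.set_same, Mem.fill_same]
        split_ifs with h3 h4 h5 h6 <;> first | omega | rfl | (subst h3; rfl)
      · rw [Mem.set_of_ne _ h, Mem.fill_of_ne _ h, Mem.fill_of_ne _ h])
  exact this

theorem Cmd.run_fill_of_not_reads {b i : ℕ} {e : Term} (hb : b ≠ 2) (he : e.reads b = false)
    {Γ : List ℕ} {M : Mem} (hg : ∀ j < M 2 i, e.eval M (j :: Γ) < M 2 0) :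
    (Cmd.loop i (.put b (.var 0) e)).run Γ M =
      M.fill b (M 2 i) (fun j => e.eval M (j :: Γ)) :=
  Cmd.run_fill hb _ (fun _ _ _ h _ => e.eval_congr hb h he _) hg

theorem flag_lt {P : Prop} [Decidable P] {L : ℕ} (h : 1 < L) : (if P then 1 else 0) < L := by
  split_ifs <;> omega

theorem flag_ne_zero {P : Prop} [Decidable P] : (if P then 1 else 0) ≠ 0 ↔ P := by
  split_ifs with h <;> simp [h]

/-- A loop that marks cells of a bank. -/
theorem Cmd.run_mark {b i : ℕ} {c addr : Term} (hb : b ≠ 2) (hc : c.reads b = false)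
    (ha : addr.reads b = false) {Γ : List ℕ} {M : Mem} (hL : 1 < M 2 0) (a : ℕ) :
    (Cmd.loop i (.ite c (.put b addr 1) .skip)).run Γ M b a ≠ 0 ↔
      M b a ≠ 0 ∨ ∃ j < M 2 i, c.holds M (j :: Γ) ∧ addr.eval M (j :: Γ) = a := by
  have := Cmd.loop_induct (i := i) (c := .ite c (.put b addr 1) .skip) (Γ := Γ) (M := M)
    (fun j M' => (∀ b', b' ≠ b → M' b' = M b') ∧ (M' b a ≠ 0 ↔
      M b a ≠ 0 ∨ ∃ j' < j, c.holds M (j' :: Γ) ∧ addr.eval M (j' :: Γ) = a)) (by simp)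
    (by
      rintro j M' hj ⟨h1, h2⟩
      have h3 : c.holds M' (j :: Γ) ↔ c.holds M (j :: Γ) := by
        rw [Term.holds, c.eval_congr hb h1 hc]; rfl
      have h4 := addr.eval_congr hb h1 ha (j :: Γ)
      have h5 : (∃ j' < j + 1, c.holds M (j' :: Γ) ∧ addr.eval M (j' :: Γ) = a) ↔
          (∃ j' < j, c.holds M (j' :: Γ) ∧ addr.eval M (j' :: Γ) = a) ∨
            (c.holds M (j :: Γ) ∧ addr.eval M (j :: Γ) = a) := by
        constructor
        · rintro ⟨j', h, h'⟩
          rcases Nat.lt_succ_iff_lt_or_eq.1 h with h | rfl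
          · exact .inl ⟨j', h, h'⟩
          · exact .inr h'
        · rintro (⟨j', h, h'⟩ | h)
          · exact ⟨j', by omega, h'⟩
          · exact ⟨j, by omega, h⟩
      by_cases h : c.holds M (j :: Γ)
      · rw [Cmd.run_ite, if_pos (h3.2 h)]
        refine ⟨fun b' hb' => by rw [Cmd.run, Mem.set_of_ne _ hb', h1 b' hb'], ?_⟩
        rw [Cmd.run, Mem.set_same, h4, h1 2 (Ne.symm hb), Term.eval_one, Nat.mod_eq_of_lt hL, h5]
        split_ifs with h6
        · simp [h, h6]
        · rw [h2]
          have : addr.eval M (j :: Γ) ≠ a := fun h7 => h6 h7.symm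
          simp [this]
      · rw [Cmd.run_ite, if_neg (mt h3.1 h)]
        refine ⟨h1, ?_⟩
        rw [Cmd.run, h2, h5]
        simp [h])
  exact this.2

/-! ### Deciding whether the remaining vertices can be colored -/

/-! Memory layout. Bank 0: the input, which begins with the instance; bank 1: the output; bank 3: scalars
(1: the makespan, 2: a success flag); bank 4: adjacency matrix of
the tree; bank 5: incidence matrix of the bags; bank 6: tables of partial colorings; bank 7:
messages between neighboring tables; bank 8: `0` or the fixed color of a vertex plus one; bank 9:
the answer of `decideC`.
Parameters in bank 2: 0: modulus of the stores; 1: length of the long loops; 2: size of a table; 3: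
length of the input; 4: its unary length; 5: number of vertices; 6: number of nodes; 7: number
of colors. -/

namespace Core

def tabT : Term := .get 2 2
def numT : Term := .get 2 5
def nodesT : Term := .get 2 6
def colorsT : Term := .get 2 7
def adjT (u v : Term) : Term := .get 0 (1 + u * numT + v)
def relT (v : Term) : Term := .get 0 (1 + numT * numT + v)
def treeT (x y : Term) : Term := .get 4 (x * nodesT + y)
def bagT (x v : Term) : Term := .get 5 (x * numT + v)
def aliveT (x e : Term) : Term := .get 6 (x * tabT + e)
def fixT (v : Term) : Term := .get 8 v
/-- Colorings of the bag `x` are coded as mixed radix numbers with one digit for each vertex of the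
graph; the digits of the vertices outside the bag are zero, in base 1. -/
def baseT (x v : Term) : Term := .ite (bagT x v) colorsT 1
def weightT (x v : Term) : Term :=
  .prod 5 (.ite (.lt (.var 0) v.up) (baseT x.up (.var 0)) 1)
def digitT (x e v : Term) : Term := e / weightT x v % baseT x v
/-- The code of a coloring, where `var 0` of `f` is the vertex. -/
def codeT (x f : Term) : Term := .sum 5 (f * weightT x.up (.var 0))

/-- The coloring `e` of the bag `x` respects the bounds, the fixed colors and the edges. -/
def checkT (x e : Term) : Term :=
  .all 5 (.imp (bagT x.up (.var 0))
    (((relT (.var 0) + digitT x.up e.up (.var 0) + 1).le (.get 3 1)).and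
      ((Term.or ((fixT (.var 0)).eq 0) ((fixT (.var 0)).eq (digitT x.up e.up (.var 0) + 1))).and
        (.all 5 (.imp ((bagT x.up.up (.var 0)).and (adjT (.var 1) (.var 0)))
          (.not (.eq (digitT x.up.up e.up.up (.var 1)) (digitT x.up.up e.up.up (.var 0)))))))))

/-- The message cell for the nodes `x` and `y` and the common part, given by `f`, of two
colorings of their bags. -/
def markT (x y f : Term) : Term := (x * nodesT + y) * tabT + codeT x f

/-- Put all colorings of bags that pass the check into the tables. -/
def initC : Cmd :=
  .loop 1 (.put 6 (.var 0) (.flag (checkT (.var 0 / tabT) (.var 0 % tabT))))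

/-- Each node `y` sends to each node `x` the restrictions of its colorings to the bag of `x`. -/
def sendC : Cmd :=
  .loop 1 (.ite (aliveT (.var 0 / tabT % nodesT) (.var 0 % tabT))
    (.put 7 (markT (.var 0 / tabT / nodesT) (.var 0 / tabT % nodesT)
      (.ite (bagT (.var 1 / tabT / nodesT) (.var 0))
        (digitT (.var 1 / tabT % nodesT) (.var 1 % tabT) (.var 0)) 0)) 1) .skip)

/-- Delete the colorings that do not match a message from each neighbor. -/
def filterC : Cmd :=
  .loop 1 (.put 6 (.var 0) (.flag ((Term.get 6 (.var 0)).and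
    (.all 6 (.imp (treeT (.var 1 / tabT) (.var 0))
      (.get 7 (markT (.var 1 / tabT) (.var 0)
        (.ite (bagT (.var 1) (.var 0)) (digitT (.var 2 / tabT) (.var 2 % tabT) (.var 0)) 0))))))))

/-- One round: clear the messages, send new ones, and delete colorings. -/
def roundC : Cmd := .seq (.loop 1 (.put 7 (.var 0) 0)) (.seq sendC filterC)

/-- Set cell 0 of bank 9 if the fixed colors extend to a coloring of the whole graph. -/
def decideC : Cmd :=
  .seq initC (.seq (.loop 6 roundC) (.seq (.put 9 0 0)
    (.loop 1 (.ite (((Term.var 0).lt tabT).and (.get 6 (.var 0))) (.put 9 0 1) .skip))))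

section Semantics

open Finset

/-! The functions below describe the code of colorings; they take the contents `P` of bank 2 and `B`
of bank 5. -/

/-- The base of the digit of `v` in the codes of colorings of the bag `x`. -/
def base (P B : ℕ → ℕ) (x v : ℕ) : ℕ := if B (x * P 5 + v) ≠ 0 then P 7 else 1

/-- The place value of the digit of `v` in the codes of colorings of the bag `x`. -/
def weight (P B : ℕ → ℕ) (x v : ℕ) : ℕ := ∏ u ∈ range (P 5), if u < v then base P B x u else 1

/-- The color of `v` in the coloring of the bag `x` that is encoded by `e`. -/
def digit (P B : ℕ → ℕ) (x e v : ℕ) : ℕ := e / weight P B x v % base P B x v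

/-- The code of the coloring `f` of the bag `x`. -/
def code (P B : ℕ → ℕ) (x : ℕ) (f : ℕ → ℕ) : ℕ := ∑ v ∈ range (P 5), f v * weight P B x v

/-- Adjacency in the conflict graph in memory. -/
abbrev adjP (M : Mem) (u v : ℕ) : Prop := M 0 (1 + u * M 2 5 + v) ≠ 0

/-- The release times in memory. -/
def rel (M : Mem) (v : ℕ) : ℕ := M 0 (1 + M 2 5 * M 2 5 + v)

/-- Adjacency of nodes in the tree in memory. -/
abbrev treeP (M : Mem) (x y : ℕ) : Prop := M 4 (x * M 2 6 + y) ≠ 0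

/-- Membership in the bags in memory. -/
abbrev bagP (M : Mem) (x v : ℕ) : Prop := M 5 (x * M 2 5 + v) ≠ 0

variable (M : Mem) (Γ : List ℕ) (x y e v f : Term)

@[simp] theorem eval_tabT : tabT.eval M Γ = M 2 2 := rfl
@[simp] theorem eval_numT : numT.eval M Γ = M 2 5 := rfl
@[simp] theorem eval_nodesT : nodesT.eval M Γ = M 2 6 := rfl
@[simp] theorem eval_relT : (relT v).eval M Γ = rel M (v.eval M Γ) := rfl
@[simp] theorem eval_fixT : (fixT v).eval M Γ = M 8 (v.eval M Γ) := rfl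
@[simp] theorem holds_adjT : (adjT x v).holds M Γ ↔ adjP M (x.eval M Γ) (v.eval M Γ) := Iff.rfl
@[simp] theorem holds_treeT : (treeT x v).holds M Γ ↔ treeP M (x.eval M Γ) (v.eval M Γ) := Iff.rfl
@[simp] theorem holds_bagT : (bagT x v).holds M Γ ↔ bagP M (x.eval M Γ) (v.eval M Γ) := Iff.rfl
@[simp] theorem holds_aliveT : (aliveT x e).holds M Γ ↔
    M 6 (x.eval M Γ * M 2 2 + e.eval M Γ) ≠ 0 := Iff.rfl
@[simp] theorem eval_baseT : (baseT x v).eval M Γ = base (M 2) (M 5) (x.eval M Γ) (v.eval M Γ) := rfl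
@[simp] theorem eval_weightT :
    (weightT x v).eval M Γ = weight (M 2) (M 5) (x.eval M Γ) (v.eval M Γ) := by
  simp [weightT, weight]
@[simp] theorem eval_digitT : (digitT x e v).eval M Γ =
    digit (M 2) (M 5) (x.eval M Γ) (e.eval M Γ) (v.eval M Γ) := by
  simp [digitT, digit]
@[simp] theorem eval_codeT : (codeT x f).eval M Γ =
    code (M 2) (M 5) (x.eval M Γ) (fun j => f.eval M (j :: Γ)) := by
  simp [codeT, code]
@[simp] theorem eval_markT : (markT x y f).eval M Γ =
    (x.eval M Γ * M 2 6 + y.eval M Γ) * M 2 2 +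
      code (M 2) (M 5) (x.eval M Γ) (fun j => f.eval M (j :: Γ)) := by
  simp [markT]

/-- The coloring `e` of the bag `x` respects the bounds, the fixed colors and the edges. -/
def Check (M : Mem) (x e : ℕ) : Prop :=
  ∀ v < M 2 5, bagP M x v → rel M v + digit (M 2) (M 5) x e v + 1 ≤ M 3 1 ∧
    (M 8 v = 0 ∨ M 8 v = digit (M 2) (M 5) x e v + 1) ∧
    ∀ u < M 2 5, bagP M x u ∧ adjP M v u →
      digit (M 2) (M 5) x e v ≠ digit (M 2) (M 5) x e u

@[simp] theorem holds_checkT : (checkT x e).holds M Γ ↔ Check M (x.eval M Γ) (e.eval M Γ) := by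
  simp [checkT, Check]

/-- The requirements on the parameters, for a tree decomposition of width `w`. -/
structure Ctx (M : Mem) (w : ℕ) : Prop where
  lim : 1 < M 2 0
  long : M 2 1 = M 2 6 * M 2 6 * M 2 2
  tab : M 2 2 = M 2 7 ^ (w + 1)
  colors : 0 < M 2 7
  nodes : 0 < M 2 6
  width : ∀ x < M 2 6, ((range (M 2 5)).filter (bagP M x)).card ≤ w + 1

variable {M} {w : ℕ}

theorem Ctx.congr {M' : Mem} (h : Ctx M w) (h2 : M' 2 = M 2) (h5 : M' 5 = M 5) : Ctx M' w := by
  exact ⟨h2 ▸ h.lim, h2 ▸ h.long, h2 ▸ h.tab, h2 ▸ h.colors, h2 ▸ h.nodes, by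
    intro x hx
    have e : (range (M' 2 5)).filter (bagP M' x) = (range (M 2 5)).filter (bagP M x) := by
      simp only [bagP, h2, h5]
    rw [e]
    exact h.width x (h2 ▸ hx)⟩

theorem base_pos (h : Ctx M w) (x v : ℕ) : 0 < base (M 2) (M 5) x v := by
  unfold base; split_ifs
  · exact h.colors
  · exact one_pos

theorem weight_eq (P B : ℕ → ℕ) (x : ℕ) {v : ℕ} (hv : v ≤ P 5) :
    weight P B x v = ∏ u ∈ range v, base P B x u := by
  rw [weight, ← prod_filter]
  congr 1
  ext u
  simp only [mem_filter, mem_range]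
  omega

theorem code_eq (P B : ℕ → ℕ) (x : ℕ) (f : ℕ → ℕ) :
    code P B x f = radix (base P B x) f (P 5) :=
  sum_congr rfl fun v hv => by rw [weight_eq P B x (mem_range.1 hv).le]

theorem digit_code {x : ℕ} {f : ℕ → ℕ} (hf : ∀ v < M 2 5, f v < base (M 2) (M 5) x v) {v : ℕ}
    (hv : v < M 2 5) : digit (M 2) (M 5) x (code (M 2) (M 5) x f) v = f v := by
  rw [digit, weight_eq _ _ _ hv.le, code_eq, radix_digit hf hv]

theorem code_lt (h : Ctx M w) {x : ℕ} (hx : x < M 2 6) {f : ℕ → ℕ}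
    (hf : ∀ v < M 2 5, f v < base (M 2) (M 5) x v) : code (M 2) (M 5) x f < M 2 2 := by
  rw [code_eq, h.tab]
  refine (radix_lt hf).trans_le ?_
  have : ∏ u ∈ range (M 2 5), base (M 2) (M 5) x u =
      M 2 7 ^ ((range (M 2 5)).filter (bagP M x)).card := by
    simp only [base]
    rw [prod_ite, prod_const, prod_const_one, mul_one]
  rw [this]
  exact Nat.pow_le_pow_right h.colors (h.width x hx)

theorem digit_lt (h : Ctx M w) (x e v : ℕ) :
    digit (M 2) (M 5) x e v < base (M 2) (M 5) x v := Nat.mod_lt _ (base_pos h x v)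

/-- The restriction of a coloring of the bag `y` to the bag `x` is a coloring of the latter. -/
theorem restrict_lt (h : Ctx M w) (x y e v : ℕ) :
    (if bagP M x v then digit (M 2) (M 5) y e v else 0) < base (M 2) (M 5) x v := by
  split_ifs with h1
  · have h2 : base (M 2) (M 5) x v = M 2 7 := if_pos h1
    rw [h2]
    refine (digit_lt h y e v).trans_le ?_
    unfold base
    split_ifs
    · exact le_rfl
    · exact h.colors
  · exact base_pos h x v

theorem restrict_lt' (h : Ctx M w) (x y e v : ℕ) :
    (if bagP M y v then digit (M 2) (M 5) x e v else 0) < base (M 2) (M 5) x v := by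
  split_ifs with h1
  · exact digit_lt h x e v
  · exact base_pos h x v

/-- The coloring `e` of the bag `x` matches an entry of the table of each neighbor. -/
def Supported (M : Mem) (x e : ℕ) : Prop :=
  ∀ y < M 2 6, treeP M x y → ∃ e' < M 2 2, M 6 (y * M 2 2 + e') ≠ 0 ∧
    code (M 2) (M 5) x (fun v => if bagP M x v then digit (M 2) (M 5) y e' v else 0) =
      code (M 2) (M 5) x (fun v => if bagP M y v then digit (M 2) (M 5) x e v else 0)

theorem index_lt {x m q e : ℕ} (hx : x < m) (he : e < q) : x * q + e < m * q := by
  calc x * q + e < (x + 1) * q := by rw [add_mul]; omega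
    _ ≤ m * q := Nat.mul_le_mul_right _ hx

theorem index_div {x q e : ℕ} (he : e < q) : (x * q + e) / q = x := by
  rw [mul_comm, Nat.mul_add_div (by omega), Nat.div_eq_of_lt he, add_zero]

theorem index_mod {x q e : ℕ} (he : e < q) : (x * q + e) % q = e := by
  rw [mul_comm, Nat.mul_add_mod, Nat.mod_eq_of_lt he]

theorem tab_pos (h : Ctx M w) : 0 < M 2 2 := by rw [h.tab]; exact Nat.pow_pos h.colors

theorem alive_index_lt (h : Ctx M w) {x e : ℕ} (hx : x < M 2 6) (he : e < M 2 2) :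
    x * M 2 2 + e < M 2 1 := by
  rw [h.long]
  refine (index_lt hx he).trans_le (Nat.mul_le_mul_right _ ?_)
  exact Nat.le_mul_of_pos_left _ h.nodes

/-- A coloring survives a round if and only if a coloring in the table of each neighbor agrees with
it on the common vertices. -/
theorem roundC_spec (h : Ctx M w) (Γ : List ℕ) {x e : ℕ} (hx : x < M 2 6) (he : e < M 2 2) :
    roundC.run Γ M 6 (x * M 2 2 + e) ≠ 0 ↔ M 6 (x * M 2 2 + e) ≠ 0 ∧ Supported M x e := by
  classical
  rw [roundC, Cmd.run_seq, Cmd.run_seq]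
  rw [Cmd.run_fill_of_not_reads (b := 7) (by decide) rfl (by
    intro j _; simp only [Term.eval_zero]; exact zero_lt_one.trans h.lim)]
  set M₁ := M.fill 7 (M 2 1) (fun j => (0 : Term).eval M (j :: Γ)) with hM₁
  have h1 : ∀ b, b ≠ 7 → M₁ b = M b := fun b hb => Mem.fill_of_ne _ hb
  set M₂ := sendC.run Γ M₁ with hM₂
  have h2 : ∀ b, b ≠ 7 → M₂ b = M b := fun b hb => by
    rw [hM₂, Cmd.run_of_not_writes, h1 b hb]
    simp [sendC, Cmd.writes, Ne.symm hb]
  have hmark : ∀ y < M 2 6, M₂ 7 ((x * M 2 6 + y) * M 2 2 + code (M 2) (M 5) x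
      (fun v => if bagP M y v then digit (M 2) (M 5) x e v else 0)) ≠ 0 ↔
      ∃ e' < M 2 2, M 6 (y * M 2 2 + e') ≠ 0 ∧
        code (M 2) (M 5) x (fun v => if bagP M x v then digit (M 2) (M 5) y e' v else 0) =
        code (M 2) (M 5) x (fun v => if bagP M y v then digit (M 2) (M 5) x e v else 0) := by
    intro y hy
    have hc := code_lt h hx (fun v _ => restrict_lt' h x y e v)
    rw [hM₂, sendC, Cmd.run_mark (by decide) rfl rfl (by rw [h1 2 (by decide)]; exact h.lim)]
    have h0 : M₁ 7 ((x * M 2 6 + y) * M 2 2 + code (M 2) (M 5) x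
      (fun v => if bagP M y v then digit (M 2) (M 5) x e v else 0)) = 0 := by
      rw [hM₁, Mem.fill_same, if_pos, Term.eval_zero]
      rw [h.long]
      exact index_lt (index_lt hx hy) hc
    rw [h0, h1 2 (by decide)]
    simp only [ne_eq, not_true_eq_false, false_or, holds_aliveT, Term.eval_mod, Term.eval_div,
      Term.eval_var_zero, eval_tabT, eval_nodesT, eval_markT, Term.eval_ite, holds_bagT,
      Term.eval_var_one, eval_digitT, Term.eval_zero, h1 2 (by decide), h1 5 (by decide),
      h1 6 (by decide)]
    constructor
    · rintro ⟨j, hj, h3, h4⟩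
      have hjm : j % M 2 2 < M 2 2 := Nat.mod_lt _ (tab_pos h)
      have hx' : j / M 2 2 / M 2 6 < M 2 6 := by
        rw [Nat.div_lt_iff_lt_mul h.nodes, Nat.div_lt_iff_lt_mul (tab_pos h), ← h.long]
        exact hj
      have hy' : j / M 2 2 % M 2 6 < M 2 6 := Nat.mod_lt _ h.nodes
      have hc' := code_lt h hx' (fun v _ => restrict_lt h (j / M 2 2 / M 2 6)
        (j / M 2 2 % M 2 6) (j % M 2 2) v)
      have h5 := congrArg (· / M 2 2) h4
      have h6 := congrArg (· % M 2 2) h4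
      beta_reduce at h5 h6
      rw [index_div hc, index_div hc'] at h5
      rw [index_mod hc, index_mod hc'] at h6
      have h7 := congrArg (· / M 2 6) h5
      have h8 := congrArg (· % M 2 6) h5
      beta_reduce at h7 h8
      rw [index_div hy, index_div hy'] at h7
      rw [index_mod hy, index_mod hy'] at h8
      rw [h7, h8] at h6
      rw [h8] at h3
      exact ⟨j % M 2 2, hjm, h3, h6⟩
    · rintro ⟨e', he', h3, h4⟩
      refine ⟨(x * M 2 6 + y) * M 2 2 + e', ?_, ?_, ?_⟩
      · rw [h.long]; exact index_lt (index_lt hx hy) he'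
      · rw [index_div he', index_mod he', index_mod hy]; exact h3
      · rw [index_div he', index_mod he', index_mod hy, index_div hy, h4]
  rw [filterC, Cmd.run_fill (b := 6) (by decide)
    (fun j => if M 6 j ≠ 0 ∧ ∀ y < M 2 6, treeP M (j / M 2 2) y →
      M₂ 7 ((j / M 2 2 * M 2 6 + y) * M 2 2 + code (M 2) (M 5) (j / M 2 2)
        (fun v => if bagP M y v then digit (M 2) (M 5) (j / M 2 2) (j % M 2 2) v else 0)) ≠ 0
      then 1 else 0)]
  · rw [Mem.fill_same, if_pos (by rw [h2 2 (by decide)]; exact alive_index_lt h hx he)]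
    rw [index_div he, index_mod he]
    have : (∀ y < M 2 6, treeP M x y →
        M₂ 7 ((x * M 2 6 + y) * M 2 2 + code (M 2) (M 5) x
        (fun v => if bagP M y v then digit (M 2) (M 5) x e v else 0)) ≠ 0) ↔ Supported M x e :=
      forall_congr' fun y => forall_congr' fun hy => by rw [hmark y hy]
    simp only [this]
    simp
  · intro j _ M' h3 h4
    have h5 : ∀ b, b ≠ 6 → b ≠ 7 → M' b = M b := fun b hb hb' => by rw [h3 b hb, h2 b hb']
    simp only [Term.eval_flag, Term.holds_and, Term.holds_get, Term.eval_var_zero,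
      Term.holds_all, Term.holds_imp, holds_treeT, Term.eval_div, Term.eval_var_one, eval_tabT,
      eval_markT, Term.eval_ite, holds_bagT, eval_digitT, Term.eval_mod,
      Term.eval_var_two, Term.eval_zero, h4, h3 7 (by decide), h5 2 (by decide) (by decide),
      h5 5 (by decide) (by decide), h2 6 (by decide), treeP, bagP, h5 4 (by decide) (by decide)]
  · intro j _
    rw [h2 2 (by decide)]
    exact flag_lt h.lim

end Semantics

end Core

namespace Core

open Finset

variable {M : Mem} {w : ℕ}

/-- The coloring `f` uses the available colors, respects the release times for the makespan `T`
and the fixed colors `F`, and is proper. Vertex `v` of color `f v` completes at time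
`T - f v`. -/
structure Sol (M : Mem) (T : ℕ) (F f : ℕ → ℕ) : Prop where
  lt : ∀ v < M 2 5, f v < M 2 7
  le : ∀ v < M 2 5, rel M v + f v + 1 ≤ T
  fix : ∀ v < M 2 5, F v = 0 ∨ F v = f v + 1
  ne : ∀ u < M 2 5, ∀ v < M 2 5, adjP M u v → f u ≠ f v

theorem Sol.congr {M' : Mem} {T : ℕ} {F f : ℕ → ℕ} (h : Sol M T F f) (h0 : M' 0 = M 0)
    (h2 : M' 2 = M 2) : Sol M' T F f := by
  obtain ⟨h3, h4, h5, h6⟩ := h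
  constructor <;> simp only [rel, adjP, h0, h2] at * <;> assumption

/-- The memory holds the parameters, the instance and a tree decomposition of width `w`. -/
structure Ready (M : Mem) (w : ℕ) : Prop where
  ctx : Ctx M w
  dec : Nonempty (RootedDec (M 2 5) (M 2 6) (adjP M) (bagP M) (treeP M))

theorem Ready.congr {M' : Mem} (h : Ready M w) (h0 : M' 0 = M 0) (h2 : M' 2 = M 2)
    (h4 : M' 4 = M 4) (h5 : M' 5 = M 5) : Ready M' w := by
  refine ⟨h.ctx.congr h2 h5, ?_⟩
  have e1 : adjP M' = adjP M := by funext u v; simp only [adjP, h0, h2]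
  have e2 : bagP M' = bagP M := by funext u v; simp only [bagP, h5, h2]
  have e3 : treeP M' = treeP M := by funext u v; simp only [treeP, h4, h2]
  rw [e1, e2, e3, h2]
  exact h.dec

/-- The tables after `t` rounds. -/
def Alive (M : Mem) : ℕ → ℕ → ℕ → Prop
  | 0, x, e => Check M x e
  | t + 1, x, e => Alive M t x e ∧ ∀ y < M 2 6, treeP M x y → ∃ e' < M 2 2, Alive M t y e' ∧
      code (M 2) (M 5) x (fun v => if bagP M x v then digit (M 2) (M 5) y e' v else 0) =
        code (M 2) (M 5) x (fun v => if bagP M y v then digit (M 2) (M 5) x e v else 0)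

theorem code_congr {P B : ℕ → ℕ} {x : ℕ} {f g : ℕ → ℕ} (h : ∀ v < P 5, f v = g v) :
    code P B x f = code P B x g :=
  sum_congr rfl fun v hv => by rw [h v (mem_range.1 hv)]

/-- The tables in memory after all rounds. -/
theorem rounds_spec (h : Ctx M w) (Γ : List ℕ) :
    ∀ x < M 2 6, ∀ e < M 2 2,
      ((Cmd.loop 6 roundC).run Γ (initC.run Γ M) 6 (x * M 2 2 + e) ≠ 0 ↔
        Alive M (M 2 6) x e) := by
  have h1 : ∀ b, b ≠ 6 → initC.run Γ M b = M b := fun b hb =>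
    Cmd.run_of_not_writes _ (by simp [initC, Cmd.writes, Ne.symm hb]) _ _
  have hloop := Cmd.loop_induct (i := 6) (c := roundC) (Γ := Γ) (M := initC.run Γ M)
    (fun t M' => (∀ b, b ≠ 6 → b ≠ 7 → M' b = M b) ∧ ∀ x < M 2 6, ∀ e < M 2 2,
      (M' 6 (x * M 2 2 + e) ≠ 0 ↔ Alive M t x e)) ?_ ?_
  · rw [h1 2 (by decide)] at hloop
    exact hloop.2
  · refine ⟨fun b hb _ => h1 b hb, fun x hx e he => ?_⟩
    rw [initC, Cmd.run_fill_of_not_reads (by decide) rfl (by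
      intro j _
      simp only [Term.eval_flag]
      exact flag_lt h.lim), Mem.fill_same, if_pos (alive_index_lt h hx he)]
    rw [Term.eval_flag]
    have hk : (checkT (.var 0 / tabT) (.var 0 % tabT)).holds M ((x * M 2 2 + e) :: Γ) ↔
        Check M x e := by
      rw [holds_checkT, Term.eval_div, Term.eval_mod, Term.eval_var_zero, eval_tabT, index_div he,
        index_mod he]
    rw [Alive, ← hk]
    split_ifs with h2 <;> simp [h2]
  · rintro t M' _ ⟨h2, h3⟩
    refine ⟨fun b hb hb' => ?_, fun x hx e he => ?_⟩
    · rw [Cmd.run_of_not_writes _ (by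
        simp [roundC, sendC, filterC, Cmd.writes, Ne.symm hb, Ne.symm hb']), h2 b hb hb']
    · have e2 := h2 2 (by decide) (by decide)
      have e5 := h2 5 (by decide) (by decide)
      have e4 := h2 4 (by decide) (by decide)
      have := roundC_spec (h.congr e2 e5) (t :: Γ) (x := x) (e := e) (by rwa [e2]) (by rwa [e2])
      rw [e2] at this
      rw [this, h3 x hx e he, Alive]
      refine and_congr_right fun _ => ?_
      simp only [Supported, treeP, bagP, e2, e4, e5]
      refine forall_congr' fun y => forall_congr' fun hy => imp_congr_right fun _ =>
        exists_congr fun e' => and_congr_right fun he' => ?_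
      rw [h3 y hy e' he']

/-- The restrictions of a coloring of the whole graph to the bags survive all rounds. -/
theorem Sol.alive (h : Ctx M w) {f : ℕ → ℕ} (hf : Sol M (M 3 1) (M 8) f) (t : ℕ) :
    ∀ x < M 2 6, Alive M t x (code (M 2) (M 5) x fun v => if bagP M x v then f v else 0) := by
  have hlt : ∀ x, ∀ v < M 2 5, (if bagP M x v then f v else 0) < base (M 2) (M 5) x v := by
    intro x v hv
    split_ifs with h1
    · have h2 : base (M 2) (M 5) x v = M 2 7 := if_pos h1
      rw [h2]; exact hf.lt v hv
    · exact base_pos h x v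
  have hdig : ∀ x, ∀ v < M 2 5, digit (M 2) (M 5) x
      (code (M 2) (M 5) x fun v => if bagP M x v then f v else 0) v =
        if bagP M x v then f v else 0 := fun x v hv => digit_code (hlt x) hv
  induction t with
  | zero =>
    intro x hx v hv hxv
    rw [hdig x v hv, if_pos hxv]
    refine ⟨hf.le v hv, hf.fix v hv, ?_⟩
    rintro u hu ⟨hxu, huv⟩
    rw [hdig x u hu, if_pos hxu]
    exact hf.ne v hv u hu huv
  | succ t ih =>
    intro x hx
    refine ⟨ih x hx, fun y hy _ => ⟨_, code_lt h hy (hlt y), ih y hy, ?_⟩⟩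
    refine code_congr fun v hv => ?_
    rw [hdig y v hv, hdig x v hv]
    split_ifs <;> rfl

/-- By `RootedDec.exists_global`, if a coloring of the bag of node `0` survives `m` rounds, where `m` is
the number of nodes, then there is a coloring of the whole graph. -/
theorem exists_sol_of_alive (h : Ready M w) {e : ℕ} (he : e < M 2 2)
    (ha : Alive M (M 2 6) 0 e) : ∃ f, Sol M (M 3 1) (M 8) f := by
  obtain ⟨D⟩ := h.dec
  have hc := h.ctx
  obtain ⟨f, hf⟩ := D.exists_global
    (fun t x g => ∃ e < M 2 2, Alive M t x e ∧ ∀ v, g v = digit (M 2) (M 5) x e v)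
    (by rintro t x g ⟨e, h1, h2, h3⟩; exact ⟨e, h1, h2.1, h3⟩)
    (by
      rintro t x hx g ⟨e, h1, h2, h3⟩ y hy hxy
      obtain ⟨e', h4, h5, h6⟩ := h2.2 y hy hxy
      refine ⟨_, ⟨e', h4, h5, fun v => rfl⟩, fun v hv hxv hyv => ?_⟩
      have h7 := congrArg (fun c => digit (M 2) (M 5) x c v) h6
      beta_reduce at h7
      rw [digit_code (fun v _ => restrict_lt hc x y e' v) hv,
        digit_code (fun v _ => restrict_lt' hc x y e v) hv, if_pos hxv, if_pos hyv] at h7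
      rw [h3, h7])
    (g₀ := fun v => digit (M 2) (M 5) 0 e v) ⟨e, he, ha, fun _ => rfl⟩
  have key : ∀ x < M 2 6, ∃ e, Check M x e ∧
      ∀ v < M 2 5, bagP M x v → f v = digit (M 2) (M 5) x e v := by
    intro x hx
    obtain ⟨g, ⟨e, _, h1, h2⟩, h3⟩ := hf x hx
    exact ⟨e, h1, fun v hv hxv => by rw [h3 v hv hxv, h2]⟩
  have hv' : ∀ v < M 2 5, f v < M 2 7 ∧ rel M v + f v + 1 ≤ M 3 1 ∧
      (M 8 v = 0 ∨ M 8 v = f v + 1) := by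
    intro v hv
    obtain ⟨e, h1, h2⟩ := key _ (D.top_lt v hv)
    have hm := D.top_mem v hv
    have h3 := h1 v hv hm
    rw [← h2 v hv hm] at h3
    have h4 := digit_lt hc (D.top v) e v
    rw [← h2 v hv hm] at h4
    have h5 : base (M 2) (M 5) (D.top v) v = M 2 7 := if_pos hm
    exact ⟨h5 ▸ h4, h3.1, h3.2.1⟩
  refine ⟨f, fun v hv => (hv' v hv).1, fun v hv => (hv' v hv).2.1, fun v hv => (hv' v hv).2.2, ?_⟩
  intro u hu v hv huv
  obtain ⟨x, hx, hxu, hxv⟩ := D.edge u hu v hv huv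
  obtain ⟨e, h1, h2⟩ := key x hx
  rw [h2 u hu hxu, h2 v hv hxv]
  exact (h1 u hu hxu).2.2 v hv ⟨hxv, huv⟩

theorem decideC_spec (h : Ready M w) (Γ : List ℕ) :
    decideC.run Γ M 9 0 ≠ 0 ↔ ∃ f, Sol M (M 3 1) (M 8) f := by
  have hc := h.ctx
  rw [decideC, Cmd.run_seq, Cmd.run_seq, Cmd.run_seq]
  have hM := rounds_spec hc Γ
  set M₁ := (Cmd.loop 6 roundC).run Γ (initC.run Γ M) with hM₁
  have h2 : M₁ 2 = M 2 := by
    rw [hM₁, Cmd.run_par rfl, Cmd.run_par rfl]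
  have e2 : (Cmd.put 9 0 0).run Γ M₁ 2 = M 2 := by rw [Cmd.run_par rfl, h2]
  have e6 : (Cmd.put 9 0 0).run Γ M₁ 6 = M₁ 6 := Cmd.run_of_not_writes _ rfl _ _
  rw [Cmd.run_mark (by decide) rfl rfl (by rw [e2]; exact hc.lim)]
  have e9 : (Cmd.put 9 0 0).run Γ M₁ 9 0 = 0 := by simp [Cmd.run]
  simp only [e9, ne_eq, not_true_eq_false, false_or, e2, Term.holds_and, Term.holds_lt,
    Term.eval_var_zero, eval_tabT, Term.holds_get, e6, Term.eval_zero, and_true]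
  constructor
  · rintro ⟨j, _, h3, h4⟩
    have := (hM 0 hc.nodes j h3).1 (by simpa using h4)
    exact exists_sol_of_alive h h3 this
  · rintro ⟨f, hf⟩
    have h3 := hf.alive hc (M 2 6) 0 hc.nodes
    have h4 : code (M 2) (M 5) 0 (fun v => if bagP M 0 v then f v else 0) < M 2 2 := by
      refine code_lt hc hc.nodes fun v hv => ?_
      split_ifs with h1
      · have h2 : base (M 2) (M 5) 0 v = M 2 7 := if_pos h1
        rw [h2]; exact hf.lt v hv
      · exact base_pos hc 0 v
    have h5 := (hM 0 hc.nodes _ h4).2 h3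
    have h6 := alive_index_lt hc hc.nodes h4
    rw [zero_mul, zero_add] at h5 h6
    exact ⟨_, h6, h4, h5⟩

/-! ### Searching for an optimal schedule -/

/-- Find the least makespan. -/
def makespanC : Cmd :=
  .loop 4 (.ite (.get 3 2) .skip (.seq (.put 3 1 (.var 0)) (.seq decideC
    (.ite (.get 9 0) (.put 3 2 1) .skip))))

/-- Find a color of vertex `var 0`. -/
def colorC : Cmd :=
  .loop 7 (.ite ((fixT (.var 1)).eq 0) (.seq (.put 8 (.var 1) (.var 0 + 1)) (.seq decideC
    (.ite (.get 9 0) .skip (.put 8 (.var 1) 0)))) .skip)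

/-- Find the least makespan and then the colors of the vertices one by one; write the completion
times. -/
def searchC : Cmd :=
  .seq (.loop 5 (.put 8 (.var 0) 0)) (.seq (.put 3 2 0) (.seq makespanC (.seq (.loop 5 colorC)
    (.loop 5 (.put 1 (.var 0) (.get 3 1 + 1 - fixT (.var 0)))))))

theorem decideC_frame (Γ : List ℕ) (M : Mem) {b : ℕ} (h6 : b ≠ 6) (h7 : b ≠ 7) (h9 : b ≠ 9) :
    decideC.run Γ M b = M b :=
  Cmd.run_of_not_writes _ (by
    simp [decideC, initC, roundC, sendC, filterC, Cmd.writes, Ne.symm h6, Ne.symm h7,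
      Ne.symm h9]) _ _

@[simp] theorem run_put (b : ℕ) (a e : Term) (Γ : List ℕ) (M : Mem) :
    (Cmd.put b a e).run Γ M = M.set b (a.eval M Γ) (e.eval M Γ % M 2 0) := rfl

theorem sol_zero_iff {T : ℕ} {F f : ℕ → ℕ} (hF : ∀ v < M 2 5, F v = 0) :
    Sol M T F f ↔ Sol M T 0 f :=
  ⟨fun h => ⟨h.lt, h.le, fun _ _ => .inl rfl, h.ne⟩,
    fun h => ⟨h.lt, h.le, fun v hv => .inl (hF v hv), h.ne⟩⟩

theorem makespanC_spec (h : Ready M w) (hlim : M 2 4 ≤ M 2 0) (hF : ∀ v < M 2 5, M 8 v = 0)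
    (hdone : M 3 2 = 0) (hT : ∃ T < M 2 4, ∃ f, Sol M T 0 f) (Γ : List ℕ) :
    (∃ f, Sol M (makespanC.run Γ M 3 1) 0 f) ∧ makespanC.run Γ M 3 1 < M 2 4 ∧
      ∀ T f, Sol M T 0 f → makespanC.run Γ M 3 1 ≤ T := by
  have := Cmd.loop_induct (i := 4) (Γ := Γ) (M := M)
    (c := .ite (.get 3 2) .skip (.seq (.put 3 1 (.var 0)) (.seq decideC
    (.ite (.get 9 0) (.put 3 2 1) .skip))))
    (fun j M' => (∀ b, b ≠ 3 → b ≠ 6 → b ≠ 7 → b ≠ 9 → M' b = M b) ∧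
      (M' 3 2 = 0 → ∀ T < j, ¬ ∃ f, Sol M T 0 f) ∧
      (M' 3 2 ≠ 0 → M' 3 1 < M 2 4 ∧ (∃ f, Sol M (M' 3 1) 0 f) ∧
        ∀ T < M' 3 1, ¬ ∃ f, Sol M T 0 f)) ?_ ?_
  · obtain ⟨_, h1, h2⟩ := this
    have h3 : makespanC.run Γ M 3 2 ≠ 0 := by
      intro h0
      obtain ⟨T, hT1, hT2⟩ := hT
      exact h1 h0 T hT1 hT2
    obtain ⟨h4, h5, h6⟩ := h2 h3
    refine ⟨h5, h4, fun T f hf => ?_⟩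
    by_contra hlt
    exact h6 T (not_le.1 hlt) ⟨f, hf⟩
  · exact ⟨fun _ _ _ _ _ => rfl, fun _ T hT => absurd hT (Nat.not_lt_zero _),
      fun h => absurd hdone h⟩
  · rintro j M' hj ⟨h1, h2, h3⟩
    rw [Cmd.run_ite]
    by_cases hd : M' 3 2 = 0
    swap
    · rw [if_pos (by exact hd)]
      exact ⟨h1, fun h => absurd h hd, h3⟩
    rw [if_neg (fun h => h hd), Cmd.run_seq, Cmd.run_seq]
    have p2 : M' 2 = M 2 := h1 2 (by decide) (by decide) (by decide) (by decide)
    have hjl : j % M' 2 0 = j := Nat.mod_eq_of_lt (by rw [p2]; omega)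
    set M₁ := (Cmd.put 3 1 (.var 0)).run (j :: Γ) M' with hM₁
    have hM₁b : ∀ b, b ≠ 3 → M₁ b = M' b := fun b hb => Mem.set_of_ne _ hb
    have hM₁3 : ∀ a, M₁ 3 a = if a = 1 then j else M' 3 a := by
      intro a
      rw [hM₁, run_put, Mem.set_same, Term.eval_var_zero, hjl]; rfl
    have hready : Ready M₁ w := h.congr
      (by rw [hM₁b 0 (by decide), h1 0 (by decide) (by decide) (by decide) (by decide)])
      (by rw [hM₁b 2 (by decide), p2])
      (by rw [hM₁b 4 (by decide), h1 4 (by decide) (by decide) (by decide) (by decide)])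
      (by rw [hM₁b 5 (by decide), h1 5 (by decide) (by decide) (by decide) (by decide)])
    have hdec := decideC_spec hready (j :: Γ)
    have hsol : ∀ f, Sol M₁ (M₁ 3 1) (M₁ 8) f ↔ Sol M j 0 f := by
      intro f
      have e0 : M₁ 0 = M 0 := by
        rw [hM₁b 0 (by decide), h1 0 (by decide) (by decide) (by decide) (by decide)]
      have e2 : M₁ 2 = M 2 := by rw [hM₁b 2 (by decide), p2]
      have e8 : M₁ 8 = M 8 := by
        rw [hM₁b 8 (by decide), h1 8 (by decide) (by decide) (by decide) (by decide)]
      rw [hM₁3, if_pos rfl, e8, ← sol_zero_iff hF]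
      exact ⟨fun h => h.congr e0.symm e2.symm, fun h => h.congr e0 e2⟩
    simp only [hsol] at hdec
    set M₂ := decideC.run (j :: Γ) M₁ with hM₂
    have hM₂b : ∀ b, b ≠ 6 → b ≠ 7 → b ≠ 9 → M₂ b = M₁ b := fun b => decideC_frame _ _
    have hM₂3 : M₂ 3 = M₁ 3 := hM₂b 3 (by decide) (by decide) (by decide)
    rw [Cmd.run_ite]
    by_cases ha : M₂ 9 0 = 0
    · rw [if_neg (fun h => h ha)]
      have hno : ¬ ∃ f, Sol M j 0 f := fun h => hdec.2 h ha
      show (∀ b, _ → _ → _ → _ → M₂ b = M b) ∧ (M₂ 3 2 = 0 → _) ∧ (M₂ 3 2 ≠ 0 → _)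
      refine ⟨fun b b3 b6 b7 b9 => by rw [hM₂b b b6 b7 b9, hM₁b b b3, h1 b b3 b6 b7 b9], ?_, ?_⟩
      · intro _ T hT
        rcases Nat.lt_succ_iff_lt_or_eq.1 hT with hT | rfl
        · exact h2 hd T hT
        · exact hno
      · intro h
        rw [hM₂3, hM₁3] at h
        exact absurd hd (by simpa using h)
    · rw [if_pos (by exact ha), run_put]
      have hyes := hdec.1 ha
      have p2' : M₂ 2 = M 2 := by
        rw [hM₂b 2 (by decide) (by decide) (by decide), hM₁b 2 (by decide), p2]
      have e31 : (M₂.set 3 ((2 : Term).eval M₂ (j :: Γ)) ((1 : Term).eval M₂ (j :: Γ) % M₂ 2 0)) 3 1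
          = j := by
        rw [Mem.set_same, Term.eval_two, if_neg (by decide), hM₂3, hM₁3, if_pos rfl]
      have e32 : (M₂.set 3 ((2 : Term).eval M₂ (j :: Γ)) ((1 : Term).eval M₂ (j :: Γ) % M₂ 2 0)) 3 2
          ≠ 0 := by
        rw [Mem.set_same, Term.eval_two, if_pos rfl, p2', Term.eval_one, Nat.mod_eq_of_lt h.ctx.lim]
        exact one_ne_zero
      refine ⟨fun b b3 b6 b7 b9 => by
        rw [Mem.set_of_ne _ b3, hM₂b b b6 b7 b9, hM₁b b b3, h1 b b3 b6 b7 b9],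
        fun h => absurd h e32, fun _ => ?_⟩
      rw [e31]
      exact ⟨hj, hyes, fun T hT => h2 hd T hT⟩

/-- The color of `v` gets fixed in such a way that the fixed colors still extend. -/
theorem colorC_spec (h : Ready M w) (hlim : M 2 7 < M 2 0) {v : ℕ} (hv : v < M 2 5)
    (hF : M 8 v = 0) (hsol : ∃ f, Sol M (M 3 1) (M 8) f) (Γ : List ℕ) :
    (∀ b, b ≠ 6 → b ≠ 7 → b ≠ 8 → b ≠ 9 → colorC.run (v :: Γ) M b = M b) ∧
      (∀ u, u ≠ v → colorC.run (v :: Γ) M 8 u = M 8 u) ∧ colorC.run (v :: Γ) M 8 v ≠ 0 ∧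
      ∃ f, Sol M (M 3 1) (colorC.run (v :: Γ) M 8) f := by
  have := Cmd.loop_induct (i := 7) (Γ := v :: Γ) (M := M)
    (c := .ite ((fixT (.var 1)).eq 0) (.seq (.put 8 (.var 1) (.var 0 + 1)) (.seq decideC
    (.ite (.get 9 0) .skip (.put 8 (.var 1) 0)))) .skip)
    (fun a M' => (∀ b, b ≠ 6 → b ≠ 7 → b ≠ 8 → b ≠ 9 → M' b = M b) ∧
      (∀ u, u ≠ v → M' 8 u = M 8 u) ∧ (∃ f, Sol M (M 3 1) (M' 8) f) ∧
      (M' 8 v = 0 → ∀ f, Sol M (M 3 1) (M' 8) f → a ≤ f v)) ?_ ?_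
  · obtain ⟨h1, h2, h3, h4⟩ := this
    refine ⟨h1, h2, fun h0 => ?_, h3⟩
    obtain ⟨f, hf⟩ := h3
    exact absurd (h4 h0 f hf) (not_le.2 (hf.lt v hv))
  · exact ⟨fun _ _ _ _ _ => rfl, fun _ _ => rfl, hsol, fun _ _ _ => Nat.zero_le _⟩
  · rintro a M' ha ⟨h1, h2, h3, h4⟩
    rw [Cmd.run_ite]
    by_cases h0 : M' 8 v = 0
    swap
    · rw [if_neg (by simpa using h0)]
      exact ⟨h1, h2, h3, fun h => absurd h h0⟩
    rw [if_pos (by simpa using h0), Cmd.run_seq, Cmd.run_seq]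
    have h1' : ∀ b, (b = 0 ∨ b = 2 ∨ b = 3 ∨ b = 4 ∨ b = 5) → M' b = M b := by
      intro b hb
      exact h1 b (by omega) (by omega) (by omega) (by omega)
    have p2 := h1' 2 (by decide)
    set M₁ := (Cmd.put 8 (.var 1) (.var 0 + 1)).run (a :: v :: Γ) M' with hM₁
    have hM₁b : ∀ b, b ≠ 8 → M₁ b = M' b := fun b hb => Mem.set_of_ne _ hb
    have hM₁8 : ∀ u, M₁ 8 u = if u = v then a + 1 else M' 8 u := by
      intro u
      rw [hM₁, run_put, Mem.set_same]
      simp only [Term.eval_add, Term.eval_var_zero, Term.eval_var_one, Term.eval_one]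
      rw [Nat.mod_eq_of_lt (by rw [p2]; omega)]
      rfl
    have hM₁' : ∀ b, (b = 0 ∨ b = 2 ∨ b = 3 ∨ b = 4 ∨ b = 5) → M₁ b = M b := by
      intro b hb
      rw [hM₁b b (by omega), h1' b hb]
    have hready : Ready M₁ w := h.congr (hM₁' 0 (by decide)) (hM₁' 2 (by decide))
      (hM₁' 4 (by decide)) (hM₁' 5 (by decide))
    have hdec := decideC_spec hready (a :: v :: Γ)
    have hs : ∀ f, Sol M₁ (M₁ 3 1) (M₁ 8) f ↔ Sol M (M 3 1) (M₁ 8) f := by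
      intro f
      rw [hM₁' 3 (by decide)]
      exact ⟨fun h => h.congr (hM₁' 0 (by decide)).symm (hM₁' 2 (by decide)).symm,
        fun h => h.congr (hM₁' 0 (by decide)) (hM₁' 2 (by decide))⟩
    simp only [hs] at hdec
    set M₂ := decideC.run (a :: v :: Γ) M₁ with hM₂
    have hM₂b : ∀ b, b ≠ 6 → b ≠ 7 → b ≠ 9 → M₂ b = M₁ b := fun b => decideC_frame _ _
    have hM₂8 : M₂ 8 = M₁ 8 := hM₂b 8 (by decide) (by decide) (by decide)
    rw [Cmd.run_ite]
    by_cases hacc : M₂ 9 0 = 0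
    · rw [if_neg (fun h => h hacc), run_put]
      have hno : ¬ ∃ f, Sol M (M 3 1) (M₁ 8) f := fun h => hdec.2 h hacc
      have e8 : ∀ u, M₂.set 8 ((Term.var 1).eval M₂ (a :: v :: Γ))
          ((0 : Term).eval M₂ (a :: v :: Γ) % M₂ 2 0) 8 u = M' 8 u := by
        intro u
        rw [Mem.set_same, hM₂8, hM₁8, Term.eval_zero, Nat.zero_mod, Term.eval_var_one]
        split_ifs with hu
        · rw [hu, h0]
        · rfl
      have e8' := funext e8
      rw [e8']
      refine ⟨fun b b6 b7 b8 b9 => by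
        rw [Mem.set_of_ne _ b8, hM₂b b b6 b7 b9, hM₁b b b8, h1 b b6 b7 b8 b9], h2, h3, ?_⟩
      intro _ f hf
      have h5 := h4 h0 f hf
      rcases h5.lt_or_eq with h6 | h6
      · exact h6
      · exfalso
        refine hno ⟨f, hf.lt, hf.le, fun u hu => ?_, hf.ne⟩
        rw [hM₁8]
        split_ifs with hu'
        · subst hu'; right; omega
        · exact hf.fix u hu
    · rw [if_pos (by exact hacc)]
      have hyes := hdec.1 hacc
      show (∀ b, _ → _ → _ → _ → M₂ b = M b) ∧ (∀ u, _ → M₂ 8 u = _) ∧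
        (∃ f, Sol _ _ (M₂ 8) f) ∧ (M₂ 8 v = 0 → _)
      rw [hM₂8]
      refine ⟨fun b b6 b7 b8 b9 => by rw [hM₂b b b6 b7 b9, hM₁b b b8, h1 b b6 b7 b8 b9],
        fun u hu => by rw [hM₁8, if_neg hu, h2 u hu], hyes, fun h => ?_⟩
      rw [hM₁8, if_pos rfl] at h
      omega

/-- The search ends with a coloring for the least possible makespan, written to the output as
completion times. -/
theorem searchC_spec (h : Ready M w) (hlim : M 2 4 ≤ M 2 0) (hlim' : M 2 7 < M 2 0)
    (hT : ∃ T < M 2 4, ∃ f, Sol M T 0 f) (Γ : List ℕ) :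
    ∃ T f, Sol M T 0 f ∧ (∀ T' f', Sol M T' 0 f' → T ≤ T') ∧
      ∀ v < M 2 5, searchC.run Γ M 1 v = T - f v := by
  have hL := h.ctx.lim
  rw [searchC, Cmd.run_seq, Cmd.run_seq, Cmd.run_seq, Cmd.run_seq]
  rw [Cmd.run_fill_of_not_reads (b := 8) (i := 5) (e := 0) (by decide) rfl
    (by intro j _; rw [Term.eval_zero]; omega)]
  set M₁ := M.fill 8 (M 2 5) (fun j => (0 : Term).eval M (j :: Γ)) with hM₁
  set M₂ := (Cmd.put 3 2 0).run Γ M₁ with hM₂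
  have hb2 : ∀ b, b ≠ 3 → b ≠ 8 → M₂ b = M b := fun b hb hb' => by
    rw [hM₂, run_put, Mem.set_of_ne _ hb, hM₁, Mem.fill_of_ne _ hb']
  have p2 := hb2 2 (by decide) (by decide)
  have hs2 : ∀ T f, Sol M₂ T 0 f ↔ Sol M T 0 f := fun T f =>
    ⟨fun h => h.congr (hb2 0 (by decide) (by decide)).symm p2.symm,
      fun h => h.congr (hb2 0 (by decide) (by decide)) p2⟩
  have hready2 : Ready M₂ w := h.congr (hb2 0 (by decide) (by decide)) p2
    (hb2 4 (by decide) (by decide)) (hb2 5 (by decide) (by decide))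
  have h8 : ∀ v < M 2 5, M₂ 8 v = 0 := by
    intro v hv
    rw [hM₂, run_put, Mem.set_of_ne _ (by decide), hM₁, Mem.fill_same, if_pos hv, Term.eval_zero]
  have hmk := makespanC_spec hready2 (by rwa [p2]) (by rwa [p2])
    (by rw [hM₂, run_put, Mem.set_same, Term.eval_two, if_pos rfl, Term.eval_zero, Nat.zero_mod])
    (by simpa only [hs2, p2] using hT) Γ
  simp only [hs2, p2] at hmk
  set M₃ := makespanC.run Γ M₂ with hM₃
  have hb3 : ∀ b, b ≠ 3 → b ≠ 6 → b ≠ 7 → b ≠ 9 → M₃ b = M₂ b := fun b h3 h6 h7 h9 =>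
    Cmd.run_of_not_writes _ (by
      simp [makespanC, decideC, initC, roundC, sendC, filterC, Cmd.writes, Ne.symm h6,
        Ne.symm h7, Ne.symm h9, Ne.symm h3]) _ _
  have hb3' : ∀ b, (b = 0 ∨ b = 2 ∨ b = 4 ∨ b = 5) → M₃ b = M b := fun b hb => by
    rw [hb3 b (by omega) (by omega) (by omega) (by omega), hb2 b (by omega) (by omega)]
  have q2 := hb3' 2 (by decide)
  obtain ⟨⟨f, hf⟩, hT1, hTmin⟩ := hmk
  set T := M₃ 3 1 with hTdef
  have hs3 : ∀ T F f, Sol M₃ T F f ↔ Sol M T F f := fun T F f =>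
    ⟨fun h => h.congr (hb3' 0 (by decide)).symm q2.symm,
      fun h => h.congr (hb3' 0 (by decide)) q2⟩
  have h38 : ∀ v < M 2 5, M₃ 8 v = 0 := fun v hv => by
    rw [hb3 8 (by decide) (by decide) (by decide) (by decide), h8 v hv]
  have hloop := Cmd.loop_induct (i := 5) (Γ := Γ) (M := M₃) (c := colorC)
    (fun v M' => (∀ b, b ≠ 6 → b ≠ 7 → b ≠ 8 → b ≠ 9 → M' b = M₃ b) ∧
      (∃ f, Sol M T (M' 8) f) ∧ (∀ u < v, M' 8 u ≠ 0) ∧ ∀ u, v ≤ u → u < M 2 5 → M' 8 u = 0)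
    ⟨fun _ _ _ _ _ => rfl, ⟨f, (sol_zero_iff h38).2 hf⟩, fun u hu => absurd hu (Nat.not_lt_zero _),
      fun u _ hu => h38 u hu⟩
    (by
      rintro v M' hv ⟨g1, g2, g3, g4⟩
      rw [q2] at hv
      have g1' : ∀ b, (b = 0 ∨ b = 2 ∨ b = 4 ∨ b = 5) → M' b = M b := fun b hb => by
        rw [g1 b (by omega) (by omega) (by omega) (by omega), hb3' b hb]
      have hs' : ∀ T F f, Sol M' T F f ↔ Sol M T F f := fun T F f =>
        ⟨fun h => h.congr (g1' 0 (by decide)).symm (g1' 2 (by decide)).symm,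
          fun h => h.congr (g1' 0 (by decide)) (g1' 2 (by decide))⟩
      have e3 : M' 3 1 = T := by rw [g1 3 (by decide) (by decide) (by decide) (by decide)]
      have r' : Ready M' w := h.congr (g1' 0 (by decide)) (g1' 2 (by decide)) (g1' 4 (by decide))
        (g1' 5 (by decide))
      have e2 := g1' 2 (by decide)
      obtain ⟨c1, c2, c3, c4⟩ := colorC_spec r' (by rwa [e2]) (v := v) (by rwa [e2])
        (g4 v le_rfl hv) (by simpa only [hs', e3] using g2) Γ
      simp only [hs', e3] at c4
      refine ⟨fun b b6 b7 b8 b9 => by rw [c1 b b6 b7 b8 b9, g1 b b6 b7 b8 b9], c4, ?_, ?_⟩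
      · intro u hu
        rcases Nat.lt_succ_iff_lt_or_eq.1 hu with hu | rfl
        · rw [c2 u (by omega)]; exact g3 u hu
        · exact c3
      · intro u hu hu'
        rw [c2 u (by omega)]
        exact g4 u (by omega) hu')
  set M₄ := (Cmd.loop 5 colorC).run Γ M₃ with hM₄
  rw [q2] at hloop
  obtain ⟨g1, ⟨f', hf'⟩, g3, -⟩ := hloop
  have r2 : M₄ 2 = M 2 := by rw [g1 2 (by decide) (by decide) (by decide) (by decide), q2]
  have r3 : M₄ 3 1 = T := by rw [g1 3 (by decide) (by decide) (by decide) (by decide)]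
  have hfix : ∀ v < M 2 5, M₄ 8 v = f' v + 1 := fun v hv =>
    (hf'.fix v hv).resolve_left (g3 v hv)
  refine ⟨T, f', ⟨hf'.lt, hf'.le, fun _ _ => .inl rfl, hf'.ne⟩, hTmin, fun v hv => ?_⟩
  have hval : ∀ j < M 2 5, (Term.get 3 1 + 1 - fixT (.var 0)).eval M₄ (j :: Γ) = T - f' j := by
    intro j hj
    simp only [Term.eval_sub, Term.eval_add, Term.eval_get, Term.eval_one, eval_fixT,
      Term.eval_var_zero, r3, hfix j hj]
    omega
  rw [Cmd.run_fill_of_not_reads (by decide) rfl (by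
    intro j hj
    rw [r2] at hj ⊢
    rw [hval j hj]
    omega), Mem.fill_same, if_pos (by rwa [r2]), hval v hv]

end Core

/-! ### Minimum separations by an auction -/

namespace Auction

open Finset

variable {n : ℕ} {E : ℕ → ℕ → Prop} {p l : ℕ → ℕ}

/-- The invariant of an auction in which the bidders `u` buy objects `v` with `E u v` at the prices
`p`, where `l u = v + 1` if `u` holds `v` and `l u = 0` if `u` holds nothing: each bidder
holds an object that was cheapest for it up to `1`, and each object with a positive price is sold. -/
structure Inv (n : ℕ) (E : ℕ → ℕ → Prop) (p l : ℕ → ℕ) : Prop where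
  inj : ∀ u < n, ∀ u' < n, l u ≠ 0 → l u = l u' → u = u'
  holds : ∀ u < n, ∀ v, l u = v + 1 → E u v ∧ ∀ v', E u v' → p v ≤ p v' + 1
  sold : ∀ v < n, p v ≠ 0 → ∃ u < n, l u = v + 1
  cap : ∀ v < n, p v ≤ n + 1

/-- The bidder `u` may bid for its cheapest object `v`. -/
def Enabled (n : ℕ) (E : ℕ → ℕ → Prop) (p l : ℕ → ℕ) (u v : ℕ) : Prop :=
  l u = 0 ∧ E u v ∧ p v < n + 1 ∧ ∀ v' < n, E u v' → p v ≤ p v'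

/-- The winner `u` of a bid takes `v` from its holder, and the price of `v` rises by one. -/
theorem Inv.bid (hE : ∀ u v, E u v → u < n ∧ v < n) (h : Inv n E p l) {u v : ℕ}
    (hb : Enabled n E p l u v) :
    Inv n E (fun v' => if v' = v then p v + 1 else p v')
      (fun j => if j = u then v + 1 else if l j = v + 1 then 0 else l j) := by
  obtain ⟨hu0, huv, hp, hmin⟩ := hb
  constructor
  · intro a ha b hb h0 hab
    beta_reduce at h0 hab
    split_ifs at h0 hab with h1 h2 h3 h4 h5 h6 h7 h8 <;>
      first | omega | exact absurd rfl h0 | exact h.inj a ha b hb h0 hab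
  · intro a ha b hab
    beta_reduce at hab ⊢
    split_ifs at hab with h1 h2
    · obtain rfl : v = b := by omega
      subst h1
      refine ⟨huv, fun v' hv' => ?_⟩
      have := hmin v' (hE _ _ hv').2 hv'
      rw [if_pos rfl]
      split_ifs <;> omega
    · have hne : b ≠ v := fun h => h2 (h ▸ hab)
      obtain ⟨h3, h4⟩ := h.holds a ha b hab
      refine ⟨h3, fun v' hv' => ?_⟩
      have := h4 v' hv'
      rw [if_neg hne]
      split_ifs with h5
      · subst h5; omega
      · exact this
  · intro b hb h0
    beta_reduce at h0 ⊢
    split_ifs at h0 with h1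
    · exact ⟨u, (hE _ _ huv).1, by simp [h1]⟩
    · obtain ⟨a, ha, hab⟩ := h.sold b hb h0
      have : a ≠ u := by rintro rfl; omega
      exact ⟨a, ha, by rw [if_neg this, if_neg (by omega), hab]⟩
  · intro b hb
    have := h.cap b hb
    split_ifs <;> omega

theorem Inv.congr (hE : ∀ u v, E u v → u < n ∧ v < n) (h : Inv n E p l) {p' l' : ℕ → ℕ}
    (hp : ∀ v < n, p' v = p v) (hl : ∀ u < n, l' u = l u) : Inv n E p' l' := by
  constructor
  · intro u hu u' hu'
    rw [hl u hu, hl u' hu']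
    exact h.inj u hu u' hu'
  · intro u hu v
    rw [hl u hu]
    intro h1
    obtain ⟨h2, h3⟩ := h.holds u hu v h1
    refine ⟨h2, fun v' hv' => ?_⟩
    rw [hp v (hE _ _ h2).2, hp v' (hE _ _ hv').2]
    exact h3 v' hv'
  · intro v hv
    rw [hp v hv]
    intro h0
    obtain ⟨u, hu, h1⟩ := h.sold v hv h0
    exact ⟨u, hu, by rw [hl u hu, h1]⟩
  · intro v hv
    rw [hp v hv]
    exact h.cap v hv

theorem exists_price_gap (p : ℕ → ℕ) (n : ℕ) : ∃ θ, 1 ≤ θ ∧ θ < n + 2 ∧ ∀ v < n, p v ≠ θ := by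
  by_contra! h
  have h1 : Icc 1 (n + 1) ⊆ (range n).image p := by
    intro θ hθ
    obtain ⟨h1, h2⟩ := mem_Icc.1 hθ
    obtain ⟨v, hv, h3⟩ := h θ h1 (by omega)
    exact mem_image.2 ⟨v, mem_range.2 hv, h3⟩
  have h2 := (card_le_card h1).trans card_image_le
  simp at h2

variable {adj : ℕ → ℕ → Prop} {A B : ℕ → Prop}

/-- The bidders are the vertices outside `B`, the objects the vertices outside `A`. -/
def Wants (n : ℕ) (adj : ℕ → ℕ → Prop) (A B : ℕ → Prop) (u v : ℕ) : Prop :=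
  u < n ∧ v < n ∧ ¬ B u ∧ ¬ A v ∧ (u = v ∨ adj u v)

/-- At the end of the auction, a price that no object has splits it into
a vertex cover and a matching of the same size. The cover gives a separation of `A` and `B`, and its
overlap is the least possible, since every separation gives a cover. -/
theorem Inv.exists_separation (h : Inv n (Wants n adj A B) p l)
    (hstable : ∀ u v, ¬ Enabled n (Wants n adj A B) p l u v) :
    ∃ θ < n + 2, ∃ X Y : Finset ℕ,
      (∀ v, v ∈ X ↔ v < n ∧ (A v ∨ θ ≤ p v)) ∧
      (∀ v, v ∈ Y ↔ v < n ∧ (B v ∨ (l v ≠ 0 ∧ p (l v - 1) < θ))) ∧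
      (∀ v < n, v ∈ X ∨ v ∈ Y) ∧
      (∀ u < n, ∀ v < n, adj u v → u ∉ Y → v ∉ X → False) ∧
      ∀ X' Y' : Finset ℕ, X' ∪ Y' = range n → (∀ v < n, A v → v ∈ X') → (∀ v < n, B v → v ∈ Y') →
        (∀ u ∈ X' \ Y', ∀ v ∈ Y' \ X', ¬ adj u v) → (X ∩ Y).card ≤ (X' ∩ Y').card := by
  classical
  obtain ⟨θ, hθ1, hθ2, hθ⟩ := exists_price_gap p n
  have cover : ∀ u v, Wants n adj A B u v → θ ≤ p v ∨ (l u ≠ 0 ∧ p (l u - 1) < θ) := by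
    intro u v huv
    by_cases h0 : l u = 0
    · left
      -- the cheapest object that `u` wants has the largest price allowed
      have hne : ((range n).filter fun v => Wants n adj A B u v).Nonempty :=
        ⟨v, mem_filter.2 ⟨mem_range.2 huv.2.1, huv⟩⟩
      obtain ⟨v₀, hv₀, hmin⟩ := exists_min_image _ p hne
      have h1 := hstable u v₀
      have h2 := hmin v (mem_filter.2 ⟨mem_range.2 huv.2.1, huv⟩)
      by_contra h3
      exact h1 ⟨h0, (mem_filter.1 hv₀).2, by omega, fun v' h4 h5 =>
        hmin v' (mem_filter.2 ⟨mem_range.2 h4, h5⟩)⟩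
    · obtain ⟨v', hv'⟩ := Nat.exists_eq_succ_of_ne_zero h0
      obtain ⟨h1, h2⟩ := h.holds u huv.1 v' hv'
      have h3 := h2 v huv
      have h4 := hθ v' h1.2.1
      have h5 : l u - 1 = v' := by omega
      rw [h5]
      omega
  let X := (range n).filter fun v => A v ∨ θ ≤ p v
  let Y := (range n).filter fun v => B v ∨ (l v ≠ 0 ∧ p (l v - 1) < θ)
  have hX : ∀ v, v ∈ X ↔ v < n ∧ (A v ∨ θ ≤ p v) := fun v => by simp [X]
  have hY : ∀ v, v ∈ Y ↔ v < n ∧ (B v ∨ (l v ≠ 0 ∧ p (l v - 1) < θ)) := fun v => by simp [Y]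
  have hXY : ∀ v < n, v ∈ X ∨ v ∈ Y := by
    intro v hv
    rw [hX, hY]
    by_cases hA : A v
    · exact .inl ⟨hv, .inl hA⟩
    by_cases hB : B v
    · exact .inr ⟨hv, .inl hB⟩
    rcases cover v v ⟨hv, hv, hB, hA, .inl rfl⟩ with h1 | h1
    · exact .inl ⟨hv, .inr h1⟩
    · exact .inr ⟨hv, .inr h1⟩
  refine ⟨θ, hθ2, X, Y, hX, hY, hXY, ?_, ?_⟩
  · intro u hu v hv huv h1 h2
    rw [hY] at h1
    rw [hX] at h2
    rcases cover u v ⟨hu, hv, fun h => h1 ⟨hu, .inl h⟩, fun h => h2 ⟨hv, .inl h⟩, .inr huv⟩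
      with h3 | h3
    · exact h2 ⟨hv, .inr h3⟩
    · exact h1 ⟨hu, .inr h3⟩
  · intro X' Y' hV hA hB hsep
    have hV' : ∀ v, v < n ↔ v ∈ X' ∨ v ∈ Y' := fun v => by rw [← mem_union, hV, mem_range]
    have hU : X ∪ Y = range n := by
      ext v
      rw [mem_union, mem_range]
      exact ⟨fun h => h.elim (fun h => ((hX v).1 h).1) fun h => ((hY v).1 h).1, hXY v⟩
    have e1 := card_union_add_card_inter X Y
    have e2 := card_union_add_card_inter X' Y'
    rw [hU] at e1
    rw [hV] at e2
    let A' := (range n).filter A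
    let B' := (range n).filter B
    let Mt := (range n).filter fun u => l u ≠ 0
    have hval : ∀ u, u ∈ Mt → u < n ∧ Wants n adj A B u (l u - 1) ∧ l u = l u - 1 + 1 := by
      intro u hu
      obtain ⟨h1, h2⟩ := mem_filter.1 hu
      have h3 : l u = l u - 1 + 1 := by omega
      exact ⟨mem_range.1 h1, (h.holds u (mem_range.1 h1) _ h3).1, h3⟩
    have hinj : ∀ u ∈ Mt, ∀ u' ∈ Mt, l u - 1 = l u' - 1 → u = u' := by
      intro u hu u' hu' he
      obtain ⟨h1, -, h2⟩ := hval u hu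
      obtain ⟨h1', -, h2'⟩ := hval u' hu'
      exact h.inj u h1 u' h1' (by omega) (by omega)
    -- the cover is at most as large as the matching
    have c1 : X.card ≤ A'.card + (Mt.filter fun u => θ ≤ p (l u - 1)).card := by
      have : X ⊆ A' ∪ (Mt.filter fun u => θ ≤ p (l u - 1)).image (fun u => l u - 1) := by
        intro v hv
        obtain ⟨h1, h2⟩ := (hX v).1 hv
        rw [mem_union]
        rcases h2 with h2 | h2
        · exact .inl (mem_filter.2 ⟨mem_range.2 h1, h2⟩)
        · obtain ⟨u, hu, h3⟩ := h.sold v h1 (by omega)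
          have h4 : l u - 1 = v := by omega
          exact .inr (mem_image.2 ⟨u, mem_filter.2
            ⟨mem_filter.2 ⟨mem_range.2 hu, by omega⟩, by rwa [h4]⟩, h4⟩)
      exact (card_le_card this).trans ((card_union_le _ _).trans
        (Nat.add_le_add_left card_image_le _))
    have c2 : Y.card ≤ B'.card + (Mt.filter fun u => ¬ θ ≤ p (l u - 1)).card := by
      have : Y ⊆ B' ∪ (Mt.filter fun u => ¬ θ ≤ p (l u - 1)) := by
        intro v hv
        obtain ⟨h1, h2⟩ := (hY v).1 hv
        rw [mem_union]
        rcases h2 with h2 | h2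
        · exact .inl (mem_filter.2 ⟨mem_range.2 h1, h2⟩)
        · exact .inr (mem_filter.2 ⟨mem_filter.2 ⟨mem_range.2 h1, h2.1⟩, not_le.2 h2.2⟩)
      exact (card_le_card this).trans (card_union_le _ _)
    have c3 := card_filter_add_card_filter_not (s := Mt) (fun u => θ ≤ p (l u - 1))
    -- the matching is at most as large as the cover given by any separation
    have c4 : Mt.card ≤ (X' \ A').card + (Y' \ B').card := by
      have d1 : (Mt.filter fun u => l u - 1 ∈ X').card ≤ (X' \ A').card := by
        refine card_le_card_of_injOn (fun u => l u - 1) ?_ ?_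
        · intro u hu
          obtain ⟨h1, h2⟩ := mem_filter.1 hu
          refine mem_coe.2 (mem_sdiff.2 ⟨h2, fun h3 => ?_⟩)
          exact (hval u h1).2.1.2.2.2.1 (mem_filter.1 h3).2
        · intro u hu u' hu' he
          exact hinj u (mem_filter.1 hu).1 u' (mem_filter.1 hu').1 he
      have d2 : (Mt.filter fun u => ¬ l u - 1 ∈ X').card ≤ (Y' \ B').card := by
        refine card_le_card ?_
        intro u hu
        obtain ⟨h1, h2⟩ := mem_filter.1 hu
        obtain ⟨h3, ⟨-, h4, h5, -, h6⟩, -⟩ := hval u h1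
        refine mem_sdiff.2 ⟨?_, fun h7 => h5 (mem_filter.1 h7).2⟩
        have h8 := ((hV' _).1 h4).resolve_left h2
        rcases h6 with h6 | h6
        · rwa [← h6] at h8
        · by_contra h9
          exact hsep u (mem_sdiff.2 ⟨((hV' _).1 h3).resolve_right h9, h9⟩) _
            (mem_sdiff.2 ⟨h8, h2⟩) h6
      have := card_filter_add_card_filter_not (s := Mt) (fun u => l u - 1 ∈ X')
      omega
    have c5 : (X' \ A').card + A'.card = X'.card :=
      card_sdiff_add_card_eq_card fun v hv =>
        hA v (mem_range.1 (mem_filter.1 hv).1) (mem_filter.1 hv).2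
    have c6 : (Y' \ B').card + B'.card = Y'.card :=
      card_sdiff_add_card_eq_card fun v hv =>
        hB v (mem_range.1 (mem_filter.1 hv).1) (mem_filter.1 hv).2
    omega

end Auction

/-! ### The program for the auction -/

namespace Auction

open Finset ConcSched.Core

/-! Bank 10: the prices; bank 11: what the bidders hold; bank 13: labels of the vertices, `1` for the
set `A` and `2` for the set `B`. Parameters in bank 2: 8: number of passes; 9: number of
pairs of vertices. -/

def wantsT (u v : Term) : Term :=
  ((Term.get 13 u).eq 2).not.and (((Term.get 13 v).eq 1).not.and ((u.eq v).or (adjT u v)))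

def enabledT (u v : Term) : Term :=
  ((Term.get 11 u).eq 0).and ((wantsT u v).and (((Term.get 10 v).lt (numT + 1)).and
    (.all 5 (.imp (wantsT u.up (.var 0)) ((Term.get 10 v.up).le (.get 10 (.var 0)))))))

/-- The pair coded by `var 0` bids, if it may. -/
def bidC : Cmd :=
  .ite (enabledT (.var 0 / numT) (.var 0 % numT))
    (.seq
      (.loop 5 (.put 11 (.var 0) (.ite ((Term.var 0).eq (.var 1 / numT)) (.var 1 % numT + 1)
        (.ite ((Term.get 11 (.var 0)).eq (.var 1 % numT + 1)) 0 (.get 11 (.var 0))))))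
      (.put 10 (.var 0 % numT) (.get 10 (.var 0 % numT) + 1)))
    .skip

/-- Run an auction from scratch, in passes over all pairs. -/
def auctionC : Cmd :=
  .seq (.loop 5 (.put 10 (.var 0) 0)) (.seq (.loop 5 (.put 11 (.var 0) 0))
    (.loop 8 (.loop 9 bidC)))

variable {M M' : Mem} {n : ℕ}

/-- What the auction needs to know about the parameters. -/
structure Params (M : Mem) (n : ℕ) : Prop where
  num : M 2 5 = n
  passes : M 2 8 = n * (n + 1) + 1
  pairs : M 2 9 = n * n
  lim : n + 2 < M 2 0

/-- Who wants what in the auction for the labels in memory. -/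
abbrev Graph (M : Mem) (n : ℕ) : ℕ → ℕ → Prop :=
  Wants n (adjP M) (fun v => M 13 v = 1) (fun v => M 13 v = 2)

theorem graph_lt {u v : ℕ} (h : Graph M n u v) : u < n ∧ v < n := ⟨h.1, h.2.1⟩

/-- The memory during an auction that was started in `M`. -/
structure Running (M : Mem) (n : ℕ) (M' : Mem) : Prop where
  frame : ∀ b, b ≠ 10 → b ≠ 11 → M' b = M b
  inv : Inv n (Graph M n) (M' 10) (M' 11)

/-- A pair either bids, which raises the sum of the prices by one, or nothing changes. -/
theorem bidC_spec (hP : Params M n) (hM' : Running M n M') {j : ℕ} (hj : j < n * n) (Γ : List ℕ) :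
    (Enabled n (Graph M n) (M' 10) (M' 11) (j / n) (j % n) ∧ Running M n (bidC.run (j :: Γ) M') ∧
      ∑ v ∈ range n, bidC.run (j :: Γ) M' 10 v = ∑ v ∈ range n, M' 10 v + 1) ∨
    (¬ Enabled n (Graph M n) (M' 10) (M' 11) (j / n) (j % n) ∧ bidC.run (j :: Γ) M' = M') := by
  have hn : 0 < n := Nat.pos_of_ne_zero (by rintro rfl; simp at hj)
  have hu : j / n < n := Nat.div_lt_of_lt_mul hj
  have hv : j % n < n := Nat.mod_lt _ hn
  have e2 := hM'.frame 2 (by decide) (by decide)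
  have e0 := hM'.frame 0 (by decide) (by decide)
  have e13 := hM'.frame 13 (by decide) (by decide)
  have e5 : M' 2 5 = n := by rw [e2, hP.num]
  have hw : ∀ u < n, ∀ v < n, (¬ M' 13 u = 2 ∧ ¬ M' 13 v = 1 ∧ (u = v ∨ adjP M' u v)) ↔
      Graph M n u v := by
    intro u hu v hv
    simp only [Graph, Wants, hu, hv, true_and, adjP, e0, e2, e13]
  have hen : (enabledT (.var 0 / numT) (.var 0 % numT)).holds M' (j :: Γ) ↔
      Enabled n (Graph M n) (M' 10) (M' 11) (j / n) (j % n) := by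
    rw [Enabled, ← hw _ hu _ hv]
    simp only [enabledT, wantsT, Term.holds_and, Term.holds_eq, Term.holds_not, Term.holds_or,
      Term.eval_get, Term.eval_zero, Term.eval_one, Term.eval_two, holds_adjT, Term.eval_div,
      Term.eval_mod, eval_numT, Term.eval_var_zero, Term.holds_lt, Term.eval_add, Term.holds_all,
      Term.holds_imp, Term.eval_up, Term.holds_le, e5]
    refine and_congr_right fun _ => and_congr_right fun _ => and_congr_right fun _ =>
      forall_congr' fun v' => forall_congr' fun hv' => ?_
    rw [hw _ hu _ hv']
  rw [bidC, Cmd.run_ite]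
  by_cases hE : Enabled n (Graph M n) (M' 10) (M' 11) (j / n) (j % n)
  swap
  · rw [if_neg (mt hen.1 hE)]
    exact .inr ⟨hE, rfl⟩
  rw [if_pos (hen.2 hE), Cmd.run_seq]
  refine .inl ⟨hE, ?_⟩
  have hbid := hM'.inv.bid (fun u v => graph_lt) hE
  have hlim : ∀ u < n, M' 11 u < M' 2 0 := by
    intro u hu
    rw [e2]
    by_cases h0 : M' 11 u = 0
    · have := hP.lim; omega
    · have h1 : M' 11 u = M' 11 u - 1 + 1 := by omega
      have h2 := (hM'.inv.holds u hu _ h1).1.2.1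
      have := hP.lim
      omega
  rw [Cmd.run_fill (b := 11) (i := 5) (by decide)
    (fun a => if a = j / n then j % n + 1 else if M' 11 a = j % n + 1 then 0 else M' 11 a)
    (by
      intro a _ M'' h1 h2
      have h3 := h1 2 (by decide)
      simp only [Term.eval_ite, Term.holds_eq, Term.eval_var_zero, Term.eval_div, Term.eval_var_one,
        eval_numT, h3, e5, Term.eval_add, Term.eval_mod, Term.eval_one, Term.eval_get, h2,
        Term.eval_zero])
    (by
      intro a ha
      rw [e5] at ha
      have := hP.lim
      have h2 := hlim a ha
      have h3 : M' 2 0 = M 2 0 := by rw [e2]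
      split_ifs <;> omega), e5, run_put]
  set M₁ := M'.fill 11 n fun a =>
    if a = j / n then j % n + 1 else if M' 11 a = j % n + 1 then 0 else M' 11 a with hM₁
  have hM₁b : ∀ b, b ≠ 11 → M₁ b = M' b := fun b hb => Mem.fill_of_ne _ hb
  have f2 := hM₁b 2 (by decide)
  have f10 := hM₁b 10 (by decide)
  have hp : M' 10 (j % n) < n + 1 := hE.2.2.1
  simp only [Term.eval_mod, Term.eval_var_zero, eval_numT, f2, e5, Term.eval_add, Term.eval_get, f10,
    Term.eval_one]
  rw [Nat.mod_eq_of_lt (show M' 10 (j % n) + 1 < M' 2 0 by rw [e2]; have := hP.lim; omega)]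
  refine ⟨⟨fun b h1 h2 => by rw [Mem.set_of_ne _ h1, hM₁b b h2, hM'.frame b h1 h2], ?_⟩, ?_⟩
  · refine hbid.congr (fun u v => graph_lt) (fun v _ => ?_) (fun u hu => ?_)
    · rw [Mem.set_same, f10]
    · rw [Mem.set_of_ne _ (by decide), hM₁, Mem.fill_same, if_pos hu]
  · have h1 : ∀ v ∈ range n, M₁.set 10 (j % n) (M' 10 (j % n) + 1) 10 v =
        M' 10 v + if v = j % n then 1 else 0 := by
      intro v _
      rw [Mem.set_same, f10]
      split_ifs with h
      · rw [h]
      · rfl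
    rw [sum_congr rfl h1, sum_add_distrib, sum_ite_eq', if_pos (mem_range.2 hv)]

/-- The auction is over. -/
def Stable (M : Mem) (n : ℕ) (M' : Mem) : Prop :=
  ∀ u v, ¬ Enabled n (Graph M n) (M' 10) (M' 11) u v

theorem stable_iff : Stable M n M' ↔
    ∀ j < n * n, ¬ Enabled n (Graph M n) (M' 10) (M' 11) (j / n) (j % n) := by
  refine ⟨fun h j _ => h _ _, fun h u v hE => ?_⟩
  obtain ⟨hu, hv⟩ := graph_lt hE.2.1
  have h1 : (u * n + v) / n = u := by
    rw [mul_comm, Nat.mul_add_div (by omega), Nat.div_eq_of_lt hv, add_zero]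
  have h2 : (u * n + v) % n = v := by
    rw [mul_comm, Nat.mul_add_mod, Nat.mod_eq_of_lt hv]
  refine h (u * n + v) ?_ (by rwa [h1, h2])
  calc u * n + v < (u + 1) * n := by rw [add_mul]; omega
    _ ≤ n * n := Nat.mul_le_mul_right _ hu

/-- A pass raises the sum of the prices unless the auction is over. -/
theorem pass_spec (hP : Params M n) (hM' : Running M n M') (Γ : List ℕ) :
    Running M n ((Cmd.loop 9 bidC).run Γ M') ∧
    ((¬ Stable M n M' ∧
      ∑ v ∈ range n, M' 10 v < ∑ v ∈ range n, (Cmd.loop 9 bidC).run Γ M' 10 v) ∨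
    (Stable M n M' ∧ (Cmd.loop 9 bidC).run Γ M' = M')) := by
  have e9 : M' 2 9 = n * n := by rw [hM'.frame 2 (by decide) (by decide), hP.pairs]
  have := Cmd.loop_induct (i := 9) (c := bidC) (Γ := Γ) (M := M')
    (fun j M'' => Running M n M'' ∧
      ((¬ Stable M n M' ∧ ∑ v ∈ range n, M' 10 v < ∑ v ∈ range n, M'' 10 v) ∨
      ((∀ j' < j, ¬ Enabled n (Graph M n) (M' 10) (M' 11) (j' / n) (j' % n)) ∧ M'' = M')))
    ⟨hM', .inr ⟨fun j hj => absurd hj (Nat.not_lt_zero _), rfl⟩⟩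
    (by
      rintro j M'' hj ⟨h1, h2⟩
      rw [e9] at hj
      rcases bidC_spec hP h1 hj Γ with ⟨h3, h4, h5⟩ | ⟨h3, h4⟩
      · refine ⟨h4, .inl ?_⟩
        rcases h2 with ⟨h2, h6⟩ | ⟨-, rfl⟩
        · exact ⟨h2, by omega⟩
        · exact ⟨fun h => h _ _ h3, by omega⟩
      · rw [h4]
        refine ⟨h1, ?_⟩
        rcases h2 with h2 | ⟨h2, rfl⟩
        · exact .inl h2
        · refine .inr ⟨fun j' hj' => ?_, rfl⟩
          rcases Nat.lt_succ_iff_lt_or_eq.1 hj' with h | rfl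
          · exact h2 j' h
          · exact h3)
  rw [e9] at this
  refine ⟨this.1, this.2.imp_right fun h => ⟨stable_iff.2 h.1, h.2⟩⟩

/-- The auction ends in time, since the sum of the prices is at most `n * (n + 1)`. -/
theorem auctionC_spec (hP : Params M n) (Γ : List ℕ) :
    Running M n (auctionC.run Γ M) ∧ Stable M n (auctionC.run Γ M) := by
  rw [auctionC, Cmd.run_seq, Cmd.run_seq]
  have hL := hP.lim
  rw [Cmd.run_fill_of_not_reads (b := 10) (i := 5) (e := 0) (by decide) rfl
    (by intro j _; rw [Term.eval_zero]; omega)]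
  set M₁ := M.fill 10 (M 2 5) (fun j => (0 : Term).eval M (j :: Γ)) with hM₁
  have e2 : M₁ 2 = M 2 := Mem.fill_of_ne _ (by decide)
  rw [Cmd.run_fill_of_not_reads (b := 11) (i := 5) (e := 0) (by decide) rfl
    (by intro j _; rw [Term.eval_zero, e2]; omega)]
  set M₂ := M₁.fill 11 (M₁ 2 5) (fun j => (0 : Term).eval M₁ (j :: Γ)) with hM₂
  have hb : ∀ b, b ≠ 10 → b ≠ 11 → M₂ b = M b := fun b h h' => by
    rw [hM₂, Mem.fill_of_ne _ h', hM₁, Mem.fill_of_ne _ h]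
  have h10 : ∀ v < n, M₂ 10 v = 0 := fun v hv => by
    rw [hM₂, Mem.fill_of_ne _ (by decide), hM₁, Mem.fill_same, if_pos (by rwa [hP.num]),
      Term.eval_zero]
  have h11 : ∀ v < n, M₂ 11 v = 0 := fun v hv => by
    rw [hM₂, Mem.fill_same, if_pos (by rwa [e2, hP.num]), Term.eval_zero]
  have hrun : Running M n M₂ := by
    refine ⟨hb, ?_, ?_, ?_, ?_⟩
    · intro u hu u' _ h0
      exact absurd (h11 u hu) h0
    · intro u hu v h0
      rw [h11 u hu] at h0; omega
    · intro v hv h0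
      exact absurd (h10 v hv) h0
    · intro v hv
      rw [h10 v hv]; omega
  have := Cmd.loop_induct (i := 8) (c := .loop 9 bidC) (Γ := Γ) (M := M₂)
    (fun t M' => Running M n M' ∧ (t ≤ ∑ v ∈ range n, M' 10 v ∨ Stable M n M'))
    ⟨hrun, .inl (Nat.zero_le _)⟩
    (by
      rintro t M' _ ⟨h1, h2⟩
      obtain ⟨h3, h4⟩ := pass_spec hP h1 (t :: Γ)
      refine ⟨h3, ?_⟩
      rcases h4 with ⟨h4, h5⟩ | ⟨h4, h5⟩
      · exact .inl (by have := h2.resolve_right h4; omega)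
      · rw [h5]; exact .inr h4)
  rw [hb 2 (by decide) (by decide), hP.passes] at this
  refine ⟨this.1, this.2.resolve_left fun h => ?_⟩
  have h1 : ∑ v ∈ range n, (Cmd.loop 8 (.loop 9 bidC)).run Γ M₂ 10 v ≤ n * (n + 1) := by
    refine (sum_le_card_nsmul _ _ (n + 1) fun v hv => this.1.inv.cap v (mem_range.1 hv)).trans ?_
    simp
  omega

end Auction

/-! ### Building a tree decomposition from separations -/

namespace Build

open Finset

open scoped Classical in
/-- The sides `side` divide the vertices into a separator, side `0`, and parts without
edges between them. The separation is good for the group `own v = a` with boundary `W`, if the new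
boundaries have at most `s` vertices. -/
structure Good (n s : ℕ) (adj : ℕ → ℕ → Prop) (own : ℕ → ℕ) (W : ℕ → Prop) (a : ℕ)
    (side : ℕ → ℕ) : Prop where
  cross : ∀ u < n, ∀ v < n, adj u v → side u = 0 ∨ side v = 0 ∨ side u = side v
  card : ∀ u < n, ((range n).filter fun v => W v ∧ (side v = 0 ∨ side v = side u)).card +
    ((range n).filter fun v => own v = a ∧ side v = 0).card + 1 ≤ s

open scoped Classical in
/-- The invariant of the construction after the nodes below `a` are done. Nodes are named
after vertices. The vertices `u` with `own u < a` are done, and `own u` is the topmost node whose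
bag contains `u`. The other vertices are in groups, named after their smallest members; all
neighbors of the group `b` outside the group are in its boundary `W b`, a part of the bag of
the future parent of `b`. -/
structure Inv (n s : ℕ) (adj : ℕ → ℕ → Prop) (a : ℕ) (own : ℕ → ℕ) (W bag : ℕ → ℕ → Prop)
    (par : ℕ → ℕ) : Prop where
  own_le : ∀ u < n, own u ≤ u
  own_own : ∀ u < n, a ≤ own u → own (own u) = own u
  par_lt : ∀ x, x ≠ 0 → par x < x
  nbr : ∀ u < n, ∀ v < n, a ≤ own u → adj u v → own v = own u ∨ W (own u) v
  bound : ∀ b < n, a ≤ b → own b = b → ∀ v < n, W b v → own v < a ∧ b ≠ 0 ∧ bag (par b) v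
  bound_card : ∀ b < n, a ≤ b → own b = b → ((range n).filter (W b)).card ≤ s
  bag_own : ∀ u < n, own u < a → bag (own u) u
  bag_par : ∀ x < n + 1, ∀ v < n, bag x v →
    x < a ∧ own v < a ∧ (x = own v ∨ (x ≠ 0 ∧ bag (par x) v))
  edge : ∀ u < n, ∀ v < n, adj u v → own u < a → own v < a → ∃ x < n + 1, bag x u ∧ bag x v
  bag_card : ∀ x < n + 1, ((range n).filter (bag x)).card ≤ 2 * s

variable {n s a : ℕ} {adj W bag W' bag' : ℕ → ℕ → Prop} {own own' par side : ℕ → ℕ}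

theorem Inv.zero (n s : ℕ) (adj : ℕ → ℕ → Prop) (h0 : ∀ u < n, own u = 0)
    (hW : ∀ b < n, ∀ v < n, ¬ W b v) (hbag : ∀ x < n + 1, ∀ v < n, ¬ bag x v) :
    Inv n s adj 0 own W bag (fun _ => 0) := by
  classical
  refine ⟨fun u hu => by simp [h0 u hu], fun u hu _ => ?_, fun x hx => by omega,
    fun u hu v hv _ _ => .inl (by rw [h0 u hu, h0 v hv]),
    fun b hb _ _ v hv h => absurd h (hW b hb v hv), fun b hb _ _ => ?_,
    fun u _ h => absurd h (Nat.not_lt_zero _), fun x hx v hv h => absurd h (hbag x hx v hv),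
    fun u _ v _ _ h => absurd h (Nat.not_lt_zero _), fun x hx => ?_⟩
  · rw [h0 u hu, h0 0 (by omega)]
  · rw [filter_false_of_mem fun v hv => hW b hb v (mem_range.1 hv)]
    simp
  · rw [filter_false_of_mem fun v hv => hbag x hx v (mem_range.1 hv)]
    simp

/-- Nothing has to be done for a vertex that does not name a group. -/
theorem Inv.skip (h : Inv n s adj a own W bag par) (ha : own a ≠ a) :
    Inv n s adj (a + 1) own W bag par := by
  have h1 : ∀ u < n, a + 1 ≤ own u ↔ a ≤ own u := by
    intro u hu
    refine ⟨fun h => by omega, fun h2 => ?_⟩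
    rcases h2.eq_or_lt with h3 | h3
    · have := h.own_own u hu h2
      rw [← h3] at this
      exact absurd this ha
    · exact h3
  have h2 : ∀ u < n, own u < a + 1 ↔ own u < a := fun u hu => by
    have := h1 u hu; omega
  have h3 : ∀ b, a + 1 ≤ b → a ≤ b := fun b hb => by omega
  exact ⟨h.own_le, fun u hu h4 => h.own_own u hu (h3 _ h4), h.par_lt,
    fun u hu v hv h4 => h.nbr u hu v hv (h3 _ h4),
    fun b hb h4 h5 v hv h6 => by
      rw [h2 v hv]
      exact h.bound b hb (h3 _ h4) h5 v hv h6,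
    fun b hb h4 h5 => h.bound_card b hb (h3 _ h4) h5,
    fun u hu h4 => h.bag_own u hu ((h2 u hu).1 h4),
    fun x hx v hv h4 => by
      rw [h2 v hv]
      obtain ⟨h5, h6⟩ := h.bag_par x hx v hv h4
      exact ⟨by omega, h6⟩,
    fun u hu v hv h4 h5 h6 => h.edge u hu v hv h4 ((h2 u hu).1 h5) ((h2 v hv).1 h6), h.bag_card⟩

/-- Membership of `u` in one of the parts into which the group of `a` is divided. -/
def Moves (own side : ℕ → ℕ) (a u : ℕ) : Prop := own u = a ∧ u ≠ a ∧ side u ≠ 0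

instance (u : ℕ) : Decidable (Moves own side a u) := inferInstanceAs (Decidable (_ ∧ _ ∧ _))

/-- The new groups: each part of the group of `a` becomes a group, named by `own'` after one of its
members; all other vertices keep their owner. -/
structure Regroup (n a : ℕ) (own side own' : ℕ → ℕ) : Prop where
  lt : ∀ u < n, Moves own side a u → own' u ≤ u
  mem : ∀ u < n, Moves own side a u → Moves own side a (own' u) ∧ side (own' u) = side u
  eq : ∀ u < n, ∀ v < n, Moves own side a u → Moves own side a v → side u = side v →
    own' u = own' v
  stay : ∀ u < n, ¬ Moves own side a u → own' u = own u

/-- Dividing the group of `a` by a good separation preserves the invariant: the bag of the new node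
`a` consists of the boundary `W a`, the vertex `a` and the members of the group on the separator; the
new boundaries consist of the part of this bag on the separator or on the respective side. -/
theorem Inv.step (hsymm : ∀ u < n, ∀ v < n, adj u v → adj v u)
    (h : Inv n s adj a own W bag par) (han : a < n) (ha : own a = a)
    (hg : Good n s adj own (W a) a side) (hown : Regroup n a own side own')
    (hbag : ∀ v < n, bag' a v ↔ W a v ∨ v = a ∨ (own v = a ∧ side v = 0))
    (hbag' : ∀ x < n + 1, x ≠ a → ∀ v < n, (bag' x v ↔ bag x v))
    (hW : ∀ b < n, own b = a → own' b = b → b ≠ a → ∀ v < n,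
      (W' b v ↔ bag' a v ∧ (side v = 0 ∨ side v = side b)))
    (hW' : ∀ b < n, own b ≠ a → ∀ v < n, (W' b v ↔ W b v)) :
    ∃ par', Inv n s adj (a + 1) own' W' bag' par' := by
  classical
  -- a vertex of a new group belongs to an old group or to a part of the group of `a`
  have hge : ∀ u < n, Moves own side a u → a + 1 ≤ own' u := by
    intro u hu hm
    obtain ⟨⟨h1, h2, -⟩, -⟩ := hown.mem u hu hm
    have h3 := h.own_le (own' u) ((hown.lt u hu hm).trans_lt hu)
    omega
  have hother : ∀ u < n, own u ≠ a → own' u = own u := fun u hu h1 =>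
    hown.stay u hu fun h2 => h1 h2.1
  have hnot : ∀ u < n, own' u < a + 1 → own' u = own u ∧ (own u < a ∨ (own u = a ∧
      (u = a ∨ side u = 0))) := by
    intro u hu h1
    have h2 : ¬ Moves own side a u := fun h2 => by have := hge u hu h2; omega
    have h3 := hown.stay u hu h2
    refine ⟨h3, ?_⟩
    by_cases h4 : own u = a
    · refine .inr ⟨h4, ?_⟩
      by_contra! h5
      exact h2 ⟨h4, h5.1, h5.2⟩
    · exact .inl (by omega)
  have hyes : ∀ u < n, a + 1 ≤ own' u → Moves own side a u ∨ (own' u = own u ∧ a + 1 ≤ own u) := by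
    intro u hu h1
    by_cases h2 : Moves own side a u
    · exact .inl h2
    · have := hown.stay u hu h2
      exact .inr ⟨this, by omega⟩
  have haa : own' a = a := by rw [hown.stay a han fun h => h.2.1 rfl, ha]
  have hold : ∀ v < n, bag' a v → own' v < a + 1 := by
    intro v hv h1
    rcases (hbag v hv).1 h1 with h2 | rfl | ⟨h2, h3⟩
    · have h3 := (h.bound a han le_rfl ha v hv h2).1
      rw [hother v hv (by omega)]
      omega
    · omega
    · rw [hown.stay v hv fun h => h.2.2 h3]
      omega
  let par' : ℕ → ℕ := fun b => if a < b ∧ own b = a then a else par b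
  have hpar' : ∀ b, ¬ (a < b ∧ own b = a) → par' b = par b := fun b hb => if_neg hb
  have hparlt : ∀ x v, x < n + 1 → x ≠ 0 → v < n → bag (par x) v → bag' (par x) v := by
    intro x v hx hx0 hv h1
    have h2 := h.par_lt x hx0
    have h3 := (h.bag_par _ (by omega) v hv h1).1
    exact (hbag' _ (by omega) (by omega) v hv).2 h1
  refine ⟨par', ?_, ?_, ?_, ?_, ?_, ?_, ?_, ?_, ?_, ?_⟩
  · intro u hu
    by_cases h1 : Moves own side a u
    · exact hown.lt u hu h1
    · rw [hown.stay u hu h1]; exact h.own_le u hu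
  · intro u hu h1
    rcases hyes u hu h1 with h2 | ⟨h2, h3⟩
    · obtain ⟨h3, h4⟩ := hown.mem u hu h2
      exact hown.eq _ ((hown.lt u hu h2).trans_lt hu) u hu h3 h2 h4
    · have h4 := h.own_own u hu (by omega)
      rw [h2, hother _ ((h.own_le u hu).trans_lt hu) (by omega), h4]
  · intro x hx
    show (if a < x ∧ own x = a then a else par x) < x
    split_ifs with h1
    · exact h1.1
    · exact h.par_lt x hx
  · intro u hu v hv h1 huv
    rcases hyes u hu h1 with h2 | ⟨h2, h3⟩
    · have h3 := hown.mem u hu h2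
      have hbn := (hown.lt u hu h2).trans_lt hu
      have hbb := hown.eq _ hbn u hu h3.1 h2 h3.2
      have hside : side v = 0 ∨ side v = side u := by
        rcases hg.cross u hu v hv huv with h4 | h4 | h4
        · exact absurd h4 h2.2.2
        · exact .inl h4
        · exact .inr h4.symm
      rw [hW _ hbn h3.1.1 hbb h3.1.2.1 v hv, h3.2]
      rcases h.nbr u hu v hv (by rw [h2.1]) huv with h4 | h4 <;> rw [h2.1] at h4
      · by_cases h5 : Moves own side a v
        · exact .inl (hown.eq v hv u hu h5 h2 (hside.resolve_left h5.2.2))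
        · refine .inr ⟨(hbag v hv).2 (.inr ?_), hside⟩
          by_contra! h6
          exact h5 ⟨h4, h6.1, h6.2 h4⟩
      · exact .inr ⟨(hbag v hv).2 (.inl h4), hside⟩
    · have h4 := h.own_own u hu (by omega)
      rw [h2, hW' _ ((h.own_le u hu).trans_lt hu) (by omega) v hv]
      rcases h.nbr u hu v hv (by omega) huv with h5 | h5
      · exact .inl (by rw [hother v hv (by omega), h5])
      · exact .inr h5
  · intro b hb h1 h2 v hv h3
    by_cases h4 : own b = a
    · rw [hW b hb h4 h2 (by omega) v hv] at h3
      refine ⟨hold v hv h3.1, by omega, ?_⟩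
      rw [show par' b = a from if_pos ⟨by omega, h4⟩]
      exact h3.1
    · rw [hother b hb h4] at h2
      rw [hW' b hb h4 v hv] at h3
      obtain ⟨h5, h6, h7⟩ := h.bound b hb (by omega) h2 v hv h3
      refine ⟨by rw [hother v hv (by omega)]; omega, h6, ?_⟩
      rw [hpar' b fun h => h4 h.2]
      exact hparlt b v (by omega) h6 hv h7
  · intro b hb h1 h2
    by_cases h4 : own b = a
    · have h5 : (range n).filter (W' b) ⊆
          ((range n).filter fun v => W a v ∧ (side v = 0 ∨ side v = side b)) ∪
          (((range n).filter fun v => own v = a ∧ side v = 0) ∪ {a}) := by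
        intro v hv
        obtain ⟨hv, h6⟩ := mem_filter.1 hv
        have hvn := mem_range.1 hv
        rw [hW b hb h4 h2 (by omega) v hvn, hbag v hvn] at h6
        simp only [mem_union, mem_filter, mem_singleton, hv, true_and]
        tauto
      have h6 := hg.card b hb
      have h7 := (card_le_card h5).trans (card_union_le _ _)
      have h8 := card_union_le ((range n).filter fun v => own v = a ∧ side v = 0) {a}
      rw [card_singleton] at h8
      omega
    · rw [hother b hb h4] at h2
      rw [filter_congr fun v hv => hW' b hb h4 v (mem_range.1 hv)]
      exact h.bound_card b hb (by omega) h2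
  · intro u hu h1
    obtain ⟨h2, h3⟩ := hnot u hu h1
    rw [h2]
    rcases h3 with h3 | ⟨h3, h4⟩
    · exact (hbag' _ (by omega) (by omega) u hu).2 (h.bag_own u hu h3)
    · rw [h3, hbag u hu]
      exact .inr (h4.imp_right fun h5 => ⟨h3, h5⟩)
  · intro x hx v hv h1
    by_cases hxa : x = a
    · subst hxa
      refine ⟨by omega, hold v hv h1, ?_⟩
      rcases (hbag v hv).1 h1 with h2 | rfl | ⟨h2, h3⟩
      · obtain ⟨-, h3, h4⟩ := h.bound x han le_rfl ha v hv h2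
        refine .inr ⟨h3, ?_⟩
        rw [hpar' x fun h => h.1.false]
        exact hparlt x v hx h3 hv h4
      · exact .inl haa.symm
      · exact .inl (by rw [hown.stay v hv fun h => h.2.2 h3, h2])
    · rw [hbag' x hx hxa v hv] at h1
      obtain ⟨h2, h3, h4⟩ := h.bag_par x hx v hv h1
      rw [hother v hv (by omega)]
      refine ⟨by omega, by omega, h4.imp_right fun ⟨h5, h6⟩ => ⟨h5, ?_⟩⟩
      rw [hpar' x fun h => by omega]
      exact hparlt x v hx h5 hv h6
  · have key : ∀ u < n, ∀ v < n, adj u v → own u = a → (u = a ∨ side u = 0) → own' v < a + 1 →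
        bag' a u ∧ bag' a v := by
      intro u hu v hv huv h1 h2 h3
      refine ⟨(hbag u hu).2 (.inr (h2.imp_right fun h => ⟨h1, h⟩)), (hbag v hv).2 ?_⟩
      rcases h.nbr u hu v hv (by omega) huv with h4 | h4
      · obtain ⟨-, h5 | ⟨h5, h6⟩⟩ := hnot v hv h3
        · omega
        · exact .inr (h6.imp_right fun h => ⟨h5, h⟩)
      · exact .inl (h1 ▸ h4)
    intro u hu v hv huv h1 h2
    obtain ⟨h3, h4⟩ := hnot u hu h1
    obtain ⟨h5, h6⟩ := hnot v hv h2
    rcases h4 with h4 | ⟨h4, h7⟩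
    · rcases h6 with h6 | ⟨h6, h8⟩
      · obtain ⟨x, hx, h7, h8⟩ := h.edge u hu v hv huv h4 h6
        have h9 := (h.bag_par x hx u hu h7).1
        exact ⟨x, hx, (hbag' x hx (by omega) u hu).2 h7, (hbag' x hx (by omega) v hv).2 h8⟩
      · obtain ⟨h9, h10⟩ := key v hv u hu (hsymm _ hu _ hv huv) h6 h8 h1
        exact ⟨a, by omega, h10, h9⟩
    · exact ⟨a, by omega, key u hu v hv huv h4 h7 h2⟩
  · intro x hx
    by_cases hxa : x = a
    · subst hxa
      have h5 : (range n).filter (bag' x) ⊆ (range n).filter (W x) ∪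
          (((range n).filter fun v => own v = x ∧ side v = 0) ∪ {x}) := by
        intro v hv
        obtain ⟨hv, h6⟩ := mem_filter.1 hv
        rw [hbag v (mem_range.1 hv)] at h6
        simp only [mem_union, mem_filter, mem_singleton, hv, true_and]
        tauto
      have h6 := hg.card x han
      have h7 := (card_le_card h5).trans (card_union_le _ _)
      have h8 := card_union_le ((range n).filter fun v => own v = x ∧ side v = 0) {x}
      have h9 := h.bound_card x han le_rfl ha
      rw [card_singleton] at h8
      omega
    · rw [filter_congr fun v hv => hbag' x hx hxa v (mem_range.1 hv)]
      exact h.bag_card x hx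

/-- The finished construction is a tree decomposition. -/
theorem Inv.rootedDec (h : Inv n s adj n own W bag par) :
    Nonempty (RootedDec n (n + 1) adj bag fun _ _ => True) := by
  have hlt : ∀ u < n, own u < n := fun u hu => (h.own_le u hu).trans_lt hu
  refine ⟨{ par := fun x => if x = 0 then 0 else par x
            dep := id
            top := own
            pos := Nat.succ_pos n
            dep_lt := fun x hx => hx
            par_zero := rfl
            par_lt := fun x hx h0 => ?_
            dep_par := fun x _ h0 => ?_
            tree_par := fun _ _ _ => trivial
            top_lt := fun v hv => (hlt v hv).trans (Nat.lt_succ_self n)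
            top_mem := fun v hv => h.bag_own v hv (hlt v hv)
            bag_par := fun x hx v hv hxv => ?_
            edge := fun u hu v hv huv => h.edge u hu v hv huv (hlt u hu) (hlt v hv) }⟩
  · rw [if_neg h0]
    exact (h.par_lt x h0).trans hx
  · rw [if_neg h0]
    exact h.par_lt x h0
  · refine (h.bag_par x hx v hv hxv).2.2.imp_right fun h1 => ⟨h1.1, ?_⟩
    rw [if_neg h1.1]
    exact h1.2

/-- The sides given by two sets that cover all vertices. -/
def sides (X Y : Finset ℕ) (v : ℕ) : ℕ := if v ∈ X then if v ∈ Y then 0 else 1 else 2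

/-- Sufficient conditions on the numbers of boundary vertices on either side. The summand `1` is for
the vertex that names the group. -/
theorem good_of_card {X Y : Finset ℕ} {W : ℕ → Prop} {Wf : Finset ℕ}
    (hsymm : ∀ u < n, ∀ v < n, adj u v → adj v u) (hWf : ∀ v, v ∈ Wf ↔ v < n ∧ W v)
    (hXY : ∀ v < n, v ∈ X ∨ v ∈ Y)
    (hcross : ∀ u < n, ∀ v < n, adj u v → u ∉ Y → v ∉ X → False)
    (hX : (Wf ∩ X).card + ((X ∩ Y) \ Wf).card + 1 ≤ s)
    (hY : (Wf ∩ Y).card + ((X ∩ Y) \ Wf).card + 1 ≤ s)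
    (hown : ∀ v < n, own v = a → ¬ W v) : Good n s adj own W a (sides X Y) := by
  classical
  have h0 : ∀ v < n, sides X Y v = 0 ↔ v ∈ X ∧ v ∈ Y := by
    intro v hv
    have := hXY v hv
    unfold sides
    split_ifs <;> simp_all
  have h1 : ∀ v < n, sides X Y v = 1 ↔ v ∉ Y := by
    intro v hv
    have := hXY v hv
    unfold sides
    split_ifs <;> simp_all
  have h2 : ∀ v < n, sides X Y v = 2 ↔ v ∉ X := by
    intro v hv
    unfold sides
    split_ifs <;> simp_all
  have h3 : ∀ v, sides X Y v = 0 ∨ sides X Y v = 1 ∨ sides X Y v = 2 := by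
    intro v
    unfold sides
    split_ifs <;> simp
  constructor
  · intro u hu v hv huv
    have e1 := hcross u hu v hv huv
    have e2 := hcross v hv u hu (hsymm _ hu _ hv huv)
    rw [← h1 u hu, ← h2 v hv] at e1
    rw [← h1 v hv, ← h2 u hu] at e2
    rcases h3 u with h4 | h4 | h4 <;> rcases h3 v with h5 | h5 | h5 <;>
      first | omega | exact (e1 h4 h5).elim | exact (e2 h5 h4).elim
  · intro u hu
    have c1 : ((range n).filter fun v => own v = a ∧ sides X Y v = 0).card ≤
        ((X ∩ Y) \ Wf).card := by
      refine card_le_card fun v hv => ?_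
      obtain ⟨hv, h4, h5⟩ := mem_filter.1 hv
      have hv := mem_range.1 hv
      rw [mem_sdiff, mem_inter, hWf]
      exact ⟨(h0 v hv).1 h5, fun h6 => hown v hv h4 h6.2⟩
    have c2 : ((range n).filter fun v => W v ∧ (sides X Y v = 0 ∨ sides X Y v = sides X Y u)).card
        ≤ (Wf ∩ X).card ∨
        ((range n).filter fun v => W v ∧ (sides X Y v = 0 ∨ sides X Y v = sides X Y u)).card
        ≤ (Wf ∩ Y).card := by
      by_cases hu2 : sides X Y u = 2
      · right
        refine card_le_card fun v hv => ?_
        obtain ⟨hv, h4, h5⟩ := mem_filter.1 hv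
        have hv := mem_range.1 hv
        rw [mem_inter, hWf]
        refine ⟨⟨hv, h4⟩, ?_⟩
        by_contra h6
        rw [(h1 v hv).2 h6, hu2] at h5
        omega
      · left
        refine card_le_card fun v hv => ?_
        obtain ⟨hv, h4, h5⟩ := mem_filter.1 hv
        have hv := mem_range.1 hv
        rw [mem_inter, hWf]
        refine ⟨⟨hv, h4⟩, ?_⟩
        by_contra h6
        rw [(h2 v hv).2 h6] at h5
        omega
    rcases c2 with c2 | c2
    · refine le_trans (Nat.add_le_add_right (Nat.add_le_add ?_ ?_) 1) hX
      · convert c2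
      · convert c1
    · refine le_trans (Nat.add_le_add_right (Nat.add_le_add ?_ ?_) 1) hY
      · convert c2
      · convert c1

/-- In a graph of treewidth at most `k`, suitable disjoint subsets `A` and `B` of a boundary of at
most `3 * k + 4` vertices have the property that all their separations with minimum overlap are
good. -/
theorem exists_labels {m k : ℕ} {bag₀ tree₀ : ℕ → ℕ → Prop}
    (hsymm : ∀ u < n, ∀ v < n, adj u v → adj v u) (D : RootedDec n m adj bag₀ tree₀)
    (hw : ∀ x < m, (@filter _ (bag₀ x) (Classical.decPred _) (range n)).card ≤ k + 1)
    {W : ℕ → Prop} {Wf : Finset ℕ} (hWf : ∀ v, v ∈ Wf ↔ v < n ∧ W v) (hcard : Wf.card ≤ 3 * k + 4)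
    (hown : ∀ v < n, own v = a → ¬ W v) :
    ∃ A ⊆ Wf, ∃ B ⊆ Wf, Disjoint A B ∧ ∀ X Y : Finset ℕ,
      (∀ v < n, v ∈ X ∨ v ∈ Y) →
      (∀ u < n, ∀ v < n, adj u v → u ∉ Y → v ∉ X → False) → A ⊆ X → B ⊆ Y →
      (∀ X' Y' : Finset ℕ, X' ∪ Y' = range n → A ⊆ X' → B ⊆ Y' →
        (∀ u ∈ X' \ Y', ∀ v ∈ Y' \ X', ¬ adj u v) → (X ∩ Y).card ≤ (X' ∩ Y').card) →
      Good n (3 * k + 4) adj own W a (sides X Y) := by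
  classical
  by_cases hlt : Wf.card < 3 * k + 4
  · -- with room for one more vertex, separations without overlap are good
    refine ⟨∅, empty_subset _, ∅, empty_subset _, disjoint_empty_left _, ?_⟩
    intro X Y hXY hcross _ _ hmin
    have h1 := hmin (range n) ∅ (by simp) (empty_subset _) (empty_subset _) (by simp)
    rw [inter_empty, card_empty, Nat.le_zero, card_eq_zero] at h1
    refine good_of_card hsymm hWf hXY hcross ?_ ?_ hown
    · have := card_le_card (inter_subset_left (s₁ := Wf) (s₂ := X))
      rw [h1]; simp; omega
    · have := card_le_card (inter_subset_left (s₁ := Wf) (s₂ := Y))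
      rw [h1]; simp; omega
  · obtain ⟨X₀, Y₀, h1, h2, h3, A, hA, B, hB, h4, h5, h6⟩ :=
      D.exists_separation (k := k) (fun x hx => by convert hw x hx) Wf
        (fun v hv => mem_range.2 ((hWf v).1 hv).1) (by omega)
    refine ⟨A, hA.trans inter_subset_left, B, hB.trans inter_subset_left, h4, ?_⟩
    intro X Y hXY hcross hAX hBY hmin
    have h7 := (hmin X₀ Y₀ h1 (hA.trans inter_subset_right) (hB.trans inter_subset_right) h2).trans h3
    have c0 := card_sdiff_add_card_inter (X ∩ Y) Wf
    -- the vertices of `B` outside the overlap are not in `X`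
    have c1 : (Wf ∩ X).card + B.card ≤ Wf.card + ((X ∩ Y) ∩ Wf).card := by
      rw [← card_union_add_card_inter]
      refine Nat.add_le_add (card_le_card (union_subset inter_subset_left
        (hB.trans inter_subset_left))) (card_le_card fun v hv => ?_)
      simp only [mem_inter] at hv ⊢
      exact ⟨⟨hv.1.2, hBY hv.2⟩, hv.1.1⟩
    have c2 : (Wf ∩ Y).card + A.card ≤ Wf.card + ((X ∩ Y) ∩ Wf).card := by
      rw [← card_union_add_card_inter]
      refine Nat.add_le_add (card_le_card (union_subset inter_subset_left
        (hA.trans inter_subset_left))) (card_le_card fun v hv => ?_)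
      simp only [mem_inter] at hv ⊢
      exact ⟨⟨hAX hv.2, hv.1.2⟩, hv.1.1⟩
    exact good_of_card hsymm hWf hXY hcross (by omega) (by omega) hown

end Build

/-! ### The program that builds a tree decomposition -/

namespace Build

open Finset ConcSched.Core

theorem Good.congr {n s a : ℕ} {adj : ℕ → ℕ → Prop} {own side side' : ℕ → ℕ} {W : ℕ → Prop}
    (h : Good n s adj own W a side) (hs : ∀ v < n, side' v = side v) :
    Good n s adj own W a side' := by
  constructor
  · intro u hu v hv huv
    rw [hs u hu, hs v hv]
    exact h.cross u hu v hv huv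
  · classical
    intro u hu
    refine le_trans (Nat.add_le_add_right (Nat.add_le_add (b := ((range n).filter fun v =>
      W v ∧ (side v = 0 ∨ side v = side u)).card) (d := ((range n).filter fun v =>
        own v = a ∧ side v = 0).card) ?_ ?_) 1) (le_trans (le_of_eq ?_) (h.card u hu))
    · refine card_le_card fun v hv => ?_
      rw [mem_filter, mem_range] at hv ⊢
      rwa [← hs v hv.1, ← hs u hu]
    · refine card_le_card fun v hv => ?_
      rw [mem_filter, mem_range] at hv ⊢
      rwa [← hs v hv.1]
    · congr!

open scoped Classical in
/-- The label `0`, `1` or `2` of the vertex `v` in the labeling of `W` that is encoded by `e`. -/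
noncomputable def label (n : ℕ) (W : ℕ → Prop) (e v : ℕ) : ℕ :=
  e / (∏ u ∈ range n, if u < v then (if W u then 3 else 1) else 1) % (if W v then 3 else 1)

/-- The sides given by the auction and the price `θ`. -/
def auctionSide (lab p l : ℕ → ℕ) (θ v : ℕ) : ℕ :=
  if lab v = 1 ∨ θ ≤ p v then (if lab v = 2 ∨ (¬ l v = 0 ∧ p (l v - 1) < θ) then 0 else 1) else 2

theorem exists_label_code {n s : ℕ} {W : ℕ → Prop} {Wf A B : Finset ℕ}
    (hWf : ∀ v, v ∈ Wf ↔ v < n ∧ W v) (hcard : Wf.card ≤ s) (hA : A ⊆ Wf)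
    (hB : B ⊆ Wf) :
    ∃ e < 3 ^ s, ∀ v < n, label n W e v = if v ∈ A then 1 else if v ∈ B then 2 else 0 := by
  classical
  let f : ℕ → ℕ := fun v => if v ∈ A then 1 else if v ∈ B then 2 else 0
  have hf : ∀ v < n, f v < if W v then 3 else 1 := by
    intro v hv
    by_cases hW : W v
    · rw [if_pos hW]
      simp only [f]
      split_ifs <;> omega
    · rw [if_neg hW]
      have h1 : v ∉ A := fun h => hW ((hWf v).1 (hA h)).2
      have h2 : v ∉ B := fun h => hW ((hWf v).1 (hB h)).2
      simp [f, h1, h2]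
  have h1 : ∏ v ∈ range n, (if W v then 3 else 1) = 3 ^ Wf.card := by
    rw [prod_ite, prod_const, prod_const_one, mul_one]
    congr 2
    ext v
    simp [hWf]
  have h2 := radix_lt hf
  rw [h1] at h2
  refine ⟨_, h2.trans_le (Nat.pow_le_pow_right (by omega) hcard), fun v hv => ?_⟩
  rw [label, ← prod_filter, show (range n).filter (fun u => u < v) = range v by
    ext u; simp only [mem_filter, mem_range]; omega]
  convert radix_digit hf hv

/-- For some labeling of the boundary, each result of an auction gives a good separation at some
price. -/
theorem exists_label {n k m : ℕ} {adj bag₀ tree₀ : ℕ → ℕ → Prop} {own : ℕ → ℕ} {W : ℕ → Prop}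
    {a : ℕ} (hsymm : ∀ u < n, ∀ v < n, adj u v → adj v u)
    (D : RootedDec n m adj bag₀ tree₀)
    (hw : ∀ x < m, (@filter _ (bag₀ x) (Classical.decPred _) (range n)).card ≤ k + 1)
    (hcard : (@filter _ W (Classical.decPred _) (range n)).card ≤ 3 * k + 4)
    (hown : ∀ v < n, own v = a → ¬ W v) :
    ∃ e < 3 ^ (3 * k + 4), ∀ p l,
      Auction.Inv n (Auction.Wants n adj (fun v => label n W e v = 1) fun v => label n W e v = 2)
        p l →
      (∀ u v, ¬ Auction.Enabled n
        (Auction.Wants n adj (fun v => label n W e v = 1) fun v => label n W e v = 2) p l u v) →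
      ∃ θ < n + 2, Good n (3 * k + 4) adj own W a (auctionSide (label n W e) p l θ) := by
  classical
  let Wf := (range n).filter W
  have hWf : ∀ v, v ∈ Wf ↔ v < n ∧ W v := fun v => by simp [Wf]
  have hcard' : Wf.card ≤ 3 * k + 4 := by convert hcard
  obtain ⟨A, hA, B, hB, hAB, hgood⟩ := exists_labels hsymm D hw hWf hcard' hown
  obtain ⟨e, he, hlab⟩ := exists_label_code hWf hcard' hA hB
  refine ⟨e, he, fun p l hinv hst => ?_⟩
  have h1 : ∀ v < n, label n W e v = 1 ↔ v ∈ A := by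
    intro v hv
    rw [hlab v hv]
    by_cases hva : v ∈ A
    · simp [hva]
    · by_cases hvb : v ∈ B <;> simp [hva, hvb]
  have h2 : ∀ v < n, label n W e v = 2 ↔ v ∈ B := by
    intro v hv
    rw [hlab v hv]
    by_cases hva : v ∈ A
    · simp [hva, disjoint_left.1 hAB hva]
    · by_cases hvb : v ∈ B <;> simp [hva, hvb]
  obtain ⟨θ, hθ, X, Y, hX, hY, hXY, hcross, hmin⟩ := hinv.exists_separation hst
  have hAn : ∀ v ∈ A, v < n := fun v hv => ((hWf v).1 (hA hv)).1
  have hBn : ∀ v ∈ B, v < n := fun v hv => ((hWf v).1 (hB hv)).1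
  refine ⟨θ, hθ, (hgood X Y hXY hcross
    (fun v hv => (hX v).2 ⟨hAn v hv, .inl ((h1 v (hAn v hv)).2 hv)⟩)
    (fun v hv => (hY v).2 ⟨hBn v hv, .inl ((h2 v (hBn v hv)).2 hv)⟩)
    (fun X' Y' h3 h4 h5 h6 => hmin X' Y' h3 (fun v hv hl => h4 ((h1 v hv).1 hl))
      (fun v hv hl => h5 ((h2 v hv).1 hl)) h6)).congr fun v hv => ?_⟩
  have h3 : v ∈ X ↔ label n W e v = 1 ∨ θ ≤ p v := by rw [hX]; simp [hv]
  have h4 : v ∈ Y ↔ label n W e v = 2 ∨ (¬ l v = 0 ∧ p (l v - 1) < θ) := by rw [hY]; simp [hv]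
  simp only [auctionSide, sides, h3, h4]

/-! Bank 3: in cell 3 whether the construction has failed, in cell 4 whether a good separation has
been found; bank 5: the bags; bank 12: the owners; bank 13: the labels; bank 14: the boundaries;
bank 15: the sides; bank 16: the new owners. Parameters in bank 2: 10: number of
cells of bank 5; 11: number of prices; 12: the bound for the boundaries; 1: number of labelings. -/

def ownT (v : Term) : Term := .get 12 v
def boundT (b v : Term) : Term := .get 14 (b * numT + v)
def sideT (v : Term) : Term := .get 15 v
def boundBaseT (a v : Term) : Term := .ite (boundT a v) (.lit 3) 1
/-- The label of `v` in the labeling of the boundary of the group `a` that is encoded by `e`, a mixed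
radix number with a digit below `3` for each boundary vertex. -/
def labelT (a e v : Term) : Term :=
  e / .prod 5 (.ite ((Term.var 0).lt v.up) (boundBaseT a.up (.var 0)) 1) % boundBaseT a v

/-- The side of `v` for the price `θ`, as in `auctionSide`. -/
def newSideT (θ v : Term) : Term :=
  .ite (((Term.get 13 v).eq 1).or (θ.le (.get 10 v)))
    (.ite (((Term.get 13 v).eq 2).or
      (((Term.get 11 v).eq 0).not.and ((Term.get 10 (.get 11 v - 1)).lt θ))) 0 1) 2

/-- The sides in memory are good for the group `a`. -/
def goodT (a : Term) : Term :=
  .and (.all 5 (.all 5 (.imp (adjT (.var 1) (.var 0))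
    (((sideT (.var 1)).eq 0).or (((sideT (.var 0)).eq 0).or ((sideT (.var 1)).eq (sideT (.var 0))))))))
  (.all 5 (Term.le
    (.sum 5 (.flag ((boundT a.up.up (.var 0)).and
      (((sideT (.var 0)).eq 0).or ((sideT (.var 0)).eq (sideT (.var 1)))))) +
      .sum 5 (.flag (((ownT (.var 0)).eq a.up.up).and ((sideT (.var 0)).eq 0))) + 1)
    (.get 2 (.lit 12))))

/-- Look for a good separation of the group `var 1` at the price `var 0`. -/
def priceC (a : Term) : Cmd :=
  .ite (.get 3 4) .skip (.seq (.loop 5 (.put 15 (.var 0) (newSideT (.var 1) (.var 0))))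
    (.ite (goodT a) (.put 3 4 1) .skip))

/-- Look for a good separation of the group `var 1` with the labels that are encoded by `var 0`. -/
def labelC : Cmd :=
  .ite (.get 3 4) .skip (.seq
    (.loop 5 (.put 13 (.var 0) (labelT (.var 2) (.var 1) (.var 0))))
    (.seq Auction.auctionC (.loop 11 (priceC (.var 2)))))

/-- The vertex `v` is in one of the parts into which the group of `a` is divided. -/
def movesT (a v : Term) : Term :=
  ((ownT v).eq a).and ((v.eq a).not.and ((sideT v).eq 0).not)

/-- The least vertex in the same part as `v`. -/
def leastT (a v : Term) : Term :=
  .sum 5 (.flag (.all 5 (.imp ((Term.var 0).le (.var 1)) (Term.not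
    ((movesT a.up.up (.var 0)).and ((sideT (.var 0)).eq (sideT v.up.up)))))))

/-- Make the node `var 0` and divide its group. -/
def splitC : Cmd :=
  .seq (.loop 10 (.put 5 (.var 0) (.flag (.ite ((Term.var 0 / numT).eq (.var 1))
      ((boundT (.var 1) (.var 0 % numT)).or (((Term.var 0 % numT).eq (.var 1)).or
        (((ownT (.var 0 % numT)).eq (.var 1)).and ((sideT (.var 0 % numT)).eq 0))))
      (.get 5 (.var 0))))))
  (.seq (.loop 5 (.put 16 (.var 0) (.ite (movesT (.var 1) (.var 0)) (leastT (.var 1) (.var 0))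
    (ownT (.var 0)))))
  (.seq (.loop 9 (.put 14 (.var 0) (.flag (.ite
      (((ownT (.var 0 / numT)).eq (.var 1)).and (((Term.get 16 (.var 0 / numT)).eq (.var 0 / numT)).and
        ((Term.var 0 / numT).eq (.var 1)).not))
      ((bagT (.var 1) (.var 0 % numT)).and (((sideT (.var 0 % numT)).eq 0).or
        ((sideT (.var 0 % numT)).eq (sideT (.var 0 / numT)))))
      (.get 14 (.var 0))))))
  (.loop 5 (.put 12 (.var 0) (.get 16 (.var 0))))))

/-- Divide the group `var 0`, if there is one, or fail. -/
def nodeC : Cmd :=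
  .ite ((Term.get 3 3).or ((ownT (.var 0)).eq (.var 0)).not) .skip
    (.seq (.put 3 4 0) (.seq (.loop 1 labelC) (.ite (.get 3 4) splitC (.put 3 3 1))))

/-- Build a tree decomposition, or fail. -/
def buildC : Cmd :=
  .seq (.loop 5 (.put 12 (.var 0) 0)) (.seq (.loop 9 (.put 14 (.var 0) 0))
    (.seq (.loop 10 (.put 5 (.var 0) 0)) (.seq (.put 3 3 0) (.loop 5 nodeC))))

/-- What the construction needs to know about the parameters. -/
structure Params (M : Mem) (n : ℕ) : Prop extends Auction.Params M n where
  cells : M 2 10 = (n + 1) * n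
  prices : M 2 11 = n + 2
  labels : M 2 1 = 3 ^ M 2 12

/-- Membership in the boundaries in memory. -/
abbrev boundP (M : Mem) (b v : ℕ) : Prop := M 14 (b * M 2 5 + v) ≠ 0

variable {M M' : Mem} {n : ℕ}

theorem Params.congr (h : Params M n) (h2 : M' 2 = M 2) : Params M' n := by
  obtain ⟨⟨h3, h4, h5, h6⟩, h7, h8, h9⟩ := h
  constructor
  · constructor <;> rw [h2] <;> assumption
  all_goals rw [h2]; assumption

theorem holds_goodT (hn : M 2 5 = n) (a : Term) (Γ : List ℕ) :
    (goodT a).holds M Γ ↔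
      Good n (M 2 12) (adjP M) (M 12) (boundP M (a.eval M Γ)) (a.eval M Γ) (M 15) := by
  classical
  subst hn
  have h1 : (goodT a).holds M Γ ↔
      (∀ u < M 2 5, ∀ v < M 2 5, adjP M u v → M 15 u = 0 ∨ M 15 v = 0 ∨ M 15 u = M 15 v) ∧
      ∀ u < M 2 5, ((range (M 2 5)).filter fun v => boundP M (a.eval M Γ) v ∧
        (M 15 v = 0 ∨ M 15 v = M 15 u)).card + ((range (M 2 5)).filter fun v =>
          M 12 v = a.eval M Γ ∧ M 15 v = 0).card + 1 ≤ M 2 12 := by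
    simp only [goodT, sideT, ownT, boundT, Term.holds_and, Term.holds_all, Term.holds_imp, holds_adjT,
      Term.eval_var_one, Term.eval_var_zero, Term.holds_or, Term.holds_eq, Term.eval_get,
      Term.eval_zero, Term.holds_le, Term.eval_add, Term.eval_sum, Term.eval_flag, Term.holds_get,
      Term.eval_mul, Term.eval_up, eval_numT, Term.eval_one, card_filter, Term.eval_lit]
  rw [h1]
  constructor
  · rintro ⟨h2, h3⟩
    refine ⟨h2, fun u hu => ?_⟩
    convert h3 u hu
  · rintro ⟨h2, h3⟩
    refine ⟨h2, fun u hu => ?_⟩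
    convert h3 u hu

/-- The sides `side` are good for the group `a` in the memory `M`. -/
def GoodAt (M : Mem) (n a : ℕ) (side : ℕ → ℕ) : Prop :=
  Good n (M 2 12) (adjP M) (M 12) (boundP M a) a side

theorem goodAt_congr {a : ℕ} {side : ℕ → ℕ} (h0 : M' 0 = M 0) (h2 : M' 2 = M 2)
    (h12 : M' 12 = M 12) (h14 : M' 14 = M 14) : GoodAt M' n a side ↔ GoodAt M n a side := by
  have e1 : adjP M' = adjP M := by funext u v; simp only [adjP, h0, h2]
  have e2 : boundP M' a = boundP M a := by funext v; simp only [boundP, h14, h2]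
  rw [GoodAt, GoodAt, e1, e2, h2, h12]

/-- The search at all prices finds a good separation if the auction gives one. -/
theorem price_loop (hP : Params M n) (h4 : M 3 4 = 0) (e a : ℕ) (Γ : List ℕ) :
    let M' := (Cmd.loop 11 (priceC (.var 2))).run (e :: a :: Γ) M
    (∀ b, b ≠ 3 → b ≠ 15 → M' b = M b) ∧ (∀ j, j ≠ 4 → M' 3 j = M 3 j) ∧
      (M' 3 4 ≠ 0 → GoodAt M n a (M' 15)) ∧
      (M' 3 4 = 0 → ∀ θ < n + 2, ¬ GoodAt M n a (auctionSide (M 13) (M 10) (M 11) θ)) := by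
  have := Cmd.loop_induct (i := 11) (c := priceC (.var 2)) (Γ := e :: a :: Γ) (M := M)
    (fun t M' => (∀ b, b ≠ 3 → b ≠ 15 → M' b = M b) ∧ (∀ j, j ≠ 4 → M' 3 j = M 3 j) ∧
      (M' 3 4 ≠ 0 → GoodAt M n a (M' 15)) ∧
      (M' 3 4 = 0 → ∀ θ < t, ¬ GoodAt M n a (auctionSide (M 13) (M 10) (M 11) θ)))
    ⟨fun _ _ _ => rfl, fun _ _ => rfl, fun h => absurd h4 h, fun _ θ hθ =>
      absurd hθ (Nat.not_lt_zero _)⟩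
    (by
      rintro θ M' - ⟨h1, h2, h3, h5⟩
      rw [priceC, Cmd.run_ite]
      by_cases h6 : M' 3 4 = 0
      swap
      · rw [if_pos (by exact h6)]
        exact ⟨h1, h2, h3, fun h => absurd h h6⟩
      rw [if_neg (fun h => h h6), Cmd.run_seq]
      have e2 := h1 2 (by decide) (by decide)
      have hL : n + 2 < M' 2 0 := by rw [e2]; exact hP.lim
      rw [Cmd.run_fill_of_not_reads (by decide) rfl (by
        intro v _
        simp only [newSideT, Term.eval_ite, Term.eval_zero, Term.eval_one, Term.eval_two]
        split_ifs <;> omega)]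
      set M₁ := M'.fill 15 (M' 2 5)
        (fun v => (newSideT (.var 1) (.var 0)).eval M' (v :: θ :: e :: a :: Γ)) with hM₁
      have hb : ∀ b, b ≠ 15 → M₁ b = M' b := fun b hb => Mem.fill_of_ne _ hb
      have e5 : M' 2 5 = n := by rw [e2, hP.num]
      have hside : ∀ v < n, M₁ 15 v = auctionSide (M 13) (M 10) (M 11) θ v := by
        intro v hv
        rw [hM₁, Mem.fill_same, if_pos (by rwa [e5]), auctionSide]
        simp only [newSideT, Term.eval_ite, Term.holds_or, Term.holds_and, Term.holds_not,
          Term.holds_eq, Term.holds_le, Term.holds_lt, Term.eval_get, Term.eval_sub,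
          Term.eval_var_zero, Term.eval_var_one, Term.eval_zero, Term.eval_one, Term.eval_two,
          h1 13 (by decide) (by decide), h1 10 (by decide) (by decide),
          h1 11 (by decide) (by decide)]
      have hb' : ∀ b, b ≠ 3 → b ≠ 15 → M₁ b = M b := fun b h h' => by rw [hb b h', h1 b h h']
      have hgood : (goodT (.var 2)).holds M₁ (θ :: e :: a :: Γ) ↔ GoodAt M n a (M₁ 15) := by
        rw [holds_goodT (by rw [hb 2 (by decide), e5]), Term.eval_var_two]
        exact goodAt_congr (hb' 0 (by decide) (by decide)) (hb' 2 (by decide) (by decide))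
          (hb' 12 (by decide) (by decide)) (hb' 14 (by decide) (by decide))
      rw [Cmd.run_ite]
      by_cases h7 : GoodAt M n a (M₁ 15)
      · rw [if_pos (hgood.2 h7), run_put]
        have h34 : ∀ j, M₁.set 3 4 (1 % M₁ 2 0) 3 j = if j = 4 then 1 else M 3 j := by
          intro j
          rw [Mem.set_same, Nat.mod_eq_of_lt (by rw [hb 2 (by decide)]; omega)]
          split_ifs with h8
          · rfl
          · rw [hb 3 (by decide), h2 j h8]
        refine ⟨fun b h h' => ?_, fun j hj => (h34 j).trans (if_neg hj), fun _ => ?_, fun h => ?_⟩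
        · rw [Mem.set_of_ne _ h, hb' b h h']
        · rw [Mem.set_of_ne _ (by decide)]; exact h7
        · have := h34 4
          rw [if_pos rfl] at this
          exact absurd (this.symm.trans h) one_ne_zero
      · rw [if_neg (mt hgood.1 h7)]
        show (∀ b, _ → _ → M₁ b = M b) ∧ (∀ j, _ → M₁ 3 j = M 3 j) ∧ (M₁ 3 4 ≠ 0 → _) ∧
          (M₁ 3 4 = 0 → _)
        rw [hb 3 (by decide)]
        refine ⟨hb', h2, fun h => absurd h6 h, fun _ θ' hθ' => ?_⟩
        rcases Nat.lt_succ_iff_lt_or_eq.1 hθ' with h8 | rfl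
        · exact h5 h6 θ' h8
        · exact fun h9 => h7 (h9.congr hside))
  rw [hP.prices] at this
  exact this

/-- The search with all labelings finds a good separation if the auction gives one for some
labeling. -/
theorem label_loop (hP : Params M n) (h4 : M 3 4 = 0) (a : ℕ) (Γ : List ℕ) :
    let M' := (Cmd.loop 1 labelC).run (a :: Γ) M
    (∀ b, b ≠ 3 → b ≠ 10 → b ≠ 11 → b ≠ 13 → b ≠ 15 → M' b = M b) ∧
      (∀ j, j ≠ 4 → M' 3 j = M 3 j) ∧ (M' 3 4 ≠ 0 → GoodAt M n a (M' 15)) ∧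
      (M' 3 4 = 0 → ∀ e < 3 ^ M 2 12, ∃ p l,
        Auction.Inv n (Auction.Wants n (adjP M) (fun v => label n (boundP M a) e v = 1)
          fun v => label n (boundP M a) e v = 2) p l ∧
        (∀ u v, ¬ Auction.Enabled n (Auction.Wants n (adjP M)
          (fun v => label n (boundP M a) e v = 1) fun v => label n (boundP M a) e v = 2) p l u v) ∧
        ∀ θ < n + 2, ¬ GoodAt M n a (auctionSide (label n (boundP M a) e) p l θ)) := by
  have := Cmd.loop_induct (i := 1) (c := labelC) (Γ := a :: Γ) (M := M)
    (fun t M' => (∀ b, b ≠ 3 → b ≠ 10 → b ≠ 11 → b ≠ 13 → b ≠ 15 → M' b = M b) ∧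
      (∀ j, j ≠ 4 → M' 3 j = M 3 j) ∧ (M' 3 4 ≠ 0 → GoodAt M n a (M' 15)) ∧
      (M' 3 4 = 0 → ∀ e < t, ∃ p l,
        Auction.Inv n (Auction.Wants n (adjP M) (fun v => label n (boundP M a) e v = 1)
          fun v => label n (boundP M a) e v = 2) p l ∧
        (∀ u v, ¬ Auction.Enabled n (Auction.Wants n (adjP M)
          (fun v => label n (boundP M a) e v = 1) fun v => label n (boundP M a) e v = 2) p l u v) ∧
        ∀ θ < n + 2, ¬ GoodAt M n a (auctionSide (label n (boundP M a) e) p l θ)))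
    ⟨fun _ _ _ _ _ _ => rfl, fun _ _ => rfl, fun h => absurd h4 h, fun _ θ hθ =>
      absurd hθ (Nat.not_lt_zero _)⟩
    (by
      rintro e M' - ⟨h1, h2, h3, h5⟩
      rw [labelC, Cmd.run_ite]
      by_cases h6 : M' 3 4 = 0
      swap
      · rw [if_pos (by exact h6)]
        exact ⟨h1, h2, h3, fun h => absurd h h6⟩
      rw [if_neg (fun h => h h6), Cmd.run_seq, Cmd.run_seq]
      have e2 := h1 2 (by decide) (by decide) (by decide) (by decide) (by decide)
      have e14 := h1 14 (by decide) (by decide) (by decide) (by decide) (by decide)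
      have hP' : Params M' n := hP.congr e2
      have hval : ∀ v, (labelT (.var 2) (.var 1) (.var 0)).eval M' (v :: e :: a :: Γ) =
          label n (boundP M a) e v := by
        classical
        intro v
        simp only [labelT, boundBaseT, boundT, Term.eval_mod, Term.eval_div, Term.eval_var_one,
          Term.eval_prod, Term.eval_ite, Term.holds_lt, Term.eval_var_zero, Term.eval_up,
          Term.holds_get, Term.eval_add, Term.eval_mul, Term.eval_var_two, eval_numT, Term.eval_lit,
          Term.eval_one, e14, boundP, label, hP'.num, hP.num]
      rw [Cmd.run_fill_of_not_reads (by decide) rfl (by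
        intro v _
        rw [hval, label]
        refine (Nat.mod_lt _ (by split_ifs <;> omega)).trans_le ?_
        have := hP'.lim
        split_ifs <;> omega)]
      set M₁ := M'.fill 13 (M' 2 5)
        (fun v => (labelT (.var 2) (.var 1) (.var 0)).eval M' (v :: e :: a :: Γ)) with hM₁
      have hb : ∀ b, b ≠ 13 → M₁ b = M' b := fun b hb => Mem.fill_of_ne _ hb
      have hlab : ∀ v < n, M₁ 13 v = label n (boundP M a) e v := fun v hv => by
        rw [hM₁, Mem.fill_same, if_pos (by rwa [hP'.num]), hval]
      have hP₁ : Params M₁ n := hP'.congr (hb 2 (by decide))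
      obtain ⟨h7, h8⟩ := Auction.auctionC_spec hP₁.toParams (e :: a :: Γ)
      set M₂ := Auction.auctionC.run (e :: a :: Γ) M₁ with hM₂
      have hP₂ : Params M₂ n := hP₁.congr (h7.frame 2 (by decide) (by decide))
      have h34 : M₂ 3 4 = 0 := by
        rw [h7.frame 3 (by decide) (by decide), hb 3 (by decide), h6]
      obtain ⟨h9, h10, h11, h12⟩ := price_loop hP₂ h34 e a Γ
      set M₃ := (Cmd.loop 11 (priceC (.var 2))).run (e :: a :: Γ) M₂ with hM₃
      have hb2 : ∀ b, b ≠ 3 → b ≠ 10 → b ≠ 11 → b ≠ 13 → b ≠ 15 → M₂ b = M b := by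
        intro b b3 b10 b11 b13 b15
        rw [h7.frame b b10 b11, hb b b13, h1 b b3 b10 b11 b13 b15]
      have hgood : ∀ side, GoodAt M₂ n a side ↔ GoodAt M n a side := fun side =>
        goodAt_congr (hb2 0 (by decide) (by decide) (by decide) (by decide) (by decide))
          (hb2 2 (by decide) (by decide) (by decide) (by decide) (by decide))
          (hb2 12 (by decide) (by decide) (by decide) (by decide) (by decide))
          (hb2 14 (by decide) (by decide) (by decide) (by decide) (by decide))
      refine ⟨fun b b3 b10 b11 b13 b15 => by rw [h9 b b3 b15, hb2 b b3 b10 b11 b13 b15],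
        fun j hj => by rw [h10 j hj, h7.frame 3 (by decide) (by decide), hb 3 (by decide), h2 j hj],
        fun h => (hgood _).1 (h11 h), fun h e' he' => ?_⟩
      rcases Nat.lt_succ_iff_lt_or_eq.1 he' with h13 | rfl
      · exact h5 h6 e' h13
      · have hW : Auction.Graph M₁ n = Auction.Wants n (adjP M)
            (fun v => label n (boundP M a) e' v = 1) fun v => label n (boundP M a) e' v = 2 := by
          funext u v
          have e0 := h1 0 (by decide) (by decide) (by decide) (by decide) (by decide)
          simp only [Auction.Graph, Auction.Wants, adjP, hb 0 (by decide), hb 2 (by decide), e0, e2]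
          refine propext (and_congr_right fun hu => and_congr_right fun hv => ?_)
          rw [hlab u hu, hlab v hv]
        refine ⟨M₂ 10, M₂ 11, hW ▸ h7.inv, fun u v => hW ▸ h8 u v, fun θ hθ hg => ?_⟩
        refine h12 h θ hθ ((hgood _).2 (hg.congr fun v hv => ?_))
        simp only [auctionSide, h7.frame 13 (by decide) (by decide), hlab v hv])
  rw [hP.labels] at this
  exact this

end Build

namespace Build

open Finset ConcSched.Core

/-- The least number with a property, as a sum. -/
theorem sum_least {n w : ℕ} {P : ℕ → Prop} [DecidablePred P] (hw : w < n) (hP : P w) :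
    P (∑ v ∈ range n, if ∀ v' < n, v' ≤ v → ¬ P v' then 1 else 0) ∧
      ∑ v ∈ range n, (if ∀ v' < n, v' ≤ v → ¬ P v' then 1 else 0) ≤ w := by
  have hex : ∃ v, P v := ⟨w, hP⟩
  have h1 : ∑ v ∈ range n, (if ∀ v' < n, v' ≤ v → ¬ P v' then 1 else 0) = Nat.find hex := by
    rw [← card_filter, show (range n).filter (fun v => ∀ v' < n, v' ≤ v → ¬ P v') =
      range (Nat.find hex) from ?_, card_range]
    ext v
    rw [mem_filter, mem_range, mem_range, Nat.lt_find_iff]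
    constructor
    · rintro ⟨h1, h2⟩ v' hv'
      exact h2 v' (hv'.trans_lt h1) hv'
    · intro h
      refine ⟨?_, fun v' _ hv' => h v' hv'⟩
      by_contra h1
      exact h w (by omega) hP
  rw [h1]
  exact ⟨Nat.find_spec hex, Nat.find_le hP⟩

/-- The least vertex in the same part of the group of `a` as `v`. -/
def least (n : ℕ) (own side : ℕ → ℕ) (a v : ℕ) : ℕ :=
  ∑ w ∈ range n, if ∀ v' < n, v' ≤ w → ¬ (Moves own side a v' ∧ side v' = side v) then 1 else 0

variable {M M' : Mem} {n : ℕ}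

/-- The memory after a group has been divided satisfies the hypotheses of `Inv.step`. -/
theorem splitC_spec (hP : Params M n) {a : ℕ} (han : a < n) (hle : ∀ v < n, M 12 v ≤ v)
    (Γ : List ℕ) :
    let M' := splitC.run (a :: Γ) M
    (∀ b, b ≠ 5 → b ≠ 12 → b ≠ 14 → b ≠ 16 → M' b = M b) ∧
    Regroup n a (M 12) (M 15) (M' 12) ∧
    (∀ v < n, (bagP M' a v ↔ boundP M a v ∨ v = a ∨ (M 12 v = a ∧ M 15 v = 0))) ∧
    (∀ x < n + 1, x ≠ a → ∀ v < n, (bagP M' x v ↔ bagP M x v)) ∧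
    (∀ b < n, M 12 b = a → M' 12 b = b → b ≠ a → ∀ v < n,
      (boundP M' b v ↔ bagP M' a v ∧ (M 15 v = 0 ∨ M 15 v = M 15 b))) ∧
    (∀ b < n, M 12 b ≠ a → ∀ v < n, (boundP M' b v ↔ boundP M b v)) := by
  intro M'
  have hL := hP.lim
  have hn := hP.num
  have hM' : M' = splitC.run (a :: Γ) M := rfl
  rw [splitC, Cmd.run_seq, Cmd.run_seq, Cmd.run_seq] at hM'
  rw [Cmd.run_fill (b := 5) (i := 10) (by decide)
    (fun j => (Term.flag (.ite ((Term.var 0 / numT).eq (.var 1))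
      ((boundT (.var 1) (.var 0 % numT)).or (((Term.var 0 % numT).eq (.var 1)).or
        (((ownT (.var 0 % numT)).eq (.var 1)).and ((sideT (.var 0 % numT)).eq 0))))
      (.get 5 (.var 0)))).eval M (j :: a :: Γ))
    (by
      intro j _ M'' h1 h2
      simp only [boundT, ownT, sideT, Term.eval_flag, Term.holds_ite, Term.holds_eq, Term.holds_or,
        Term.holds_and, Term.holds_get, Term.eval_get, Term.eval_add, Term.eval_mul, Term.eval_div,
        Term.eval_mod, Term.eval_var_zero, Term.eval_var_one, eval_numT, Term.eval_zero,
        h1 2 (by decide), h1 14 (by decide), h1 12 (by decide), h1 15 (by decide), h2])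
    (by
      intro j _
      rw [Term.eval_flag]
      exact flag_lt (by omega))] at hM'
  set M₁ := M.fill 5 (M 2 10) (fun j => (Term.flag (.ite ((Term.var 0 / numT).eq (.var 1))
      ((boundT (.var 1) (.var 0 % numT)).or (((Term.var 0 % numT).eq (.var 1)).or
        (((ownT (.var 0 % numT)).eq (.var 1)).and ((sideT (.var 0 % numT)).eq 0))))
      (.get 5 (.var 0)))).eval M (j :: a :: Γ)) with hM₁
  have b1 : ∀ b, b ≠ 5 → M₁ b = M b := fun b hb => Mem.fill_of_ne _ hb
  have f2 := b1 2 (by decide)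
  have f12 := b1 12 (by decide)
  have f15 := b1 15 (by decide)
  have hnew : ∀ v < n, (Term.ite (movesT (.var 1) (.var 0)) (leastT (.var 1) (.var 0))
      (ownT (.var 0))).eval M₁ (v :: a :: Γ) = if Moves (M 12) (M 15) a v then
        least n (M 12) (M 15) a v else M 12 v := by
    intro v _
    simp only [movesT, leastT, ownT, sideT, Term.eval_ite, Term.holds_and, Term.holds_eq,
      Term.holds_not, Term.holds_le, Term.holds_all, Term.holds_imp, Term.eval_sum, Term.eval_flag,
      Term.eval_get, Term.eval_var_zero, Term.eval_var_one, Term.eval_zero, Term.eval_up, f2, f12,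
      f15, hn, least, Moves, ne_eq]
    congr
  have hleast : ∀ v < n, Moves (M 12) (M 15) a v →
      Moves (M 12) (M 15) a (least n (M 12) (M 15) a v) ∧
      M 15 (least n (M 12) (M 15) a v) = M 15 v ∧ least n (M 12) (M 15) a v ≤ v := by
    intro v hv hm
    have := sum_least (P := fun v' => Moves (M 12) (M 15) a v' ∧ M 15 v' = M 15 v) hv ⟨hm, rfl⟩
    exact ⟨this.1.1, this.1.2, this.2⟩
  rw [Cmd.run_fill_of_not_reads (b := 16) (i := 5) (by decide) rfl (by
    intro v hv
    rw [f2, hn] at hv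
    rw [hnew v hv, f2]
    split_ifs with h1
    · have := (hleast v hv h1).2.2; omega
    · have := hle v hv; omega)] at hM'
  set M₂ := M₁.fill 16 (M₁ 2 5) (fun v => (Term.ite (movesT (.var 1) (.var 0))
    (leastT (.var 1) (.var 0)) (ownT (.var 0))).eval M₁ (v :: a :: Γ)) with hM₂
  have b2 : ∀ b, b ≠ 16 → M₂ b = M₁ b := fun b hb => Mem.fill_of_ne _ hb
  have g2 : M₂ 2 = M 2 := by rw [b2 2 (by decide), f2]
  have g16 : ∀ v < n, M₂ 16 v = if Moves (M 12) (M 15) a v then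
        least n (M 12) (M 15) a v else M 12 v := fun v hv => by
    rw [hM₂, Mem.fill_same, f2, hn, if_pos hv, hnew v hv]
  rw [Cmd.run_fill (b := 14) (i := 9) (by decide)
    (fun j => (Term.flag (.ite
      (((ownT (.var 0 / numT)).eq (.var 1)).and (((Term.get 16 (.var 0 / numT)).eq (.var 0 / numT)).and
        ((Term.var 0 / numT).eq (.var 1)).not))
      ((bagT (.var 1) (.var 0 % numT)).and (((sideT (.var 0 % numT)).eq 0).or
        ((sideT (.var 0 % numT)).eq (sideT (.var 0 / numT)))))
      (.get 14 (.var 0)))).eval M₂ (j :: a :: Γ))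
    (by
      intro j _ M'' h1 h2
      simp only [ownT, sideT, Term.eval_flag, Term.holds_ite, Term.holds_eq, Term.holds_or,
        Term.holds_and, Term.holds_get, Term.eval_get, holds_bagT, bagP, Term.eval_div,
        Term.eval_mod, Term.eval_var_zero, Term.eval_var_one, eval_numT, Term.eval_zero, Term.holds_not,
        h1 2 (by decide), h1 5 (by decide), h1 12 (by decide), h1 15 (by decide), h1 16 (by decide),
        h2])
    (by
      intro j _
      rw [Term.eval_flag, g2]
      exact flag_lt (by omega))] at hM'
  set M₃ := M₂.fill 14 (M₂ 2 9) (fun j => (Term.flag (.ite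
      (((ownT (.var 0 / numT)).eq (.var 1)).and (((Term.get 16 (.var 0 / numT)).eq (.var 0 / numT)).and
        ((Term.var 0 / numT).eq (.var 1)).not))
      ((bagT (.var 1) (.var 0 % numT)).and (((sideT (.var 0 % numT)).eq 0).or
        ((sideT (.var 0 % numT)).eq (sideT (.var 0 / numT)))))
      (.get 14 (.var 0)))).eval M₂ (j :: a :: Γ)) with hM₃
  have b3 : ∀ b, b ≠ 14 → M₃ b = M₂ b := fun b hb => Mem.fill_of_ne _ hb
  have hnew' : ∀ v < n, M₃ 16 v ≤ v := by
    intro v hv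
    rw [b3 16 (by decide), g16 v hv]
    split_ifs with h1
    · exact (hleast v hv h1).2.2
    · exact hle v hv
  rw [Cmd.run_fill_of_not_reads (b := 12) (i := 5) (by decide) rfl (by
    intro v hv
    rw [b3 2 (by decide), g2, hn] at hv
    rw [Term.eval_get, Term.eval_var_zero, b3 2 (by decide), g2]
    have := hnew' v hv
    omega)] at hM'
  have b4 : ∀ b, b ≠ 12 → M' b = M₃ b := fun b hb => by rw [hM', Mem.fill_of_ne _ hb]
  have hown : ∀ v < n, M' 12 v = M₂ 16 v := fun v hv => by
    rw [hM', Mem.fill_same, if_pos (by rwa [b3 2 (by decide), g2, hn]), Term.eval_get,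
      Term.eval_var_zero, b3 16 (by decide)]
  have hb2 : M' 2 = M 2 := by rw [b4 2 (by decide), b3 2 (by decide), g2]
  have hb5 : M' 5 = M₁ 5 := by rw [b4 5 (by decide), b3 5 (by decide), b2 5 (by decide)]
  have hbag : ∀ x < n + 1, ∀ v < n, (bagP M' x v ↔ if x = a then (boundP M a v ∨ v = a ∨
      (M 12 v = a ∧ M 15 v = 0)) else bagP M x v) := by
    intro x hx v hv
    have h1 : x * n + v < M 2 10 := by rw [hP.cells]; exact index_lt hx hv
    simp only [bagP, hb5, hb2, hn, hM₁, Mem.fill_same, h1, if_true, Term.eval_flag, Term.holds_ite,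
      Term.holds_eq, Term.eval_div, Term.eval_mod, Term.eval_var_zero, Term.eval_var_one, eval_numT,
      index_div hv, index_mod hv, boundT, ownT, sideT, Term.holds_or, Term.holds_and,
      Term.holds_get, Term.eval_get, Term.eval_add, Term.eval_mul, Term.eval_zero, boundP,
      flag_ne_zero]
  have hbound : ∀ b < n, ∀ v < n, (boundP M' b v ↔ if M 12 b = a ∧ M' 12 b = b ∧ b ≠ a then
      (bagP M' a v ∧ (M 15 v = 0 ∨ M 15 v = M 15 b)) else boundP M b v) := by
    intro b hb v hv
    have h1 : b * n + v < M 2 9 := by rw [hP.pairs]; exact index_lt hb hv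
    have e12 : M₂ 12 = M 12 := by rw [b2 12 (by decide), f12]
    have e15 : M₂ 15 = M 15 := by rw [b2 15 (by decide), f15]
    have e5 : M₂ 5 = M' 5 := by rw [b2 5 (by decide), hb5]
    have e14 : M₂ 14 = M 14 := by rw [b2 14 (by decide), b1 14 (by decide)]
    have e16 := hown b hb
    simp only [boundP, b4 14 (by decide), hb2, hn, hM₃, Mem.fill_same, g2, h1, if_true,
      Term.eval_flag, Term.holds_ite, Term.holds_and, Term.holds_eq, Term.holds_not, Term.holds_or,
      Term.eval_div, Term.eval_mod, Term.eval_var_zero, Term.eval_var_one, eval_numT, index_div hv,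
      index_mod hv, ownT, sideT, Term.eval_get, Term.holds_get, holds_bagT, bagP, Term.eval_zero, e12,
      e15, e5, e14, ← e16, flag_ne_zero, ne_eq]
  refine ⟨fun b h5 h12 h14 h16 => by rw [b4 b h12, b3 b h14, b2 b h16, b1 b h5], ?_, ?_, ?_, ?_, ?_⟩
  · have key : ∀ v < n, Moves (M 12) (M 15) a v → Moves (M 12) (M 15) a (M' 12 v) ∧
        M 15 (M' 12 v) = M 15 v ∧ M' 12 v ≤ v := by
      intro v hv hm
      rw [hown v hv, g16 v hv, if_pos hm]
      exact hleast v hv hm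
    refine ⟨fun u hu hm => (key u hu hm).2.2, fun u hu hm => ⟨(key u hu hm).1, (key u hu hm).2.1⟩,
      fun u hu v hv hmu hmv huv => ?_, fun u hu hm => ?_⟩
    · rw [hown u hu, g16 u hu, if_pos hmu, hown v hv, g16 v hv, if_pos hmv, least, least,
        huv]
    · rw [hown u hu, g16 u hu, if_neg hm]
  · intro v hv
    rw [hbag a (by omega) v hv, if_pos rfl]
  · intro x hx hxa v hv
    rw [hbag x hx v hv, if_neg hxa]
  · intro b hb h1 h2 h3 v hv
    rw [hbound b hb v hv, if_pos ⟨h1, h2, h3⟩]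
  · intro b hb h1 v hv
    rw [hbound b hb v hv, if_neg fun h => h1 h.1]

/-- The memory `M'` when the nodes below `a` are done, in a construction that was started with the
memory `M`. -/
structure Progress (M : Mem) (n a : ℕ) (M' : Mem) : Prop where
  frame : ∀ b, b ≠ 3 → b ≠ 5 → (b < 10 ∨ 16 < b) → M' b = M b
  cells : ∀ j, j ≠ 3 → j ≠ 4 → M' 3 j = M 3 j
  inv : M' 3 3 = 0 → ∃ par, Inv n (M 2 12) (adjP M) a (M' 12) (boundP M') (bagP M') par

/-- The graph has treewidth at most `k`, where `3 * k + 4` is the bound for the boundaries. -/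
def Narrow (M : Mem) (n : ℕ) : Prop :=
  ∃ (k m : ℕ) (bag tree : ℕ → ℕ → Prop) (_ : RootedDec n m (adjP M) bag tree), M 2 12 = 3 * k + 4 ∧
    ∀ x < m, (@filter _ (bag x) (Classical.decPred _) (range n)).card ≤ k + 1

/-- If the graph has small treewidth, then the construction does not fail at a node. -/
theorem nodeC_spec (hP : Params M n) (hsymm : ∀ u < n, ∀ v < n, adjP M u v → adjP M v u)
    {a : ℕ} (han : a < n) (h : Progress M n a M') (Γ : List ℕ) :
    Progress M n (a + 1) (nodeC.run (a :: Γ) M') ∧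
      (Narrow M n → M' 3 3 = 0 → nodeC.run (a :: Γ) M' 3 3 = 0) := by
  have e2 := h.frame 2 (by decide) (by decide) (by decide)
  have e0 := h.frame 0 (by decide) (by decide) (by decide)
  have eadj : adjP M' = adjP M := by funext u v; simp only [adjP, e0, e2]
  rw [nodeC, Cmd.run_ite]
  by_cases hskip : M' 3 3 = 0 ∧ M' 12 a = a
  swap
  · rw [if_pos (by
      simp only [ownT, Term.holds_or, Term.holds_get, Term.holds_not, Term.holds_eq, Term.eval_get,
        Term.eval_var_zero]
      by_cases h1 : M' 3 3 = 0
      · exact .inr fun h2 => hskip ⟨h1, h2⟩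
      · exact .inl h1)]
    refine ⟨⟨h.frame, h.cells, fun h1 => ?_⟩, fun _ h1 => h1⟩
    obtain ⟨par, hinv⟩ := h.inv h1
    exact ⟨par, hinv.skip fun h2 => hskip ⟨h1, h2⟩⟩
  obtain ⟨h33, haa⟩ := hskip
  rw [if_neg (by
    simp only [ownT, Term.holds_or, Term.holds_get, Term.holds_not, Term.holds_eq, Term.eval_get,
      Term.eval_var_zero, haa, not_true_eq_false, or_false]
    exact fun h => h h33), Cmd.run_seq, Cmd.run_seq, Cmd.run_ite, run_put]
  obtain ⟨par, hinv⟩ := h.inv h33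
  set M₁ := M'.set 3 ((4 : Term).eval M' (a :: Γ)) ((0 : Term).eval M' (a :: Γ) % M' 2 0) with hM₁
  have b1 : ∀ b, b ≠ 3 → M₁ b = M' b := fun b hb => Mem.set_of_ne _ hb
  have hP₁ : Params M₁ n := hP.congr (by rw [b1 2 (by decide), e2])
  have h34 : ∀ j, M₁ 3 j = if j = 4 then 0 else M' 3 j := by
    intro j
    rw [hM₁, Mem.set_same, Term.eval_zero, Nat.zero_mod]
    rfl
  obtain ⟨h1, h2, h3, h4⟩ := label_loop hP₁ (by rw [h34, if_pos rfl]) a Γ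
  set M₂ := (Cmd.loop 1 labelC).run (a :: Γ) M₁ with hM₂
  have g2 : M₁ 2 = M 2 := by rw [b1 2 (by decide), e2]
  have g0 : M₁ 0 = M 0 := by rw [b1 0 (by decide), e0]
  have ga : adjP M₁ = adjP M := by funext u v; simp only [adjP, g0, g2]
  have gb : boundP M₁ = boundP M' := by
    funext b v; simp only [boundP, b1 14 (by decide), b1 2 (by decide)]
  have gg : ∀ side, GoodAt M₁ n a side ↔ Good n (M 2 12) (adjP M) (M' 12) (boundP M' a) a side := by
    intro side
    rw [GoodAt, ga, gb, g2, b1 12 (by decide)]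
  have hcell : ∀ j, j ≠ 3 → j ≠ 4 → M₂ 3 j = M 3 j := fun j h5 h6 => by
    rw [h2 j h6, h34, if_neg h6, h.cells j h5 h6]
  have b2 : ∀ b, b ≠ 3 → b ≠ 10 → b ≠ 11 → b ≠ 13 → b ≠ 15 → M₂ b = M' b :=
    fun b b3 b10 b11 b13 b15 => by rw [h1 b b3 b10 b11 b13 b15, b1 b b3]
  have hframe : ∀ b, b ≠ 3 → b ≠ 5 → (b < 10 ∨ 16 < b) → M₂ b = M b := fun b b3 b5 hb => by
    rw [b2 b b3 (by omega) (by omega) (by omega) (by omega), h.frame b b3 b5 hb]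
  have k2 := hframe 2 (by decide) (by decide) (by decide)
  by_cases hfound : M₂ 3 4 = 0
  · rw [if_neg (fun h => h hfound), run_put]
    have h33' : M₂.set 3 ((3 : Term).eval M₂ (a :: Γ)) ((1 : Term).eval M₂ (a :: Γ) % M₂ 2 0) 3 3
        = 1 := by
      rw [Mem.set_same, if_pos (show 3 = (3 : Term).eval M₂ (a :: Γ) from rfl), Term.eval_one, k2,
        Nat.mod_eq_of_lt (by have := hP.lim; omega)]
    refine ⟨⟨fun b b3 b5 hb => by rw [Mem.set_of_ne _ b3, hframe b b3 b5 hb], fun j j3 j4 => ?_,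
      fun h5 => ?_⟩, fun hN _ => ?_⟩
    · rw [Mem.set_same, if_neg (by exact j3), hcell j j3 j4]
    · rw [h33'] at h5
      exact absurd h5 one_ne_zero
    · exfalso
      obtain ⟨k, m, bag, tree, D, hk, hw⟩ := hN
      obtain ⟨e, he, hgood⟩ := exists_label (own := M' 12) (W := boundP M' a) (a := a) hsymm D hw
        (by
          have := hinv.bound_card a han le_rfl haa
          rw [hk] at this
          convert this)
        (fun v hv hva hvW => by
          have := (hinv.bound a han le_rfl haa v hv hvW).1
          omega)
      obtain ⟨p, l, h5, h6, h7⟩ := h4 hfound e (by rw [g2, hk]; exact he)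
      rw [ga, gb] at h5 h6
      obtain ⟨θ, h8, h9⟩ := hgood p l h5 h6
      refine h7 θ h8 ((gg _).2 ?_)
      rw [hk, gb]
      exact h9
  · rw [if_pos (by exact hfound)]
    have hg := (gg _).1 (h3 hfound)
    have hP₂ : Params M₂ n := hP.congr k2
    have q12 : M₂ 12 = M' 12 :=
      b2 12 (by decide) (by decide) (by decide) (by decide) (by decide)
    have qb : boundP M₂ = boundP M' := by
      funext b v
      simp only [boundP, k2, e2, b2 14 (by decide) (by decide) (by decide) (by decide) (by decide)]
    have qbag : bagP M₂ = bagP M' := by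
      funext b v
      simp only [bagP, k2, e2, b2 5 (by decide) (by decide) (by decide) (by decide) (by decide)]
    obtain ⟨c1, c2, c3, c4, c5, c6⟩ := splitC_spec hP₂ han (by rw [q12]; exact hinv.own_le) Γ
    rw [q12] at c2 c3 c5 c6
    rw [qb] at c3 c6
    rw [qbag] at c4
    set M₃ := splitC.run (a :: Γ) M₂ with hM₃
    have h3eq : M₃ 3 = M₂ 3 := c1 3 (by decide) (by decide) (by decide) (by decide)
    have h33' : M₃ 3 3 = 0 := by
      rw [h3eq, h2 3 (by decide), h34, if_neg (by decide), h33]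
    refine ⟨⟨fun b b3 b5 hb => ?_, fun j j3 j4 => ?_, fun _ => ?_⟩, fun _ _ => h33'⟩
    · rw [c1 b b5 (by omega) (by omega) (by omega), hframe b b3 b5 hb]
    · rw [h3eq, hcell j j3 j4]
    · exact hinv.step hsymm han haa hg c2 c3 c4 c5 c6

/-- The construction ends with a tree decomposition or fails; it does not fail if the graph has small
treewidth. -/
theorem buildC_spec (hP : Params M n) (hsymm : ∀ u < n, ∀ v < n, adjP M u v → adjP M v u)
    (Γ : List ℕ) :
    Progress M n n (buildC.run Γ M) ∧ (Narrow M n → buildC.run Γ M 3 3 = 0) := by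
  have hL := hP.lim
  rw [buildC, Cmd.run_seq, Cmd.run_seq, Cmd.run_seq, Cmd.run_seq]
  rw [Cmd.run_fill_of_not_reads (b := 12) (i := 5) (e := 0) (by decide) rfl
    (by intro j _; rw [Term.eval_zero]; omega)]
  set M₁ := M.fill 12 (M 2 5) (fun j => (0 : Term).eval M (j :: Γ)) with hM₁
  have e1 : M₁ 2 = M 2 := Mem.fill_of_ne _ (by decide)
  rw [Cmd.run_fill_of_not_reads (b := 14) (i := 9) (e := 0) (by decide) rfl
    (by intro j _; rw [Term.eval_zero, e1]; omega)]
  set M₂ := M₁.fill 14 (M₁ 2 9) (fun j => (0 : Term).eval M₁ (j :: Γ)) with hM₂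
  have e2 : M₂ 2 = M 2 := by rw [hM₂, Mem.fill_of_ne _ (by decide), e1]
  rw [Cmd.run_fill_of_not_reads (b := 5) (i := 10) (e := 0) (by decide) rfl
    (by intro j _; rw [Term.eval_zero, e2]; omega), run_put]
  set M₃ := M₂.fill 5 (M₂ 2 10) (fun j => (0 : Term).eval M₂ (j :: Γ)) with hM₃
  set M₄ := M₃.set 3 ((3 : Term).eval M₃ Γ) ((0 : Term).eval M₃ Γ % M₃ 2 0) with hM₄
  have hb : ∀ b, b ≠ 3 → b ≠ 5 → b ≠ 12 → b ≠ 14 → M₄ b = M b := fun b b3 b5 b12 b14 => by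
    rw [hM₄, Mem.set_of_ne _ b3, hM₃, Mem.fill_of_ne _ b5, hM₂, Mem.fill_of_ne _ b14, hM₁,
      Mem.fill_of_ne _ b12]
  have h2 := hb 2 (by decide) (by decide) (by decide) (by decide)
  have h33 : ∀ j, M₄ 3 j = if j = 3 then 0 else M 3 j := by
    intro j
    rw [hM₄, Mem.set_same, Term.eval_zero, Nat.zero_mod, hM₃, Mem.fill_of_ne _ (by decide), hM₂,
      Mem.fill_of_ne _ (by decide), hM₁, Mem.fill_of_ne _ (by decide)]
    rfl
  have hstate : Progress M n 0 M₄ := by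
    refine ⟨fun b b3 b5 hb' => hb b b3 b5 (by omega) (by omega), fun j j3 _ => by
      rw [h33, if_neg j3], fun _ => ⟨_, Inv.zero n _ _ ?_ ?_ ?_⟩⟩
    · intro u hu
      rw [hM₄, Mem.set_of_ne _ (by decide), hM₃, Mem.fill_of_ne _ (by decide), hM₂,
        Mem.fill_of_ne _ (by decide), hM₁, Mem.fill_same, hP.num, if_pos hu, Term.eval_zero]
    · intro b hb v hv h
      refine h ?_
      rw [h2, hM₄, Mem.set_of_ne _ (by decide), hM₃, Mem.fill_of_ne _ (by decide), hM₂,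
        Mem.fill_same, e1, hP.pairs, hP.num, if_pos (index_lt hb hv), Term.eval_zero]
    · intro x hx v hv h
      refine h ?_
      rw [h2, hM₄, Mem.set_of_ne _ (by decide), hM₃, Mem.fill_same, e2, hP.cells, hP.num,
        if_pos (index_lt hx hv), Term.eval_zero]
  have := Cmd.loop_induct (i := 5) (c := nodeC) (Γ := Γ) (M := M₄)
    (fun a M' => Progress M n a M' ∧ (Narrow M n → M' 3 3 = 0))
    ⟨hstate, fun _ => by rw [h33, if_pos rfl]⟩
    (by
      rintro a M' ha ⟨g1, g2⟩
      rw [h2, hP.num] at ha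
      obtain ⟨g3, g4⟩ := nodeC_spec hP hsymm ha g1 Γ
      exact ⟨g3, fun hN => g4 hN (g2 hN)⟩)
  rw [h2, hP.num] at this
  exact this

end Build

/-! ### Schedules as colorings -/

open Finset

theorem RootedDec.congr {n m : ℕ} {adj adj' bag bag' tree tree' : ℕ → ℕ → Prop}
    (D : RootedDec n m adj bag tree) (hadj : ∀ u < n, ∀ v < n, adj' u v → adj u v)
    (hbag : ∀ x < m, ∀ v < n, bag' x v ↔ bag x v)
    (htree : ∀ x < m, ∀ y < m, tree x y → tree' x y) : Nonempty (RootedDec n m adj' bag' tree') :=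
  ⟨{ D with
      tree_par := fun x hx h0 => htree _ (D.par_lt x hx h0) x hx (D.tree_par x hx h0)
      top_mem := fun v hv => (hbag _ (D.top_lt v hv) v hv).2 (D.top_mem v hv)
      bag_par := fun x hx v hv h => (D.bag_par x hx v hv ((hbag x hx v hv).1 h)).imp_right
        fun h1 => ⟨h1.1, (hbag _ (D.par_lt x hx h1.1) v hv).2 h1.2⟩
      edge := fun u hu v hv h => by
        obtain ⟨x, hx, h1, h2⟩ := D.edge u hu v hv (hadj u hu v hv h)
        exact ⟨x, hx, (hbag x hx u hu).2 h1, (hbag x hx v hv).2 h2⟩ }⟩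

namespace Core

variable {n : ℕ} {G : SimpleGraph (Fin n)} {r : Fin n → ℕ} {M : Mem} {w : ℕ}

/-- The memory holds the instance. -/
structure Holds (M : Mem) {n : ℕ} (G : SimpleGraph (Fin n)) (r : Fin n → ℕ) : Prop where
  num : M 2 5 = n
  adj : ∀ u v : Fin n, adjP M u v ↔ G.Adj u v
  rel : ∀ v : Fin n, rel M v = r v

theorem Holds.congr {M' : Mem} (h : Holds M G r) (h0 : M' 0 = M 0) (h5 : M' 2 5 = M 2 5) :
    Holds M' G r := by
  obtain ⟨h1, h2, h3⟩ := h
  constructor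
  · rw [h5, h1]
  · simpa only [adjP, h0, h5] using h2
  · simpa only [Core.rel, h0, h5] using h3

theorem Holds.onNat_iff (h : Holds M G r) {u v : ℕ} (hu : u < n) (hv : v < n) :
    onNat G.Adj u v ↔ adjP M u v := by
  rw [h.adj ⟨u, hu⟩ ⟨v, hv⟩]
  exact ⟨fun ⟨_, _, h⟩ => h, fun h => ⟨hu, hv, h⟩⟩

/-- A proper coloring of a graph of small treewidth that has the least total color uses few
colors, so few colors suffice. -/
theorem exists_sol (h : Holds M G r) (hR : Ready M w) (hK : ∀ c, 2 ^ c ≤ n ^ w → c < M 2 7)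
    {T : ℕ} {f : ℕ → ℕ} (hf : ∀ u v : Fin n, G.Adj u v → f u ≠ f v)
    (hT : ∀ v : Fin n, r v + f v + 1 ≤ T) : ∃ g, Sol M T 0 g := by
  obtain ⟨D⟩ := hR.dec
  have hnum := h.num
  obtain ⟨D'⟩ := D.congr (adj' := onNat G.Adj) (bag' := bagP M) (tree' := treeP M)
    (by
      rw [hnum]
      exact fun u hu v hv huv => (h.onNat_iff hu hv).1 huv)
    (fun _ _ _ _ => Iff.rfl) (fun _ _ _ _ h => h)
  have hsymm : ∀ u v, onNat G.Adj u v → onNat G.Adj v u := fun u v ⟨hu, hv, h⟩ => ⟨hv, hu, h.symm⟩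
  have hirr : ∀ v, ¬ onNat G.Adj v v := fun v ⟨_, _, h⟩ => G.loopless.irrefl _ h
  obtain ⟨g, h1, h2, h3⟩ := exists_grundy (n := n) hsymm hirr (f := f)
    (fun u hu v hv ⟨_, _, huv⟩ => hf _ _ huv)
  refine ⟨g, fun v hv => hK _ ?_, fun v hv => ?_, fun _ _ => .inl rfl, fun u hu v hv huv => ?_⟩
  · refine two_pow_color_le hsymm hirr ?_ h3 (by rwa [← hnum])
    intro U hU hne
    rw [← hnum] at hU
    convert D'.exists_degree_le (w := w) hirr (fun x hx => by convert hR.ctx.width x hx) U hU hne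
  · rw [hnum] at hv
    have h4 := hT ⟨v, hv⟩
    have h5 := h.rel ⟨v, hv⟩
    have h6 := h2 v
    dsimp only at h4 h5
    omega
  · rw [hnum] at hu hv
    exact h1 u hu v hv ((h.onNat_iff hu hv).2 huv)

/-- Schedules with makespan at most `T` and proper colorings `f` with `r v + f v + 1 ≤ T` correspond to
each other by `C v = T - f v`, so that the search finds an optimal schedule. -/
theorem searchC_optimal (h : Holds M G r) (hR : Ready M w)
    (hK : ∀ c, 2 ^ c ≤ n ^ w → c < M 2 7) (hU : ∑ v, r v + n < M 2 4) (hlim : M 2 4 ≤ M 2 0)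
    (hlim' : M 2 7 < M 2 0) {s : State} (hs : s.bank = searchC.run [] M) :
    IsOptimal G (fun _ => 1) r (output n s) := by
  have hnum := h.num
  obtain ⟨T, f, hf, hmin, hout⟩ := searchC_spec hR hlim hlim'
    ⟨_, hU, exists_sol h hR hK (f := id) (fun u v huv he => G.ne_of_adj huv (Fin.ext he))
      fun v => by
        have h1 := single_le_sum (f := r) (fun _ _ => Nat.zero_le _) (mem_univ v)
        have h2 := v.isLt
        simp only [id]
        omega⟩ []
  have hout' : ∀ v : Fin n, output n s v = T - f v := fun v => by
    rw [output, hs, hout v (by rw [hnum]; exact v.isLt)]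
  have hle : ∀ v : Fin n, r v + f v + 1 ≤ T := fun v => by
    rw [← h.rel v]
    exact hf.le v (by rw [hnum]; exact v.isLt)
  refine ⟨⟨fun v => ?_, fun u v huv => ?_⟩, fun C' hC' => ?_⟩
  · have := hle v
    rw [hout']
    beta_reduce
    omega
  · have h1 := hle u
    have h2 := hle v
    have h3 := hf.ne u (by rw [hnum]; exact u.isLt) v (by rw [hnum]; exact v.isLt)
      ((h.adj u v).2 huv)
    rw [hout', hout', Set.disjoint_left]
    intro x hx hx'
    rw [Set.mem_Ico] at hx hx'
    beta_reduce at hx hx'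
    omega
  · have hT' : ∀ v, C' v ≤ makespan C' := fun v => Finset.le_sup (f := C') (mem_univ v)
    obtain ⟨g, hg⟩ := exists_sol h hR hK (T := makespan C')
      (f := fun v => if hv : v < n then makespan C' - C' ⟨v, hv⟩ else 0)
      (fun u v huv he => by
        simp only [Fin.is_lt, dif_pos, Fin.eta] at he
        have h1 := hC'.2 u v huv
        have h2 := hC'.1 u
        have h3 := hC'.1 v
        have h4 := hT' u
        have h5 := hT' v
        rw [Set.disjoint_left] at h1
        beta_reduce at h1 h2 h3
        refine h1 (a := C' u - 1) ?_ ?_ <;> rw [Set.mem_Ico] <;> omega)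
      (fun v => by
        simp only [Fin.is_lt, dif_pos, Fin.eta]
        have h2 := hC'.1 v
        have h4 := hT' v
        beta_reduce at h2
        omega)
    have h1 := hmin _ _ hg
    refine Finset.sup_le fun v _ => ?_
    rw [hout']
    omega

end Core

/-! ### The input word -/

theorem getD_bitMatrix {a b : ℕ} (R : Fin a → Fin b → Prop) [∀ i j, Decidable (R i j)] (i : Fin a)
    (j : Fin b) : (bitMatrix R).getD (i * b + j) 0 = if R i j then 1 else 0 := by
  classical
  have h1 : bitMatrix R = List.ofFn fun k : Fin (a * b) =>
      if R k.divNat k.modNat then 1 else 0 := by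
    rw [bitMatrix, List.ofFn_mul]
    congr 2
    funext i
    congr 1
    funext j
    have e1 : (⟨i * b + j, by
      calc i * b + j < (i + 1) * b := by rw [add_mul]; omega
        _ ≤ a * b := Nat.mul_le_mul_right _ i.isLt⟩ : Fin (a * b)).divNat = i := by
      apply Fin.ext
      simp only [Fin.coe_divNat]
      exact Core.index_div j.isLt
    have e2 : (⟨i * b + j, by
      calc i * b + j < (i + 1) * b := by rw [add_mul]; omega
        _ ≤ a * b := Nat.mul_le_mul_right _ i.isLt⟩ : Fin (a * b)).modNat = j := by
      apply Fin.ext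
      simp only [Fin.coe_modNat]
      exact Core.index_mod j.isLt
    rw [e1, e2]
    congr
  have h2 : (i : ℕ) * b + j < a * b := Core.index_lt i.isLt j.isLt
  rw [h1, List.getD_eq_getElem _ _ (by simpa using h2), List.getElem_ofFn]
  have e1 : (⟨i * b + j, h2⟩ : Fin (a * b)).divNat = i := Fin.ext (Core.index_div j.isLt)
  have e2 : (⟨i * b + j, h2⟩ : Fin (a * b)).modNat = j := Fin.ext (Core.index_mod j.isLt)
  rw [e1, e2]

theorem length_bitMatrix {a b : ℕ} (R : Fin a → Fin b → Prop) : (bitMatrix R).length = a * b := by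
  simp [bitMatrix, List.length_flatten, List.map_ofFn, Function.comp_def]

theorem length_le_unaryLength (l : List ℕ) : l.length ≤ unaryLength l := by
  induction l with
  | nil => simp
  | cons a l ih => simp only [unaryLength, List.map_cons, List.sum_cons, List.length_cons] at *; omega

theorem getD_le_unaryLength (l : List ℕ) (i : ℕ) : l.getD i 0 ≤ unaryLength l := by
  induction l generalizing i with
  | nil => simp
  | cons a l ih =>
    simp only [unaryLength, List.map_cons, List.sum_cons] at *
    cases i with
    | zero => simp only [List.getD_cons_zero]; omega
    | succ i => have := ih i; simp only [List.getD_cons_succ]; omega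

theorem unaryLength_append (l l' : List ℕ) :
    unaryLength (l ++ l') = unaryLength l + unaryLength l' := by
  simp [unaryLength]

theorem unaryLength_eq (l : List ℕ) :
    ∑ i ∈ range l.length, l.getD i 0 + l.length = unaryLength l := by
  induction l with
  | nil => simp [unaryLength]
  | cons a l ih =>
    rw [List.length_cons, sum_range_succ']
    simp only [List.getD_cons_succ, List.getD_cons_zero, unaryLength, List.map_cons,
      List.sum_cons] at *
    omega

section Encoding

variable {n m : ℕ} (G : SimpleGraph (Fin n)) (r : Fin n → ℕ) (l : List ℕ)

theorem length_encodeInstance : (encodeInstance G r).length = 1 + n * n + n := by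
  simp [encodeInstance, length_bitMatrix]; ring

theorem sum_add_lt_unaryLength : ∑ v, r v + n < unaryLength (encodeInstance G r) := by
  have h1 : unaryLength (encodeInstance G r) =
      n + 1 + (unaryLength (bitMatrix G.Adj) + (∑ v, r v + n)) := by
    simp [encodeInstance, unaryLength, List.map_ofFn, Function.comp_def, List.sum_ofFn,
      sum_add_distrib]
  omega

theorem getD_encode_adj [DecidableRel G.Adj] (u v : Fin n) :
    (encodeInstance G r ++ l).getD (1 + u * n + v) 0 = if G.Adj u v then 1 else 0 := by
  rw [← getD_bitMatrix G.Adj, encodeInstance, List.cons_append, List.append_assoc,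
    show 1 + u * n + v = (u * n + v : ℕ) + 1 by ring, List.getD_cons_succ, List.getD_append]
  rw [length_bitMatrix]
  exact Core.index_lt u.isLt v.isLt

theorem getD_encode_rel (v : Fin n) :
    (encodeInstance G r ++ l).getD (1 + n * n + v) 0 = r v := by
  rw [encodeInstance, List.cons_append, List.append_assoc,
    show 1 + n * n + v = (n * n + v : ℕ) + 1 by ring, List.getD_cons_succ,
    List.getD_append_right _ _ _ _ (by rw [length_bitMatrix]; omega), length_bitMatrix,
    Nat.add_sub_cancel_left, List.getD_append _ _ _ _ (by simp),
    List.getD_eq_getElem _ _ (by simp), List.getElem_ofFn]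

theorem getD_encode_append (i : ℕ) :
    (encodeInstance G r ++ l).getD (1 + n * n + n + i) 0 = l.getD i 0 := by
  rw [List.getD_append_right _ _ _ _ (by rw [length_encodeInstance]; omega), length_encodeInstance,
    Nat.add_sub_cancel_left]

variable {G} (D : TreeDecomposition G m)

theorem TreeDecomposition.getD_encode_tree [DecidableRel D.tree.Adj] (x y : Fin m) :
    D.encode.getD (1 + (x * m + y)) 0 = if D.tree.Adj x y then 1 else 0 := by
  rw [← getD_bitMatrix D.tree.Adj, TreeDecomposition.encode, add_comm 1, List.getD_cons_succ,
    List.getD_append]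
  rw [length_bitMatrix]
  exact Core.index_lt x.isLt y.isLt

theorem TreeDecomposition.getD_encode_bag (x : Fin m) (v : Fin n) :
    D.encode.getD (1 + m * m + (x * n + v)) 0 = if v ∈ D.bag x then 1 else 0 := by
  rw [← getD_bitMatrix (fun x v => v ∈ D.bag x), TreeDecomposition.encode,
    show 1 + m * m + (x * n + v) = m * m + (x * n + v) + 1 by ring, List.getD_cons_succ,
    List.getD_append_right _ _ _ _ (by rw [length_bitMatrix]; omega), length_bitMatrix,
    Nat.add_sub_cancel_left]

theorem TreeDecomposition.length_encode : D.encode.length = 1 + m * m + m * n := by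
  simp [TreeDecomposition.encode, length_bitMatrix]; ring

end Encoding

/-! ### Running times of composed programs -/

open Finset ConcSched.Core

/-- On the memory contents `M`, the program `P` computes `M'` in time at most `B`, whatever the
registers contain. -/
def Steps (P : Prog) (M M' : Mem) (B : ℕ) : Prop :=
  ∀ s : State, s.bank = M → ∃ t s', Exec P s t s' ∧ s'.bank = M' ∧ t ≤ B

theorem Steps.seq {P Q : Prog} {M M' M'' : Mem} {B B' : ℕ} (h : Steps P M M' B)
    (h' : Steps Q M' M'' B') : Steps (P.seq Q) M M'' (B + B') := by
  intro s hs
  obtain ⟨t, s', h1, h2, h3⟩ := h s hs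
  obtain ⟨t', s'', h4, h5, h6⟩ := h' s' h2
  exact ⟨_, _, .seq h1 h4, h5, Nat.add_le_add h3 h6⟩

theorem Steps.mono {P : Prog} {M M' : Mem} {B B' : ℕ} (h : Steps P M M' B) (hB : B ≤ B') :
    Steps P M M' B' := by
  intro s hs
  obtain ⟨t, s', h1, h2, h3⟩ := h s hs
  exact ⟨t, s', h1, h2, h3.trans hB⟩

/-- Compiled commands as composable steps. -/
theorem Cmd.exists_steps (c : Cmd) (hc : c.ok = true) : ∃ d, ∀ N M, Bounded N M → M 2 0 ≠ 0 →
    Steps (c.comp [] 0) M (c.run [] M) (N ^ d * (M 2 1 + 1) ^ c.depth) ∧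
      Bounded N (c.run [] M) := by
  obtain ⟨d, hd⟩ := c.exec_comp hc
  refine ⟨d, fun N M hM h0 => ⟨?_, ?_⟩⟩
  · rintro s rfl
    obtain ⟨t, s', h1, h2, -, h3, -⟩ := hd N s [] 0 hM h0 (by simp) (by simp)
    exact ⟨t, s', h1, h2, h3⟩
  · obtain ⟨t, s', -, h2, -, -, h3⟩ := hd N ⟨fun _ => 0, M⟩ [] 0 hM h0 (by simp) (by simp)
    rw [h2] at h3
    exact h3

/-- Programs that store parameters in bank 2, one after the other. -/
def setPars : List (ℕ × Term) → Prog
  | [] => .skip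
  | (i, e) :: l => .seq (.seq (e.comp [] 0) (.put 2 (.lit i) (.reg 0))) (setPars l)

/-- The memory after the parameters have been stored. -/
noncomputable def runPars : List (ℕ × Term) → Mem → Mem
  | [], M => M
  | (i, e) :: l, M => runPars l (M.set 2 i (e.eval M []))

/-- The parameters are within the bound `N`. -/
def Fits (N : ℕ) : List (ℕ × Term) → Mem → Prop
  | [], _ => True
  | (i, e) :: l, M => ((e.eval M []).size ≤ N ∧ (3 ≤ i → e.eval M [] ≤ N)) ∧
      Fits N l (M.set 2 i (e.eval M []))

theorem runPars_of_ne (l : List (ℕ × Term)) (M : Mem) {b : ℕ} (hb : b ≠ 2) :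
    runPars l M b = M b := by
  induction l generalizing M with
  | nil => rfl
  | cons p l ih => rw [runPars, ih, Mem.set_of_ne _ hb]

theorem Bounded.setPar {N : ℕ} {M : Mem} (h : Bounded N M) {i v : ℕ} (hv : v.size ≤ N)
    (hi : 3 ≤ i → v ≤ N) : Bounded N (M.set 2 i v) := by
  refine ⟨h.two_le, fun b a => ?_, fun j hj => ?_⟩
  · by_cases hb : b = 2
    · subst hb
      rw [Mem.set_same]
      split_ifs
      · exact hv
      · exact h.size_le _ _
    · rw [Mem.set_of_ne _ hb]
      exact h.size_le _ _
  · rw [Mem.set_same]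
    split_ifs with h1
    · exact hi (h1 ▸ hj)
    · exact h.par_le j hj

theorem setPars_steps (l : List (ℕ × Term)) (hl : ∀ p ∈ l, p.2.ok = true) :
    ∃ c, ∀ N M, Bounded N M → Fits N l M →
      Steps (setPars l) M (runPars l M) (N ^ c) ∧ Bounded N (runPars l M) := by
  induction l with
  | nil => exact ⟨0, fun N M hM _ => ⟨fun s hs => ⟨1, s, .skip s, hs, by simp⟩, hM⟩⟩
  | cons p l ih =>
    obtain ⟨i, e⟩ := p
    obtain ⟨c, hc⟩ := ih fun p hp => hl p (List.mem_cons_of_mem _ hp)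
    obtain ⟨d, hd⟩ := e.exec_comp (hl _ List.mem_cons_self)
    refine ⟨(d + (3 + i + 1) + 1) + c + 1, fun N M hM hF => ?_⟩
    obtain ⟨⟨h1, h2⟩, h3⟩ := hF
    obtain ⟨h4, h5⟩ := hc N _ (hM.setPar h1 h2) h3
    refine ⟨?_, h5⟩
    have hN := hM.two_le
    refine (Steps.seq (B := N ^ (d + (3 + i + 1) + 1)) ?_ h4).mono (add_le_pow hN le_rfl le_rfl)
    rintro s rfl
    obtain ⟨t, s', g1, g2, -, g3, g4, -⟩ := hd N s [] 0 hM (by simp) (by simp)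
    refine ⟨_, _, .seq g1 (.put s' _ _ _), ?_, ?_⟩
    · simp only [State.setCell, Expr.eval, g2, g3]
      rfl
    · refine add_le_pow hN g4 ?_
      simp only [Expr.cost, g2]
      have h6 := size_le_self i
      have h7 : 3 + i ≤ N ^ (3 + i) := const_le_pow hN _
      have h8 : N ≤ N ^ (3 + i) := Nat.le_self_pow (by omega) N
      calc _ ≤ (3 + i) + N := by
              have : (e.eval s.bank []).size ≤ N := h1
              simp only [List.map_nil] at this ⊢
              omega
        _ ≤ N ^ (3 + i) + N ^ (3 + i) := Nat.add_le_add h7 h8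
        _ = 2 * N ^ (3 + i) := by ring
        _ ≤ N * N ^ (3 + i) := Nat.mul_le_mul_right _ hN
        _ = N ^ (3 + i + 1) := by ring

/-! ### The number of colors and the sizes of the tables -/

namespace Core

/-- The number of vertices of the bag `x`. -/
def cardT (x : Term) : Term := .sum 5 (.flag (bagT x.up (.var 0)))

/-- The width of the tree decomposition in memory: the largest size of a bag is the number of `j < n`
that are smaller than the size of some bag. -/
def widthT : Term := .sum 5 (.flag (.ex 6 ((Term.var 1).lt (cardT (.var 0))))) - 1

/-- One more than the binary logarithm of `n ^ w`, where `w` is in cell 10 of bank 2 and `n ^ 2` in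
cell 12. -/
def colorCountT : Term :=
  1 + .sum 12 (.flag (.le (.prod 12 (.ite ((Term.var 0).lt (.var 1 + 1)) 2 1)) (.prod 10 numT)))

/-- The parameters that depend on the tree decomposition. -/
def tableL : List (ℕ × Term) :=
  [(10, widthT), (11, .get 2 (.lit 10) + 1), (12, numT * numT), (7, colorCountT),
    (2, .prod 11 colorsT), (1, nodesT * nodesT * tabT)]

theorem tableL_ok : ∀ p ∈ tableL, p.2.ok = true := by decide

/-- The maximum of the numbers `c x ≤ n` for `x < m`. -/
def maxCard (n m : ℕ) (c : ℕ → ℕ) : ℕ := ∑ j ∈ range n, if ∃ x < m, j < c x then 1 else 0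

theorem le_maxCard {n m : ℕ} {c : ℕ → ℕ} {x : ℕ} (hx : x < m) (hc : c x ≤ n) : c x ≤ maxCard n m c := by
  rw [maxCard, ← card_filter]
  calc c x = (range (c x)).card := (card_range _).symm
    _ ≤ _ := card_le_card fun j hj => by
      rw [mem_range] at hj
      exact mem_filter.2 ⟨mem_range.2 (by omega), x, hx, hj⟩

theorem maxCard_le {n m b : ℕ} {c : ℕ → ℕ} (hc : ∀ x < m, c x ≤ b) : maxCard n m c ≤ b := by
  rw [maxCard, ← card_filter]
  calc _ ≤ (range b).card := card_le_card fun j hj => by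
        obtain ⟨-, x, hx, h⟩ := mem_filter.1 hj
        exact mem_range.2 (h.trans_le (hc x hx))
    _ = b := card_range b

/-- One more than the binary logarithm of `n ^ w`, where `w ≤ n`. -/
def colorCount (n w : ℕ) : ℕ := 1 + ∑ j ∈ range (n * n), if 2 ^ (j + 1) ≤ n ^ w then 1 else 0

theorem colorCount_le_log (n w : ℕ) : colorCount n w ≤ 1 + Nat.log 2 (n ^ w) := by
  rw [colorCount, ← card_filter]
  refine Nat.add_le_add_left ?_ 1
  calc _ ≤ (range (Nat.log 2 (n ^ w))).card := card_le_card fun j hj => by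
        obtain ⟨-, h⟩ := mem_filter.1 hj
        refine mem_range.2 (Nat.lt_of_succ_le ?_)
        exact Nat.le_log_of_pow_le (by omega) h
    _ = _ := card_range _

theorem colorCount_le (n w : ℕ) : colorCount n w ≤ n * n + 1 := by
  rw [colorCount, ← card_filter, add_comm]
  exact Nat.add_le_add_right ((card_filter_le _ _).trans (card_range _).le) 1

theorem lt_colorCount {n w c : ℕ} (hw : w ≤ n) (h : 2 ^ c ≤ n ^ w) : c < colorCount n w := by
  rw [colorCount, ← card_filter, Nat.lt_one_add_iff]
  rcases Nat.eq_zero_or_pos n with rfl | hn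
  · obtain rfl : w = 0 := by omega
    rw [pow_zero] at h
    have : c = 0 := by
      by_contra h0
      have := Nat.one_lt_two_pow h0
      omega
    omega
  have h1 : 2 ^ c ≤ 2 ^ (n * n) := calc
    2 ^ c ≤ n ^ w := h
    _ ≤ n ^ n := Nat.pow_le_pow_right hn hw
    _ ≤ (2 ^ n) ^ n := Nat.pow_le_pow_left Nat.lt_two_pow_self.le _
    _ = 2 ^ (n * n) := (pow_mul _ _ _).symm
  have h2 : c ≤ n * n := (Nat.pow_le_pow_iff_right (by omega)).1 h1
  calc c = (range c).card := (card_range c).symm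
    _ ≤ _ := card_le_card fun j hj => by
      rw [mem_range] at hj
      exact mem_filter.2 ⟨mem_range.2 (by omega), (Nat.pow_le_pow_right (by omega) hj).trans h⟩

theorem prod_two_lt {N j : ℕ} (h : j ≤ N) : ∏ i ∈ range N, (if i < j then 2 else 1) = 2 ^ j := by
  rw [← prod_filter, show (range N).filter (fun i => i < j) = range j by
    ext i; simp only [mem_filter, mem_range]; omega, prod_const, card_range]

/-- The number of vertices of a bag. -/
def bagCard (M : Mem) (x : ℕ) : ℕ := ((range (M 2 5)).filter (bagP M x)).card

theorem eval_widthT (M : Mem) : widthT.eval M [] = maxCard (M 2 5) (M 2 6) (bagCard M) - 1 := by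
  simp only [widthT, cardT, Term.eval_sub, Term.eval_sum, Term.eval_flag, Term.holds_ex,
    Term.holds_lt, Term.eval_var_one, Term.eval_one, maxCard, bagCard, card_filter, holds_bagT,
    Term.eval_up, Term.eval_var_zero]

theorem eval_colorCountT {M : Mem} {n w : ℕ} (h5 : M 2 5 = n) (h12 : M 2 12 = n * n)
    (h10 : M 2 10 = w) : colorCountT.eval M [] = colorCount n w := by
  simp only [colorCountT, Term.eval_add, Term.eval_sum, Term.eval_flag, Term.holds_le,
    Term.eval_prod, Term.eval_ite, Term.holds_lt, Term.eval_var_zero, Term.eval_var_one,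
    Term.eval_one, Term.eval_two, eval_numT, h5, h12, h10, prod_const, card_range, colorCount]
  congr 1
  refine sum_congr rfl fun j hj => ?_
  rw [prod_two_lt (Nat.succ_le_of_lt (mem_range.1 hj))]

/-- What is known after the parameters have been computed. -/
structure Tabled (M : Mem) (n m w : ℕ) (M' : Mem) : Prop where
  frame : ∀ b, b ≠ 2 → M' b = M b
  par : ∀ i, i = 0 ∨ i = 3 ∨ i = 4 ∨ i = 5 ∨ i = 6 → M' 2 i = M 2 i
  colors : M' 2 7 = colorCount n w
  tab : M' 2 2 = colorCount n w ^ (w + 1)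
  long : M' 2 1 = m * m * colorCount n w ^ (w + 1)
  width_le : w ≤ n
  card_le : ∀ x < m, bagCard M x ≤ w + 1
  width_min : ∀ b, (∀ x < m, bagCard M x ≤ b + 1) → w ≤ b

theorem size_le_of_le_pow {x a b : ℕ} (h : x ≤ a ^ b) : x.size ≤ a * b + 1 := by
  rw [Nat.size_le]
  calc x ≤ a ^ b := h
    _ ≤ (2 ^ a) ^ b := Nat.pow_le_pow_left Nat.lt_two_pow_self.le _
    _ = 2 ^ (a * b) := (pow_mul _ _ _).symm
    _ < 2 ^ (a * b + 1) := Nat.pow_lt_pow_right (by omega) (by omega)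

theorem tableL_spec {M : Mem} {n m U : ℕ} (h5 : M 2 5 = n) (h6 : M 2 6 = m)
    (hn : n * n + n + 1 ≤ U) (hm : m ≤ U) :
    Fits ((U + 3) ^ 2) tableL M ∧ ∃ w, Tabled M n m w (runPars tableL M) := by
  set w := maxCard n m (bagCard M) - 1 with hw
  have hcard : ∀ x, bagCard M x ≤ n := fun x => by
    rw [bagCard, ← h5]
    exact (card_filter_le _ _).trans (card_range _).le
  have hwn : w ≤ n := by
    have := maxCard_le (n := n) (m := m) (c := bagCard M) fun x _ => hcard x
    omega
  have hK := colorCount_le n w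
  set K := colorCount n w with hKdef
  have e1 : widthT.eval M [] = w := by rw [eval_widthT, h5, h6]
  set M₁ := M.set 2 10 w with hM₁
  set M₂ := M₁.set 2 11 (w + 1) with hM₂
  set M₃ := M₂.set 2 12 (n * n) with hM₃
  set M₄ := M₃.set 2 7 K with hM₄
  set M₅ := M₄.set 2 2 (K ^ (w + 1)) with hM₅
  set M₆ := M₅.set 2 1 (m * m * K ^ (w + 1)) with hM₆
  have e2 : (Term.get 2 (.lit 10) + 1).eval M₁ [] = w + 1 := by simp [hM₁]
  have e3 : (numT * numT).eval M₂ [] = n * n := by simp [hM₂, hM₁, h5]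
  have e4 : colorCountT.eval M₃ [] = K :=
    eval_colorCountT (by simp [hM₃, hM₂, hM₁, h5]) (by simp [hM₃]) (by simp [hM₃, hM₂, hM₁])
  have e5 : (Term.prod 11 colorsT).eval M₄ [] = K ^ (w + 1) := by
    have h1 : M₄ 2 11 = w + 1 := by simp [hM₄, hM₃, hM₂]
    have h2 : M₄ 2 7 = K := by simp [hM₄]
    have h3 : ∀ Γ, colorsT.eval M₄ Γ = K := fun Γ => h2
    simp only [Term.eval_prod, h3, prod_const, card_range, h1]
  have e6 : (nodesT * nodesT * tabT).eval M₅ [] = m * m * K ^ (w + 1) := by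
    simp [hM₅, hM₄, hM₃, hM₂, hM₁, h6]
  have hrun : runPars tableL M = M₆ := by
    simp only [tableL, runPars, e1, ← hM₁, e2, ← hM₂, e3, ← hM₃, e4, ← hM₄, e5, ← hM₅, e6, ← hM₆]
  have hUU : U * U ≤ (U + 3) ^ 2 := by nlinarith
  have hU1 : U + 3 ≤ (U + 3) ^ 2 := Nat.le_self_pow (by omega) _
  have hKU : K ≤ U := by omega
  have hpow : K ^ (w + 1) ≤ U ^ (n + 1) :=
    (Nat.pow_le_pow_left hKU _).trans (Nat.pow_le_pow_right (by omega) (by omega))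
  have hlong : m * m * K ^ (w + 1) ≤ U ^ (n + 3) := calc
    m * m * K ^ (w + 1) ≤ U * U * U ^ (n + 1) := by gcongr
    _ = U ^ (n + 3) := by ring
  have hnU : n ≤ U := by nlinarith
  have hsmall : ∀ x, x ≤ U + 3 → x.size ≤ (U + 3) ^ 2 ∧ x ≤ (U + 3) ^ 2 := fun x hx => by
    have := size_le_self x
    omega
  have hbig : ∀ x, x ≤ U ^ (n + 3) → x.size ≤ (U + 3) ^ 2 := fun x hx => by
    refine (size_le_of_le_pow hx).trans ?_
    nlinarith
  refine ⟨?_, w, ?_⟩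
  · simp only [tableL, Fits, e1, ← hM₁, e2, ← hM₂, e3, ← hM₃, e4, ← hM₄, e5, ← hM₅, e6]
    have s1 := hsmall w (by omega)
    have s2 := hsmall (w + 1) (by omega)
    have s3 := hsmall (n * n) (by omega)
    have s4 := hsmall K (by omega)
    have s5 := hbig (K ^ (w + 1)) (hpow.trans (Nat.pow_le_pow_right (by omega) (by omega)))
    have s6 := hbig _ hlong
    exact ⟨⟨s1.1, fun _ => s1.2⟩, ⟨s2.1, fun _ => s2.2⟩, ⟨s3.1, fun _ => s3.2⟩,
      ⟨s4.1, fun _ => s4.2⟩, ⟨s5, fun h => by omega⟩, ⟨s6, fun h => by omega⟩, trivial⟩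
  · rw [hrun]
    refine ⟨fun b hb => ?_, fun i hi => ?_, ?_, ?_, ?_, hwn, fun x hx => ?_, fun b hb => ?_⟩
    · rw [hM₆, Mem.set_of_ne _ hb, hM₅, Mem.set_of_ne _ hb, hM₄, Mem.set_of_ne _ hb, hM₃,
        Mem.set_of_ne _ hb, hM₂, Mem.set_of_ne _ hb, hM₁, Mem.set_of_ne _ hb]
    · rcases hi with rfl | rfl | rfl | rfl | rfl <;> simp [hM₆, hM₅, hM₄, hM₃, hM₂, hM₁]
    · simp [hM₆, hM₅, hM₄, hKdef]
    · simp [hM₆, hM₅, hKdef]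
    · simp [hM₆, hKdef]
    · have := le_maxCard (m := m) hx (hcard x)
      omega
    · have := maxCard_le (n := n) hb
      omega

end Core

/-! ### The algorithm for a tree decomposition in memory -/

open Finset ConcSched.Core

namespace Core

/-- Compute an optimal schedule from the instance and a tree decomposition in memory. -/
def finishP : Prog := .seq (setPars tableL) (searchC.comp [] 0)

/-- The search is optimal and fast for the width `w` of the tree decomposition in memory. -/
theorem finishP_spec : ∃ c : ℕ, ∀ (n m U : ℕ) (G : SimpleGraph (Fin n)) (r : Fin n → ℕ) (M : Mem),
    Holds M G r → M 2 6 = m → Nonempty (RootedDec n m (adjP M) (bagP M) (treeP M)) →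
    n * n + n + 1 ≤ U → m ≤ U → M 2 4 = U → M 2 0 = U + 2 → ∑ v, r v + n < U →
    Bounded ((U + 3) ^ 2) M →
    ∃ w, (∀ b, (∀ x < m, bagCard M x ≤ b + 1) → w ≤ b) ∧
      ∀ s : State, s.bank = M → ∃ t s', Exec finishP s t s' ∧
        IsOptimal G (fun _ => 1) r (output n s') ∧
        t ≤ ((U + 3) ^ 2) ^ c * colorCount n w ^ (w + 1) := by
  obtain ⟨c, hc⟩ := setPars_steps tableL tableL_ok
  obtain ⟨d, hd⟩ := searchC.exists_steps (by decide)
  refine ⟨c + (d + 1) + 1, fun n m U G r M hM h6 hD hn hm h4 h0 hr hB => ?_⟩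
  obtain ⟨hfit, w, hT⟩ := tableL_spec hM.num h6 hn hm
  obtain ⟨hs1, hB1⟩ := hc _ _ hB hfit
  set M' := runPars tableL M with hM'
  have p0 : M' 2 0 = U + 2 := by rw [hT.par 0 (by omega), h0]
  have p4 : M' 2 4 = U := by rw [hT.par 4 (by omega), h4]
  have p5 : M' 2 5 = n := by rw [hT.par 5 (by omega), hM.num]
  have p6 : M' 2 6 = m := by rw [hT.par 6 (by omega), h6]
  have hK := colorCount_le n w
  have hKpos : 0 < colorCount n w := by rw [colorCount]; omega
  have hadj : adjP M' = adjP M := by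
    funext u v; simp only [adjP, hT.frame 0 (by decide), p5, hM.num]
  have hbag : bagP M' = bagP M := by
    funext u v; simp only [bagP, hT.frame 5 (by decide), p5, hM.num]
  have htree : treeP M' = treeP M := by
    funext u v; simp only [treeP, hT.frame 4 (by decide), p6, h6]
  have hready : Ready M' w := by
    refine ⟨⟨by omega, ?_, ?_, ?_, ?_, ?_⟩, ?_⟩
    · rw [hT.long, hT.tab, p6]
    · rw [hT.tab, hT.colors]
    · rw [hT.colors]; exact hKpos
    · rw [p6]; exact hD.some.pos
    · intro x hx
      rw [p6] at hx
      have := hT.card_le x hx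
      have e : bagCard M' x = bagCard M x := by
        simp only [bagCard, p5, hM.num, bagP, hT.frame 5 (by decide)]
      rw [← e] at this
      exact this
    · rw [p5, p6, hadj, hbag, htree]
      exact hD
  have hholds : Holds M' G r := hM.congr (hT.frame 0 (by decide)) (by rw [p5, hM.num])
  obtain ⟨hs2, -⟩ := hd _ M' hB1 (by omega)
  refine ⟨w, hT.width_min, fun s hs => ?_⟩
  obtain ⟨t, s', h1, h2, h3⟩ := (hs1.seq hs2) s hs
  refine ⟨t, s', h1, ?_, h3.trans ?_⟩
  · exact searchC_optimal hholds hready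
      (fun c hc => by rw [hT.colors]; exact lt_colorCount hT.width_le hc) (by rw [p4]; exact hr)
      (by rw [p4, p0]; omega) (by rw [hT.colors, p0]; omega) h2
  · have hdepth : searchC.depth = 1 := by decide
    rw [hdepth, pow_one, hT.long]
    set N := (U + 3) ^ 2 with hN
    have hK1 : 1 ≤ colorCount n w ^ (w + 1) := Nat.one_le_pow _ _ hKpos
    have h5 : m * m * colorCount n w ^ (w + 1) + 1 ≤ N * colorCount n w ^ (w + 1) := calc
      _ ≤ U * U * colorCount n w ^ (w + 1) + colorCount n w ^ (w + 1) := by gcongr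
      _ = (U * U + 1) * colorCount n w ^ (w + 1) := by ring
      _ ≤ _ := Nat.mul_le_mul_right _ (by rw [hN]; nlinarith)
    refine add_le_pow_mul hB.two_le (le_pow_mul hK1 le_rfl) ?_
    calc N ^ d * (m * m * colorCount n w ^ (w + 1) + 1) ≤ N ^ d * (N * colorCount n w ^ (w + 1)) :=
          Nat.mul_le_mul_left _ h5
      _ = N ^ (d + 1) * colorCount n w ^ (w + 1) := by ring

end Core

/-! ### Reading the input -/

/-- The parameters that depend on the instance only. -/
def instanceL : List (ℕ × Term) :=
  [(4, .sum 3 (.get 0 (.var 0)) + .get 2 (.lit 3)), (0, .get 2 (.lit 4) + 2), (5, .get 0 0)]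

theorem instanceL_ok : ∀ p ∈ instanceL, p.2.ok = true := by decide

/-- The memory after the length of the input `l` has been stored in bank 2. -/
noncomputable def startMem (l : List ℕ) : Mem := Mem.set (initial l).bank 2 3 l.length

theorem startMem_zero (l : List ℕ) (a : ℕ) : startMem l 0 a = l.getD a 0 := by
  rw [startMem, Mem.set_of_ne _ (by decide)]
  rfl

theorem startMem_two (l : List ℕ) (a : ℕ) : startMem l 2 a = if a = 3 then l.length else 0 := by
  rw [startMem, Mem.set_same]
  rfl

theorem startMem_of_ne (l : List ℕ) {b : ℕ} (h0 : b ≠ 0) (h2 : b ≠ 2) (a : ℕ) :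
    startMem l b a = 0 := by
  rw [startMem, Mem.set_of_ne _ h2]
  exact if_neg h0

theorem two_le_bound (U : ℕ) : 2 ≤ (U + 3) ^ 2 := by
  have : U + 3 ≤ (U + 3) ^ 2 := Nat.le_self_pow (by omega) _
  omega

theorem startMem_bounded (l : List ℕ) : Bounded ((unaryLength l + 3) ^ 2) (startMem l) := by
  have h1 : unaryLength l ≤ (unaryLength l + 3) ^ 2 := by nlinarith
  have h2 : ∀ b a, startMem l b a ≤ unaryLength l := by
    intro b a
    by_cases h0 : b = 0
    · subst h0
      rw [startMem_zero]
      exact getD_le_unaryLength _ _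
    · by_cases h2 : b = 2
      · subst h2
        rw [startMem_two]
        split_ifs
        · exact length_le_unaryLength l
        · exact Nat.zero_le _
      · rw [startMem_of_ne l h0 h2]
        exact Nat.zero_le _
  exact ⟨two_le_bound _, fun b a => (size_le_self _).trans ((h2 b a).trans h1),
    fun i _ => (h2 2 i).trans h1⟩

/-- What the memory contains after `instanceL`, for an input `l` with `n` jobs. -/
structure Prepared (l : List ℕ) (n : ℕ) (M : Mem) : Prop where
  frame : ∀ b, b ≠ 2 → M b = startMem l b
  lim : M 2 0 = unaryLength l + 2
  length : M 2 4 = unaryLength l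
  num : M 2 5 = n
  bounded : Bounded ((unaryLength l + 3) ^ 2) M

theorem instanceL_spec {l : List ℕ} {n : ℕ} (hl : l.getD 0 0 = n) :
    Fits ((unaryLength l + 3) ^ 2) instanceL (startMem l) ∧
      (Bounded ((unaryLength l + 3) ^ 2) (runPars instanceL (startMem l)) →
        Prepared l n (runPars instanceL (startMem l))) := by
  set U := unaryLength l with hU
  have e1 : (Term.sum 3 (.get 0 (.var 0)) + .get 2 (.lit 3)).eval (startMem l) [] = U := by
    simp only [Term.eval_add, Term.eval_sum, Term.eval_get, Term.eval_var_zero, Term.eval_lit,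
      startMem_zero, startMem_two, if_true]
    exact unaryLength_eq l
  set M₁ := (startMem l).set 2 4 U with hM₁
  set M₂ := M₁.set 2 0 (U + 2) with hM₂
  set M₃ := M₂.set 2 5 n with hM₃
  have e2 : (Term.get 2 (.lit 4) + 2).eval M₁ [] = U + 2 := by simp [hM₁]
  have e3 : (Term.get 0 0).eval M₂ [] = n := by
    rw [Term.eval_get, Term.eval_zero, hM₂, Mem.set_of_ne _ (by decide), hM₁,
      Mem.set_of_ne _ (by decide), startMem_zero, hl]
  have hrun : runPars instanceL (startMem l) = M₃ := by
    simp only [instanceL, runPars, e1, ← hM₁, e2, ← hM₂, e3, ← hM₃]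
  have hn : n ≤ U := hl ▸ getD_le_unaryLength l 0
  have hsmall : ∀ x, x ≤ U + 3 → x.size ≤ (U + 3) ^ 2 ∧ x ≤ (U + 3) ^ 2 := fun x hx => by
    have h1 := size_le_self x
    have h2 : U + 3 ≤ (U + 3) ^ 2 := Nat.le_self_pow (by omega) _
    omega
  constructor
  · simp only [instanceL, Fits, e1, ← hM₁, e2, ← hM₂, e3]
    have s1 := hsmall U (by omega)
    have s2 := hsmall (U + 2) (by omega)
    have s3 := hsmall n (by omega)
    exact ⟨⟨s1.1, fun _ => s1.2⟩, ⟨s2.1, fun _ => s2.2⟩, ⟨s3.1, fun _ => s3.2⟩, trivial⟩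
  · rw [hrun]
    refine fun hB => ⟨fun b hb => ?_, ?_, ?_, ?_, hB⟩
    · rw [hM₃, Mem.set_of_ne _ hb, hM₂, Mem.set_of_ne _ hb, hM₁, Mem.set_of_ne _ hb]
    · simp [hM₃, hM₂, hU]
    · simp [hM₃, hM₂, hM₁, hU]
    · simp [hM₃]

/-- The memory holds the instance when the parameters have been stored. -/
theorem Prepared.holds {n : ℕ} {G : SimpleGraph (Fin n)} {r : Fin n → ℕ} {l : List ℕ} {M : Mem}
    (h : Prepared (encodeInstance G r ++ l) n M) : Holds M G r := by
  classical
  refine ⟨h.num, fun u v => ?_, fun v => ?_⟩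
  · rw [adjP, h.num, h.frame 0 (by decide), startMem_zero, getD_encode_adj]
    exact flag_ne_zero
  · rw [rel, h.num, h.frame 0 (by decide), startMem_zero, getD_encode_rel]

/-- Store the parameters that depend on the instance, and continue with `P`. -/
def startP (P : Prog) : Prog := .seq (.put 2 (.lit 3) (.reg 0)) (.seq (setPars instanceL) P)

theorem startP_spec : ∃ c : ℕ, ∀ (P : Prog) (l : List ℕ) (n : ℕ), l.getD 0 0 = n →
    ∃ M, Prepared l n M ∧ ∀ (Q : State → Prop) (B : ℕ),
      (∀ s : State, s.bank = M → ∃ t s', Exec P s t s' ∧ Q s' ∧ t ≤ B) →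
      ∃ t s', Exec (startP P) (initial l) t s' ∧ Q s' ∧
        t ≤ ((unaryLength l + 3) ^ 2) ^ c + B := by
  obtain ⟨c, hc⟩ := setPars_steps instanceL instanceL_ok
  refine ⟨3 + c + 1, fun P l n hl => ?_⟩
  obtain ⟨hfit, hprep⟩ := instanceL_spec hl
  obtain ⟨hsteps, hB⟩ := hc _ _ (startMem_bounded l) hfit
  refine ⟨_, hprep hB, fun Q B hP => ?_⟩
  obtain ⟨t, s', h1, h2, h3⟩ := hsteps ((initial l).setCell 2 3 l.length) rfl
  obtain ⟨t', s'', h4, h5, h6⟩ := hP s' h2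
  refine ⟨_, s'', .seq (.put _ _ _ _) (.seq h1 h4), h5, ?_⟩
  set N := (unaryLength l + 3) ^ 2 with hN
  have h7 : 1 + (Expr.lit 3).cost (initial l) + (Expr.reg 0).cost (initial l) ≤ N ^ 3 := by
    have h8 : ((initial l).reg 0).size ≤ unaryLength l :=
      (size_le_self _).trans (length_le_unaryLength l)
    have h9 : (3 : ℕ).size = 2 := by decide
    simp only [Expr.cost, h9]
    have h10 : N ≤ N ^ 3 := Nat.le_self_pow (by omega) _
    have h11 : unaryLength l + 6 ≤ N := by rw [hN]; nlinarith
    omega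
  have h2N : 2 ≤ N := two_le_bound _
  have h8 := add_le_pow h2N h7 h3
  have h9 : (Expr.lit 3).eval (initial l) = 3 := rfl
  omega

open Finset ConcSched.Core

/-! ### The algorithm for a given tree decomposition -/

/-- The number of nodes, and the sizes of the two matrices of the tree decomposition. -/
def copyL : List (ℕ × Term) :=
  [(6, .get 0 (1 + numT * numT + numT)), (8, nodesT * nodesT), (9, nodesT * numT)]

theorem copyL_ok : ∀ p ∈ copyL, p.2.ok = true := by decide

/-- Copy the tree to bank 4 and the bags to bank 5. -/
def copyC : Cmd :=
  .seq (.loop 8 (.put 4 (.var 0) (.get 0 (1 + numT * numT + numT + (1 + .var 0)))))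
    (.loop 9 (.put 5 (.var 0)
      (.get 0 (1 + numT * numT + numT + (1 + .get 2 (.lit 8) + .var 0)))))

theorem size_le_sq {x U : ℕ} (hx : x ≤ U) : x.size ≤ (U + 3) ^ 2 ∧ x ≤ (U + 3) ^ 2 := by
  have h1 := size_le_self x
  have h2 : U + 3 ≤ (U + 3) ^ 2 := Nat.le_self_pow (by omega) _
  omega

theorem onNat_coe {a b : ℕ} {R : Fin a → Fin b → Prop} (i : Fin a) (j : Fin b) :
    onNat R i j ↔ R i j :=
  ⟨fun ⟨_, _, h⟩ => h, fun h => ⟨i.isLt, j.isLt, h⟩⟩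

/-- The tree decomposition is in memory after it has been copied. -/
theorem copyC_spec {n m : ℕ} {G : SimpleGraph (Fin n)} {r : Fin n → ℕ} (D : TreeDecomposition G m)
    {M : Mem} (hM : Prepared (encodeInstance G r ++ D.encode) n M) :
    Fits ((unaryLength (encodeInstance G r ++ D.encode) + 3) ^ 2) copyL M ∧
      (∀ b, b ≠ 2 → b ≠ 4 → b ≠ 5 → copyC.run [] (runPars copyL M) b = M b) ∧
      (∀ i, i ≤ 5 → copyC.run [] (runPars copyL M) 2 i = M 2 i) ∧
      copyC.run [] (runPars copyL M) 2 6 = m ∧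
      (∀ x y : Fin m, treeP (copyC.run [] (runPars copyL M)) x y ↔ D.tree.Adj x y) ∧
      (∀ (x : Fin m) (v : Fin n), bagP (copyC.run [] (runPars copyL M)) x v ↔ v ∈ D.bag x) := by
  classical
  set l := encodeInstance G r ++ D.encode with hl
  set U := unaryLength l with hU
  have hlen : (1 + n * n + n) + (1 + m * m + m * n) ≤ U := by
    have := length_le_unaryLength l
    rw [hl, List.length_append, length_encodeInstance, D.length_encode, ← hl, ← hU] at this
    exact this
  have h0 : ∀ i, M 0 (1 + n * n + n + i) = D.encode.getD i 0 := fun i => by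
    rw [hM.frame 0 (by decide), startMem_zero, hl, getD_encode_append]
  have h0U : ∀ i, M 0 i ≤ U := fun i => by
    rw [hM.frame 0 (by decide), startMem_zero]
    exact getD_le_unaryLength _ _
  have hnum := hM.num
  set M₁ := M.set 2 6 m with hM₁
  set M₂ := M₁.set 2 8 (m * m) with hM₂
  set M₃ := M₂.set 2 9 (m * n) with hM₃
  have e1 : (Term.get 0 (1 + numT * numT + numT)).eval M [] = m := by
    simp only [Term.eval_get, Term.eval_add, Term.eval_mul, Term.eval_one, eval_numT, hnum]
    rw [show 1 + n * n + n = 1 + n * n + n + 0 from rfl, h0]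
    rfl
  have e2 : (nodesT * nodesT).eval M₁ [] = m * m := by simp [hM₁]
  have e3 : (nodesT * numT).eval M₂ [] = m * n := by simp [hM₂, hM₁, hnum]
  have hrun : runPars copyL M = M₃ := by
    simp only [copyL, runPars, e1, ← hM₁, e2, ← hM₂, e3, ← hM₃]
  have hmm : m ≤ m * m := Nat.le_mul_self m
  have p0 : M₃ 2 0 = U + 2 := by simp [hM₃, hM₂, hM₁, hM.lim, hU]
  have p5 : M₃ 2 5 = n := by simp [hM₃, hM₂, hM₁, hnum]
  have p8 : M₃ 2 8 = m * m := by simp [hM₃, hM₂]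
  have p9 : M₃ 2 9 = m * n := by simp [hM₃]
  have b0 : ∀ b, b ≠ 2 → M₃ b = M b := fun b hb => by
    rw [hM₃, Mem.set_of_ne _ hb, hM₂, Mem.set_of_ne _ hb, hM₁, Mem.set_of_ne _ hb]
  refine ⟨?_, ?_⟩
  · simp only [copyL, Fits, e1, ← hM₁, e2, ← hM₂, e3]
    have s1 := size_le_sq (show m ≤ U by omega)
    have s2 := size_le_sq (show m * m ≤ U by omega)
    have s3 := size_le_sq (show m * n ≤ U by omega)
    exact ⟨⟨s1.1, fun _ => s1.2⟩, ⟨s2.1, fun _ => s2.2⟩, ⟨s3.1, fun _ => s3.2⟩, trivial⟩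
  rw [hrun, copyC, Cmd.run_seq, Cmd.run_fill_of_not_reads (b := 4) (by decide) rfl (by
    intro j _
    rw [Term.eval_get, b0 0 (by decide), p0]
    exact (h0U _).trans_lt (by omega))]
  set M₄ := M₃.fill 4 _ _ with hM₄
  have f2 : M₄ 2 = M₃ 2 := Mem.fill_of_ne _ (by decide)
  have f0 : M₄ 0 = M 0 := (Mem.fill_of_ne _ (by decide)).trans (b0 0 (by decide))
  rw [Cmd.run_fill_of_not_reads (b := 5) (by decide) rfl (by
    intro j _
    rw [Term.eval_get, f0, f2, p0]
    exact (h0U _).trans_lt (by omega))]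
  set M₅ := M₄.fill 5 _ _ with hM₅
  have g2 : M₅ 2 = M₃ 2 := (Mem.fill_of_ne _ (by decide)).trans f2
  refine ⟨fun b h2 h4 h5 => ?_, fun i hi => ?_, ?_, fun x y => ?_, fun x v => ?_⟩
  · rw [hM₅, Mem.fill_of_ne _ h5, hM₄, Mem.fill_of_ne _ h4, b0 b h2]
  · rw [g2]
    simp only [hM₃, hM₂, hM₁, Mem.set_same]
    rw [if_neg (by omega), if_neg (by omega), if_neg (by omega)]
  · rw [g2]
    simp [hM₃, hM₂, hM₁]
  · have g6 : M₅ 2 6 = m := by rw [g2]; simp [hM₃, hM₂, hM₁]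
    rw [treeP, g6, hM₅, Mem.fill_of_ne _ (by decide), hM₄, Mem.fill_same, p8,
      if_pos (index_lt x.isLt y.isLt)]
    simp only [Term.eval_get, Term.eval_add, Term.eval_mul, Term.eval_one, eval_numT,
      Term.eval_var_zero, p5, b0 0 (by decide)]
    rw [h0, D.getD_encode_tree]
    exact flag_ne_zero
  · have g5 : M₅ 2 5 = n := by rw [g2, p5]
    rw [bagP, g5, hM₅, Mem.fill_same, f2, p9, if_pos (index_lt x.isLt v.isLt)]
    simp only [Term.eval_get, Term.eval_add, Term.eval_mul, Term.eval_one, eval_numT,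
      Term.eval_var_zero, Term.eval_lit, f2, p5, p8, f0]
    rw [h0, D.getD_encode_bag]
    exact flag_ne_zero

/-- An algorithm for instances with a given tree decomposition. -/
theorem exists_decomposed_program : ∃ (P : Prog) (c : ℕ), ∀ (n : ℕ) (G : SimpleGraph (Fin n))
    (r : Fin n → ℕ) (m : ℕ) (D : TreeDecomposition G m), ∃ (t : ℕ) (s : State) (w : ℕ),
      Exec P (initial (encodeInstance G r ++ D.encode)) t s ∧
      IsOptimal G (fun _ => 1) r (output n s) ∧ w ≤ D.width ∧
      t ≤ ((unaryLength (encodeInstance G r ++ D.encode) + 3) ^ 2) ^ c *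
        colorCount n w ^ (w + 1) := by
  classical
  obtain ⟨c₁, h₁⟩ := startP_spec
  obtain ⟨c₂, h₂⟩ := setPars_steps copyL copyL_ok
  obtain ⟨c₃, h₃⟩ := copyC.exists_steps (by decide)
  obtain ⟨c₄, h₄⟩ := finishP_spec
  refine ⟨startP (.seq (.seq (setPars copyL) (copyC.comp [] 0)) finishP),
    c₁ + ((c₂ + c₃ + 1) + c₄ + 1) + 1, fun n G r m D => ?_⟩
  set l := encodeInstance G r ++ D.encode with hl
  set U := unaryLength l with hU
  obtain ⟨M, hM, hP⟩ := h₁ (.seq (.seq (setPars copyL) (copyC.comp [] 0)) finishP) l n rfl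
  obtain ⟨hfit, hframe, hpar, hm, htree, hbag⟩ := copyC_spec D hM
  obtain ⟨hs2, hB2⟩ := h₂ _ _ hM.bounded hfit
  set M₁ := runPars copyL M with hM₁
  have hpar2 : copyC.run [] M₁ 2 = M₁ 2 := Cmd.run_par (by decide) _ _
  obtain ⟨hs3, hB3⟩ := h₃ _ _ hB2 (by
    rw [← hpar2, hpar 0 (by omega), hM.lim]
    omega)
  set M₂ := copyC.run [] M₁ with hM₂
  have hlen : (1 + n * n + n) + (1 + m * m + m * n) ≤ U := by
    have := length_le_unaryLength l
    rw [hl, List.length_append, length_encodeInstance, D.length_encode, ← hl, ← hU] at this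
    exact this
  have hmm : m ≤ m * m := Nat.le_mul_self m
  have hH : Holds M₂ G r := hM.holds.congr (hframe 0 (by decide) (by decide) (by decide))
    (hpar 5 (by omega))
  have hdec : Nonempty (RootedDec n m (adjP M₂) (bagP M₂) (treeP M₂)) := by
    obtain ⟨D'⟩ := D.exists_rootedDec
    refine D'.congr (fun u hu v hv h => (hH.onNat_iff hu hv).2 h) (fun x hx v hv => ?_)
      (fun x hx y hy ⟨_, _, h⟩ => (htree ⟨x, hx⟩ ⟨y, hy⟩).2 h)
    rw [hbag ⟨x, hx⟩ ⟨v, hv⟩, ← onNat_coe (R := fun x v => v ∈ D.bag x)]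
  have hr : ∑ v, r v + n < U := by
    have := sum_add_lt_unaryLength G r
    rw [hU, hl, unaryLength_append]
    omega
  obtain ⟨w, hw, hfin⟩ := h₄ n m U G r M₂ hH hm hdec (by omega) (by omega)
    ((hpar 4 (by omega)).trans hM.length) ((hpar 0 (by omega)).trans hM.lim) hr hB3
  have hwD : w ≤ D.width := hw _ fun x hx => by
    refine le_trans (card_le_card fun v hv => ?_) (D.card_bag_le x)
    obtain ⟨hv, hvb⟩ := mem_filter.1 hv
    rw [hH.num, mem_range] at hv
    exact mem_filter.2 ⟨mem_range.2 hv, hx, hv, (hbag ⟨x, hx⟩ ⟨v, hv⟩).1 hvb⟩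
  set N := (U + 3) ^ 2 with hN
  have hpos : 1 ≤ colorCount n w ^ (w + 1) := Nat.one_le_pow _ _ (by rw [colorCount]; omega)
  have hN2 : 2 ≤ N := hM.bounded.two_le
  have hd : copyC.depth = 0 := by decide
  obtain ⟨t, s, g1, g2, g3⟩ := hP (fun s => IsOptimal G (fun _ => 1) r (output n s))
    (N ^ ((c₂ + c₃ + 1) + c₄ + 1) * colorCount n w ^ (w + 1)) (fun s hs => by
      obtain ⟨t, s', k1, k2, k3⟩ := (hs2.seq hs3) s hs
      obtain ⟨t', s'', k4, k5, k6⟩ := hfin s' k2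
      refine ⟨_, s'', .seq k1 k4, k5, add_le_pow_mul hN2 (le_pow_mul hpos (k3.trans ?_)) k6⟩
      rw [hd, pow_zero, mul_one]
      exact add_le_pow hN2 le_rfl le_rfl)
  exact ⟨t, s, w, g1, g2, hwD, g3.trans (add_le_pow_mul hN2 (le_pow_mul hpos le_rfl) le_rfl)⟩

open Finset ConcSched.Core

/-! ### The algorithm without a tree decomposition -/

/-- The decomposition with one bag. -/
theorem exists_decomposition {n : ℕ} (G : SimpleGraph (Fin n)) :
    ∃ (m : ℕ) (D : TreeDecomposition G m), D.width = n - 1 := by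
  refine ⟨1, { tree := ⊥
               bag := fun _ => univ
               isTree := ⟨{ preconnected := fun x y => by rw [Subsingleton.elim x y]
                            nonempty := ⟨0⟩ }, SimpleGraph.isAcyclic_bot⟩
               vertex_mem := fun v => ⟨0, mem_univ v⟩
               edge_mem := fun u v _ => ⟨0, mem_univ u, mem_univ v⟩
               connected := fun v =>
                { preconnected := fun x y => by rw [Subsingleton.elim x y]
                  nonempty := ⟨⟨0, mem_univ v⟩⟩ } }, ?_⟩
  simp [TreeDecomposition.width]

theorem exists_width_eq_treewidth {n : ℕ} (G : SimpleGraph (Fin n)) :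
    ∃ (m : ℕ) (D : TreeDecomposition G m), D.width = treewidth G := by
  obtain ⟨m, D, h⟩ := exists_decomposition G
  exact Nat.sInf_mem (s := {w | ∃ (m : ℕ) (D : TreeDecomposition G m), D.width = w}) ⟨_, m, D, h⟩

theorem treewidth_le {n : ℕ} (G : SimpleGraph (Fin n)) : treewidth G ≤ n - 1 :=
  Nat.sInf_le (exists_decomposition G)

/-- The time of a loop that ends after at most `m` rounds. -/
theorem exec_loop {e : Expr} {body : Prog} {m C T : ℕ} (I : ℕ → State → Prop)
    (hC : ∀ k s, I k s → e.cost s ≤ C)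
    (hb : ∀ k s, I k s → e.eval s ≠ 0 →
      k < m ∧ ∃ t s', Exec body s t s' ∧ I (k + 1) s' ∧ t ≤ T) {s : State} (h0 : I 0 s) :
    ∃ t s', Exec (.loop e body) s t s' ∧ (∃ k, I k s') ∧ e.eval s' = 0 ∧
      t ≤ (m + 1) * (1 + C + T) := by
  have key : ∀ d k s, m ≤ k + d → I k s → ∃ t s', Exec (.loop e body) s t s' ∧ (∃ k, I k s') ∧
      e.eval s' = 0 ∧ t ≤ (d + 1) * (1 + C + T) := by
    intro d
    induction d with
    | zero =>
      intro k s hk h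
      by_cases he : e.eval s = 0
      · have := hC k s h
        exact ⟨_, s, .loop_done he, ⟨k, h⟩, he, by omega⟩
      · have := (hb k s h he).1
        omega
    | succ d ih =>
      intro k s hk h
      have h1 := hC k s h
      by_cases he : e.eval s = 0
      · exact ⟨_, s, .loop_done he, ⟨k, h⟩, he, by nlinarith⟩
      · obtain ⟨-, t, s', h2, h3, h4⟩ := hb k s h he
        obtain ⟨t', s'', h5, h6, h7, h8⟩ := ih (k + 1) s' (by omega) h3
        refine ⟨_, s'', .loop_step he h2 h5, h6, h7, ?_⟩
        have : (d + 1 + 1) * (1 + C + T) = (d + 1) * (1 + C + T) + (1 + C + T) := by ring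
        omega
  exact key m 0 s (by omega) h0

/-- The parameters of the construction of a tree decomposition. -/
def buildL : List (ℕ × Term) :=
  [(8, numT * (numT + 1) + 1), (9, numT * numT), (10, (numT + 1) * numT), (11, numT + 2)]

/-- The parameters for a guess of the treewidth. -/
def guessL : List (ℕ × Term) :=
  [(12, .lit 3 * .get 3 (.lit 5) + .lit 4), (1, .prod 12 (.lit 3))]

/-- The number of nodes of the tree decomposition, and the size of its adjacency matrix. -/
def treeL : List (ℕ × Term) := [(6, numT + 1), (8, nodesT * nodesT)]

theorem buildL_ok : ∀ p ∈ buildL, p.2.ok = true := by decide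
theorem guessL_ok : ∀ p ∈ guessL, p.2.ok = true := by decide
theorem treeL_ok : ∀ p ∈ treeL, p.2.ok = true := by decide

/-- Try to build a tree decomposition for the current guess, and increase the guess. -/
def guessC : Cmd := .seq Build.buildC (.put 3 (.lit 5) (.get 3 (.lit 5) + 1))

/-- Guess the treewidth until a tree decomposition is found. -/
def guessP : Prog :=
  .loop (.get 3 (.lit 3)) (.seq (setPars guessL) (guessC.comp [] 0))

/-- Mark that no tree decomposition has been found yet. -/
def flagC : Cmd := .put 3 (.lit 3) 1

/-- Store the complete graph on the nodes in place of the tree. Rooted tree decompositions require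
only that the edges of the tree are recorded, and further neighbors do no harm to the search. -/
def treeC : Cmd := .loop 8 (.put 4 (.var 0) 1)

/-- The memory before guess `k` of the treewidth `tw`, where `M` is the memory before the first
guess. The tree decomposition that has been found has bags of size at most
`2 * (3 * tw + 4)`. -/
structure Guessing (N n tw : ℕ) (M : Mem) (k : ℕ) (M' : Mem) : Prop where
  bounded : Bounded N M'
  input : M' 0 = M 0
  par : ∀ i, i ≠ 1 → i ≠ 12 → M' 2 i = M 2 i
  count : M' 3 5 = k
  le : k ≤ tw + 1
  found : M' 3 3 = 0 → Nonempty (RootedDec n (n + 1) (adjP M') (bagP M') fun _ _ => True) ∧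
    ∀ x < n + 1, bagCard M' x ≤ 2 * (3 * tw + 4)
  last : k = tw + 1 → M' 3 3 = 0

/-- The memory once the parameters that do not depend on the guess are known. -/
structure Base (n U : ℕ) (M : Mem) : Prop where
  lim : M 2 0 = U + 2
  num : M 2 5 = n
  passes : M 2 8 = n * (n + 1) + 1
  pairs : M 2 9 = n * n
  cells : M 2 10 = (n + 1) * n
  prices : M 2 11 = n + 2

/-- A guess that is at least the treewidth succeeds. -/
theorem guess_spec {n U tw k : ℕ} {M M' : Mem} (hU : n * n + n + 1 ≤ U) (htw : tw ≤ n)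
    (hM : Base n U M) (hsymm : ∀ u < n, ∀ v < n, adjP M u v → adjP M v u)
    (hdec : ∃ m bag tree, Nonempty (RootedDec n m (adjP M) bag tree) ∧
      ∀ x < m, (@filter _ (bag x) (Classical.decPred _) (range n)).card ≤ tw + 1)
    (h : Guessing ((U + 3) ^ 2) n tw M k M') (h3 : M' 3 3 ≠ 0) :
    k ≤ tw ∧ Fits ((U + 3) ^ 2) guessL M' ∧ runPars guessL M' 2 0 ≠ 0 ∧
      runPars guessL M' 2 1 + 1 ≤ 3 ^ (3 * tw + 5) ∧
      (Bounded ((U + 3) ^ 2) (guessC.run [] (runPars guessL M')) →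
        Guessing ((U + 3) ^ 2) n tw M (k + 1) (guessC.run [] (runPars guessL M'))) := by
  have hk : k ≤ tw := by
    have h1 := h.le
    have h2 := h.last
    by_contra hk
    exact h3 (h2 (by omega))
  set M₁ := M'.set 2 12 (3 * k + 4) with hM₁
  set M₂ := M₁.set 2 1 (3 ^ (3 * k + 4)) with hM₂
  have e1 : (Term.lit 3 * .get 3 (.lit 5) + .lit 4).eval M' [] = 3 * k + 4 := by
    simp only [Term.eval_add, Term.eval_mul, Term.eval_lit, Term.eval_get, h.count]
  have e2 : (Term.prod 12 (.lit 3)).eval M₁ [] = 3 ^ (3 * k + 4) := by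
    simp [hM₁]
  have hrun : runPars guessL M' = M₂ := by
    simp only [guessL, runPars, e1, ← hM₁, e2, ← hM₂]
  have hpow : (3 : ℕ) ^ (3 * k + 4) + 1 ≤ 3 ^ (3 * tw + 5) := by
    have h1 : (3 : ℕ) ^ (3 * k + 4) ≤ 3 ^ (3 * tw + 4) := Nat.pow_le_pow_right (by omega) (by omega)
    have h2 : 1 ≤ (3 : ℕ) ^ (3 * tw + 4) := Nat.one_le_pow _ _ (by omega)
    have h3 : (3 : ℕ) ^ (3 * tw + 5) = 3 ^ (3 * tw + 4) * 3 := pow_succ _ _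
    omega
  have q2 : ∀ i, i ≠ 1 → i ≠ 12 → M₂ 2 i = M 2 i := fun i h1 h12 => by
    rw [hM₂, Mem.set_same, if_neg h1, hM₁, Mem.set_same, if_neg h12, h.par i h1 h12]
  have q12 : M₂ 2 12 = 3 * k + 4 := by simp [hM₂, hM₁]
  have q1 : M₂ 2 1 = 3 ^ (3 * k + 4) := by simp [hM₂]
  have qb : ∀ b, b ≠ 2 → M₂ b = M' b := fun b hb => by
    rw [hM₂, Mem.set_of_ne _ hb, hM₁, Mem.set_of_ne _ hb]
  have q0 := q2 0 (by decide) (by decide)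
  refine ⟨hk, ?_, by rw [hrun, q0, hM.lim]; omega, by rw [hrun, q1]; exact hpow, ?_⟩
  · simp only [guessL, Fits, e1, ← hM₁, e2]
    have hn : n ≤ n * n := Nat.le_mul_self n
    have h1 : 9 * n + 13 ≤ (U + 3) ^ 2 := by nlinarith
    have h2 := size_le_self (3 * k + 4)
    have h4 := size_le_of_le_pow (le_refl (3 ^ (3 * k + 4)))
    exact ⟨⟨by omega, fun _ => by omega⟩, ⟨by omega, fun h => by omega⟩, trivial⟩
  rw [hrun, guessC, Cmd.run_seq, run_put]
  have hP : Build.Params M₂ n := by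
    refine ⟨⟨?_, ?_, ?_, ?_⟩, ?_, ?_, ?_⟩
    · rw [q2 5 (by decide) (by decide), hM.num]
    · rw [q2 8 (by decide) (by decide), hM.passes]
    · rw [q2 9 (by decide) (by decide), hM.pairs]
    · rw [q0, hM.lim]
      omega
    · rw [q2 10 (by decide) (by decide), hM.cells]
    · rw [q2 11 (by decide) (by decide), hM.prices]
    · rw [q1, q12]
  have hadj : adjP M₂ = adjP M := by
    funext u v
    simp only [adjP, qb 0 (by decide), h.input, hP.num, hM.num]
  obtain ⟨hprog, hnarrow⟩ := Build.buildC_spec hP (by rwa [hadj]) []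
  set M₃ := Build.buildC.run [] M₂ with hM₃
  have r0 : M₃ 0 = M₂ 0 := hprog.frame 0 (by decide) (by decide) (by decide)
  have r2 : M₃ 2 = M₂ 2 := hprog.frame 2 (by decide) (by decide) (by decide)
  have r35 : M₃ 3 5 = k := by
    rw [hprog.cells 5 (by decide) (by decide), qb 3 (by decide), h.count]
  have e3 : (Term.get 3 (.lit 5) + 1).eval M₃ [] % M₃ 2 0 = k + 1 := by
    rw [r2, q0, hM.lim]
    simp only [Term.eval_add, Term.eval_get, Term.eval_lit, Term.eval_one, r35]
    exact Nat.mod_eq_of_lt (by nlinarith)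
  rw [e3, Term.eval_lit]
  intro hB
  set M₄ := M₃.set 3 5 (k + 1) with hM₄
  have s2 : M₄ 2 = M₂ 2 := by rw [hM₄, Mem.set_of_ne _ (by decide), r2]
  have s0 : M₄ 0 = M₂ 0 := by rw [hM₄, Mem.set_of_ne _ (by decide), r0]
  have s33 : M₄ 3 3 = M₃ 3 3 := by rw [hM₄, Mem.set_same, if_neg (by decide)]
  have s5 : M₄ 5 = M₃ 5 := by rw [hM₄, Mem.set_of_ne _ (by decide)]
  have hbag : bagP M₄ = bagP M₃ := by
    funext x v
    simp only [bagP, s2, r2, s5]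
  refine ⟨hB, by rw [s0, qb 0 (by decide), h.input], fun i h1 h12 => by rw [s2, q2 i h1 h12],
    by rw [hM₄, Mem.set_same, if_pos rfl], by omega, fun h0 => ?_, fun hlast => ?_⟩
  · obtain ⟨par, hinv⟩ := hprog.inv (s33 ▸ h0)
    have hadj' : adjP M₄ = adjP M₂ := by
      funext u v
      simp only [adjP, s2, s0]
    rw [hadj', hbag]
    refine ⟨hinv.rootedDec, fun x hx => ?_⟩
    have h1 := hinv.bag_card x hx
    rw [q12] at h1
    refine le_trans (card_le_card fun v hv => ?_) (h1.trans (by omega))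
    obtain ⟨hv, hvb⟩ := mem_filter.1 hv
    rw [s2, hP.num] at hv
    rw [hbag] at hvb
    exact (@mem_filter _ _ (Classical.decPred _) _ _).2 ⟨hv, hvb⟩
  · obtain ⟨m, bag, tree, ⟨D⟩, hcard⟩ := hdec
    rw [s33]
    obtain rfl : k = tw := by omega
    refine hnarrow ⟨k, m, bag, tree, ?_, q12, hcard⟩
    rwa [hadj]

/-- Compute an optimal schedule from the instance in memory. -/
def solveP : Prog :=
  .seq (.seq (.seq (setPars buildL) (flagC.comp [] 0)) guessP)
    (.seq (.seq (setPars treeL) (treeC.comp [] 0)) finishP)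

/-- The memory before the first guess. -/
theorem buildL_spec {n U : ℕ} {M : Mem} (h0 : M 2 0 = U + 2) (h5 : M 2 5 = n)
    (hU : n * n + n + 1 ≤ U) :
    Fits ((U + 3) ^ 2) buildL M ∧ Base n U (runPars buildL M) ∧
      ∀ i < 7, runPars buildL M 2 i = M 2 i := by
  set M₁ := M.set 2 8 (n * (n + 1) + 1) with hM₁
  set M₂ := M₁.set 2 9 (n * n) with hM₂
  set M₃ := M₂.set 2 10 ((n + 1) * n) with hM₃
  set M₄ := M₃.set 2 11 (n + 2) with hM₄
  have e1 : (numT * (numT + 1) + 1).eval M [] = n * (n + 1) + 1 := by simp [h5]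
  have e2 : (numT * numT).eval M₁ [] = n * n := by simp [hM₁, h5]
  have e3 : ((numT + 1) * numT).eval M₂ [] = (n + 1) * n := by simp [hM₂, hM₁, h5]
  have e4 : (numT + 2).eval M₃ [] = n + 2 := by simp [hM₃, hM₂, hM₁, h5]
  have hrun : runPars buildL M = M₄ := by
    simp only [buildL, runPars, e1, ← hM₁, e2, ← hM₂, e3, ← hM₃, e4, ← hM₄]
  have hbound : U + 3 ≤ (U + 3) ^ 2 := Nat.le_self_pow (by omega) _
  have hsmall : ∀ x, x ≤ U + 3 → x.size ≤ (U + 3) ^ 2 ∧ x ≤ (U + 3) ^ 2 := fun x hx => by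
    have := size_le_self x
    omega
  refine ⟨?_, ?_, fun i hi => ?_⟩
  · simp only [buildL, Fits, e1, ← hM₁, e2, ← hM₂, e3, ← hM₃, e4]
    have s1 := hsmall (n * (n + 1) + 1) (by rw [mul_add, mul_one]; omega)
    have s2 := hsmall (n * n) (by omega)
    have s3 := hsmall ((n + 1) * n) (by rw [add_mul, one_mul]; omega)
    have s4 := hsmall (n + 2) (by omega)
    exact ⟨⟨s1.1, fun _ => s1.2⟩, ⟨s2.1, fun _ => s2.2⟩, ⟨s3.1, fun _ => s3.2⟩,
      ⟨s4.1, fun _ => s4.2⟩, trivial⟩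
  · rw [hrun]
    constructor <;> simp [hM₄, hM₃, hM₂, hM₁, h0, h5]
  · rw [hrun]
    simp only [hM₄, hM₃, hM₂, hM₁, Mem.set_same]
    rw [if_neg (by omega), if_neg (by omega), if_neg (by omega), if_neg (by omega)]

/-- The guesses find a tree decomposition of width at most six times the treewidth, plus
a constant. -/
theorem guessP_spec : ∃ c, ∀ {n U tw : ℕ} {M : Mem}, n * n + n + 1 ≤ U → tw ≤ n → Base n U M →
    (∀ u < n, ∀ v < n, adjP M u v → adjP M v u) →
    (∃ m bag tree, Nonempty (RootedDec n m (adjP M) bag tree) ∧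
      ∀ x < m, (@filter _ (bag x) (Classical.decPred _) (range n)).card ≤ tw + 1) →
    Bounded ((U + 3) ^ 2) M → M 3 3 = 1 → M 3 5 = 0 → ∀ s : State, s.bank = M →
    ∃ t s' k, Exec guessP s t s' ∧ Guessing ((U + 3) ^ 2) n tw M k s'.bank ∧
      s'.bank 3 3 = 0 ∧ t ≤ ((U + 3) ^ 2) ^ c * 3 ^ (3 * tw + 5) := by
  obtain ⟨c₁, h₁⟩ := setPars_steps guessL guessL_ok
  obtain ⟨c₂, h₂⟩ := guessC.exists_steps (by decide)
  refine ⟨1 + (4 + (c₁ + c₂ + 1) + 1), fun {n U tw M} hU htw hM hsymm hdec hB hM3 hM5 s hs => ?_⟩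
  set N := (U + 3) ^ 2 with hN
  set P := 3 ^ (3 * tw + 5) with hP
  have hP1 : 1 ≤ P := Nat.one_le_pow _ _ (by omega)
  have hN2 := hB.two_le
  obtain ⟨t, s', g1, ⟨k, hk⟩, g2, g3⟩ := exec_loop (e := .get 3 (.lit 3))
    (body := .seq (setPars guessL) (guessC.comp [] 0)) (m := tw + 1) (C := 4 + N)
    (T := N ^ (c₁ + c₂ + 1) * P) (s := s) (fun k s' => Guessing N n tw M k s'.bank)
    (fun k s' h => by
      have h1 := h.bounded.size_le 3 3
      have h2 : (3 : ℕ).size = 2 := by decide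
      simp only [Expr.cost, Expr.eval, h2]
      omega)
    (fun k s' h h3 => by
      obtain ⟨f1, f2, f3, f4, f5⟩ := guess_spec hU htw hM hsymm hdec h h3
      obtain ⟨f6, f7⟩ := h₁ _ _ h.bounded f2
      obtain ⟨f8, f9⟩ := h₂ _ _ f7 f3
      obtain ⟨t, s'', k1, k2, k3⟩ := (f6.seq f8) s' rfl
      refine ⟨by omega, t, s'', k1, by rw [k2]; exact f5 f9, k3.trans ?_⟩
      have hd : guessC.depth = 1 := by decide
      rw [hd, pow_one]
      exact add_le_pow_mul hN2 (le_pow_mul hP1 le_rfl) (Nat.mul_le_mul_left _ f4))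
    (by
      rw [hs]
      exact ⟨hB, rfl, fun _ _ _ => rfl, hM5, by omega, fun h => by omega, fun h => by omega⟩)
  refine ⟨t, s', k, g1, hk, g2, g3.trans ?_⟩
  have h1 : tw + 1 + 1 ≤ N := by
    have : U + 3 ≤ N := Nat.le_self_pow (by omega) _
    have := Nat.le_mul_self n
    omega
  have h2 : 1 + (4 + N) ≤ N ^ 4 := by
    have h5 : 9 ≤ N := by rw [hN]; nlinarith
    have h6 : N * N ≤ N ^ 4 := by
      rw [← pow_two]
      exact Nat.pow_le_pow_right (by omega) (by omega)
    nlinarith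
  calc _ ≤ N * (N ^ (4 + (c₁ + c₂ + 1) + 1) * P) :=
        Nat.mul_le_mul h1 (add_le_pow_mul hN2 (le_pow_mul hP1 h2) le_rfl)
    _ = _ := by ring

/-- The memory once the tree has been stored. -/
theorem treeC_spec {n U : ℕ} {M : Mem} (h0 : M 2 0 = U + 2) (h5 : M 2 5 = n)
    (hU : n * n + n + 1 ≤ U) :
    Fits ((U + 3) ^ 2) treeL M ∧ runPars treeL M 2 0 ≠ 0 ∧
      (∀ b, b ≠ 2 → b ≠ 4 → treeC.run [] (runPars treeL M) b = M b) ∧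
      (∀ i, i < 6 → treeC.run [] (runPars treeL M) 2 i = M 2 i) ∧
      treeC.run [] (runPars treeL M) 2 6 = n + 1 ∧
      ∀ x < n + 1, ∀ y < n + 1, treeP (treeC.run [] (runPars treeL M)) x y := by
  set M₁ := M.set 2 6 (n + 1) with hM₁
  set M₂ := M₁.set 2 8 ((n + 1) * (n + 1)) with hM₂
  have e1 : (numT + 1).eval M [] = n + 1 := by simp [h5]
  have e2 : (nodesT * nodesT).eval M₁ [] = (n + 1) * (n + 1) := by simp [hM₁]
  have hrun : runPars treeL M = M₂ := by
    simp only [treeL, runPars, e1, ← hM₁, e2, ← hM₂]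
  have q0 : M₂ 2 0 = U + 2 := by simp [hM₂, hM₁, h0]
  have q6 : M₂ 2 6 = n + 1 := by simp [hM₂, hM₁]
  have q8 : M₂ 2 8 = (n + 1) * (n + 1) := by simp [hM₂]
  refine ⟨?_, by rw [hrun, q0]; omega, ?_⟩
  · simp only [treeL, Fits, e1, ← hM₁, e2]
    have h1 : (n + 1) * (n + 1) ≤ (U + 3) ^ 2 := by nlinarith
    have h2 := size_le_self ((n + 1) * (n + 1))
    have h3 := size_le_sq (show n + 1 ≤ U by nlinarith)
    exact ⟨⟨h3.1, fun _ => h3.2⟩, ⟨h2.trans h1, fun _ => h1⟩, trivial⟩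
  rw [hrun, treeC, Cmd.run_fill_of_not_reads (b := 4) (by decide) rfl (by
    intro j _
    rw [q0, Term.eval_one]
    omega)]
  set M₃ := M₂.fill 4 _ _ with hM₃
  have r2 : M₃ 2 = M₂ 2 := Mem.fill_of_ne _ (by decide)
  refine ⟨fun b h2 h4 => ?_, fun i hi => ?_, by rw [r2, q6], fun x hx y hy => ?_⟩
  · rw [hM₃, Mem.fill_of_ne _ h4, hM₂, Mem.set_of_ne _ h2, hM₁, Mem.set_of_ne _ h2]
  · rw [r2]
    simp only [hM₂, hM₁, Mem.set_same]
    rw [if_neg (by omega), if_neg (by omega)]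
  · rw [treeP, r2, q6, hM₃, Mem.fill_same, q8, if_pos (index_lt hx hy), Term.eval_one]
    decide

theorem colorCount_pow_mono {n w b : ℕ} (h : w ≤ b) :
    colorCount n w ^ (w + 1) ≤ colorCount n b ^ (b + 1) := by
  have h1 : colorCount n w ≤ colorCount n b := by
    rw [colorCount, colorCount]
    refine Nat.add_le_add_left (sum_le_sum fun j hj => ?_) 1
    have hn : 0 < n := by
      rcases Nat.eq_zero_or_pos n with rfl | hn
      · simp at hj
      · exact hn
    have h2 : n ^ w ≤ n ^ b := Nat.pow_le_pow_right hn h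
    split_ifs <;> omega
  calc _ ≤ colorCount n b ^ (w + 1) := Nat.pow_le_pow_left h1 _
    _ ≤ _ := Nat.pow_le_pow_right (by rw [colorCount]; omega) (by omega)

/-- An algorithm for instances without a tree decomposition. -/
theorem exists_program : ∃ (P : Prog) (c : ℕ), ∀ (n : ℕ) (G : SimpleGraph (Fin n))
    (r : Fin n → ℕ), ∃ (t : ℕ) (s : State), Exec P (initial (encodeInstance G r)) t s ∧
      IsOptimal G (fun _ => 1) r (output n s) ∧
      t ≤ ((unaryLength (encodeInstance G r) + 3) ^ 2) ^ c *
        (3 ^ (3 * treewidth G + 5) *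
          colorCount n (6 * treewidth G + 7) ^ (6 * treewidth G + 8)) := by
  classical
  obtain ⟨c₁, h₁⟩ := startP_spec
  obtain ⟨c₂, h₂⟩ := setPars_steps buildL buildL_ok
  obtain ⟨c₃, h₃⟩ := flagC.exists_steps (by decide)
  obtain ⟨c₄, h₄⟩ := guessP_spec
  obtain ⟨c₅, h₅⟩ := setPars_steps treeL treeL_ok
  obtain ⟨c₆, h₆⟩ := treeC.exists_steps (by decide)
  obtain ⟨c₇, h₇⟩ := finishP_spec
  refine ⟨startP solveP,
    c₁ + (((c₂ + c₃ + 1) + c₄ + 1) + ((c₅ + c₆ + 1) + c₇ + 1) + 1) + 1, fun n G r => ?_⟩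
  set l := encodeInstance G r with hl
  set U := unaryLength l with hUdef
  have hU : n * n + n + 1 ≤ U := by
    have := length_le_unaryLength l
    rw [hl, length_encodeInstance, ← hl, ← hUdef] at this
    omega
  have hr : ∑ v, r v + n < U := sum_add_lt_unaryLength G r
  obtain ⟨M, hM, hP⟩ := h₁ solveP l n rfl
  have hH : Holds M G r := by
    refine Prepared.holds (l := []) ?_
    rwa [List.append_nil]
  have htw : treewidth G ≤ n := (treewidth_le G).trans (Nat.sub_le _ _)
  set N := (U + 3) ^ 2 with hN
  have hN2 : 2 ≤ N := hM.bounded.two_le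
  -- the parameters
  obtain ⟨hfit, hbase, hpar⟩ := buildL_spec hM.lim hM.num hU
  obtain ⟨hs2, hB2⟩ := h₂ _ _ hM.bounded hfit
  set M₁ := runPars buildL M with hM₁
  have hb1 : ∀ b, b ≠ 2 → M₁ b = M b := fun b hb => runPars_of_ne _ _ hb
  obtain ⟨hs3, hB3⟩ := h₃ _ _ hB2 (by rw [hbase.lim]; omega)
  have hM₂ : flagC.run [] M₁ = M₁.set 3 3 1 := by
    rw [flagC, run_put, hbase.lim, Term.eval_lit, Term.eval_one, Nat.mod_eq_of_lt (by omega)]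
  rw [hM₂] at hs3 hB3
  set M₂ := M₁.set 3 3 1 with hM₂'
  have hb2 : ∀ b, b ≠ 3 → M₂ b = M₁ b := fun b hb => Mem.set_of_ne _ hb
  have hbase2 : Base n U M₂ := by
    obtain ⟨g1, g2, g3, g4, g5, g6⟩ := hbase
    constructor <;> rw [hb2 2 (by decide)] <;> assumption
  have hpar2 : ∀ i < 7, M₂ 2 i = M 2 i := fun i hi => by rw [hb2 2 (by decide), hpar i hi]
  have h20 : M₂ 0 = M 0 := by rw [hb2 0 (by decide), hb1 0 (by decide)]
  have hH2 : Holds M₂ G r := hH.congr h20 (hpar2 5 (by omega))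
  have h3z : ∀ j, M₁ 3 j = 0 := fun j => by
    rw [hb1 3 (by decide), hM.frame 3 (by decide), startMem_of_ne _ (by decide) (by decide)]
  have hsymm : ∀ u < n, ∀ v < n, adjP M₂ u v → adjP M₂ v u := fun u hu v hv h =>
    (hH2.adj ⟨v, hv⟩ ⟨u, hu⟩).2 ((hH2.adj ⟨u, hu⟩ ⟨v, hv⟩).1 h).symm
  have hdec : ∃ m bag tree, Nonempty (RootedDec n m (adjP M₂) bag tree) ∧
      ∀ x < m, (@filter _ (bag x) (Classical.decPred _) (range n)).card ≤ treewidth G + 1 := by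
    obtain ⟨m, D, hD⟩ := exists_width_eq_treewidth G
    obtain ⟨D'⟩ := D.exists_rootedDec
    refine ⟨m, onNat fun x v => v ∈ D.bag x, onNat D.tree.Adj,
      D'.congr (fun u hu v hv h => (hH2.onNat_iff hu hv).2 h) (fun _ _ _ _ => Iff.rfl)
        fun _ _ _ _ h => h, fun x _ => ?_⟩
    rw [← hD]
    convert D.card_bag_le x
  set K := 3 ^ (3 * treewidth G + 5) with hK
  have hK1 : 1 ≤ K := Nat.one_le_pow _ _ (by omega)
  set b := 6 * treewidth G + 7 with hb
  set L := colorCount n b ^ (b + 1) with hL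
  have hL1 : 1 ≤ L := Nat.one_le_pow _ _ (by rw [colorCount]; omega)
  have hKL : 1 ≤ K * L := Nat.one_le_iff_ne_zero.2 (by positivity)
  obtain ⟨t, s, g1, g2, g3⟩ := hP (fun s => IsOptimal G (fun _ => 1) r (output n s))
    (N ^ (((c₂ + c₃ + 1) + c₄ + 1) + ((c₅ + c₆ + 1) + c₇ + 1) + 1) * (K * L)) (fun s hs => by
      obtain ⟨t₁, s₁, k1, k2, k3⟩ := (hs2.seq hs3) s hs
      obtain ⟨t₂, s₂, k, k4, hk, hk0, k6⟩ := h₄ hU htw hbase2 hsymm hdec hB3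
        (by rw [hM₂', Mem.set_same, if_pos rfl])
        (by rw [hM₂', Mem.set_same, if_neg (by decide), h3z]) s₁ k2
      obtain ⟨⟨D⟩, hcard⟩ := hk.found hk0
      set M₃ := s₂.bank with hM₃
      have hpar3 : ∀ i < 7, i ≠ 1 → M₃ 2 i = M 2 i := fun i hi h1 => by
        rw [hk.par i h1 (by omega), hpar2 i hi]
      have h30 : M₃ 2 0 = U + 2 := (hpar3 0 (by omega) (by decide)).trans hM.lim
      have h35 : M₃ 2 5 = n := (hpar3 5 (by omega) (by decide)).trans hM.num
      obtain ⟨hfit3, hne, hf1, hf2, hf6, hf4⟩ := treeC_spec h30 h35 hU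
      obtain ⟨hs5, hB5⟩ := h₅ _ _ hk.bounded hfit3
      obtain ⟨hs6, hB6⟩ := h₆ _ _ hB5 hne
      set M₄ := runPars treeL M₃ with hM₄
      set M₅ := treeC.run [] M₄ with hM₅
      have h55 : M₅ 2 5 = n := (hf2 5 (by omega)).trans h35
      have hH5 : Holds M₅ G r := by
        refine hH2.congr ?_ ?_
        · rw [hf1 0 (by decide) (by decide), hk.input]
        · rw [h55, hH2.num]
      have hbag : bagP M₅ = bagP M₃ := by
        funext x v
        simp only [bagP, h55, h35, hf1 5 (by decide) (by decide)]
      have hadj : adjP M₅ = adjP M₃ := by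
        funext x v
        simp only [adjP, h55, h35, hf1 0 (by decide) (by decide)]
      obtain ⟨w, hw, hfin⟩ := h₇ n (n + 1) U G r M₅ hH5 hf6
        (by
          rw [hbag, hadj]
          exact D.congr (fun _ _ _ _ h => h) (fun _ _ _ _ => Iff.rfl)
            fun x hx y hy _ => hf4 x hx y hy)
        hU (by nlinarith) ((hf2 4 (by omega)).trans ((hpar3 4 (by omega) (by decide)).trans
          hM.length)) ((hf2 0 (by omega)).trans h30) hr hB6
      have hwb : w ≤ b := hw b fun x hx => by
        have h1 := hcard x hx
        have h2 : bagCard M₅ x = bagCard M₃ x := by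
          simp only [bagCard, h55, h35, bagP, hf1 5 (by decide) (by decide)]
        omega
      obtain ⟨t₃, s₃, k7, k8, k9⟩ := (hs5.seq hs6) s₂ rfl
      obtain ⟨t₄, s₄, k10, k11, k12⟩ := hfin s₃ k8
      have d1 : flagC.depth = 0 := by decide
      have d2 : treeC.depth = 0 := by decide
      rw [d1, pow_zero, mul_one] at k3
      rw [d2, pow_zero, mul_one] at k9
      refine ⟨_, s₄, .seq (.seq k1 k4) (.seq k7 k10), k11, add_le_pow_mul hN2
        (add_le_pow_mul hN2 (le_pow_mul hKL (k3.trans (add_le_pow hN2 le_rfl le_rfl)))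
          (k6.trans (Nat.mul_le_mul_left _ (Nat.le_mul_of_pos_right _ hL1))))
        (add_le_pow_mul hN2 (le_pow_mul hKL (k9.trans (add_le_pow hN2 le_rfl le_rfl)))
          (k12.trans (Nat.mul_le_mul_left _ ((colorCount_pow_mono hwb).trans
            (Nat.le_mul_of_pos_left _ hK1)))))⟩)
  refine ⟨t, s, g1, g2, g3.trans (add_le_pow_mul hN2 (le_pow_mul hKL le_rfl) le_rfl)⟩

/-! ### Estimates of the running times -/

theorem logb_nonneg (n : ℕ) : 0 ≤ Real.logb 2 n := by
  rcases Nat.eq_zero_or_pos n with rfl | hn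
  · simp
  · exact Real.logb_nonneg one_lt_two (by exact_mod_cast hn)

theorem colorCount_le_logb (n w : ℕ) : (Core.colorCount n w : ℝ) ≤ w * Real.logb 2 n + 1 := by
  have h1 : (Core.colorCount n w : ℝ) ≤ 1 + Nat.log 2 (n ^ w) := by
    exact_mod_cast Core.colorCount_le_log n w
  have h2 := Real.natLog_le_logb (n ^ w) 2
  push_cast at h2
  rw [Real.logb_pow] at h2
  linarith

theorem bound_pow_le {U : ℕ} (hU : 1 ≤ U) (c : ℕ) : ((U + 3) ^ 2) ^ c ≤ 16 ^ c * U ^ (2 * c) := by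
  rw [pow_mul, ← mul_pow]
  refine Nat.pow_le_pow_left ?_ c
  nlinarith

theorem one_le_unaryLength {n : ℕ} (G : SimpleGraph (Fin n)) (r : Fin n → ℕ) (l : List ℕ) :
    1 ≤ unaryLength (encodeInstance G r ++ l) := by
  have := sum_add_lt_unaryLength G r
  rw [unaryLength_append]
  omega

/-- The time of the algorithm for a given tree decomposition of width `d`. -/
theorem decomposed_time {n U c w d t : ℕ} (hU : 1 ≤ U) (hw : w ≤ d)
    (ht : t ≤ ((U + 3) ^ 2) ^ c * Core.colorCount n w ^ (w + 1)) :
    (t : ℝ) ≤ (16 ^ c + 2 * c : ℕ) * (U : ℝ) ^ (16 ^ c + 2 * c) *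
      (d * Real.logb 2 n + 1) ^ (d + 1) := by
  have hL := logb_nonneg n
  have hU' : (1 : ℝ) ≤ U := by exact_mod_cast hU
  have h1 : (t : ℝ) ≤ 16 ^ c * (U : ℝ) ^ (2 * c) * (Core.colorCount n w : ℝ) ^ (w + 1) := by
    exact_mod_cast ht.trans (Nat.mul_le_mul_right _ (bound_pow_le hU c))
  have h2 : (Core.colorCount n w : ℝ) ≤ d * Real.logb 2 n + 1 := by
    have h3 : (w : ℝ) ≤ d := by exact_mod_cast hw
    have h4 := colorCount_le_logb n w
    have h5 := mul_le_mul_of_nonneg_right h3 hL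
    linarith
  have h3 : (1 : ℝ) ≤ d * Real.logb 2 n + 1 := by
    have := mul_nonneg (Nat.cast_nonneg (α := ℝ) d) hL
    linarith
  have h4 : (Core.colorCount n w : ℝ) ^ (w + 1) ≤ (d * Real.logb 2 n + 1) ^ (d + 1) :=
    (pow_le_pow_left₀ (Nat.cast_nonneg _) h2 _).trans (pow_le_pow_right₀ h3 (by omega))
  have h5 : (16 : ℝ) ^ c ≤ (16 ^ c + 2 * c : ℕ) := by
    push_cast
    linarith [Nat.cast_nonneg (α := ℝ) c]
  have h6 : (U : ℝ) ^ (2 * c) ≤ (U : ℝ) ^ (16 ^ c + 2 * c) := pow_le_pow_right₀ hU' (Nat.le_add_left _ _)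
  refine h1.trans ?_
  gcongr

theorem logb_le_self (n : ℕ) : Real.logb 2 n ≤ n := by
  rcases Nat.eq_zero_or_pos n with rfl | hn
  · simp
  · rw [Real.logb_le_iff_le_rpow one_lt_two (by exact_mod_cast hn), Real.rpow_natCast]
    exact_mod_cast Nat.lt_two_pow_self.le

/-- For treewidth 0, the number of colors that the search admits is not bounded by a constant, but
its eighth power is polynomial. -/
theorem table_le {n k U : ℕ} (hU : n + 1 ≤ U) (hk : k ≤ n - 1) :
    (3 : ℝ) ^ (3 * k + 5) * (Core.colorCount n (6 * k + 7) : ℝ) ^ (6 * k + 8) ≤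
      3 ^ 5 * 8 ^ 8 * (U : ℝ) ^ 8 * (k * Real.logb 2 n + 1) ^ (86 * k) := by
  have hL := logb_nonneg n
  have h1 := colorCount_le_logb n (6 * k + 7)
  have hU' : (n : ℝ) + 1 ≤ U := by exact_mod_cast hU
  have hn0 : (0 : ℝ) ≤ n := Nat.cast_nonneg n
  rcases Nat.eq_zero_or_pos k with rfl | hk0
  · have h2 := logb_le_self n
    have h3 : (Core.colorCount n (6 * 0 + 7) : ℝ) ≤ 8 * U := by
      push_cast at h1
      norm_num at h1 ⊢
      linarith
    have h4 := pow_le_pow_left₀ (Nat.cast_nonneg _) h3 8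
    rw [mul_pow] at h4
    simp only [mul_zero, zero_add, pow_zero, mul_one] at h4 ⊢
    linarith
  · set L := Real.logb 2 n with hLdef
    have hL1 : 1 ≤ L := by
      rw [hLdef, Real.le_logb_iff_rpow_le one_lt_two (by exact_mod_cast (by omega : 0 < n)),
        Real.rpow_one]
      exact_mod_cast (by omega : 2 ≤ n)
    set X := k * L + 1 with hX
    have hk1 : (1 : ℝ) ≤ k := by exact_mod_cast hk0
    have hX2 : 2 ≤ X := by nlinarith
    have h2 : (Core.colorCount n (6 * k + 7) : ℝ) ≤ X ^ 5 := by
      have h3 : (Core.colorCount n (6 * k + 7) : ℝ) ≤ 13 * X := by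
        push_cast at h1
        nlinarith
      have h4 : (2 : ℝ) ^ 4 ≤ X ^ 4 := pow_le_pow_left₀ (by norm_num) hX2 4
      calc _ ≤ 13 * X := h3
        _ ≤ X ^ 4 * X := by
          refine mul_le_mul_of_nonneg_right ?_ (by linarith)
          norm_num at h4
          linarith
        _ = X ^ 5 := by ring
    have h3 : (Core.colorCount n (6 * k + 7) : ℝ) ^ (6 * k + 8) ≤ X ^ (70 * k) := calc
      _ ≤ (X ^ 5) ^ (6 * k + 8) := pow_le_pow_left₀ (Nat.cast_nonneg _) h2 _
      _ = X ^ (5 * (6 * k + 8)) := (pow_mul _ _ _).symm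
      _ ≤ _ := pow_le_pow_right₀ (by linarith) (by omega)
    have h4 : (3 : ℝ) ^ (3 * k + 5) ≤ X ^ (16 * k) := calc
      _ ≤ (X ^ 2) ^ (3 * k + 5) := pow_le_pow_left₀ (by norm_num) (by nlinarith) _
      _ = X ^ (2 * (3 * k + 5)) := (pow_mul _ _ _).symm
      _ ≤ _ := pow_le_pow_right₀ (by linarith) (by omega)
    have h5 : (1 : ℝ) ≤ 3 ^ 5 * 8 ^ 8 * (U : ℝ) ^ 8 := by
      have := one_le_pow₀ (n := 8) (by linarith : (1 : ℝ) ≤ U)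
      linarith
    calc _ ≤ X ^ (16 * k) * X ^ (70 * k) := by gcongr
      _ = 1 * X ^ (86 * k) := by rw [← pow_add, one_mul]; congr 1; ring
      _ ≤ _ := mul_le_mul_of_nonneg_right h5 (by positivity)

/-- Powers of logarithms are at most quadratic, up to a factor that depends on the exponent. -/
theorem logb_pow_le {n U : ℕ} (hU : n + 1 ≤ U) (p : ℕ) :
    (Real.logb 2 n + 1) ^ p ≤ (p + 1) ^ p * (U : ℝ) ^ 2 := by
  set L := Real.logb 2 n with hLdef
  have hL : 0 ≤ L := logb_nonneg n
  have hU' : (n : ℝ) + 1 ≤ U := by exact_mod_cast hU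
  have hp : (0 : ℝ) < p + 1 := by positivity
  -- `1 + x ≤ exp x` for `x = L / (p + 1)`
  have h1 : L + 1 ≤ (p + 1) * Real.exp (L / (p + 1)) := by
    have h2 := Real.add_one_le_exp (L / (p + 1))
    have h3 := mul_le_mul_of_nonneg_left h2 hp.le
    have h4 : (p + 1) * (L / (p + 1) + 1) = L + (p + 1) := by field_simp
    have h5 : (0 : ℝ) ≤ p := Nat.cast_nonneg p
    linarith
  have h2 : Real.exp (L / (p + 1)) ^ p ≤ Real.exp L := by
    rw [← Real.exp_nat_mul]
    refine Real.exp_le_exp.2 ?_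
    rw [mul_div_assoc', div_le_iff₀ hp]
    nlinarith
  have h3 : Real.exp L ≤ (U : ℝ) ^ 2 := by
    rcases Nat.eq_zero_or_pos n with rfl | hn
    · have h5 : L = 0 := by simp [hLdef]
      rw [h5, Real.exp_zero]
      exact one_le_pow₀ (by exact_mod_cast hU)
    · have hn' : (0 : ℝ) < n := by exact_mod_cast hn
      have h5 : 0 ≤ Real.log n := Real.log_nonneg (by exact_mod_cast hn)
      have h6 : L ≤ 2 * Real.log n := by
        rw [hLdef, Real.logb, div_le_iff₀ (Real.log_pos one_lt_two)]
        nlinarith [Real.log_two_gt_d9]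
      calc Real.exp L ≤ Real.exp (2 * Real.log n) := Real.exp_le_exp.2 h6
        _ = (n : ℝ) ^ 2 := by
          rw [two_mul, Real.exp_add, Real.exp_log hn', pow_two]
        _ ≤ _ := pow_le_pow_left₀ hn'.le (by linarith) 2
  calc (L + 1) ^ p ≤ ((p + 1) * Real.exp (L / (p + 1))) ^ p := pow_le_pow_left₀ (by linarith) h1 p
    _ = (p + 1) ^ p * Real.exp (L / (p + 1)) ^ p := mul_pow _ _ _
    _ ≤ _ := by
      refine mul_le_mul_of_nonneg_left (h2.trans h3) (by positivity)

/-- The bound in terms of the treewidth, for the algorithm without a tree decomposition. -/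
def parameterBound (A k : ℕ) : ℕ := A * ((k + 1) * (86 * k + 1)) ^ (86 * k)

theorem primrec_pow : Primrec₂ fun a b : ℕ => a ^ b := by
  have h : Primrec₂ fun a b : ℕ => Nat.rec (motive := fun _ => ℕ) 1 (fun _ x => x * a) b :=
    Primrec.nat_rec (f := fun _ : ℕ => 1) (g := fun a (p : ℕ × ℕ) => p.2 * a) (Primrec.const 1)
      (Primrec.nat_mul.comp (Primrec.snd.comp Primrec.snd) Primrec.fst)
  refine h.of_eq fun a b => ?_
  induction b with
  | zero => rfl
  | succ b ih => rw [pow_succ, ← ih]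

theorem computable_parameterBound (A : ℕ) : Computable (parameterBound A) := by
  have h1 : Primrec fun k : ℕ => 86 * k := Primrec.nat_mul.comp (Primrec.const 86) Primrec.id
  have h2 : Primrec fun k : ℕ => (k + 1) * (86 * k + 1) :=
    Primrec.nat_mul.comp Primrec.succ (Primrec.succ.comp h1)
  exact (Primrec.nat_mul.comp (Primrec.const A) (primrec_pow.comp h2 h1)).to_comp

/-- The time of the algorithm without a tree decomposition, for treewidth `k`. -/
theorem time_le {n U c k t A C : ℕ} (hU : n + 1 ≤ U) (hk : k ≤ n - 1)
    (hA : A = 16 ^ c * (3 ^ 5 * 8 ^ 8)) (hC : C = A + 2 * c + 86)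
    (ht : t ≤ ((U + 3) ^ 2) ^ c * (3 ^ (3 * k + 5) * Core.colorCount n (6 * k + 7) ^ (6 * k + 8))) :
    (t : ℝ) ≤ C * (U : ℝ) ^ C * (k * Real.logb 2 n + 1) ^ (C * k) ∧
      t ≤ parameterBound A k * U ^ C := by
  have hL := logb_nonneg n
  set L := Real.logb 2 n with hLdef
  have hU' : (1 : ℝ) ≤ U := by exact_mod_cast (by omega : 1 ≤ U)
  have hk0 : (0 : ℝ) ≤ k := Nat.cast_nonneg k
  have h1 : (t : ℝ) ≤ 16 ^ c * (U : ℝ) ^ (2 * c) *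
      (3 ^ (3 * k + 5) * (Core.colorCount n (6 * k + 7) : ℝ) ^ (6 * k + 8)) := by
    exact_mod_cast ht.trans (Nat.mul_le_mul_right _ (bound_pow_le (by omega) c))
  have h2 : (t : ℝ) ≤ A * (U : ℝ) ^ (2 * c + 8) * (k * L + 1) ^ (86 * k) := by
    refine h1.trans ((mul_le_mul_of_nonneg_left (table_le hU hk) (by positivity)).trans_eq ?_)
    rw [hA]
    push_cast
    ring
  have hX : 1 ≤ k * L + 1 := by
    have := mul_nonneg hk0 hL
    linarith
  constructor
  · refine h2.trans ?_
    have h3 : (A : ℝ) ≤ C := by exact_mod_cast (by omega : A ≤ C)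
    have h4 : (U : ℝ) ^ (2 * c + 8) ≤ (U : ℝ) ^ C := pow_le_pow_right₀ hU' (by omega)
    have h5 : (k * L + 1) ^ (86 * k) ≤ (k * L + 1) ^ (C * k) :=
      pow_le_pow_right₀ hX (Nat.mul_le_mul_right _ (by omega))
    gcongr
  · have h3 : (k * L + 1) ^ (86 * k) ≤
        (((k + 1) * (86 * k + 1)) ^ (86 * k) : ℝ) * (U : ℝ) ^ 2 := calc
      _ ≤ ((k + 1) * (L + 1)) ^ (86 * k) := pow_le_pow_left₀ (by linarith) (by nlinarith) _
      _ = ((k : ℝ) + 1) ^ (86 * k) * (L + 1) ^ (86 * k) := mul_pow _ _ _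
      _ ≤ ((k : ℝ) + 1) ^ (86 * k) * (((86 * k : ℕ) + 1) ^ (86 * k) * (U : ℝ) ^ 2) :=
        mul_le_mul_of_nonneg_left (logb_pow_le hU _) (by positivity)
      _ = _ := by rw [mul_pow]; push_cast; ring
    have h4 : (t : ℝ) ≤ parameterBound A k * (U : ℝ) ^ (2 * c + 10) := by
      refine h2.trans ((mul_le_mul_of_nonneg_left h3 (by positivity)).trans_eq ?_)
      rw [parameterBound]
      push_cast
      ring
    have h5 : t ≤ parameterBound A k * U ^ (2 * c + 10) := by exact_mod_cast h4
    refine h5.trans (Nat.mul_le_mul_left _ (Nat.pow_le_pow_right (by omega) ?_))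
    have : 1 ≤ A := by
      rw [hA]
      exact Nat.one_le_iff_ne_zero.2 (by positivity)
    omega

end ConcSched

theorem mainTheorem7 :
    (∃ (P : Prog) (c : ℕ), ∀ (n : ℕ) (G : SimpleGraph (Fin n)) (r : Fin n → ℕ)
      (m : ℕ) (D : TreeDecomposition G m), ∃ (t : ℕ) (s : State),
        Exec P (initial (encodeInstance G r ++ D.encode)) t s ∧
        IsOptimal G (fun _ => 1) r (output n s) ∧
        (t : ℝ) ≤ c * (unaryLength (encodeInstance G r ++ D.encode) : ℝ) ^ c *
          (D.width * Real.logb 2 n + 1) ^ (D.width + 1)) ∧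
    (∃ (P : Prog) (c : ℕ) (f : ℕ → ℕ), Computable f ∧
      ∀ (n : ℕ) (G : SimpleGraph (Fin n)) (r : Fin n → ℕ), ∃ (t : ℕ) (s : State),
        Exec P (initial (encodeInstance G r)) t s ∧
        IsOptimal G (fun _ => 1) r (output n s) ∧
        (t : ℝ) ≤ c * (unaryLength (encodeInstance G r) : ℝ) ^ c *
          (treewidth G * Real.logb 2 n + 1) ^ (c * treewidth G) ∧
        t ≤ f (treewidth G) * unaryLength (encodeInstance G r) ^ c) := by
  constructor
  · obtain ⟨P, c, h⟩ := exists_decomposed_program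
    refine ⟨P, 16 ^ c + 2 * c, fun n G r m D => ?_⟩
    obtain ⟨t, s, w, h1, h2, h3, h4⟩ := h n G r m D
    exact ⟨t, s, h1, h2, decomposed_time (one_le_unaryLength G r _) h3 h4⟩
  · obtain ⟨P, c, h⟩ := exists_program
    refine ⟨P, 16 ^ c * (3 ^ 5 * 8 ^ 8) + 2 * c + 86, parameterBound (16 ^ c * (3 ^ 5 * 8 ^ 8)),
      computable_parameterBound _, fun n G r => ?_⟩
    obtain ⟨t, s, h1, h2, h3⟩ := h n G r
    have hU : n + 1 ≤ unaryLength (encodeInstance G r) := by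
      have := sum_add_lt_unaryLength G r
      omega
    exact ⟨t, s, h1, h2, time_le hU (treewidth_le G) rfl rfl h3⟩
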